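/- Let $k\ge 1$ be an odd integer, $N\ge 1$ an odd squarefree integer, and $p$ an odd prime not dividing $N$. Write $S_w(M)$ for the space of cusp forms of weight $w$ for $\Gamma_0(M)$ and $S_w^{(2)}(M)$ for the space of Siegel cusp forms of genus two and weight $w$ for $\Gamma_0^{(2)}(M)$. On functions of $\tau\in\mathcal H$ let $(V\phi)(\tau)=\phi(p\tau)$; on Siegel forms $F=\sum_B A(B)q^B$, with $q^B=e^{2\pi i\,\mathrm{Tr}(BZ)}$, let $UF=\sum_B A(pB)q^B$, i.e. $UF(Z)=p^{-3}\sum_{B\in \mathrm{Sym}_2(\mathbf Z/p\mathbf Z)}F((Z+B)/p)$, which lies in $S_w^{(2)}(Np)$ if $F\in S_w^{(2)}(N)$. Let $\varpi:S_{w}^{(2)}(M)\to S_{w}(M)\otimes S_{w}(M)$ be the pullback to the diagonal, $\varpi(F)(\tau_1,\tau_2)=F(\mathrm{diag}(\tau_1,\tau_2))$. We write $\phi\times\psi$ for the function $\phi(\tau_1)\psi(\tau_2)$. Let $f\in S_{2k}^{\mathrm{new}}(N)$ be a normalised eigenform with $p$-th Fourier coefficient $a_p=a_p(f)$, and let $h=\sum_n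 c(n)q^n\in S_{k+1/2}^{\mathrm{new}}(N)$ be a non-zero newform in Kohnen's plus space of level $4N$ in Shimura–Shintani correspondence with $f$, i.e. $T_{\ell^2}h=a_\ell(f)h$ for all primes $\ell\nmid N$. Let $F=\mathrm{SK}_N(h)\in S_{k+1}^{(2)}(N)$ be its Saito–Kurokawa lift, that is $$F=\sum_{B>0}A(B)q^B,\qquad A(B)=\sum_{\substack{0<d\mid\gcd(B)\\ (d,N)=1}}d^k\,c\!\left(\frac{\det(2B)}{d^2}\right),$$ where $B=\begin{pmatrix} n&r/2\\ r/2&m\end{pmatrix}$ runs over the positive definite half-integral matrices and $\gcd(B)=\gcd(n,r,m)$. Let $\phi\in S_{k+1}^{\mathrm{new}}(N)$ be a normalised eigenform with $p$-th Fourier coefficient $a_p(\phi)$. For $M\in\{N,Np\}$ let $e_\phi$ be the Hecke-equivariant projection of $S_{k+1}(M)$ onto $\{g\in S_{k+1}(M): T_\ell g=a_\ell(\phi)g \text{ for all primes } \ell\nmid M\}$, and put $\varpi_\phi=(e_\phi\otimes e_\phi)\circ\varpi$ on $S^{(2)}_{k+1}(M)$. Let $\lambda_\phi\in\mathbf C$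 be such that $\varpi_\phi(F)=\lambda_\phi\,\phi\times\phi$. Then $a_p(\phi)^2\neq p^{k-1}(p+1)^2$ and $$\varpi_\phi(UF)=\lambda_\phi\left(A\,\phi\times\phi+B\,\phi\times V\phi+C\,V\phi\times\phi+D\,V\phi\times V\phi\right),$$ where $$A=\frac{(p^{k-1}(p-1)+a_p)\,a_p(\phi)^2-p^k(p+1)(p^{k-1}(p+1)+a_p)}{a_p(\phi)^2-p^{k-1}(p+1)^2},$$ $$B=C=\frac{p\,a_p(\phi)}{p+1}\left(p^k-p^{k-1}+a_p-A\right),\qquad D=-p^{k+1}\left(p^k+a_p-A\right).$$ -/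

import Mathlib

open scoped UpperHalfPlane MatrixGroups CongruenceSubgroup Manifold Topology TensorProduct

noncomputable section

namespace SKPullback

/-! ### Elliptic modular forms -/

/-- The space `S_w(M)` of cusp forms of weight `w`, level `Γ₀(M)` and trivial character. -/
abbrev S (M : ℕ) (w : ℤ) : Type := CuspForm (CongruenceSubgroup.Gamma0 M) w

/-- The `n`-th Fourier coefficient of a `1`-periodic function on the upper half plane. -/
def coeff (f : ℍ → ℂ) (n : ℕ) : ℂ := (UpperHalfPlane.qExpansion 1 f).coeff n

/-- `(V_d f)(τ) = f(d τ)`, that is `∑ a_n q^n ↦ ∑ a_n q^(d n)` (for `d ≥ 1`). -/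
def opV (d : ℕ) : (ℍ → ℂ) →ₗ[ℂ] (ℍ → ℂ) where
  toFun f τ := f (UpperHalfPlane.ofComplex ((d : ℂ) * (τ : ℂ)))
  map_add' _ _ := rfl
  map_smul' _ _ := rfl

/-- `(U_d f)(τ) = d⁻¹ ∑_{b mod d} f((τ + b) / d)`, that is `∑ a_n q^n ↦ ∑ a_(d n) q^n`
(for `d ≥ 1`). -/
def opU (d : ℕ) : (ℍ → ℂ) →ₗ[ℂ] (ℍ → ℂ) where
  toFun f τ := (d : ℂ)⁻¹ *
    ∑ b ∈ Finset.range d, f (UpperHalfPlane.ofComplex (((τ : ℂ) + (b : ℂ)) / (d : ℂ)))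
  map_add' f g := by
    funext τ
    simp [Finset.sum_add_distrib, mul_add]
  map_smul' c f := by
    funext τ
    simp only [Pi.smul_apply, smul_eq_mul, RingHom.id_apply, ← Finset.mul_sum]
    ring

/-- The Hecke operator at the prime `ℓ` in weight `w` and level `Γ₀(M)`: it is
`T_ℓ = U_ℓ + ℓ^(w-1) V_ℓ` if `ℓ ∤ M`, and `U_ℓ` if `ℓ ∣ M`. -/
def hecke (M : ℕ) (w : ℤ) (ℓ : ℕ) : (ℍ → ℂ) →ₗ[ℂ] (ℍ → ℂ) :=
  opU ℓ + (if ℓ ∣ M then (0 : ℂ) else (ℓ : ℂ) ^ (w - 1)) • opV ℓ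

/-- The Petersson product `[SL₂(ℤ) : Γ₀(M)]⁻¹ ∫_{Γ₀(M)\ℍ} f ḡ y^s dμ` with `dμ = dx dy / y²`, of
two functions such that `f ḡ y^s` is `Γ₀(M)`-invariant. The integral is taken over the union of
the translates `γ 𝒟` of the standard fundamental domain `𝒟` of `SL₂(ℤ)`, where `γ` runs over
representatives of `Γ₀(M) \ SL₂(ℤ)`. -/
def petersson (M : ℕ) (s : ℝ) (f g : ℍ → ℂ) : ℂ :=
  ((CongruenceSubgroup.Gamma0 M).index : ℂ)⁻¹ *
    ∑ᶠ c : SL(2, ℤ) ⧸ CongruenceSubgroup.Gamma0 M,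
      ∫ z in ModularGroup.fd,
        f (c.out⁻¹ • z) * (starRingEnd ℂ) (g (c.out⁻¹ • z)) *
          (((c.out⁻¹ • z).im ^ s : ℝ) : ℂ)

/-- `φ ∈ S_w^new(M)`: `φ` is orthogonal to all old forms `g(d τ)` with `g ∈ S_w(M')`,
`d M' ∣ M` and `M' ≠ M`. -/
def IsNew (M : ℕ) (w : ℤ) (φ : S M w) : Prop :=
  ∀ (M' d : ℕ) (g : S M' w), d * M' ∣ M → M' ≠ M → petersson M (w : ℝ) φ (opV d g) = 0

/-- `φ` is a normalised eigenform (of all Hecke operators) in `S_w^new(M)`. -/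
structure IsNormalisedNewform (M : ℕ) (w : ℤ) (φ : S M w) : Prop where
  isNew : IsNew M w φ
  coeff_one : coeff φ 1 = 1
  eigen : ∀ ℓ : ℕ, ℓ.Prime → hecke M w ℓ φ = coeff φ ℓ • (φ : ℍ → ℂ)

/-! ### Half-integral weight -/

/-- The theta series `θ(τ) = ∑_{n ∈ ℤ} exp(2 π i n² τ)`. -/
def theta (τ : ℍ) : ℂ := jacobiTheta (2 * (τ : ℂ))

/-- Cusp forms of weight `k + 1/2`, level `Γ₀(4M)` and trivial character in the sense of Shimura,
with the factor of automorphy `(θ(γτ) / θ(τ))^(2k+1)`; they vanish at all cusps. -/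
structure IsHalfIntegralCuspForm (k M : ℕ) (h : ℍ → ℂ) : Prop where
  holo : MDiff h
  transf : ∀ γ ∈ CongruenceSubgroup.Gamma0 (4 * M), ∀ τ : ℍ,
    h (γ • τ) * theta τ ^ (2 * k + 1) = theta (γ • τ) ^ (2 * k + 1) * h τ
  zero_at_cusps : ∀ γ : SL(2, ℤ),
    Filter.Tendsto
      (fun τ : ℍ => ‖UpperHalfPlane.denom γ τ‖ ^ (-((k : ℝ) + 1 / 2)) * ‖h (γ • τ)‖)
      UpperHalfPlane.atImInfty (𝓝 0)

/-- `(-1)^k n ≡ 0, 1 mod 4`. -/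
def IsPlusIndex (k n : ℕ) : Prop :=
  ((-1) ^ k * (n : ℤ)) % 4 = 0 ∨ ((-1) ^ k * (n : ℤ)) % 4 = 1

/-- Kohnen's plus space `S_{k+1/2}(M)`. -/
structure IsKohnenPlus (k M : ℕ) (h : ℍ → ℂ) : Prop where
  isCusp : IsHalfIntegralCuspForm k M h
  plus : ∀ n : ℕ, ¬ IsPlusIndex k n → coeff h n = 0

/-- The subspace `S_{k+1/2}^new(M)` of Kohnen's plus space (`M` odd and squarefree): the
orthogonal complement of the old forms, which are spanned by the spaces
`S_{k+1/2}(M/ℓ)` and `U_{ℓ²} S_{k+1/2}(M/ℓ)`, for the primes `ℓ ∣ M`. -/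
structure IsKohnenNew (k M : ℕ) (h : ℍ → ℂ) : Prop where
  isPlus : IsKohnenPlus k M h
  orth : ∀ ℓ : ℕ, ℓ.Prime → ℓ ∣ M → ∀ g : ℍ → ℂ, IsKohnenPlus k (M / ℓ) g →
    petersson (4 * M) ((k : ℝ) + 1 / 2) h g = 0 ∧
    petersson (4 * M) ((k : ℝ) + 1 / 2) h (opU (ℓ ^ 2) g) = 0

/-- The Kronecker symbol `(a / ℓ)` for a prime `ℓ`. -/
def kronecker (a : ℤ) (ℓ : ℕ) : ℤ :=
  if ℓ = 2 then ZMod.χ₈ (a : ZMod 8) else jacobiSym a ℓ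

/-- The `n`-th Fourier coefficient of `T_{ℓ²} h`, for `h` in Kohnen's plus space of weight
`k + 1/2` and level prime to `ℓ`, and `(-1)^k n ≡ 0, 1 mod 4` (the other coefficients vanish). -/
def halfHeckeCoeff (k ℓ : ℕ) (h : ℍ → ℂ) (n : ℕ) : ℂ :=
  coeff h (ℓ ^ 2 * n)
    + (kronecker ((-1) ^ k * (n : ℤ)) ℓ : ℂ) * (ℓ : ℂ) ^ (k - 1) * coeff h n
    + (ℓ : ℂ) ^ (2 * k - 1) * (if ℓ ^ 2 ∣ n then coeff h (n / ℓ ^ 2) else 0)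

/-- `h` is a non-zero form in `S_{k+1/2}^new(N)` in Shimura--Shintani correspondence with `f`:
`T_{ℓ²} h = a_ℓ(f) h` for all primes `ℓ ∤ N`. -/
structure IsShimuraShintani (N k : ℕ) (f : S N (2 * (k : ℤ))) (h : ℍ → ℂ) : Prop where
  isNew : IsKohnenNew k N h
  ne_zero : h ≠ 0
  eigen : ∀ ℓ : ℕ, ℓ.Prime → ¬ ℓ ∣ N → ∀ n : ℕ, IsPlusIndex k n →
    halfHeckeCoeff k ℓ h n = coeff f ℓ * coeff h n

/-! ### Siegel modular forms of genus two -/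

/-- The matrix `(τ₁, z; z, τ₂)`. -/
def symMat (τ₁ z τ₂ : ℂ) : Matrix (Fin 2) (Fin 2) ℂ := !![τ₁, z; z, τ₂]

/-- Siegel's upper half space of genus two. Functions on it are represented by functions on all
complex matrices, and only their values on `siegelH` are ever used. -/
def siegelH : Set (Matrix (Fin 2) (Fin 2) ℂ) :=
  {Z | Z.IsSymm ∧ (Z.map Complex.im).PosDef}

/-- The factor `C Z + D` of `γ = (A, B; C, D)`. -/
def siegelDenom (γ : Matrix (Fin 2 ⊕ Fin 2) (Fin 2 ⊕ Fin 2) ℤ) (Z : Matrix (Fin 2) (Fin 2) ℂ) :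
    Matrix (Fin 2) (Fin 2) ℂ :=
  γ.toBlocks₂₁.map (Int.cast : ℤ → ℂ) * Z + γ.toBlocks₂₂.map (Int.cast : ℤ → ℂ)

/-- The action `γ Z = (A Z + B) (C Z + D)⁻¹` of `γ = (A, B; C, D)`. -/
def siegelAct (γ : Matrix (Fin 2 ⊕ Fin 2) (Fin 2 ⊕ Fin 2) ℤ) (Z : Matrix (Fin 2) (Fin 2) ℂ) :
    Matrix (Fin 2) (Fin 2) ℂ :=
  (γ.toBlocks₁₁.map (Int.cast : ℤ → ℂ) * Z + γ.toBlocks₁₂.map (Int.cast : ℤ → ℂ)) *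
    (siegelDenom γ Z)⁻¹

/-- The space `S_w^{(2)}(M)` of Siegel cusp forms of genus two, weight `w` and level
`Γ₀^{(2)}(M) = {(A, B; C, D) ∈ Sp₄(ℤ) : C ≡ 0 mod M}`. Cuspidality: Siegel's operator kills
`F|γ` for every `γ ∈ Sp₄(ℤ)`. -/
structure IsSiegelCuspForm (M : ℕ) (w : ℤ) (F : Matrix (Fin 2) (Fin 2) ℂ → ℂ) : Prop where
  holo : DifferentiableOn ℂ (fun x : ℂ × ℂ × ℂ => F (symMat x.1 x.2.1 x.2.2))
    {x | symMat x.1 x.2.1 x.2.2 ∈ siegelH}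
  transf : ∀ γ ∈ Matrix.symplecticGroup (Fin 2) ℤ, (∀ i j, (M : ℤ) ∣ γ.toBlocks₂₁ i j) →
    ∀ Z ∈ siegelH, F (siegelAct γ Z) = (siegelDenom γ Z).det ^ w * F Z
  zero_at_cusps : ∀ γ ∈ Matrix.symplecticGroup (Fin 2) ℤ, ∀ τ : ℍ,
    Filter.Tendsto
      (fun t : ℝ => (siegelDenom γ (symMat τ 0 (t * Complex.I))).det ^ (-w) *
        F (siegelAct γ (symMat τ 0 (t * Complex.I))))
      Filter.atTop (𝓝 0)

/-- `(U_p F)(Z) = p⁻³ ∑_B F((Z + B) / p)`, where `B` runs over the symmetric matrices modulo `p`;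
that is `∑ A(B) q^B ↦ ∑ A(p B) q^B`. -/
def siegelU (p : ℕ) (F : Matrix (Fin 2) (Fin 2) ℂ → ℂ) (Z : Matrix (Fin 2) (Fin 2) ℂ) : ℂ :=
  ((p : ℂ) ^ 3)⁻¹ *
    ∑ a ∈ Finset.range p, ∑ b ∈ Finset.range p, ∑ c ∈ Finset.range p,
      F ((p : ℂ)⁻¹ • (Z + symMat a b c))

/-- The positive definite half-integral matrices `B = (n, r/2; r/2, m)`, as triples `(n, r, m)`. -/
def PosHalfInt : Type :=
  {x : ℤ × ℤ × ℤ // 0 < x.1 ∧ 0 < 4 * x.1 * x.2.2 - x.2.1 ^ 2}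

/-- The coefficient `A(B) = ∑_{d ∣ gcd(n, r, m), (d, N) = 1} d^k c((4 n m - r²) / d²)`, where
`c(j)` is the `j`-th Fourier coefficient of `h`. -/
def skCoeff (N k : ℕ) (h : ℍ → ℂ) (B : PosHalfInt) : ℂ :=
  ∑ d ∈ (Nat.divisors (Int.gcd (Int.gcd B.1.1 B.1.2.1) B.1.2.2)).filter (Nat.Coprime · N),
    (d : ℂ) ^ k * coeff h ((4 * B.1.1 * B.1.2.2 - B.1.2.1 ^ 2) / (d : ℤ) ^ 2).toNat

/-- `F ∈ S_{k+1}^{(2)}(N)` is the Saito--Kurokawa lift `SK_N(h)`, i.e. the Siegel cusp form with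
Fourier expansion `F(Z) = ∑_{B > 0} A(B) exp(2 π i Tr(B Z))`. -/
structure IsSaitoKurokawaLift (N k : ℕ) (h : ℍ → ℂ) (F : Matrix (Fin 2) (Fin 2) ℂ → ℂ) :
    Prop where
  isSiegel : IsSiegelCuspForm N ((k : ℤ) + 1) F
  expansion : ∀ Z ∈ siegelH, HasSum
    (fun B : PosHalfInt => skCoeff N k h B * Complex.exp (2 * Real.pi * Complex.I *
      ((B.1.1 : ℂ) * Z 0 0 + (B.1.2.1 : ℂ) * Z 0 1 + (B.1.2.2 : ℂ) * Z 1 1))) (F Z)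

/-! ### Pullback to the diagonal and `φ`-components -/

/-- The function `(τ₁, τ₂) ↦ ∑ f_i(τ₁) g_i(τ₂)` attached to `∑ f_i ⊗ g_i`. -/
def tensorFun (M : ℕ) (w : ℤ) : S M w ⊗[ℂ] S M w →ₗ[ℂ] (ℍ → ℍ → ℂ) :=
  TensorProduct.lift (LinearMap.mk₂ ℂ (fun (f g : S M w) (τ₁ τ₂ : ℍ) => f τ₁ * g τ₂)
    (fun f f' g => by funext τ₁ τ₂; simp [add_mul])
    (fun c f g => by funext τ₁ τ₂; simp [mul_assoc])
    (fun f g g' => by funext τ₁ τ₂; simp [mul_add])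
    (fun c f g => by funext τ₁ τ₂; simp [mul_left_comm]))

open Classical in
/-- The pullback `ϖ(F) ∈ S_w(M) ⊗ S_w(M)` of a Siegel cusp form `F ∈ S_w^{(2)}(M)`: the element
of the tensor product whose function on `ℍ × ℍ` is `(τ₁, τ₂) ↦ F(diag(τ₁, τ₂))`. -/
def pullback (M : ℕ) (w : ℤ) (F : Matrix (Fin 2) (Fin 2) ℂ → ℂ) : S M w ⊗[ℂ] S M w :=
  if H : ∃ t : S M w ⊗[ℂ] S M w, ∀ τ₁ τ₂ : ℍ, tensorFun M w t τ₁ τ₂ = F (symMat τ₁ 0 τ₂)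
  then H.choose else 0

/-- The component `{g ∈ S_w(M) : T_ℓ g = a_ℓ g for all primes ℓ ∤ M}`. -/
def heckeComponent (M : ℕ) (w : ℤ) (a : ℕ → ℂ) : Submodule ℂ (S M w) where
  carrier := {g | ∀ ℓ : ℕ, ℓ.Prime → ¬ ℓ ∣ M → hecke M w ℓ g = a ℓ • (g : ℍ → ℂ)}
  add_mem' {f g} hf hg ℓ hℓ hM := by
    simp [hf ℓ hℓ hM, hg ℓ hℓ hM]
  zero_mem' ℓ _ _ := by simp
  smul_mem' c f hf ℓ hℓ hM := by
    simp [hf ℓ hℓ hM, smul_comm c]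

/-- The Hecke-stable complement of `heckeComponent`: the span of the images of the operators
`T_ℓ - a_ℓ` on `S_w(M)`, for the primes `ℓ ∤ M`; it is the sum of the other simultaneous
eigenspaces of these operators. -/
def heckeComplement (M : ℕ) (w : ℤ) (a : ℕ → ℂ) : Submodule ℂ (S M w) :=
  Submodule.span ℂ {g | ∃ ℓ : ℕ, ℓ.Prime ∧ ¬ ℓ ∣ M ∧ ∃ x : S M w,
    (g : ℍ → ℂ) = hecke M w ℓ x - a ℓ • (x : ℍ → ℂ)}

open Classical in
/-- The Hecke-equivariant projection `e` of `S_w(M)` onto `heckeComponent`. -/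
def heckeProj (M : ℕ) (w : ℤ) (a : ℕ → ℂ) : S M w →ₗ[ℂ] S M w :=
  if H : IsCompl (heckeComponent M w a) (heckeComplement M w a) then
    (heckeComponent M w a).projection (heckeComplement M w a) H else 0

/-- `ϖ_φ(F) = (e_φ ⊗ e_φ)(ϖ(F))` for `F ∈ S_w^{(2)}(M)`, as a function on `ℍ × ℍ`; here `e_φ` is
the projection of `S_w(M)` onto the `φ`-component. -/
def pullbackComponent (M : ℕ) (w : ℤ) (φ : ℍ → ℂ) (F : Matrix (Fin 2) (Fin 2) ℂ → ℂ) :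
    ℍ → ℍ → ℂ :=
  tensorFun M w (TensorProduct.map (heckeProj M w (coeff φ)) (heckeProj M w (coeff φ))
    (pullback M w F))

end SKPullback

end

open SKPullback

open SKPullback

noncomputable section

namespace SKPullback

open UpperHalfPlane
open scoped ModularForm

/-! ### The slash action of integral matrices of positive determinant -/

/-! Let G and E be the restrictions of F and UF to the diagonal. The Hecke equation of h at p², read
on the coefficients A(n, r, m), becomes a linear relation between A(p²n, pr, p²m), A(pn, r, pm),
A(n, r/p, m) and A(n/p, r/p², m/p) (`skExt_relation`). On the diagonal the coefficients are summed
over r, so the index r may be rescaled freely, and the relation turns into (U⊗U)E = (p^k + a_p -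
p^(k-1)) (U⊗U)G + p^(k-1) E - (a_p p^k + p^(2k-1)) G + p^(3k-1) (V⊗V)G
(`IsSaitoKurokawaLift.diag_relation`). The projection on the φ-component commutes with U_p, with V_p
and with the inclusion of level N in level Np, so the same identity holds between the components. At
level Np the φ-component is spanned by φ and Vφ, with Uφ = a_p(φ) φ - p^k Vφ and UVφ = φ. Writing
the component of E as a combination of the four products of φ and Vφ and comparing coefficients
gives four linear equations, solved in `solve_linear`; the system is regular because a_p(φ)² ≠
p^(k-1) (p+1)².

The rest establishes the facts used in this computation.

The inequality is the strict bound |a_p(φ)| < p^((k-1)/2) (p+1) (`norm_eigenvalue_lt`). It needs no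
deep estimate: |φ| y^((k+1)/2) attains its maximum, and equality would propagate the maximum along τ
↦ pτ into the cusp, where this function tends to zero.

The projections exist because the T_ℓ are self-adjoint (`ip_hecke`) on a finite dimensional space
(`exists_coeff_bound`), so that the common eigenspace and the span of the images of the T_ℓ - a_ℓ
are orthogonal complements (`isCompl_eigComponent`).

That φ and Vφ span the component is multiplicity one for squarefree level. Its core is the
Atkin-Lehner statement that a form whose coefficients vanish at all n prime to the level is a sum of
forms V_q s_q (`eq_sum_opV_of_coeff_eq_zero`), together with the fact that a newform of level N
cannot become old at level Np up to a form V_p s (`mem_oldSpace_of_eq_add`), which again rests on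
the strict eigenvalue bound.

On the Siegel side the restrictions of F and UF must be shown to be cusp forms in each variable.
Only the vanishing of Siegel's operator along diagonal matrices is given; a Koecher type argument
with Phragmén-Lindelöf and the Schwarz lemma (`IsJacobiCusp.tendsto_zero`) extends it to the lines
that occur in UF. Cusp forms in each variable separately then form the tensor product, by finite
dimensionality (`exists_tensorFun_eq`). -/

/-- An integral matrix of non-zero determinant as an element of `GL₂(ℝ)` (junk value `1`). -/
def toGL (A : Matrix (Fin 2) (Fin 2) ℤ) : GL (Fin 2) ℝ :=
  if h : (A.map (Int.cast : ℤ → ℝ)).det ≠ 0 then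
    Matrix.GeneralLinearGroup.mkOfDetNeZero _ h else 1

lemma det_map_cast (A : Matrix (Fin 2) (Fin 2) ℤ) :
    (A.map (Int.cast : ℤ → ℝ)).det = (A.det : ℝ) := by
  simp [Matrix.det_fin_two]

lemma toGL_val {A : Matrix (Fin 2) (Fin 2) ℤ} (hA : A.det ≠ 0) :
    (toGL A : Matrix (Fin 2) (Fin 2) ℝ) = A.map (Int.cast : ℤ → ℝ) := by
  have h : (A.map (Int.cast : ℤ → ℝ)).det ≠ 0 := by
    rw [det_map_cast]; exact_mod_cast hA
  rw [toGL, dif_pos h]; rfl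

lemma toGL_mul {A B : Matrix (Fin 2) (Fin 2) ℤ} (hA : A.det ≠ 0) (hB : B.det ≠ 0) :
    toGL (A * B) = toGL A * toGL B := by
  have hAB : (A * B).det ≠ 0 := by rw [Matrix.det_mul]; exact mul_ne_zero hA hB
  apply Units.ext
  rw [Units.val_mul, toGL_val hA, toGL_val hB, toGL_val hAB]
  ext i j
  simp [Matrix.mul_apply]

lemma toGL_SL (γ : SL(2, ℤ)) : toGL (γ : Matrix (Fin 2) (Fin 2) ℤ) =
    Matrix.SpecialLinearGroup.mapGL ℝ γ := by
  have : (γ : Matrix (Fin 2) (Fin 2) ℤ).det ≠ 0 := by simp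
  apply Units.ext
  rw [toGL_val this]
  ext i j
  simp

lemma toGL_det {A : Matrix (Fin 2) (Fin 2) ℤ} (hA : 0 < A.det) :
    (Matrix.GeneralLinearGroup.det (toGL A)).val = (A.det : ℝ) := by
  rw [Matrix.GeneralLinearGroup.val_det_apply, toGL_val hA.ne', det_map_cast]

lemma toGL_det_pos {A : Matrix (Fin 2) (Fin 2) ℤ} (hA : 0 < A.det) :
    0 < (Matrix.GeneralLinearGroup.det (toGL A)).val := by
  rw [toGL_det hA]; exact_mod_cast hA

lemma denom_toGL {A : Matrix (Fin 2) (Fin 2) ℤ} (hA : 0 < A.det) (z : ℂ) :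
    denom (toGL A) z = A 1 0 * z + A 1 1 := by
  simp [denom, toGL_val hA.ne']

lemma num_toGL {A : Matrix (Fin 2) (Fin 2) ℤ} (hA : 0 < A.det) (z : ℂ) :
    num (toGL A) z = A 0 0 * z + A 0 1 := by
  simp [num, toGL_val hA.ne']

lemma coe_toGL_smul {A : Matrix (Fin 2) (Fin 2) ℤ} (hA : 0 < A.det) (z : ℍ) :
    ((toGL A • z : ℍ) : ℂ) = (A 0 0 * z + A 0 1) / (A 1 0 * z + A 1 1) := by
  rw [coe_smul_of_det_pos (toGL_det_pos hA), denom_toGL hA, num_toGL hA]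

lemma im_toGL_smul {A : Matrix (Fin 2) (Fin 2) ℤ} (hA : 0 < A.det) (z : ℍ) :
    (toGL A • z : ℍ).im = A.det * z.im / ‖(A 1 0 * z + A 1 1 : ℂ)‖ ^ 2 := by
  rw [im_smul_eq_div_normSq, toGL_det hA, denom_toGL hA, Complex.normSq_eq_norm_sq,
    abs_of_pos (by exact_mod_cast hA)]

lemma cz_add_d_ne_zero {A : Matrix (Fin 2) (Fin 2) ℤ} (hA : 0 < A.det) (z : ℍ) :
    (A 1 0 * z + A 1 1 : ℂ) ≠ 0 := by
  rw [← denom_toGL hA]; exact denom_ne_zero _ _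

/-- The weight `w` slash operator of an integral matrix. -/
def sl (w : ℤ) (A : Matrix (Fin 2) (Fin 2) ℤ) (f : ℍ → ℂ) : ℍ → ℂ := f ∣[w] toGL A

lemma sl_apply {w : ℤ} {A : Matrix (Fin 2) (Fin 2) ℤ} (hA : 0 < A.det) (f : ℍ → ℂ) (z : ℍ) :
    sl w A f z = (A.det : ℂ) ^ (w - 1) * (A 1 0 * z + A 1 1 : ℂ) ^ (-w) * f (toGL A • z) := by
  rw [sl, ModularForm.slash_apply, σ, if_pos (toGL_det_pos hA), toGL_det hA, denom_toGL hA,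
    abs_of_pos (by exact_mod_cast hA)]
  rw [ContinuousAlgEquiv.refl_apply, Complex.ofReal_intCast]
  ring

lemma sl_mul {w : ℤ} {A B : Matrix (Fin 2) (Fin 2) ℤ} (hA : A.det ≠ 0) (hB : B.det ≠ 0)
    (f : ℍ → ℂ) : sl w (A * B) f = sl w B (sl w A f) := by
  rw [sl, toGL_mul hA hB, SlashAction.slash_mul]; rfl

lemma sl_add (w : ℤ) (A : Matrix (Fin 2) (Fin 2) ℤ) (f g : ℍ → ℂ) :
    sl w A (f + g) = sl w A f + sl w A g := SlashAction.add_slash _ _ _ _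

lemma sl_sum (w : ℤ) (A : Matrix (Fin 2) (Fin 2) ℤ) {ι : Type*} (s : Finset ι) (f : ι → ℍ → ℂ) :
    sl w A (∑ i ∈ s, f i) = ∑ i ∈ s, sl w A (f i) := SlashAction.sum_slash _ _

lemma sl_smul {w : ℤ} {A : Matrix (Fin 2) (Fin 2) ℤ} (hA : 0 < A.det) (c : ℂ) (f : ℍ → ℂ) :
    sl w A (c • f) = c • sl w A f := by
  funext z
  simp only [sl_apply hA, Pi.smul_apply, smul_eq_mul]
  ring

lemma mdiff_sl (w : ℤ) (A : Matrix (Fin 2) (Fin 2) ℤ) {f : ℍ → ℂ} (hf : MDiff f) :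
    MDiff (sl w A f) := hf.slash w _

/-- `|f| y^(w/2)` is bounded on the upper half plane. -/
def HasBound (w : ℤ) (f : ℍ → ℂ) : Prop := ∃ C : ℝ, ∀ z : ℍ, ‖f z‖ * z.im ^ (w / 2 : ℝ) ≤ C

/-- Since Im(Az) = det A · y / |cz+d|², the factor (cz+d)^(-w) cancels against Im(Az)^(w/2), and
only a power of the determinant survives. -/
lemma norm_sl {w : ℤ} {A : Matrix (Fin 2) (Fin 2) ℤ} (hA : 0 < A.det) (f : ℍ → ℂ) (z : ℍ) :
    ‖sl w A f z‖ * z.im ^ (w / 2 : ℝ) =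
      (A.det : ℝ) ^ (w / 2 - 1 : ℝ) *
        (‖f (toGL A • z)‖ * (toGL A • z : ℍ).im ^ (w / 2 : ℝ)) := by
  have hd : (0 : ℝ) < A.det := by exact_mod_cast hA
  have hj : 0 < ‖(A 1 0 * z + A 1 1 : ℂ)‖ := norm_pos_iff.mpr (cz_add_d_ne_zero hA z)
  have hy := z.im_pos
  rw [sl_apply hA, im_toGL_smul hA]
  rw [norm_mul, norm_mul, norm_zpow, norm_zpow, Complex.norm_intCast, abs_of_pos hd,
    Real.div_rpow (by positivity) (by positivity), Real.mul_rpow hd.le hy.le,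
    ← Real.rpow_natCast (‖(A 1 0 * z + A 1 1 : ℂ)‖) 2, ← Real.rpow_mul hj.le,
    ← Real.rpow_intCast, ← Real.rpow_intCast]
  rw [show ((2 : ℕ) : ℝ) * (w / 2 : ℝ) = w by push_cast; ring]
  have h1 : (A.det : ℝ) ^ ((w - 1 : ℤ) : ℝ) =
      (A.det : ℝ) ^ (w / 2 - 1 : ℝ) * (A.det : ℝ) ^ (w / 2 : ℝ) := by
    rw [← Real.rpow_add hd]; congr 1; push_cast; ring
  have h2 : ‖(A 1 0 * z + A 1 1 : ℂ)‖ ^ ((-w : ℤ) : ℝ) =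
      (‖(A 1 0 * z + A 1 1 : ℂ)‖ ^ (w : ℝ))⁻¹ := by
    rw [← Real.rpow_neg hj.le]; push_cast; rfl
  rw [h1, h2]
  field_simp

lemma HasBound.sl {w : ℤ} {A : Matrix (Fin 2) (Fin 2) ℤ} (hA : 0 < A.det) {f : ℍ → ℂ}
    (hf : HasBound w f) : HasBound w (sl w A f) := by
  obtain ⟨C, hC⟩ := hf
  refine ⟨(A.det : ℝ) ^ (w / 2 - 1 : ℝ) * C, fun z => ?_⟩
  rw [norm_sl hA]
  have hd : (0 : ℝ) < A.det := by exact_mod_cast hA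
  exact mul_le_mul_of_nonneg_left (hC _) (by positivity)

/-- The space of cusp forms of weight `w` and level `Γ₀(M)`, as a space of functions; for `w > 0`
the growth condition is equivalent to vanishing at the cusps. -/
def cuspSpace (M : ℕ) (w : ℤ) : Submodule ℂ (ℍ → ℂ) where
  carrier := {f | MDiff f ∧ (∀ γ ∈ CongruenceSubgroup.Gamma0 M,
    sl w (γ : Matrix (Fin 2) (Fin 2) ℤ) f = f) ∧ HasBound w f}
  add_mem' {f g} hf hg := by
    obtain ⟨C, hC⟩ := hf.2.2
    obtain ⟨D, hD⟩ := hg.2.2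
    refine ⟨hf.1.add hg.1, fun γ hγ => by rw [sl_add, hf.2.1 γ hγ, hg.2.1 γ hγ],
      C + D, fun z => ?_⟩
    have : 0 ≤ z.im ^ (w / 2 : ℝ) := Real.rpow_nonneg z.im_pos.le _
    calc _ ≤ (‖f z‖ + ‖g z‖) * z.im ^ (w / 2 : ℝ) :=
          mul_le_mul_of_nonneg_right (norm_add_le _ _) this
      _ ≤ _ := by rw [add_mul]; exact add_le_add (hC z) (hD z)
  zero_mem' := by
    refine ⟨mdifferentiable_const, fun γ _ => SlashAction.zero_slash _ _, 0, fun z => by simp⟩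
  smul_mem' c f hf := by
    obtain ⟨C, hC⟩ := hf.2.2
    refine ⟨hf.1.const_smul c, fun γ hγ => by rw [sl_smul (by simp), hf.2.1 γ hγ],
      ‖c‖ * C, fun z => ?_⟩
    simp only [Pi.smul_apply, norm_smul, mul_assoc]
    exact mul_le_mul_of_nonneg_left (hC z) (norm_nonneg _)

lemma coe_mem_cuspSpace {M : ℕ} [NeZero M] {w : ℤ} (f : S M w) : (f : ℍ → ℂ) ∈ cuspSpace M w := by
  refine ⟨CuspFormClass.holo f, fun γ hγ => ?_, ?_⟩
  · rw [sl, toGL_SL]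
    exact SlashInvariantFormClass.slash_action_eq f _ ⟨γ, hγ, rfl⟩
  · obtain ⟨C, hC⟩ := CuspFormClass.exists_bound f
    refine ⟨C, fun z => ?_⟩
    have := hC z
    rwa [le_div_iff₀ (Real.rpow_pos_of_pos z.im_pos _)] at this

/-- The bound says |f| ≤ C y^(-w/2), which tends to zero because w > 0. -/
lemma HasBound.isZeroAtImInfty {w : ℤ} (hw : 0 < w) {f : ℍ → ℂ} (hf : HasBound w f) :
    IsZeroAtImInfty f := by
  obtain ⟨C, hC⟩ := hf
  have hw' : (0 : ℝ) < w / 2 := by positivity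
  rw [isZeroAtImInfty_iff]
  intro ε hε
  have h1 : Filter.Tendsto (fun y : ℝ => ε * y ^ (w / 2 : ℝ)) Filter.atTop Filter.atTop :=
    (tendsto_rpow_atTop hw').const_mul_atTop hε
  obtain ⟨A, hA⟩ := Filter.eventually_atTop.mp (h1.eventually_ge_atTop C)
  refine ⟨A, fun z hz => ?_⟩
  have h2 := (hC z).trans (hA _ hz)
  exact le_of_mul_le_mul_right h2 (Real.rpow_pos_of_pos z.im_pos _)

/-- The cusp form attached to an element of `cuspSpace`. -/
def mkCusp {M : ℕ} [NeZero M] {w : ℤ} (hw : 0 < w) (f : ℍ → ℂ) (hf : f ∈ cuspSpace M w) :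
    S M w where
  toFun := f
  slash_action_eq' := by
    rintro _ ⟨γ, hγ, rfl⟩
    rw [← toGL_SL]
    exact hf.2.1 γ hγ
  holo' := hf.1
  zero_at_cusps' {c} hc := by
    rw [Subgroup.IsArithmetic.isCusp_iff_isCusp_SL2Z] at hc
    rw [OnePoint.isZeroAt_iff_forall_SL2Z hc]
    intro γ _
    -- The growth condition is stable under the slash action of all of SL₂(ℤ), so one bound on f
    -- yields vanishing at every cusp.
    have : HasBound w (sl w (γ : Matrix (Fin 2) (Fin 2) ℤ) f) := hf.2.2.sl (by simp)
    rw [sl, toGL_SL] at this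
    exact this.isZeroAtImInfty hw

lemma mkCusp_coe {M : ℕ} [NeZero M] {w : ℤ} (hw : 0 < w) (f : ℍ → ℂ) (hf : f ∈ cuspSpace M w) :
    (mkCusp hw f hf : ℍ → ℂ) = f := rfl

/-! ### `q`-expansions -/

/-- `f` is given by a convergent `q`-expansion. -/
def IsQ (f : ℍ → ℂ) : Prop :=
  MDiff f ∧ ∀ τ : ℍ, HasSum (fun n : ℕ => coeff f n * Function.Periodic.qParam 1 τ ^ n) (f τ)

lemma isQ_of_periodic {f : ℍ → ℂ} (hf : MDiff f)
    (hper : Function.Periodic (f ∘ ofComplex) ((1 : ℝ) : ℂ)) (hb : IsBoundedAtImInfty f) :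
    IsQ f := by
  refine ⟨hf, fun τ => ?_⟩
  simpa [coeff] using UpperHalfPlane.hasSum_qExpansion one_pos hper hf hb τ

lemma periodic_of_hasSum {f : ℍ → ℂ} {c : ℕ → ℂ}
    (h : ∀ τ : ℍ, HasSum (fun n : ℕ => c n * Function.Periodic.qParam 1 τ ^ n) (f τ)) :
    Function.Periodic (f ∘ ofComplex) ((1 : ℝ) : ℂ) := by
  intro z
  by_cases hz : 0 < z.im
  · have hz' : 0 < (z + ((1 : ℝ) : ℂ)).im := by simpa using hz
    simp only [Function.comp_apply, ofComplex_apply_of_im_pos hz, ofComplex_apply_of_im_pos hz']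
    have h1 := h ⟨z, hz⟩
    have h2 := h ⟨_, hz'⟩
    have : Function.Periodic.qParam 1 (z + ((1 : ℝ) : ℂ)) = Function.Periodic.qParam 1 z :=
      by
        simp only [Function.Periodic.qParam, Complex.ofReal_one, div_one, mul_add, mul_one,
          Complex.exp_add, Complex.exp_two_pi_mul_I]
    simp only [this] at h2
    exact h2.unique h1
  · have hz' : ¬ 0 < (z + ((1 : ℝ) : ℂ)).im := by simpa using hz
    rw [Function.comp_apply, Function.comp_apply, ofComplex_apply_of_im_nonpos (not_lt.mp hz),
      ofComplex_apply_of_im_nonpos (not_lt.mp hz')]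

/-- An expansion valid on all of ℍ forces periodicity and boundedness at infinity, so the function
of q is analytic at 0 and its Taylor series is unique. Every later computation of coefficients goes
through this. -/
lemma coeff_eq_of_hasSum {f : ℍ → ℂ} (hf : MDiff f) {c : ℕ → ℂ}
    (h : ∀ τ : ℍ, HasSum (fun n : ℕ => c n * Function.Periodic.qParam 1 τ ^ n) (f τ)) (n : ℕ) :
    coeff f n = c n := by
  have h' : ∀ τ : ℍ, HasSum (fun n : ℕ => c n • Function.Periodic.qParam 1 τ ^ n) (f τ) := by
    simpa only [smul_eq_mul] using h
  have hb := isBoundedAtImInfty_of_hasSum_qExpansion one_pos h'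
  have ha := analyticAt_cuspFunction_zero one_pos (periodic_of_hasSum h) hf hb
  have h1 := (hasFPowerSeriesOnBall_cuspFunction one_pos ha h').hasFPowerSeriesAt
  have h2 := congrArg (FormalMultilinearSeries.coeff · n)
    (h1.eq_formalMultilinearSeries ha.hasFPowerSeriesAt)
  simp only [FormalMultilinearSeries.coeff_ofScalars] at h2
  rw [coeff, UpperHalfPlane.qExpansion_coeff, h2]
  ring

lemma isQ_of_hasSum {f : ℍ → ℂ} (hf : MDiff f) {c : ℕ → ℂ}
    (h : ∀ τ : ℍ, HasSum (fun n : ℕ => c n * Function.Periodic.qParam 1 τ ^ n) (f τ)) : IsQ f :=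
  ⟨hf, by simpa only [coeff_eq_of_hasSum hf h] using h⟩

lemma IsQ.ext {f g : ℍ → ℂ} (hf : IsQ f) (hg : IsQ g) (h : ∀ n, coeff f n = coeff g n) :
    f = g := by
  funext τ
  have h1 := hf.2 τ
  simp only [h] at h1
  exact h1.unique (hg.2 τ)

lemma coeff_add {f g : ℍ → ℂ} (hf : IsQ f) (hg : IsQ g) (n : ℕ) :
    coeff (f + g) n = coeff f n + coeff g n :=
  coeff_eq_of_hasSum (hf.1.add hg.1) (c := fun n => coeff f n + coeff g n) (fun τ => by
    simpa only [add_mul, Pi.add_apply] using (hf.2 τ).add (hg.2 τ)) n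

lemma IsQ.smul {f : ℍ → ℂ} (hf : IsQ f) (a : ℂ) : IsQ (a • f) :=
  isQ_of_hasSum (hf.1.const_smul a) (c := fun n => a * coeff f n) fun τ => by
    simpa only [mul_assoc, Pi.smul_apply, smul_eq_mul] using (hf.2 τ).mul_left a

lemma coeff_smul {f : ℍ → ℂ} (hf : IsQ f) (a : ℂ) (n : ℕ) :
    coeff (a • f) n = a * coeff f n :=
  coeff_eq_of_hasSum (hf.1.const_smul a) (c := fun n => a * coeff f n) (fun τ => by
    simpa only [mul_assoc, Pi.smul_apply, smul_eq_mul] using (hf.2 τ).mul_left a) n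

lemma hasSum_qParam_zero (τ : ℍ) : HasSum (fun n : ℕ => (0 : ℕ → ℂ) n *
    Function.Periodic.qParam 1 τ ^ n) ((0 : ℍ → ℂ) τ) := by
  simp only [Pi.zero_apply, zero_mul]
  exact hasSum_zero

lemma isQ_zero : IsQ 0 :=
  isQ_of_hasSum mdifferentiable_const (c := 0) hasSum_qParam_zero

lemma coeff_zero (n : ℕ) : coeff 0 n = 0 :=
  coeff_eq_of_hasSum mdifferentiable_const (c := 0) hasSum_qParam_zero n

lemma coeff_sub {f g : ℍ → ℂ} (hf : IsQ f) (hg : IsQ g) (n : ℕ) :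
    coeff (f - g) n = coeff f n - coeff g n := by
  have := coeff_add hf (hg.smul (-1)) n
  rw [coeff_smul hg, neg_one_smul, ← sub_eq_add_neg] at this
  rw [this]; ring

/-! ### The operators `U` and `V` -/

/-- The matrix `diag(d, 1)`. -/
def matV (d : ℕ) : Matrix (Fin 2) (Fin 2) ℤ := !![(d : ℤ), 0; 0, 1]

/-- The matrix `(1, j; 0, d)`. -/
def matU (d : ℕ) (j : ℤ) : Matrix (Fin 2) (Fin 2) ℤ := !![1, j; 0, (d : ℤ)]

lemma det_matV (d : ℕ) : (matV d).det = d := by simp [matV, Matrix.det_fin_two]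

lemma det_matU (d : ℕ) (j : ℤ) : (matU d j).det = d := by simp [matU, Matrix.det_fin_two]

lemma det_matV_pos {d : ℕ} (hd : 0 < d) : 0 < (matV d).det := by
  rw [det_matV]; exact_mod_cast hd

lemma det_matU_pos {d : ℕ} (hd : 0 < d) (j : ℤ) : 0 < (matU d j).det := by
  rw [det_matU]; exact_mod_cast hd

lemma im_mul_pos {d : ℕ} (hd : 0 < d) (τ : ℍ) : 0 < ((d : ℂ) * (τ : ℂ)).im := by
  have : (0 : ℝ) < d := by exact_mod_cast hd
  have := mul_pos this τ.im_pos
  simpa using this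

lemma im_add_div_pos {d : ℕ} (hd : 0 < d) (b : ℝ) (τ : ℍ) :
    0 < (((τ : ℂ) + (b : ℂ)) / (d : ℂ)).im := by
  have : (0 : ℝ) < d := by exact_mod_cast hd
  have h : (((τ : ℂ) + (b : ℂ)) / (d : ℂ)).im = τ.im / d := by
    rw [Complex.div_natCast_im]; simp
  rw [h]
  have := τ.im_pos
  positivity

lemma matV_smul {d : ℕ} (hd : 0 < d) (τ : ℍ) :
    toGL (matV d) • τ = ofComplex ((d : ℂ) * (τ : ℂ)) := by
  apply UpperHalfPlane.ext
  rw [coe_toGL_smul (det_matV_pos hd), ofComplex_apply_of_im_pos (im_mul_pos hd τ)]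
  simp [matV]

lemma matU_smul {d : ℕ} (hd : 0 < d) (j : ℤ) (τ : ℍ) :
    toGL (matU d j) • τ = ofComplex (((τ : ℂ) + (j : ℂ)) / (d : ℂ)) := by
  apply UpperHalfPlane.ext
  have := im_add_div_pos hd j τ
  rw [Complex.ofReal_intCast] at this
  rw [coe_toGL_smul (det_matU_pos hd j), ofComplex_apply_of_im_pos this]
  simp [matU]

lemma sl_matV {d : ℕ} (hd : 0 < d) (w : ℤ) (f : ℍ → ℂ) :
    sl w (matV d) f = (d : ℂ) ^ (w - 1) • opV d f := by
  funext τ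
  rw [sl_apply (det_matV_pos hd), matV_smul hd, det_matV]
  simp [matV, opV]

lemma sl_matU {d : ℕ} (hd : 0 < d) (w : ℤ) (j : ℤ) (f : ℍ → ℂ) (τ : ℍ) :
    sl w (matU d j) f τ = (d : ℂ)⁻¹ * f (ofComplex (((τ : ℂ) + (j : ℂ)) / (d : ℂ))) := by
  have hd' : (d : ℂ) ≠ 0 := by exact_mod_cast hd.ne'
  rw [sl_apply (det_matU_pos hd j), matU_smul hd, det_matU]
  congr 1
  simp only [matU, Matrix.of_apply, Matrix.cons_val', Matrix.cons_val_zero, Matrix.cons_val_one,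
    Matrix.cons_val_fin_one, Int.cast_zero, zero_mul, zero_add, Int.cast_natCast]
  rw [← zpow_add₀ hd', show w - 1 + -w = -1 by ring, zpow_neg_one]

lemma opV_eq_sl {d : ℕ} (hd : 0 < d) (w : ℤ) (f : ℍ → ℂ) :
    opV d f = (d : ℂ) ^ (1 - w) • sl w (matV d) f := by
  have hd' : (d : ℂ) ≠ 0 := by exact_mod_cast hd.ne'
  rw [sl_matV hd, smul_smul, ← zpow_add₀ hd', show 1 - w + (w - 1) = 0 by ring, zpow_zero, one_smul]

lemma opU_eq_sl {d : ℕ} (hd : 0 < d) (w : ℤ) (f : ℍ → ℂ) :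
    opU d f = ∑ j ∈ Finset.range d, sl w (matU d j) f := by
  funext τ
  rw [Finset.sum_apply]
  simp only [sl_matU hd, opU, LinearMap.coe_mk, AddHom.coe_mk, Finset.mul_sum, Int.cast_natCast]

lemma mdiff_opV {d : ℕ} (hd : 0 < d) {f : ℍ → ℂ} (hf : MDiff f) : MDiff (opV d f) := by
  rw [opV_eq_sl hd 0]
  exact (mdiff_sl _ _ hf).const_smul _

lemma mdiff_finsetSum {ι : Type*} (s : Finset ι) {f : ι → ℍ → ℂ} (hf : ∀ i ∈ s, MDiff (f i)) :
    MDiff (∑ i ∈ s, f i) := by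
  classical
  induction s using Finset.induction_on with
  | empty => exact mdifferentiable_const
  | insert a s ha ih =>
    rw [Finset.sum_insert ha]
    exact (hf a (by simp)).add (ih fun i hi => hf i (by simp [hi]))

lemma mdiff_opU {d : ℕ} (hd : 0 < d) {f : ℍ → ℂ} (hf : MDiff f) : MDiff (opU d f) := by
  rw [opU_eq_sl hd 0]
  exact mdiff_finsetSum _ fun i _ => mdiff_sl _ _ hf

lemma hasSum_opV {d : ℕ} (hd : 0 < d) {f : ℍ → ℂ} (hf : IsQ f) (τ : ℍ) :
    HasSum (fun n : ℕ => (if d ∣ n then coeff f (n / d) else 0) *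
      Function.Periodic.qParam 1 τ ^ n) (opV d f τ) := by
  have h1 := hf.2 (ofComplex ((d : ℂ) * (τ : ℂ)))
  have hinj : Function.Injective (fun n : ℕ => d * n) := fun a b h => Nat.eq_of_mul_eq_mul_left hd h
  have key : (fun n : ℕ => (if d ∣ n then coeff f (n / d) else 0) *
      Function.Periodic.qParam 1 τ ^ n) ∘ (fun n : ℕ => d * n) =
      fun n => coeff f n * Function.Periodic.qParam 1
        ((ofComplex ((d : ℂ) * (τ : ℂ)) : ℍ) : ℂ) ^ n := by
    funext n
    simp only [Function.comp_apply, dvd_mul_right, if_true, Nat.mul_div_cancel_left _ hd]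
    rw [ofComplex_apply_of_im_pos (im_mul_pos hd τ)]
    congr 1
    simp only [Function.Periodic.qParam]
    rw [← Complex.exp_nat_mul, ← Complex.exp_nat_mul]
    congr 1
    push_cast
    ring
  rw [← key] at h1
  refine (hinj.hasSum_iff fun n hn => ?_).mp h1
  rw [if_neg, zero_mul]
  rintro ⟨m, rfl⟩
  exact hn ⟨m, rfl⟩

lemma IsQ.opV {d : ℕ} (hd : 0 < d) {f : ℍ → ℂ} (hf : IsQ f) : IsQ (opV d f) :=
  isQ_of_hasSum (mdiff_opV hd hf.1) (hasSum_opV hd hf)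

lemma coeff_opV {d : ℕ} (hd : 0 < d) {f : ℍ → ℂ} (hf : IsQ f) (n : ℕ) :
    coeff (opV d f) n = if d ∣ n then coeff f (n / d) else 0 :=
  coeff_eq_of_hasSum (mdiff_opV hd hf.1) (hasSum_opV hd hf) n

lemma sum_exp_range {d : ℕ} (hd : 0 < d) (n : ℤ) :
    ∑ b ∈ Finset.range d, Complex.exp (2 * Real.pi * Complex.I * (n * b / d)) =
      if (d : ℤ) ∣ n then (d : ℂ) else 0 := by
  have hd' : (d : ℂ) ≠ 0 := by exact_mod_cast hd.ne'
  set ζ := Complex.exp (2 * Real.pi * Complex.I * (n / d)) with hζ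
  have h1 : ∀ b : ℕ, Complex.exp (2 * Real.pi * Complex.I * (n * b / d)) = ζ ^ b := by
    intro b
    rw [hζ, ← Complex.exp_nat_mul]
    congr 1
    ring
  simp only [h1]
  have hζd : ζ ^ d = 1 := by
    rw [hζ, ← Complex.exp_nat_mul, Complex.exp_eq_one_iff]
    exact ⟨n, by field_simp⟩
  split_ifs with h
  · obtain ⟨m, rfl⟩ := h
    have : ζ = 1 := by
      rw [hζ, Complex.exp_eq_one_iff]
      exact ⟨m, by push_cast; field_simp⟩
    simp [this]
  · have hne : ζ ≠ 1 := by
      rw [hζ, Ne, Complex.exp_eq_one_iff]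
      rintro ⟨m, hm⟩
      apply h
      refine ⟨m, ?_⟩
      have h2 : (2 * Real.pi * Complex.I : ℂ) ≠ 0 := Complex.two_pi_I_ne_zero
      have h3 : (n / d : ℂ) = m := by
        apply mul_left_cancel₀ h2
        rw [hm]; ring
      rw [div_eq_iff hd'] at h3
      have : (n : ℂ) = ((d * m : ℤ) : ℂ) := by push_cast; rw [h3]; ring
      exact_mod_cast this
    rw [geom_sum_eq hne, hζd]; simp

lemma sum_qParam_shift {d : ℕ} (hd : 0 < d) (τ : ℍ) (n : ℕ) (a : ℂ) :
    (d : ℂ)⁻¹ * ∑ b ∈ Finset.range d, a *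
      Function.Periodic.qParam 1 ((ofComplex (((τ : ℂ) + (b : ℂ)) / (d : ℂ)) : ℍ) : ℂ) ^ n =
      a * Complex.exp (2 * Real.pi * Complex.I * (n * τ / d)) *
        ((d : ℂ)⁻¹ * if (d : ℤ) ∣ (n : ℤ) then (d : ℂ) else 0) := by
  rw [← sum_exp_range hd, Finset.mul_sum, Finset.mul_sum, Finset.mul_sum]
  refine Finset.sum_congr rfl fun b _ => ?_
  have hpos : 0 < (((τ : ℂ) + (b : ℂ)) / (d : ℂ)).im := by
    have := im_add_div_pos hd (b : ℝ) τ
    rwa [Complex.ofReal_natCast] at this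
  have hd' : (d : ℂ) ≠ 0 := by exact_mod_cast hd.ne'
  rw [ofComplex_apply_of_im_pos hpos]
  simp only [Function.Periodic.qParam]
  rw [← Complex.exp_nat_mul]
  have : Complex.exp (↑n * (2 * ↑Real.pi * Complex.I * ((↑τ + ↑b) / ↑d) / ((1 : ℝ) : ℂ))) =
      Complex.exp (2 * Real.pi * Complex.I * (n * τ / d)) *
      Complex.exp (2 * Real.pi * Complex.I * ((n : ℤ) * b / d)) := by
    rw [← Complex.exp_add]
    congr 1
    rw [Complex.ofReal_one, Int.cast_natCast]
    field_simp
  rw [this]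
  ring

lemma hasSum_opU {d : ℕ} (hd : 0 < d) {f : ℍ → ℂ} (hf : IsQ f) (τ : ℍ) :
    HasSum (fun n : ℕ => coeff f (d * n) * Function.Periodic.qParam 1 τ ^ n) (opU d f τ) := by
  have hd' : (d : ℂ) ≠ 0 := by exact_mod_cast hd.ne'
  have h1 : HasSum (fun n : ℕ => (d : ℂ)⁻¹ * ∑ b ∈ Finset.range d, coeff f n *
      Function.Periodic.qParam 1 ((ofComplex (((τ : ℂ) + (b : ℂ)) / (d : ℂ)) : ℍ) : ℂ) ^ n)
      (opU d f τ) := by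
    have h0 : opU d f τ = (d : ℂ)⁻¹ * ∑ b ∈ Finset.range d,
      f (ofComplex (((τ : ℂ) + (b : ℂ)) / (d : ℂ))) := rfl
    rw [h0]
    refine HasSum.mul_left _ (hasSum_sum fun b _ => ?_)
    exact hf.2 (ofComplex (((τ : ℂ) + (b : ℂ)) / (d : ℂ)))
  have hinj : Function.Injective (fun n : ℕ => d * n) := fun a b h => Nat.eq_of_mul_eq_mul_left hd h
  simp only [sum_qParam_shift hd] at h1
  rw [← hinj.hasSum_iff] at h1
  · have key : (fun n : ℕ => coeff f n * Complex.exp (2 * Real.pi * Complex.I * (n * τ / d)) *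
        ((d : ℂ)⁻¹ * if (d : ℤ) ∣ (n : ℤ) then (d : ℂ) else 0)) ∘ (fun n : ℕ => d * n) =
        fun n : ℕ => coeff f (d * n) * Function.Periodic.qParam 1 τ ^ n := by
      funext n
      have hdvd : (d : ℤ) ∣ ((d * n : ℕ) : ℤ) := by exact_mod_cast Nat.dvd_mul_right d n
      rw [Function.comp_apply, if_pos hdvd, inv_mul_cancel₀ hd', mul_one]
      congr 1
      rw [Function.Periodic.qParam, ← Complex.exp_nat_mul]
      congr 1
      rw [Complex.ofReal_one, Nat.cast_mul]
      field_simp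
    rwa [key] at h1
  · intro n hn
    rw [if_neg, mul_zero, mul_zero]
    intro h
    obtain ⟨m, rfl⟩ := Int.natCast_dvd_natCast.mp h
    exact hn ⟨m, rfl⟩

lemma IsQ.opU {d : ℕ} (hd : 0 < d) {f : ℍ → ℂ} (hf : IsQ f) : IsQ (opU d f) :=
  isQ_of_hasSum (mdiff_opU hd hf.1) (hasSum_opU hd hf)

lemma coeff_opU {d : ℕ} (hd : 0 < d) {f : ℍ → ℂ} (hf : IsQ f) (n : ℕ) :
    coeff (opU d f) n = coeff f (d * n) :=
  coeff_eq_of_hasSum (mdiff_opU hd hf.1) (hasSum_opU hd hf) n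

lemma isQ_of_mem {M : ℕ} {w : ℤ} (hw : 0 < w) {f : ℍ → ℂ} (hf : f ∈ cuspSpace M w) : IsQ f := by
  refine isQ_of_periodic hf.1 ?_ ?_
  · have hT := hf.2.1 ModularGroup.T (by
      rw [CongruenceSubgroup.Gamma0_mem]; simp [ModularGroup.T])
    have hdet : 0 < (ModularGroup.T : Matrix (Fin 2) (Fin 2) ℤ).det := by simp
    intro z
    by_cases hz : 0 < z.im
    · have hz' : 0 < (z + ((1 : ℝ) : ℂ)).im := by simpa using hz
      simp only [Function.comp_apply, ofComplex_apply_of_im_pos hz, ofComplex_apply_of_im_pos hz']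
      have := congrFun hT ⟨z, hz⟩
      rw [sl_apply hdet] at this
      rw [← this]
      have h2 : toGL (ModularGroup.T : Matrix (Fin 2) (Fin 2) ℤ) • (⟨z, hz⟩ : ℍ) = ⟨_, hz'⟩ := by
        apply UpperHalfPlane.ext
        rw [coe_toGL_smul hdet]
        simp [ModularGroup.T]
      rw [h2]
      simp [ModularGroup.T]
    · have hz' : ¬ 0 < (z + ((1 : ℝ) : ℂ)).im := by simpa using hz
      rw [Function.comp_apply, Function.comp_apply, ofComplex_apply_of_im_nonpos (not_lt.mp hz),
        ofComplex_apply_of_im_nonpos (not_lt.mp hz')]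
  · exact (hf.2.2.isZeroAtImInfty hw).isBoundedAtImInfty

lemma coeff_zero_of_mem {M : ℕ} {w : ℤ} (hw : 0 < w) {f : ℍ → ℂ} (hf : f ∈ cuspSpace M w) :
    coeff f 0 = 0 := by
  have hQ := isQ_of_mem hw hf
  rw [coeff, UpperHalfPlane.qExpansion_coeff_zero one_pos
    (analyticAt_cuspFunction_zero one_pos (periodic_of_hasSum hQ.2) hf.1
      (hf.2.2.isZeroAtImInfty hw).isBoundedAtImInfty) (periodic_of_hasSum hQ.2)]
  exact (hf.2.2.isZeroAtImInfty hw).valueAtInfty_eq_zero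

/-! ### Sums over coset representatives -/

lemma mem_Gamma0_iff_dvd {M : ℕ} {γ : SL(2, ℤ)} :
    γ ∈ CongruenceSubgroup.Gamma0 M ↔ (M : ℤ) ∣ γ 1 0 := by
  rw [CongruenceSubgroup.Gamma0_mem, ZMod.intCast_zmod_eq_zero_iff_dvd]

/-- `A ∈ Γ₀(M) B`. -/
def CosetRel (M : ℕ) (A B : Matrix (Fin 2) (Fin 2) ℤ) : Prop :=
  ∃ γ ∈ CongruenceSubgroup.Gamma0 M, A = (γ : Matrix (Fin 2) (Fin 2) ℤ) * B

lemma CosetRel.of_entries {M : ℕ} {A B : Matrix (Fin 2) (Fin 2) ℤ} (a b c d : ℤ)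
    (hdet : a * d - b * c = 1) (hc : (M : ℤ) ∣ c) (h00 : A 0 0 = a * B 0 0 + b * B 1 0)
    (h01 : A 0 1 = a * B 0 1 + b * B 1 1) (h10 : A 1 0 = c * B 0 0 + d * B 1 0)
    (h11 : A 1 1 = c * B 0 1 + d * B 1 1) : CosetRel M A B := by
  refine ⟨⟨!![a, b; c, d], by rw [Matrix.det_fin_two_of]; exact hdet⟩,
    mem_Gamma0_iff_dvd.mpr (by simpa using hc), ?_⟩
  ext i j
  fin_cases i <;> fin_cases j <;> simp [Matrix.mul_apply, Fin.sum_univ_two, h00, h01, h10, h11]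

lemma CosetRel.entries {M : ℕ} {A B : Matrix (Fin 2) (Fin 2) ℤ} (h : CosetRel M A B) :
    ∃ a b c d : ℤ, a * d - b * c = 1 ∧ (M : ℤ) ∣ c ∧ A 0 0 = a * B 0 0 + b * B 1 0 ∧
      A 0 1 = a * B 0 1 + b * B 1 1 ∧ A 1 0 = c * B 0 0 + d * B 1 0 ∧
      A 1 1 = c * B 0 1 + d * B 1 1 := by
  obtain ⟨γ, hγ, rfl⟩ := h
  have := γ.det_coe
  rw [Matrix.det_fin_two] at this
  exact ⟨γ 0 0, γ 0 1, γ 1 0, γ 1 1, this, mem_Gamma0_iff_dvd.mp hγ,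
    by simp [Matrix.mul_apply, Fin.sum_univ_two], by simp [Matrix.mul_apply, Fin.sum_univ_two],
    by simp [Matrix.mul_apply, Fin.sum_univ_two], by simp [Matrix.mul_apply, Fin.sum_univ_two]⟩

lemma CosetRel.sl_eq {M : ℕ} {w : ℤ} {A B : Matrix (Fin 2) (Fin 2) ℤ} (h : CosetRel M A B)
    (hB : 0 < B.det) {f : ℍ → ℂ} (hf : f ∈ cuspSpace M w) : sl w A f = sl w B f := by
  obtain ⟨γ, hγ, rfl⟩ := h
  rw [sl_mul (by simp) hB.ne', hf.2.1 γ hγ]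

lemma CosetRel.symm_trans {M : ℕ} {A B C : Matrix (Fin 2) (Fin 2) ℤ} (h : CosetRel M A C)
    (h' : CosetRel M B C) : CosetRel M A B := by
  obtain ⟨γ, hγ, rfl⟩ := h
  obtain ⟨δ, hδ, rfl⟩ := h'
  refine ⟨γ * δ⁻¹, mul_mem hγ (inv_mem hδ), ?_⟩
  rw [← Matrix.mul_assoc, ← Matrix.SpecialLinearGroup.coe_mul, inv_mul_cancel_right]

lemma CosetRel.cancel_right {M : ℕ} {A B : Matrix (Fin 2) (Fin 2) ℤ} (γ : SL(2, ℤ))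
    (h : CosetRel M (A * γ) (B * γ)) : CosetRel M A B := by
  obtain ⟨δ, hδ, h⟩ := h
  refine ⟨δ, hδ, ?_⟩
  have := congrArg (fun X => X * ((γ⁻¹ : SL(2, ℤ)) : Matrix (Fin 2) (Fin 2) ℤ)) h
  simpa only [Matrix.mul_assoc, ← Matrix.SpecialLinearGroup.coe_mul, mul_inv_cancel,
    Matrix.SpecialLinearGroup.coe_one, Matrix.mul_one] using this

/-- The matrices `r i` represent distinct cosets of `Γ₀(M')`, whose union is stable under right
multiplication by `Γ₀(M)`. -/
structure IsReps {ι : Type*} (M' M : ℕ) (r : ι → Matrix (Fin 2) (Fin 2) ℤ) : Prop where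
  pos : ∀ i, 0 < (r i).det
  step : ∀ γ ∈ CongruenceSubgroup.Gamma0 M, ∀ i, ∃ j,
    CosetRel M' (r i * (γ : Matrix (Fin 2) (Fin 2) ℤ)) (r j)
  inj : ∀ i j, CosetRel M' (r i) (r j) → i = j

lemma hasBound_finsetSum {ι : Type*} {w : ℤ} (s : Finset ι) {f : ι → ℍ → ℂ}
    (hf : ∀ i ∈ s, HasBound w (f i)) : HasBound w (∑ i ∈ s, f i) := by
  classical
  choose! C hC using hf
  refine ⟨∑ i ∈ s, C i, fun z => ?_⟩
  rw [Finset.sum_apply]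
  calc _ ≤ (∑ i ∈ s, ‖f i z‖) * z.im ^ (w / 2 : ℝ) :=
        mul_le_mul_of_nonneg_right (norm_sum_le _ _) (Real.rpow_nonneg z.im_pos.le _)
    _ ≤ _ := by
        rw [Finset.sum_mul]
        exact Finset.sum_le_sum fun i hi => hC i hi z

/-- Right multiplication by γ permutes the cosets: `step` gives a map of the index set, `inj` makes
it injective, and finiteness makes it bijective. The slashed sum is therefore only reordered. -/
lemma IsReps.sum_mem {ι : Type*} [Fintype ι] {M' M : ℕ} {w : ℤ}
    {r : ι → Matrix (Fin 2) (Fin 2) ℤ} (hr : IsReps M' M r) {f : ℍ → ℂ}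
    (hf : f ∈ cuspSpace M' w) : ∑ i, sl w (r i) f ∈ cuspSpace M w := by
  refine ⟨mdiff_finsetSum _ fun i _ => mdiff_sl _ _ hf.1, fun γ hγ => ?_,
    hasBound_finsetSum _ fun i _ => hf.2.2.sl (hr.pos i)⟩
  choose σ hσ using hr.step γ hγ
  have hinj : Function.Injective σ := fun i j hij => by
    refine hr.inj _ _ (CosetRel.cancel_right γ ?_)
    have h1 := hσ i
    rw [hij] at h1
    exact h1.symm_trans (hσ j)
  rw [sl_sum, ← (Equiv.ofBijective σ hinj.bijective_of_finite).sum_comp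
    (fun i => sl w (r i) f)]
  refine Finset.sum_congr rfl fun i _ => ?_
  rw [← sl_mul (hr.pos i).ne' (by simp), (hσ i).sl_eq (hr.pos _) hf]
  rfl

/-- Two lists of matrices that represent the same cosets give the same operator. It is enough that
one list is irredundant and maps into the other, since the lists have equal length. -/
lemma sum_sl_eq_of_rel {ι κ : Type*} [Fintype ι] [Fintype κ] {M : ℕ} {w : ℤ}
    {r : ι → Matrix (Fin 2) (Fin 2) ℤ} {s : κ → Matrix (Fin 2) (Fin 2) ℤ}
    (hs : ∀ j, 0 < (s j).det) (hinj : ∀ i i', CosetRel M (r i) (r i') → i = i')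
    (hex : ∀ i, ∃ j, CosetRel M (r i) (s j)) (hcard : Fintype.card ι = Fintype.card κ)
    {f : ℍ → ℂ} (hf : f ∈ cuspSpace M w) : ∑ i, sl w (r i) f = ∑ j, sl w (s j) f := by
  choose σ hσ using hex
  have hi : Function.Injective σ := fun i j hij => by
    refine hinj _ _ ?_
    have h1 := hσ i
    rw [hij] at h1
    exact h1.symm_trans (hσ j)
  rw [← (Equiv.ofBijective σ ((Fintype.bijective_iff_injective_and_card σ).mpr
    ⟨hi, hcard⟩)).sum_comp (fun j => sl w (s j) f)]
  exact Finset.sum_congr rfl fun i _ => (hσ i).sl_eq (hs _) hf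

/-! ### Hecke operators on cusp forms -/

lemma exists_fin_of_not_dvd {ℓ : ℕ} (hℓ : ℓ.Prime) {a : ℤ} (b : ℤ) (ha : ¬ (ℓ : ℤ) ∣ a) :
    ∃ j : Fin ℓ, (ℓ : ℤ) ∣ b - a * (j : ℕ) := by
  have hp : Prime (ℓ : ℤ) := Nat.prime_iff_prime_int.mp hℓ
  obtain ⟨u, v, huv⟩ := (hp.coprime_iff_not_dvd.mpr ha)
  have hpos : (0 : ℤ) < ℓ := by exact_mod_cast hℓ.pos
  have h1 := Int.emod_nonneg (v * b) hpos.ne'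
  have h2 := Int.emod_lt_of_pos (v * b) hpos
  refine ⟨⟨((v * b) % ℓ).toNat, by omega⟩, ?_⟩
  simp only [Int.toNat_of_nonneg h1]
  have h3 := Int.emod_add_mul_ediv (v * b) ℓ
  refine ⟨b * u + a * (v * b / ℓ), ?_⟩
  linear_combination -b * huv - a * h3

/-- Representatives of the cosets `Γ₀(M) \ {A : det A = ℓ, M ∣ A 1 0}`. -/
def heckeRep (ℓ : ℕ) : Option (Fin ℓ) → Matrix (Fin 2) (Fin 2) ℤ
  | none => matV ℓ
  | some j => matU ℓ (j : ℕ)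

lemma heckeRep_det_pos {ℓ : ℕ} (hℓ : 0 < ℓ) (i : Option (Fin ℓ)) : 0 < (heckeRep ℓ i).det := by
  cases i with
  | none => exact det_matV_pos hℓ
  | some j => exact det_matU_pos hℓ _

/-- A (1, j; 0, ℓ)⁻¹ is integral exactly when the second column of A is j times the first modulo ℓ.
One entry of the first column is a unit modulo ℓ and determines j; the congruence for the other row
then follows from det A = ℓ. -/
lemma rel_matU {M ℓ : ℕ} (hℓ : ℓ.Prime) {A : Matrix (Fin 2) (Fin 2) ℤ} (hA : A.det = ℓ)
    (hM : (M : ℤ) ∣ A 1 0) (h : ¬ ((ℓ : ℤ) ∣ A 0 0 ∧ (ℓ : ℤ) ∣ A 1 0)) :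
    ∃ j : Fin ℓ, CosetRel M A (matU ℓ (j : ℕ)) := by
  have hp : Prime (ℓ : ℤ) := Nat.prime_iff_prime_int.mp hℓ
  rw [Matrix.det_fin_two] at hA
  have key : ∀ j : Fin ℓ, (ℓ : ℤ) ∣ A 0 1 - A 0 0 * (j : ℕ) → (ℓ : ℤ) ∣ A 1 1 - A 1 0 * (j : ℕ) →
      CosetRel M A (matU ℓ (j : ℕ)) := by
    rintro j ⟨u, hu⟩ ⟨v, hv⟩
    refine CosetRel.of_entries (A 0 0) u (A 1 0) v ?_ hM ?_ ?_ ?_ ?_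
    · apply mul_left_cancel₀ hp.ne_zero
      linear_combination hA - A 0 0 * hv + A 1 0 * hu
    all_goals simp [matU]
    · linear_combination hu
    · linear_combination hv
  by_cases h0 : (ℓ : ℤ) ∣ A 0 0
  · have h1 : ¬ (ℓ : ℤ) ∣ A 1 0 := fun h1 => h ⟨h0, h1⟩
    obtain ⟨j, hj⟩ := exists_fin_of_not_dvd hℓ (A 1 1) h1
    refine ⟨j, key j ?_ hj⟩
    have : (ℓ : ℤ) ∣ A 1 0 * (A 0 1 - A 0 0 * (j : ℕ)) := by
      rw [show A 1 0 * (A 0 1 - A 0 0 * (j : ℕ)) = A 0 0 * (A 1 1 - A 1 0 * (j : ℕ)) - ℓ by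
        linear_combination -hA]
      exact dvd_sub (dvd_mul_of_dvd_right hj _) dvd_rfl
    exact (hp.dvd_or_dvd this).resolve_left h1
  · obtain ⟨j, hj⟩ := exists_fin_of_not_dvd hℓ (A 0 1) h0
    refine ⟨j, key j hj ?_⟩
    have : (ℓ : ℤ) ∣ A 0 0 * (A 1 1 - A 1 0 * (j : ℕ)) := by
      rw [show A 0 0 * (A 1 1 - A 1 0 * (j : ℕ)) = A 1 0 * (A 0 1 - A 0 0 * (j : ℕ)) + ℓ by
        linear_combination hA]
      exact dvd_add (dvd_mul_of_dvd_right hj _) dvd_rfl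
    exact (hp.dvd_or_dvd this).resolve_left h0

lemma rel_heckeRep {M ℓ : ℕ} (hℓ : ℓ.Prime) (hℓM : ¬ ℓ ∣ M) {A : Matrix (Fin 2) (Fin 2) ℤ}
    (hA : A.det = ℓ) (hM : (M : ℤ) ∣ A 1 0) : ∃ i, CosetRel M A (heckeRep ℓ i) := by
  have hp : Prime (ℓ : ℤ) := Nat.prime_iff_prime_int.mp hℓ
  by_cases h : (ℓ : ℤ) ∣ A 0 0 ∧ (ℓ : ℤ) ∣ A 1 0
  · obtain ⟨⟨u, hu⟩, v, hv⟩ := h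
    rw [Matrix.det_fin_two] at hA
    refine ⟨none, CosetRel.of_entries u (A 0 1) v (A 1 1) ?_ ?_ ?_ ?_ ?_ ?_⟩
    · apply mul_left_cancel₀ hp.ne_zero
      linear_combination hA - A 1 1 * hu + A 0 1 * hv
    -- This is where ℓ ∤ M enters: divisibility by M survives the division of the lower left entry
    -- by ℓ.
    · rw [hv] at hM
      have hcop : IsCoprime (M : ℤ) (ℓ : ℤ) := by
        rw [Nat.isCoprime_iff_coprime]
        exact ((Nat.Prime.coprime_iff_not_dvd hℓ).mpr hℓM).symm
      exact hcop.dvd_of_dvd_mul_left hM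
    all_goals simp [heckeRep, matV]
    · linear_combination hu
    · linear_combination hv
  · obtain ⟨j, hj⟩ := rel_matU hℓ hA hM h
    exact ⟨some j, hj⟩

lemma heckeRep_inj {M ℓ : ℕ} (hℓ : ℓ.Prime) (i j : Option (Fin ℓ))
    (h : CosetRel M (heckeRep ℓ i) (heckeRep ℓ j)) : i = j := by
  have hp : Prime (ℓ : ℤ) := Nat.prime_iff_prime_int.mp hℓ
  obtain ⟨a, b, c, d, hdet, -, h00, h01, h10, h11⟩ := h.entries
  cases i with
  | none =>
    cases j with
    | none => rfl
    | some j =>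
      simp [heckeRep, matU, matV] at h00 h01 h10 h11
      exfalso
      rw [← h10] at h11
      exact hp.not_isUnit (IsUnit.of_mul_eq_one d (by linear_combination -h11))
  | some i =>
    cases j with
    | none =>
      simp [heckeRep, matU, matV] at h00 h01 h10 h11
      exfalso
      exact hp.not_isUnit (IsUnit.of_mul_eq_one a (by linear_combination -h00))
    | some j =>
      simp [heckeRep, matU] at h00 h01 h10 h11
      have h1 : (ℓ : ℤ) ∣ ((i : ℕ) : ℤ) - ((j : ℕ) : ℤ) :=
        ⟨b, by rw [h01, ← h00]; ring⟩
      have h2 : ((i : ℕ) : ℤ) - ((j : ℕ) : ℤ) = 0 := by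
        apply Int.eq_zero_of_abs_lt_dvd h1
        have := i.2; have := j.2
        rw [abs_lt]; omega
      have : (i : ℕ) = j := by omega
      rw [Fin.ext this]

lemma isReps_heckeRep {M ℓ : ℕ} (hℓ : ℓ.Prime) (hℓM : ¬ ℓ ∣ M) : IsReps M M (heckeRep ℓ) where
  pos := heckeRep_det_pos hℓ.pos
  step γ hγ i := by
    have hγ' := mem_Gamma0_iff_dvd.mp hγ
    refine rel_heckeRep hℓ hℓM ?_ ?_
    · rw [Matrix.det_mul, γ.det_coe, mul_one]
      cases i with
      | none => exact det_matV _
      | some j => exact det_matU _ _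
    · cases i with
      | none => simpa [heckeRep, matV, Matrix.mul_apply, Fin.sum_univ_two] using hγ'
      | some j =>
        simpa [heckeRep, matU, Matrix.mul_apply, Fin.sum_univ_two] using hγ'.mul_left _
  inj := heckeRep_inj hℓ

lemma isReps_matU {M ℓ : ℕ} (hℓ : ℓ.Prime) (hℓM : ℓ ∣ M) :
    IsReps M M (fun j : Fin ℓ => matU ℓ (j : ℕ)) where
  pos j := det_matU_pos hℓ.pos _
  step γ hγ i := by
    have hp : Prime (ℓ : ℤ) := Nat.prime_iff_prime_int.mp hℓ
    have hγ' := mem_Gamma0_iff_dvd.mp hγ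
    have hγℓ : (ℓ : ℤ) ∣ γ 1 0 := (Int.natCast_dvd_natCast.mpr hℓM).trans hγ'
    refine rel_matU hℓ ?_ ?_ ?_
    · rw [Matrix.det_mul, γ.det_coe, mul_one, det_matU]
    · simpa [matU, Matrix.mul_apply, Fin.sum_univ_two] using hγ'.mul_left _
    -- When ℓ divides the level, the coset of diag(ℓ, 1) cannot occur: it would force ℓ to divide
    -- the whole first column of γ, against det γ = 1.
    · rintro ⟨h, -⟩
      simp [matU, Matrix.mul_apply, Fin.sum_univ_two] at h
      have h0 : (ℓ : ℤ) ∣ γ 0 0 := (dvd_add_left (hγℓ.mul_left _)).mp h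
      have hdet := γ.det_coe
      rw [Matrix.det_fin_two] at hdet
      have : (ℓ : ℤ) ∣ 1 := by
        rw [← hdet]
        exact dvd_sub (h0.mul_right _) (hγℓ.mul_left _)
      exact hp.not_isUnit (isUnit_of_dvd_one this)
  inj i j h := by
    simpa using heckeRep_inj hℓ (some i) (some j) h

lemma hecke_eq_sum {M ℓ : ℕ} (hℓ : ℓ.Prime) (hℓM : ¬ ℓ ∣ M) (w : ℤ) (f : ℍ → ℂ) :
    hecke M w ℓ f = ∑ i, sl w (heckeRep ℓ i) f := by
  rw [Fintype.sum_option]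
  simp only [heckeRep]
  rw [sl_matV hℓ.pos, hecke, if_neg hℓM, LinearMap.add_apply, LinearMap.smul_apply,
    opU_eq_sl hℓ.pos w, Finset.sum_range, add_comm]

lemma hecke_mem {M ℓ : ℕ} (hℓ : ℓ.Prime) (hℓM : ¬ ℓ ∣ M) {w : ℤ} {f : ℍ → ℂ}
    (hf : f ∈ cuspSpace M w) : hecke M w ℓ f ∈ cuspSpace M w := by
  rw [hecke_eq_sum hℓ hℓM]
  exact (isReps_heckeRep hℓ hℓM).sum_mem hf

lemma opU_mem {M ℓ : ℕ} (hℓ : ℓ.Prime) (hℓM : ℓ ∣ M) {w : ℤ} {f : ℍ → ℂ}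
    (hf : f ∈ cuspSpace M w) : opU ℓ f ∈ cuspSpace M w := by
  rw [opU_eq_sl hℓ.pos w, Finset.sum_range]
  exact (isReps_matU hℓ hℓM).sum_mem hf

lemma isReps_matV {M d : ℕ} (hd : 0 < d) : IsReps M (d * M) (fun _ : Unit => matV d) where
  pos _ := det_matV_pos hd
  step γ hγ _ := by
    obtain ⟨c, hc⟩ := mem_Gamma0_iff_dvd.mp hγ
    have hdet := γ.det_coe
    rw [Matrix.det_fin_two] at hdet
    push_cast at hc
    refine ⟨(), CosetRel.of_entries (γ 0 0) (d * γ 0 1) (M * c) (γ 1 1) ?_ ⟨c, rfl⟩ ?_ ?_ ?_ ?_⟩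
    · linear_combination hdet + γ 0 1 * hc
    all_goals simp [matV, Matrix.mul_apply, Fin.sum_univ_two]
    · ring
    · rw [hc]; ring
  inj _ _ _ := rfl

lemma opV_mem {M d : ℕ} (hd : 0 < d) {w : ℤ} {f : ℍ → ℂ} (hf : f ∈ cuspSpace M w) :
    opV d f ∈ cuspSpace (d * M) w := by
  rw [opV_eq_sl hd w]
  refine Submodule.smul_mem _ _ ?_
  simpa using (isReps_matV (M := M) hd).sum_mem hf

lemma cuspSpace_mono {M M' : ℕ} (h : M ∣ M') (w : ℤ) : cuspSpace M w ≤ cuspSpace M' w :=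
  fun _ hf => ⟨hf.1, fun γ hγ => hf.2.1 γ (mem_Gamma0_iff_dvd.mpr
    ((Int.natCast_dvd_natCast.mpr h).trans (mem_Gamma0_iff_dvd.mp hγ))), hf.2.2⟩

/-! ### Traces -/

/-- The matrix `(1, 0; c, 1)`. -/
def matL (c : ℤ) : Matrix (Fin 2) (Fin 2) ℤ := !![1, 0; c, 1]

lemma det_matL (c : ℤ) : (matL c).det = 1 := by simp [matL, Matrix.det_fin_two]

lemma det_matL_pos (c : ℤ) : 0 < (matL c).det := by simp [det_matL]

lemma sl_eq_self {M : ℕ} {w : ℤ} {A : Matrix (Fin 2) (Fin 2) ℤ} (hA : A.det = 1)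
    (hM : (M : ℤ) ∣ A 1 0) {f : ℍ → ℂ} (hf : f ∈ cuspSpace M w) : sl w A f = f :=
  hf.2.1 ⟨A, hA⟩ (mem_Gamma0_iff_dvd.mpr hM)

lemma fin_eq_of_dvd_sub {q : ℕ} {i j : Fin q} (h : (q : ℤ) ∣ ((i : ℕ) : ℤ) - ((j : ℕ) : ℤ)) :
    i = j := by
  have h2 : ((i : ℕ) : ℤ) - ((j : ℕ) : ℤ) = 0 := by
    apply Int.eq_zero_of_abs_lt_dvd h
    have := i.2; have := j.2
    rw [abs_lt]; omega
  have : (i : ℕ) = j := by omega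
  rw [Fin.ext this]

/-- As q ∣ M, the lower right entry d of a matrix in Γ₀(M) is a unit modulo q, so its coset is fixed
by the solution j of c/M ≡ d j modulo q. Hence there are q cosets. -/
lemma isReps_matL {M q : ℕ} (hM : 0 < M) (hq : q.Prime) (hqM : q ∣ M) :
    IsReps (M * q) M (fun j : Fin q => matL (M * (j : ℕ))) where
  pos _ := det_matL_pos _
  step γ hγ i := by
    have hp : Prime (q : ℤ) := Nat.prime_iff_prime_int.mp hq
    set A := matL (M * (i : ℕ)) * (γ : Matrix (Fin 2) (Fin 2) ℤ) with hA
    have hdet : A.det = 1 := by rw [hA, Matrix.det_mul, det_matL, γ.det_coe, one_mul]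
    have hMA : (M : ℤ) ∣ A 1 0 := by
      rw [hA, Matrix.mul_apply, Fin.sum_univ_two]
      exact dvd_add (Dvd.dvd.mul_right (by simp [matL]) _)
        ((mem_Gamma0_iff_dvd.mp hγ).mul_left _)
    obtain ⟨c, hc⟩ := hMA
    rw [Matrix.det_fin_two] at hdet
    have hd : ¬ (q : ℤ) ∣ A 1 1 := by
      intro hd
      apply hp.not_dvd_one
      rw [← hdet, hc]
      exact dvd_sub (hd.mul_left _)
        (((Int.natCast_dvd_natCast.mpr hqM).mul_right _).mul_left _)
    obtain ⟨j, hj⟩ := exists_fin_of_not_dvd hq c hd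
    refine ⟨j, CosetRel.of_entries (A 0 0 - A 0 1 * (M * (j : ℕ))) (A 0 1)
      (A 1 0 - A 1 1 * (M * (j : ℕ))) (A 1 1) ?_ ?_ ?_ ?_ ?_ ?_⟩
    · linear_combination hdet
    · obtain ⟨u, hu⟩ := hj
      refine ⟨u, ?_⟩
      push_cast
      linear_combination hc + M * hu
    all_goals simp [matL]
  inj i j h := by
    obtain ⟨a, b, c, d, hdet, ⟨u, hu⟩, h00, h01, h10, h11⟩ := h.entries
    simp [matL] at h00 h01 h10 h11
    apply fin_eq_of_dvd_sub
    refine ⟨u, ?_⟩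
    have hM' : (M : ℤ) ≠ 0 := by exact_mod_cast hM.ne'
    apply mul_left_cancel₀ hM'
    push_cast at hu
    rw [← h11] at h10
    linear_combination h10 + hu

/-- Representatives of `Γ₀(M q) \ Γ₀(M)` if `q ∤ M` and `x q t - y M z = 1`. -/
def traceRep (M q : ℕ) (x y z t : ℤ) : Option (Fin q) → Matrix (Fin 2) (Fin 2) ℤ
  | none => !![x, y; M * z, q * t]
  | some j => matL (M * (j : ℕ))

lemma traceRep_det {M q : ℕ} {x y z t : ℤ} (h : x * (q * t) - y * (M * z) = 1)
    (i : Option (Fin q)) : (traceRep M q x y z t i).det = 1 := by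
  cases i with
  | none => rw [traceRep, Matrix.det_fin_two_of, h]
  | some j => exact det_matL _

lemma traceRep_dvd (M q : ℕ) (x y z t : ℤ) (i : Option (Fin q)) :
    (M : ℤ) ∣ traceRep M q x y z t i 1 0 := by
  cases i <;> simp [traceRep, matL]

/-- The equation `h` forces q ∤ M, and there are q + 1 cosets. If q ∤ d the coset is found as for q
∣ M; the matrices with q ∣ d form the one extra coset, whose representative has lower right entry q
t. -/
lemma isReps_traceRep {M q : ℕ} (hM : 0 < M) (hq : q.Prime) {x y z t : ℤ}
    (h : x * (q * t) - y * (M * z) = 1) : IsReps (M * q) M (traceRep M q x y z t) where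
  pos i := by simp [traceRep_det h]
  step γ hγ i := by
    have hp : Prime (q : ℤ) := Nat.prime_iff_prime_int.mp hq
    set A := traceRep M q x y z t i * (γ : Matrix (Fin 2) (Fin 2) ℤ) with hA
    have hdet : A.det = 1 := by rw [hA, Matrix.det_mul, traceRep_det h, γ.det_coe, one_mul]
    have hMA : (M : ℤ) ∣ A 1 0 := by
      rw [hA, Matrix.mul_apply, Fin.sum_univ_two]
      exact dvd_add ((traceRep_dvd M q x y z t i).mul_right _)
        ((mem_Gamma0_iff_dvd.mp hγ).mul_left _)
    obtain ⟨c, hc⟩ := hMA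
    rw [Matrix.det_fin_two] at hdet
    by_cases hd : (q : ℤ) ∣ A 1 1
    · obtain ⟨v, hv⟩ := hd
      refine ⟨none, CosetRel.of_entries (A 0 0 * (q * t) - A 0 1 * (M * z))
        (-A 0 0 * y + A 0 1 * x) (A 1 0 * (q * t) - A 1 1 * (M * z))
        (-A 1 0 * y + A 1 1 * x) ?_ ?_ ?_ ?_ ?_ ?_⟩
      · linear_combination (x * (q * t) - y * (M * z)) * hdet + h
      · refine ⟨c * t - v * z, ?_⟩
        push_cast
        linear_combination (q * t : ℤ) * hc - (M * z : ℤ) * hv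
      all_goals simp [traceRep]
      · linear_combination -A 0 0 * h
      · linear_combination -A 0 1 * h
      · linear_combination -A 1 0 * h
      · linear_combination -A 1 1 * h
    · obtain ⟨j, hj⟩ := exists_fin_of_not_dvd hq c hd
      refine ⟨some j, CosetRel.of_entries (A 0 0 - A 0 1 * (M * (j : ℕ))) (A 0 1)
        (A 1 0 - A 1 1 * (M * (j : ℕ))) (A 1 1) ?_ ?_ ?_ ?_ ?_ ?_⟩
      · linear_combination hdet
      · obtain ⟨u, hu⟩ := hj
        refine ⟨u, ?_⟩
        push_cast
        linear_combination hc + M * hu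
      all_goals simp [traceRep, matL]
  inj i j h' := by
    have hp : Prime (q : ℤ) := Nat.prime_iff_prime_int.mp hq
    obtain ⟨a, b, c, d, hdet, ⟨u, hu⟩, h00, h01, h10, h11⟩ := h'.entries
    push_cast at hu
    cases i with
    | none =>
      cases j with
      | none => rfl
      | some j =>
        simp [traceRep, matL] at h00 h01 h10 h11
        exfalso
        apply hp.not_dvd_one
        rw [← hdet, hu, ← h11]
        exact dvd_sub ((dvd_mul_right _ _).mul_left _)
          (((dvd_mul_left _ _).mul_right _).mul_left _)
    | some i =>
      cases j with
      | none =>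
        simp [traceRep, matL] at h00 h01 h10 h11
        exfalso
        apply hp.not_dvd_one
        rw [h11, hu]
        exact dvd_add (((dvd_mul_left _ _).mul_right _).mul_right _)
          ((dvd_mul_right _ _).mul_left _)
      | some j =>
        simp [traceRep, matL] at h00 h01 h10 h11
        congr 1
        apply fin_eq_of_dvd_sub
        refine ⟨u, ?_⟩
        have hM' : (M : ℤ) ≠ 0 := by exact_mod_cast hM.ne'
        apply mul_left_cancel₀ hM'
        rw [← h11] at h10
        linear_combination h10 + hu

/-- Matrices `(1, 0; 0, q)` and `(1, i; 0, q) (1, 0; C j, 1)`. -/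
def shiftRep (C q : ℕ) (i : ℤ) : Option (Fin q) → Matrix (Fin 2) (Fin 2) ℤ
  | none => matU q 0
  | some j => !![1 + i * C * (j : ℕ), i; C * q * (j : ℕ), q]

lemma shiftRep_det (C q : ℕ) (i : ℤ) (j : Option (Fin q)) : (shiftRep C q i j).det = q := by
  cases j with
  | none => exact det_matU _ _
  | some j => rw [shiftRep, Matrix.det_fin_two_of]; ring

/-- The union of the cosets is diag(1, q) Γ₀(C). Modulo q the group Γ₀(Cq) only scales the top row
of such a matrix, so a coset is a point (A₀₀ : A₀₁) of the projective line over 𝔽_q. The point with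
A₀₁ = 0 is `none`; the others are (1 + iCj : i), which runs over everything else because iC is a
unit. -/
lemma isReps_shiftRep {C q : ℕ} (hq : q.Prime) (hqC : ¬ q ∣ C) {i : ℤ}
    (hi : ¬ (q : ℤ) ∣ i) : IsReps (C * q) C (shiftRep C q i) where
  pos j := by rw [shiftRep_det]; exact_mod_cast hq.pos
  step γ hγ j := by
    have hp : Prime (q : ℤ) := Nat.prime_iff_prime_int.mp hq
    set A := shiftRep C q i j * (γ : Matrix (Fin 2) (Fin 2) ℤ) with hA
    have hdet : A.det = q := by rw [hA, Matrix.det_mul, shiftRep_det, γ.det_coe, mul_one]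
    obtain ⟨g, hg⟩ := mem_Gamma0_iff_dvd.mp hγ
    have hc : ∃ c, A 1 0 = C * q * c := by
      rw [hA, Matrix.mul_apply, Fin.sum_univ_two, hg]
      cases j with
      | none => exact ⟨g, by simp [shiftRep, matU]; ring⟩
      | some j => exact ⟨(j : ℕ) * γ 0 0 + g, by simp [shiftRep]; ring⟩
    have hd : ∃ d, A 1 1 = q * d := by
      rw [hA, Matrix.mul_apply, Fin.sum_univ_two]
      cases j with
      | none => exact ⟨γ 1 1, by simp [shiftRep, matU]⟩
      | some j => exact ⟨C * (j : ℕ) * γ 0 1 + γ 1 1, by simp [shiftRep]; ring⟩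
    obtain ⟨c, hc⟩ := hc
    obtain ⟨d, hd⟩ := hd
    have hdet' : A 0 0 * d - A 0 1 * (C * c) = 1 := by
      rw [Matrix.det_fin_two, hc, hd] at hdet
      apply mul_left_cancel₀ hp.ne_zero
      linear_combination hdet
    by_cases hb : (q : ℤ) ∣ A 0 1
    · obtain ⟨u, hu⟩ := hb
      refine ⟨none, CosetRel.of_entries (A 0 0) u (C * q * c) d ?_ ⟨c, by push_cast; ring⟩
        ?_ ?_ ?_ ?_⟩
      · linear_combination hdet' + C * c * hu
      all_goals simp [shiftRep, matU]
      · linear_combination hu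
      · linear_combination hc
      · linear_combination hd
    · have hbi : ¬ (q : ℤ) ∣ A 0 1 * i * C := by
        intro h
        rcases hp.dvd_or_dvd h with h | h
        · rcases hp.dvd_or_dvd h with h | h
          · exact hb h
          · exact hi h
        · exact hqC (Int.natCast_dvd_natCast.mp h)
      obtain ⟨n, u, hu⟩ := exists_fin_of_not_dvd hq (A 0 0 * i - A 0 1) hbi
      refine ⟨some n, CosetRel.of_entries (A 0 0 - A 0 1 * C * (n : ℕ)) (-u)
        (C * q * (c - (n : ℕ) * d)) (-C * c * i + d * (1 + i * C * (n : ℕ))) ?_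
        ⟨c - (n : ℕ) * d, by push_cast; ring⟩ ?_ ?_ ?_ ?_⟩
      · linear_combination hdet' - C * (c - (n : ℕ) * d) * hu
      all_goals simp [shiftRep]
      · linear_combination -C * (n : ℕ) * hu
      · linear_combination -hu
      · linear_combination hc
      · linear_combination hd
  inj j j' h := by
    have hp : Prime (q : ℤ) := Nat.prime_iff_prime_int.mp hq
    obtain ⟨a, b, c, d, hdet, ⟨u, hu⟩, h00, h01, h10, h11⟩ := h.entries
    cases j with
    | none =>
      cases j' with
      | none => rfl
      | some j' =>
        simp [shiftRep, matU] at h00 h01 h10 h11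
        exfalso
        apply hp.not_dvd_one
        have h2 : (q : ℤ) ∣ a * i := ⟨-b, by linear_combination -h01⟩
        obtain ⟨v, hv⟩ := (hp.dvd_or_dvd h2).resolve_right hi
        exact ⟨v * (1 + i * C * (j' : ℕ)) + b * C * (j' : ℕ), by
          linear_combination h00 + (1 + i * C * (j' : ℕ)) * hv⟩
    | some j =>
      cases j' with
      | none =>
        simp [shiftRep, matU] at h00 h01 h10 h11
        exact absurd ⟨b, by rw [h01]; ring⟩ hi
      | some j' =>
        simp [shiftRep] at h00 h01 h10 h11
        congr 1
        apply fin_eq_of_dvd_sub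
        have h2 : (q : ℤ) ∣ i * (1 - a) := ⟨b, by linear_combination h01⟩
        obtain ⟨v, hv⟩ := (hp.dvd_or_dvd h2).resolve_left hi
        have h3 : (q : ℤ) ∣ (i * C) * (((j : ℕ) : ℤ) - ((j' : ℕ) : ℤ)) := by
          refine ⟨-v * (1 + i * C * (j' : ℕ)) + b * C * (j' : ℕ), ?_⟩
          linear_combination h00 - (1 + i * C * (j' : ℕ)) * hv
        refine (hp.dvd_or_dvd h3).resolve_left fun h4 => ?_
        rcases hp.dvd_or_dvd h4 with h | h
        · exact hi h
        · exact hqC (Int.natCast_dvd_natCast.mp h)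

/-- The trace from level `M q` to level `M`, if `q ∣ M`. -/
def trL (w : ℤ) (M q : ℕ) (f : ℍ → ℂ) : ℍ → ℂ := ∑ j : Fin q, sl w (matL (M * (j : ℕ))) f

lemma trL_mem {M q : ℕ} (hM : 0 < M) (hq : q.Prime) (hqM : q ∣ M) {w : ℤ} {f : ℍ → ℂ}
    (hf : f ∈ cuspSpace (M * q) w) : trL w M q f ∈ cuspSpace M w :=
  (isReps_matL hM hq hqM).sum_mem hf

lemma trL_of_mem {M q : ℕ} {w : ℤ} {f : ℍ → ℂ} (hf : f ∈ cuspSpace M w) :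
    trL w M q f = (q : ℂ) • f := by
  have : ∀ j : Fin q, sl w (matL (M * (j : ℕ))) f = f := fun j =>
    sl_eq_self (det_matL _) (by simp [matL]) hf
  rw [trL, Finset.sum_congr rfl fun j _ => this j]
  simp [Nat.cast_smul_eq_nsmul]

lemma sl_opV_comm {w : ℤ} {d : ℕ} (hd : 0 < d) {A B : Matrix (Fin 2) (Fin 2) ℤ}
    (hA : 0 < A.det) (hB : 0 < B.det) (h : matV d * A = B * matV d) (f : ℍ → ℂ) :
    sl w A (opV d f) = opV d (sl w B f) := by
  rw [opV_eq_sl hd w, opV_eq_sl hd w, sl_smul hA, ← sl_mul (det_matV_pos hd).ne' hA.ne', h,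
    sl_mul hB.ne' (det_matV_pos hd).ne']

lemma trL_opV (w : ℤ) {M d q : ℕ} (hd : 0 < d) (f : ℍ → ℂ) :
    trL w (d * M) q (opV d f) = opV d (trL w M q f) := by
  rw [trL, trL, map_sum]
  refine Finset.sum_congr rfl fun j _ => ?_
  refine sl_opV_comm hd (det_matL_pos _) (det_matL_pos _) ?_ f
  ext i j
  fin_cases i <;> fin_cases j <;>
    simp [matV, matL, Matrix.mul_apply, Fin.sum_univ_two]
  ring

/-! ### Forms whose coefficients are supported on multiples of primes dividing the level -/

lemma sl_scalar {q : ℕ} (hq : 0 < q) (w : ℤ) (f : ℍ → ℂ) :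
    sl w (matU q 0 * matV q) f = ((q : ℂ) ^ (w - 2)) • f := by
  have hm : matU q 0 * matV q = !![(q : ℤ), 0; 0, (q : ℤ)] := by
    ext i j
    fin_cases i <;> fin_cases j <;> simp [matU, matV, Matrix.mul_apply, Fin.sum_univ_two]
  have hq' : (q : ℂ) ≠ 0 := by exact_mod_cast hq.ne'
  have hdet : 0 < (!![(q : ℤ), 0; 0, (q : ℤ)] : Matrix (Fin 2) (Fin 2) ℤ).det := by
    rw [Matrix.det_fin_two_of]
    have : (0 : ℤ) < q := by exact_mod_cast hq
    nlinarith
  funext z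
  rw [hm, sl_apply hdet]
  have hz : toGL !![(q : ℤ), 0; 0, (q : ℤ)] • z = z := by
    apply UpperHalfPlane.ext
    rw [coe_toGL_smul hdet]
    simp [hq']
  rw [hz, Pi.smul_apply, smul_eq_mul, Matrix.det_fin_two_of]
  congr 1
  simp only [Matrix.of_apply, Matrix.cons_val', Matrix.cons_val_zero, Matrix.cons_val_one,
    Matrix.cons_val_fin_one]
  push_cast
  rw [zero_mul, zero_add, sub_zero, mul_zpow, ← zpow_add₀ hq', ← zpow_add₀ hq']
  congr 1
  ring

lemma opV_eq_inv_smul_sl {q : ℕ} (hq : 0 < q) (w : ℤ) (f : ℍ → ℂ) :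
    sl w (matV q) f = (q : ℂ) ^ (w - 1) • opV q f := sl_matV hq w f

lemma sl_shiftRep {C q : ℕ} (hq : 0 < q) {w : ℤ} (i : ℤ) (j : Fin q) (G : ℍ → ℂ) :
    sl w (matL ((C * q : ℕ) * (j : ℕ))) (sl w (matU q i * matV q) G) =
      sl w (matV q) (sl w (shiftRep C q i (some j)) G) := by
  have hsh : (shiftRep C q i (some j)).det ≠ 0 := by
    rw [shiftRep_det]
    exact_mod_cast hq.ne'
  have hUV : (matU q i * matV q).det ≠ 0 := by
    rw [Matrix.det_mul]
    exact mul_ne_zero (det_matU_pos hq _).ne' (det_matV_pos hq).ne'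
  have hmat : matU q i * matV q * matL ((C * q : ℕ) * (j : ℕ)) =
      shiftRep C q i (some j) * matV q := by
    ext a b
    fin_cases a <;> fin_cases b <;>
      simp [matU, matV, matL, shiftRep, Matrix.mul_apply, Fin.sum_univ_two] <;> ring
  rw [← sl_mul hUV (det_matL_pos _).ne', hmat, sl_mul hsh (det_matV_pos hq).ne']

/-- V_q U_q G is q^(1-w) times the sum over i of G slashed with (1, i; 0, q) diag(q, 1). For i = 0
this matrix is scalar and the trace returns q^(w-1) G. For i ≠ 0 the translates in the trace are, up
to diag(q, 1) on the right, the cosets `shiftRep` other than `none`; completing them gives a form Y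
i of level C, and the term that was added contributes -q^(w-2) G. In total G - ((q-1)/q) G = q⁻¹ G
remains besides the image of V_q. -/
lemma trL_opV_opU {C q : ℕ} (hq : q.Prime) (hqC : ¬ q ∣ C) {w : ℤ} {G : ℍ → ℂ}
    (hG : G ∈ cuspSpace (C * q) w) : ∃ Y ∈ cuspSpace C w,
    trL w (C * q) q (opV q (opU q G)) = (q : ℂ)⁻¹ • G + opV q Y := by
  have hq0 : (q : ℂ) ≠ 0 := by exact_mod_cast hq.ne_zero
  set Y : ℕ → ℍ → ℂ := fun i => ∑ o, sl w (shiftRep C q i o) G with hY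
  have hYmem : ∀ i ∈ (Finset.range q).erase 0, Y i ∈ cuspSpace C w := fun i hi => by
    refine (isReps_shiftRep hq hqC ?_).sum_mem hG
    rw [Finset.mem_erase, Finset.mem_range] at hi
    intro h
    exact hi.1 (Nat.eq_zero_of_dvd_of_lt (Int.natCast_dvd_natCast.mp h) hi.2)
  refine ⟨∑ i ∈ (Finset.range q).erase 0, Y i, Submodule.sum_mem _ hYmem, ?_⟩
  have hT0 : ∑ j : Fin q, sl w (matL ((C * q : ℕ) * (j : ℕ))) (sl w (matU q 0 * matV q) G) =
      (q : ℂ) ^ (w - 1) • G := by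
    have : ∀ j : Fin q, sl w (matL ((C * q : ℕ) * (j : ℕ))) (sl w (matU q 0 * matV q) G) =
        (q : ℂ) ^ (w - 2) • G := fun j => by
      rw [sl_scalar hq.pos, sl_smul (det_matL_pos _),
        sl_eq_self (det_matL _) (by simp [matL]) hG]
    rw [Finset.sum_congr rfl fun j _ => this j, Finset.sum_const, Finset.card_univ,
      Fintype.card_fin, ← Nat.cast_smul_eq_nsmul ℂ, smul_smul, ← zpow_one_add₀ hq0]
    congr 2
    ring
  have hT : ∀ i : ℕ, ∑ j : Fin q, sl w (matL ((C * q : ℕ) * (j : ℕ)))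
      (sl w (matU q i * matV q) G) =
        (q : ℂ) ^ (w - 1) • opV q (Y i) - (q : ℂ) ^ (w - 2) • G := fun i => by
    have hj : ∀ j : Fin q, sl w (matL ((C * q : ℕ) * (j : ℕ))) (sl w (matU q i * matV q) G) =
        sl w (matV q) (sl w (shiftRep C q i (some j)) G) := fun j => sl_shiftRep hq.pos _ _ _
    have hY' : Y i = sl w (matU q 0) G + ∑ j, sl w (shiftRep C q i (some j)) G :=
      Fintype.sum_option _
    rw [Finset.sum_congr rfl fun j _ => hj j, ← opV_eq_inv_smul_sl hq.pos, ← sl_scalar hq.pos,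
      eq_sub_iff_add_eq', hY', sl_add, sl_sum,
      ← sl_mul (det_matU_pos hq.pos _).ne' (det_matV_pos hq.pos).ne']
  have hVU : opV q (opU q G) = (q : ℂ) ^ (1 - w) • ∑ i ∈ Finset.range q,
      sl w (matU q i * matV q) G := by
    rw [opV_eq_sl hq.pos w, opU_eq_sl hq.pos w, sl_sum]
    congr 1
    exact Finset.sum_congr rfl fun i _ =>
      (sl_mul (det_matU_pos hq.pos _).ne' (det_matV_pos hq.pos).ne' _).symm
  have h1 : trL w (C * q) q (opV q (opU q G)) = (q : ℂ) ^ (1 - w) • ∑ i ∈ Finset.range q,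
      ∑ j : Fin q, sl w (matL ((C * q : ℕ) * (j : ℕ))) (sl w (matU q i * matV q) G) := by
    rw [hVU, trL]
    simp only [sl_smul (det_matL_pos _), sl_sum]
    rw [← Finset.smul_sum, Finset.sum_comm]
  rw [h1, ← Finset.add_sum_erase _ _ (Finset.mem_range.mpr hq.pos), Finset.sum_congr rfl
    (fun i _ => hT i), Nat.cast_zero, hT0, Finset.sum_sub_distrib, Finset.sum_const,
    Finset.card_erase_of_mem (Finset.mem_range.mpr hq.pos), Finset.card_range, map_sum,
    ← Finset.smul_sum]
  rw [smul_add, smul_sub, smul_smul, smul_smul, ← zpow_add₀ hq0, show 1 - w + (w - 1) = 0 by ring,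
    zpow_zero, one_smul, one_smul, ← Nat.cast_smul_eq_nsmul ℂ, smul_smul, smul_smul,
    Nat.cast_sub hq.one_le, mul_right_comm, ← zpow_add₀ hq0, show 1 - w + (w - 2) = -1 by ring,
    zpow_neg_one]
  have : (q : ℂ)⁻¹ = 1 - (q : ℂ)⁻¹ * ((q : ℂ) - (1 : ℕ)) := by field_simp; push_cast; ring
  conv_rhs => rw [this]
  rw [sub_smul, one_smul]
  abel

/-- This is the Atkin-Lehner lemma at primes that divide the level exactly once. The induction
removes one prime q from Q: G - V_q U_q G keeps only the coefficients prime to q, so the other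
primes suffice for it, at the price of an extra factor q in the level. Tracing back to the original
level multiplies G by q, turns V_q U_q G into q⁻¹ G + V_q Y, and commutes with the other V_r. The
resulting multiple (q - q⁻¹) G has the required form. -/
theorem eq_sum_opV_of_coeff_eq_zero {w : ℤ} (hw : 0 < w) (Q : Finset ℕ) :
    ∀ (M : ℕ), 0 < M → (∀ q ∈ Q, q.Prime ∧ q ∣ M ∧ ¬ q * q ∣ M) → ∀ G ∈ cuspSpace M w,
    (∀ n, (∀ q ∈ Q, ¬ q ∣ n) → coeff G n = 0) →
    ∃ s : ℕ → ℍ → ℂ, (∀ q ∈ Q, s q ∈ cuspSpace (M / q) w) ∧ G = ∑ q ∈ Q, opV q (s q) := by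
  classical
  induction Q using Finset.induction_on with
  | empty =>
    intro M hM _ G hG h
    refine ⟨0, by simp, ?_⟩
    rw [Finset.sum_empty]
    exact (isQ_of_mem hw hG).ext isQ_zero fun n => by rw [h n (by simp), coeff_zero]
  | insert q Q hqQ ih =>
    intro M hM hQ G hG h
    obtain ⟨hq, ⟨C, hC⟩, hq2⟩ := hQ q (Finset.mem_insert_self _ _)
    rw [mul_comm] at hC
    subst hC
    have hqC : ¬ q ∣ C := fun hd => hq2 (mul_dvd_mul_right hd q)
    have hC0 : 0 < C := Nat.pos_of_mul_pos_right hM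
    have hU := opU_mem hq (dvd_mul_left q C) hG
    have hV := opV_mem hq.pos hU
    have hGQ := isQ_of_mem hw hG
    rw [mul_comm q] at hV
    set H := G - opV q (opU q G) with hH
    have hHmem : H ∈ cuspSpace (C * q * q) w :=
      Submodule.sub_mem _ (cuspSpace_mono (dvd_mul_right _ _) w hG) hV
    have hQ' : ∀ r ∈ Q, r.Prime ∧ r ∣ C * q * q ∧ ¬ r * r ∣ C * q * q := fun r hr => by
      obtain ⟨h1, h2, h3⟩ := hQ r (Finset.mem_insert_of_mem hr)
      refine ⟨h1, h2.mul_right _, fun h4 => h3 ?_⟩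
      have hcop : Nat.Coprime r q := (Nat.coprime_primes h1 hq).mpr (by rintro rfl; exact hqQ hr)
      exact (Nat.Coprime.mul_left hcop hcop).dvd_of_dvd_mul_right h4
    -- At level C q q the prime q is no longer simple, which is harmless since the smaller set Q
    -- does not contain it.
    obtain ⟨s, hs, hHs⟩ := ih (C * q * q) (Nat.mul_pos hM hq.pos) hQ' H hHmem fun n hn => by
      rw [hH, coeff_sub hGQ ((hGQ.opU hq.pos).opV hq.pos), coeff_opV hq.pos (hGQ.opU hq.pos)]
      split_ifs with hqn
      · rw [coeff_opU hq.pos hGQ, Nat.mul_div_cancel' hqn, sub_self]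
      · rw [h n (by
          intro r hr
          rcases Finset.mem_insert.mp hr with rfl | hr'
          · exact hqn
          · exact hn r hr'), sub_zero]
    obtain ⟨Y, hY, hYeq⟩ := trL_opV_opU hq hqC hG
    have hq0 : (q : ℂ) ≠ 0 := by exact_mod_cast hq.ne_zero
    have hc : (q : ℂ) - (q : ℂ)⁻¹ ≠ 0 := by
      intro h0
      have h1 : ((q * q : ℕ) : ℂ) = ((1 : ℕ) : ℂ) := by
        push_cast
        field_simp at h0
        linear_combination h0
      have h2 := Nat.cast_injective h1
      have := hq.two_le
      nlinarith
    have htr : ∀ f g : ℍ → ℂ, trL w (C * q) q (f - g) =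
        trL w (C * q) q f - trL w (C * q) q g := fun f g => by
      rw [eq_sub_iff_add_eq, trL, trL, trL, ← Finset.sum_add_distrib]
      exact Finset.sum_congr rfl fun j _ => by rw [← sl_add, sub_add_cancel]
    have hsum : trL w (C * q) q (∑ r ∈ Q, opV r (s r)) =
        ∑ r ∈ Q, opV r (trL w (C * q / r) q (s r)) := by
      rw [trL, Finset.sum_congr rfl fun j _ => sl_sum _ _ _ _, Finset.sum_comm]
      refine Finset.sum_congr rfl fun r hr => ?_
      obtain ⟨h1, ⟨e, he⟩, -⟩ := hQ r (Finset.mem_insert_of_mem hr)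
      have := trL_opV w (M := e) (q := q) h1.pos (s r)
      rw [← he] at this
      rw [he, Nat.mul_div_cancel_left _ h1.pos, ← this, ← he]
      rfl
    have key : ((q : ℂ) - (q : ℂ)⁻¹) • G =
        opV q Y + ∑ r ∈ Q, opV r (trL w (C * q / r) q (s r)) := by
      rw [← hsum, ← hHs, hH, htr, hYeq, trL_of_mem hG, sub_smul]
      abel
    refine ⟨fun r => ((q : ℂ) - (q : ℂ)⁻¹)⁻¹ • if r = q then Y else
      trL w (C * q / r) q (s r), fun r hr => Submodule.smul_mem _ _ ?_, ?_⟩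
    · by_cases hrq : r = q
      · subst hrq
        rw [if_pos rfl, Nat.mul_div_cancel _ hq.pos]
        exact hY
      · have hne : r ≠ q := hrq
        have hr := (Finset.mem_insert.mp hr).resolve_left hrq
        rw [if_neg hne]
        obtain ⟨h1, ⟨e, he⟩, -⟩ := hQ r (Finset.mem_insert_of_mem hr)
        have h2 := hs r hr
        rw [he, mul_assoc, Nat.mul_div_cancel_left _ h1.pos] at h2
        rw [he, Nat.mul_div_cancel_left _ h1.pos]
        refine trL_mem (Nat.pos_of_ne_zero ?_) hq ?_ h2
        · rintro rfl
          rw [mul_zero] at he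
          exact hM.ne' he
        · have hcop : Nat.Coprime q r := (Nat.coprime_primes hq h1).mpr hne.symm
          exact hcop.dvd_of_dvd_mul_left (he ▸ dvd_mul_left q C)
    · rw [Finset.sum_insert hqQ]
      have h3 : ∑ r ∈ Q, opV r (((q : ℂ) - (q : ℂ)⁻¹)⁻¹ • if r = q then Y else
          trL w (C * q / r) q (s r)) =
          ((q : ℂ) - (q : ℂ)⁻¹)⁻¹ • ∑ r ∈ Q, opV r (trL w (C * q / r) q (s r)) := by
        rw [Finset.smul_sum]
        refine Finset.sum_congr rfl fun r hr => ?_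
        rw [if_neg (by rintro rfl; exact hqQ hr), map_smul]
      simp only [if_true]
      rw [h3, map_smul, ← smul_add, ← key, smul_smul, inv_mul_cancel₀ hc, one_smul]

/-! ### The trace from level `M p` to level `M`, for `p ∤ M` -/

/-- The trace attached to the representatives `traceRep`. -/
def trW (w : ℤ) (M q : ℕ) (x y z t : ℤ) (f : ℍ → ℂ) : ℍ → ℂ :=
  ∑ i, sl w (traceRep M q x y z t i) f

lemma trW_add (w : ℤ) (M q : ℕ) (x y z t : ℤ) (f g : ℍ → ℂ) :
    trW w M q x y z t (f + g) = trW w M q x y z t f + trW w M q x y z t g := by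
  simp only [trW, sl_add, Finset.sum_add_distrib]

lemma trW_mem {M q : ℕ} (hM : 0 < M) (hq : q.Prime) {x y z t : ℤ}
    (h : x * (q * t) - y * (M * z) = 1) {w : ℤ} {f : ℍ → ℂ} (hf : f ∈ cuspSpace (M * q) w) :
    trW w M q x y z t f ∈ cuspSpace M w :=
  (isReps_traceRep hM hq h).sum_mem hf

lemma trW_of_mem {M q : ℕ} {x y z t : ℤ} (h : x * (q * t) - y * (M * z) = 1) {w : ℤ}
    {f : ℍ → ℂ} (hf : f ∈ cuspSpace M w) :
    trW w M q x y z t f = ((q : ℂ) + 1) • f := by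
  rw [trW, Finset.sum_congr rfl fun i _ =>
    sl_eq_self (traceRep_det h i) (traceRep_dvd M q x y z t i) hf]
  rw [Finset.sum_const, Finset.card_univ, Fintype.card_option, Fintype.card_fin,
    ← Nat.cast_smul_eq_nsmul ℂ]
  push_cast
  rfl

lemma trW_opV (w : ℤ) {M d q : ℕ} (hd : 0 < d) {x y z t : ℤ}
    (h : x * (q * t) - y * (d * M * z) = 1) (f : ℍ → ℂ) :
    trW w (d * M) q x y z t (opV d f) = opV d (trW w M q x (d * y) z t f) := by
  rw [trW, trW, map_sum]
  refine Finset.sum_congr rfl fun i _ => ?_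
  refine sl_opV_comm hd (by rw [traceRep_det (by push_cast; exact h)]; exact one_pos)
    (by rw [traceRep_det (by linear_combination h)]; exact one_pos) ?_ f
  ext a b
  cases i <;> fin_cases a <;> fin_cases b <;>
    simp [traceRep, matV, matL, Matrix.mul_apply, Fin.sum_univ_two] <;> ring

/-- Conjugating (a, b; c, d) by diag(p, 1) gives (a, b/p; pc, d). Integrality of b/p follows from
det B = 1. -/
lemma CosetRel.of_matV_mul {M p : ℕ} (hp : 0 < p) {A B : Matrix (Fin 2) (Fin 2) ℤ}
    (hB : B.det = 1) (h : CosetRel M (matV p * A) (matV p * B)) :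
    CosetRel (M * p) A B := by
  have hp' : (p : ℤ) ≠ 0 := by exact_mod_cast hp.ne'
  obtain ⟨a, b, c, d, hdet, hc, h00, h01, h10, h11⟩ := h.entries
  simp [matV, Matrix.mul_apply, Fin.sum_univ_two] at h00 h01 h10 h11
  rw [Matrix.det_fin_two] at hB
  obtain ⟨v, hv⟩ : (p : ℤ) ∣ b := by
    refine ⟨A 0 1 * B 0 0 - A 0 0 * B 0 1, ?_⟩
    linear_combination -b * hB + B 0 1 * h00 - B 0 0 * h01
  refine CosetRel.of_entries a v (p * c) d ?_ ?_ ?_ ?_ ?_ ?_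
  · linear_combination hdet + c * hv
  · push_cast
    rw [mul_comm]
    exact mul_dvd_mul_left _ hc
  · apply mul_left_cancel₀ hp'
    linear_combination h00 + B 1 0 * hv
  · apply mul_left_cancel₀ hp'
    linear_combination h01 + B 1 1 * hv
  · linear_combination h10
  · linear_combination h11

/-- Multiplying representatives of Γ₀(Mp) \ Γ₀(M) on the left by diag(p, 1) gives p + 1 distinct
cosets of matrices of determinant p, hence a full set of representatives for T_p. -/
lemma trW_opV_self {M p : ℕ} (hM : 0 < M) (hp : p.Prime) (hpM : ¬ p ∣ M) {x y z t : ℤ}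
    (h : x * (p * t) - y * (M * z) = 1) {w : ℤ} {f : ℍ → ℂ} (hf : f ∈ cuspSpace M w) :
    trW w M p x y z t (opV p f) = (p : ℂ) ^ (1 - w) • hecke M w p f := by
  rw [hecke_eq_sum hp hpM, ← sum_sl_eq_of_rel (r := fun i => matV p * traceRep M p x y z t i)
    (heckeRep_det_pos hp.pos) ?_ ?_ ?_ hf, Finset.smul_sum, trW]
  · refine Finset.sum_congr rfl fun i _ => ?_
    have hdet := traceRep_det h i
    rw [opV_eq_sl hp.pos w, sl_smul (by rw [hdet]; exact one_pos),
      sl_mul (det_matV_pos hp.pos).ne' (by rw [hdet]; exact one_ne_zero)]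
  · intro i j hij
    exact (isReps_traceRep hM hp h).inj _ _
      (hij.of_matV_mul hp.pos (traceRep_det h _))
  · intro i
    refine rel_heckeRep hp hpM ?_ ?_
    · rw [Matrix.det_mul, det_matV, traceRep_det h, mul_one]
    · have := traceRep_dvd M p x y z t i
      rw [Matrix.mul_apply, Fin.sum_univ_two]
      simpa [matV] using this
  · rfl

lemma exists_trace_params {M p : ℕ} (hp : p.Prime) (hpM : ¬ p ∣ M) :
    ∃ x y z t : ℤ, x * (p * t) - y * (M * z) = 1 := by
  have : IsCoprime (p : ℤ) (M : ℤ) := by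
    rw [Nat.isCoprime_iff_coprime]
    exact (Nat.Prime.coprime_iff_not_dvd hp).mpr hpM
  obtain ⟨u, v, huv⟩ := this
  exact ⟨u, -v, 1, 1, by linear_combination huv⟩

/-! ### The invariant norm of a cusp form -/

/-- The function `|f| y^(w/2)`. -/
def invNorm (w : ℤ) (f : ℍ → ℂ) (z : ℍ) : ℝ := ‖f z‖ * z.im ^ (w / 2 : ℝ)

lemma invNorm_nonneg (w : ℤ) (f : ℍ → ℂ) (z : ℍ) : 0 ≤ invNorm w f z :=
  mul_nonneg (norm_nonneg _) (Real.rpow_nonneg z.im_pos.le _)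

lemma invNorm_sl {w : ℤ} {A : Matrix (Fin 2) (Fin 2) ℤ} (hA : 0 < A.det) (f : ℍ → ℂ) (z : ℍ) :
    invNorm w (sl w A f) z = (A.det : ℝ) ^ (w / 2 - 1 : ℝ) * invNorm w f (toGL A • z) :=
  norm_sl hA f z

lemma invNorm_sl_of_det_eq_one {w : ℤ} {A : Matrix (Fin 2) (Fin 2) ℤ} (hA : A.det = 1)
    (f : ℍ → ℂ) (z : ℍ) : invNorm w (sl w A f) z = invNorm w f (toGL A • z) := by
  rw [invNorm_sl (by rw [hA]; exact one_pos), hA]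
  simp

lemma invNorm_smul_eq {M : ℕ} {w : ℤ} {A : Matrix (Fin 2) (Fin 2) ℤ} (hA : A.det = 1)
    (hM : (M : ℤ) ∣ A 1 0) {f : ℍ → ℂ} (hf : f ∈ cuspSpace M w) (z : ℍ) :
    invNorm w f (toGL A • z) = invNorm w f z := by
  rw [← invNorm_sl_of_det_eq_one hA, sl_eq_self hA hM hf]

lemma invNorm_eq_zero {w : ℤ} {f : ℍ → ℂ} {z : ℍ} (h : invNorm w f z = 0) : f z = 0 := by
  rcases mul_eq_zero.mp h with h | h
  · exact norm_eq_zero.mp h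
  · exact absurd h (Real.rpow_pos_of_pos z.im_pos _).ne'

lemma continuous_invNorm (w : ℤ) {f : ℍ → ℂ} (hf : Continuous f) : Continuous (invNorm w f) :=
  hf.norm.mul (UpperHalfPlane.continuous_im.rpow_const fun z => Or.inl z.im_pos.ne')

lemma invNorm_sq (w : ℤ) (f : ℍ → ℂ) (z : ℍ) :
    invNorm w f z ^ 2 = ‖UpperHalfPlane.petersson w f f z‖ := by
  rw [invNorm, UpperHalfPlane.petersson, norm_mul, norm_mul, Complex.norm_conj, norm_zpow,
    Complex.norm_real, Real.norm_of_nonneg z.im_pos.le, mul_pow, ← Real.rpow_natCast,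
    ← Real.rpow_natCast (z.im ^ (w / 2 : ℝ)), ← Real.rpow_mul z.im_pos.le]
  norm_num
  rw [← Real.rpow_intCast, sq]
  exact Or.inl rfl

open ConjAct Pointwise in
lemma isZeroAtImInfty_petersson_sl {M : ℕ} (hM : 0 < M) {w : ℤ} (hw : 0 < w) {f : ℍ → ℂ}
    (hf : f ∈ cuspSpace M w) (γ : SL(2, ℤ)) : IsZeroAtImInfty
      (UpperHalfPlane.petersson w (sl w (γ : Matrix (Fin 2) (Fin 2) ℤ) f)
        (sl w (γ : Matrix (Fin 2) (Fin 2) ℤ) f)) := by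
  have : NeZero M := ⟨hM.ne'⟩
  set F := mkCusp hw f hf
  have harith : (toConjAct (Matrix.SpecialLinearGroup.mapGL ℝ γ : GL (Fin 2) ℝ)⁻¹ •
      (CongruenceSubgroup.Gamma0 M : Subgroup (GL (Fin 2) ℝ))).IsArithmetic := by
    simpa [(show Rat.castHom ℝ = algebraMap ℚ ℝ by rfl), map_inv,
      Matrix.SpecialLinearGroup.map_mapGL] using! Subgroup.IsArithmetic.conj
        (CongruenceSubgroup.Gamma0 M : Subgroup (GL (Fin 2) ℝ))
        (Matrix.SpecialLinearGroup.mapGL ℚ γ)⁻¹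
  rw [sl, toGL_SL]
  exact (CuspFormClass.zero_at_infty <| CuspForm.translate F
    (Matrix.SpecialLinearGroup.mapGL ℝ γ)).petersson_isZeroAtImInfty_left w _
    (CuspForm.translate F (Matrix.SpecialLinearGroup.mapGL ℝ γ))

lemma exists_invNorm_smul_lt {M : ℕ} (hM : 0 < M) {w : ℤ} (hw : 0 < w) {f : ℍ → ℂ}
    (hf : f ∈ cuspSpace M w) (γ : SL(2, ℤ)) {ε : ℝ} (hε : 0 < ε) :
    ∃ A : ℝ, ∀ z : ℍ, A ≤ z.im → invNorm w f (γ • z) < ε := by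
  have h := isZeroAtImInfty_petersson_sl hM hw hf γ
  rw [isZeroAtImInfty_iff] at h
  obtain ⟨A, hA⟩ := h (ε ^ 2 / 2) (by positivity)
  refine ⟨A, fun z hz => ?_⟩
  have h1 := hA z hz
  rw [← invNorm_sq, invNorm_sl_of_det_eq_one γ.det_coe, toGL_SL] at h1
  have h2 : invNorm w f (γ • z) ^ 2 ≤ ε ^ 2 / 2 := h1
  exact lt_of_pow_lt_pow_left₀ 2 hε.le (lt_of_le_of_lt h2 (half_lt_self (by positivity)))

/-- The invariant norm of a cusp form attains its maximum. -/
lemma exists_forall_invNorm_le {M : ℕ} (hM : 0 < M) {w : ℤ} (hw : 0 < w) {f : ℍ → ℂ}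
    (hf : f ∈ cuspSpace M w) : ∃ z₀ : ℍ, ∀ z, invNorm w f z ≤ invNorm w f z₀ := by
  have : NeZero M := ⟨hM.ne'⟩
  by_cases hz : ∀ z, invNorm w f z = 0
  · exact ⟨I, fun z => by rw [hz, hz]⟩
  push Not at hz
  obtain ⟨z₁, hz₁⟩ := hz
  have hpos : 0 < invNorm w f z₁ := lt_of_le_of_ne (invNorm_nonneg _ _ _) hz₁.symm
  have hfin : Finite (SL(2, ℤ) ⧸ CongruenceSubgroup.Gamma0 M) :=
    Subgroup.finite_quotient_of_finiteIndex
  have := Fintype.ofFinite (SL(2, ℤ) ⧸ CongruenceSubgroup.Gamma0 M)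
  choose A hA using fun c : SL(2, ℤ) ⧸ CongruenceSubgroup.Gamma0 M =>
    exists_invNorm_smul_lt hM hw hf c.out⁻¹ hpos
  set B := ∑ c, |A c| with hB
  have hAB : ∀ c, A c ≤ B := fun c => (le_abs_self _).trans
    (Finset.single_le_sum (f := fun c => |A c|) (fun _ _ => abs_nonneg _) (Finset.mem_univ c))
  -- K is the image of a truncated fundamental domain under finitely many representatives, hence
  -- compact. Above height B the invariant norm is smaller than at z₁, so a maximum over K is a
  -- global maximum.
  set K : Set ℍ := ⋃ c : SL(2, ℤ) ⧸ CongruenceSubgroup.Gamma0 M,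
    (fun z : ℍ => c.out⁻¹ • z) '' ModularGroup.truncatedFundamentalDomain B with hK
  have hKc : IsCompact K := isCompact_iUnion fun c =>
    (ModularGroup.isCompact_truncatedFundamentalDomain B).image
      (continuous_const_smul (Matrix.SpecialLinearGroup.mapGL ℝ c.out⁻¹ : GL (Fin 2) ℝ))
  have hred : ∀ z : ℍ, ∃ (c : SL(2, ℤ) ⧸ CongruenceSubgroup.Gamma0 M) (z' : ℍ),
      z' ∈ ModularGroup.fd ∧ invNorm w f z = invNorm w f (c.out⁻¹ • z') := fun z => by
    obtain ⟨g, hg⟩ := ModularGroup.exists_smul_mem_fd z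
    refine ⟨QuotientGroup.mk g, g • z, hg, ?_⟩
    obtain ⟨γ, hγ⟩ := QuotientGroup.mk_out_eq_mul (CongruenceSubgroup.Gamma0 M) g
    rw [hγ, mul_inv_rev, smul_smul, inv_mul_cancel_right]
    have h1 := invNorm_smul_eq (M := M) (A := ((γ⁻¹ : CongruenceSubgroup.Gamma0 M) : SL(2, ℤ)))
      (Matrix.SpecialLinearGroup.det_coe _) (mem_Gamma0_iff_dvd.mp (γ⁻¹).2) hf z
    rw [toGL_SL] at h1
    exact h1.symm
  have hle : ∀ z : ℍ, z ∈ K ∨ invNorm w f z < invNorm w f z₁ ∨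
      ∃ z' ∈ K, invNorm w f z = invNorm w f z' := fun z => by
    obtain ⟨c, z', hz', h⟩ := hred z
    rcases le_or_gt z'.im B with h1 | h1
    · exact Or.inr (Or.inr ⟨_, Set.mem_iUnion.mpr ⟨c, z', ⟨hz', h1⟩, rfl⟩, h⟩)
    · refine Or.inr (Or.inl ?_)
      rw [h]
      exact hA c z' ((hAB c).trans h1.le)
  have hne : ∃ z' ∈ K, invNorm w f z₁ = invNorm w f z' := by
    rcases hle z₁ with h | h | h
    · exact ⟨z₁, h, rfl⟩
    · exact absurd h (lt_irrefl _)
    · exact h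
  obtain ⟨z₂, hz₂, h12⟩ := hne
  obtain ⟨z₀, hz₀, hmax⟩ := hKc.exists_isMaxOn ⟨z₂, hz₂⟩
    (continuous_invNorm w hf.1.continuous).continuousOn
  refine ⟨z₀, fun z => ?_⟩
  rcases hle z with h | h | ⟨z', h, h'⟩
  · exact hmax h
  · exact h.le.trans (h12 ▸ hmax hz₂)
  · exact h' ▸ hmax h

/-- Iterating σ keeps the invariant norm constant along an orbit whose height grows like cⁿ, whereas
the invariant norm of a cusp form decays at infinity. -/
lemma eq_zero_of_invNorm_scale {M : ℕ} (hM : 0 < M) {w : ℤ} (hw : 0 < w) {f : ℍ → ℂ}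
    (hf : f ∈ cuspSpace M w) {z : ℍ} {σ : ℍ → ℍ} {c : ℝ} (hc : 1 < c)
    (him : ∀ z, (σ z).im = c * z.im)
    (h : ∀ z', invNorm w f z' = invNorm w f z → invNorm w f (σ z') = invNorm w f z) :
    f z = 0 := by
  by_contra hne
  have hpos : 0 < invNorm w f z := lt_of_le_of_ne (invNorm_nonneg _ _ _)
    fun h0 => hne (invNorm_eq_zero h0.symm)
  obtain ⟨A, hA⟩ := exists_invNorm_smul_lt hM hw hf 1 hpos
  have h1 : ∀ n : ℕ, invNorm w f (σ^[n] z) = invNorm w f z ∧ (σ^[n] z).im = c ^ n * z.im := by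
    intro n
    induction n with
    | zero => simp
    | succ n ih =>
      rw [Function.iterate_succ_apply', him, ih.2, pow_succ]
      exact ⟨h _ ih.1, by ring⟩
  have h2 : Filter.Tendsto (fun n : ℕ => c ^ n * z.im) Filter.atTop Filter.atTop :=
    (tendsto_pow_atTop_atTop_of_one_lt hc).atTop_mul_const z.im_pos
  obtain ⟨n, hn⟩ := (h2.eventually_ge_atTop A).exists
  have := hA (σ^[n] z) (by rw [(h1 n).2]; exact hn)
  rw [one_smul, (h1 n).1] at this
  exact lt_irrefl _ this

/-- At a point where |f| y^(w/2) has its maximum m, each of the p + 1 terms of T_p f contributes at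
most p^(w/2-1) m. If |b| reached the bound, all these terms would be maximal, so the maximum would
also be attained at pτ. Repeating this moves the maximum into the cusp, which forces f = 0. -/
lemma norm_eigenvalue_lt {M p : ℕ} (hM : 0 < M) (hp : p.Prime) (hpM : ¬ p ∣ M) {w : ℤ}
    (hw : 0 < w) {f : ℍ → ℂ} (hf : f ∈ cuspSpace M w) (hne : f ≠ 0) {b : ℂ}
    (hb : hecke M w p f = b • f) : ‖b‖ < (p : ℝ) ^ (w / 2 - 1 : ℝ) * ((p : ℝ) + 1) := by
  obtain ⟨z₀, hz₀⟩ := exists_forall_invNorm_le hM hw hf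
  set m := invNorm w f z₀ with hm
  have hp0 : (0 : ℝ) < p := by exact_mod_cast hp.pos
  have hP : 0 < (p : ℝ) ^ (w / 2 - 1 : ℝ) := by positivity
  have key : ∀ z, ‖b‖ * invNorm w f z ≤ (p : ℝ) ^ (w / 2 - 1 : ℝ) *
      ∑ i, invNorm w f (toGL (heckeRep p i) • z) := fun z => by
    have h1 := congrFun hb z
    rw [hecke_eq_sum hp hpM, Finset.sum_apply, Pi.smul_apply, smul_eq_mul] at h1
    rw [invNorm, ← mul_assoc, ← norm_mul, ← h1, Finset.mul_sum]
    calc _ ≤ (∑ i, ‖sl w (heckeRep p i) f z‖) * z.im ^ (w / 2 : ℝ) :=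
          mul_le_mul_of_nonneg_right (norm_sum_le _ _) (Real.rpow_nonneg z.im_pos.le _)
      _ = _ := by
          rw [Finset.sum_mul]
          refine Finset.sum_congr rfl fun i _ => ?_
          have h2 := invNorm_sl (w := w) (heckeRep_det_pos hp.pos i) f z
          have h3 : (heckeRep p i).det = p := by
            cases i with
            | none => exact det_matV _
            | some j => exact det_matU _ _
          rw [h3] at h2
          simpa [invNorm] using h2
  by_contra! hle
  have key2 : ∀ z, invNorm w f z = m → ∀ i, invNorm w f (toGL (heckeRep p i) • z) = m := by
    intro z hz i
    have h1 := key z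
    rw [hz] at h1
    have hm0 : 0 ≤ m := invNorm_nonneg _ _ _
    have h2 : (p : ℝ) ^ (w / 2 - 1 : ℝ) * (((p : ℝ) + 1) * m) ≤ (p : ℝ) ^ (w / 2 - 1 : ℝ) *
        ∑ i, invNorm w f (toGL (heckeRep p i) • z) := by
      refine le_trans ?_ h1
      rw [← mul_assoc]
      exact mul_le_mul_of_nonneg_right hle hm0
    have h3 := le_of_mul_le_mul_left h2 hP
    have h4 : ∑ i : Option (Fin p), (m - invNorm w f (toGL (heckeRep p i) • z)) ≤ 0 := by
      rw [Finset.sum_sub_distrib, Finset.sum_const, Finset.card_univ, Fintype.card_option,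
        Fintype.card_fin, nsmul_eq_mul]
      push_cast
      linarith
    have h5 := (Finset.sum_eq_zero_iff_of_nonneg (fun i _ => sub_nonneg.mpr (hz₀ _))).mp
      (le_antisymm h4 (Finset.sum_nonneg fun i _ => sub_nonneg.mpr (hz₀ _))) i (Finset.mem_univ i)
    linarith
  have hzero : f z₀ = 0 := by
    refine eq_zero_of_invNorm_scale hM hw hf (σ := fun z => toGL (matV p) • z) (c := p)
      (by exact_mod_cast hp.one_lt) (fun z => ?_) (fun z' hz' => key2 z' hz' none)
    rw [im_toGL_smul (det_matV_pos hp.pos), det_matV]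
    simp [matV]
  apply hne
  funext z
  have h1 := hz₀ z
  have h2 : m = 0 := by rw [hm, invNorm, hzero, norm_zero, zero_mul]
  rw [h2] at h1
  exact invNorm_eq_zero (le_antisymm h1 (invNorm_nonneg _ _ _))

/-- If f and V_p f both have level M, the invariant norm of f is preserved by Γ₀(M) and by its
conjugate under diag(p, 1). A suitable product of such elements is z ↦ p (pz - y), which multiplies
heights by p²; so f vanishes everywhere. -/
lemma eq_zero_of_opV_mem {M p : ℕ} (hM : 0 < M) (hp : p.Prime) (hpM : ¬ p ∣ M) {w : ℤ}
    (hw : 0 < w) {f : ℍ → ℂ} (hf : f ∈ cuspSpace M w) (hVf : opV p f ∈ cuspSpace M w) :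
    f = 0 := by
  obtain ⟨x, y, hxy⟩ : IsCoprime (p : ℤ) (M : ℤ) := by
    rw [Nat.isCoprime_iff_coprime]
    exact (Nat.Prime.coprime_iff_not_dvd hp).mpr hpM
  have hp0 : (p : ℂ) ≠ 0 := by exact_mod_cast hp.ne_zero
  have hdetA : (!![-x, -y; (M : ℤ), -(p : ℤ)] : Matrix (Fin 2) (Fin 2) ℤ).det = 1 := by
    rw [Matrix.det_fin_two_of]; linear_combination hxy
  have hV : ∀ z, invNorm w (opV p f) z =
      ‖(p : ℂ) ^ (1 - w)‖ * (p : ℝ) ^ (w / 2 - 1 : ℝ) * invNorm w f (toGL (matV p) • z) := by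
    intro z
    have h1 := invNorm_sl (w := w) (det_matV_pos hp.pos) f z
    rw [det_matV] at h1
    rw [opV_eq_sl hp.pos w, invNorm, Pi.smul_apply, smul_eq_mul, norm_mul, mul_assoc, mul_assoc]
    congr 1
  have hinv : ∀ z, invNorm w f (toGL (matV p) • toGL (matL M) • z) =
      invNorm w f (toGL (matV p) • z) := by
    intro z
    have h1 := invNorm_smul_eq (det_matL (M : ℤ)) (by simp [matL]) hVf z
    rw [hV, hV] at h1
    refine mul_left_cancel₀ ?_ h1
    have hp' : (0 : ℝ) < p := by exact_mod_cast hp.pos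
    exact mul_ne_zero (norm_ne_zero_iff.mpr (zpow_ne_zero _ hp0)) (by positivity)
  set σ : ℍ → ℍ := fun z => toGL (matV p) • toGL !![(p : ℤ), -y; 0, 1] • z with hσ
  have hdetB : 0 < (!![(p : ℤ), -y; 0, 1] : Matrix (Fin 2) (Fin 2) ℤ).det := by
    rw [Matrix.det_fin_two_of]
    have := hp.pos
    simpa using this
  funext z
  refine eq_zero_of_invNorm_scale hM hw hf (σ := σ) (c := (p : ℝ) ^ 2) ?_ ?_ ?_
  · have : (1 : ℝ) < p := by exact_mod_cast hp.one_lt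
    nlinarith
  · intro z
    rw [hσ]
    simp only
    rw [im_toGL_smul (det_matV_pos hp.pos), det_matV, im_toGL_smul hdetB]
    simp [matV]
    ring
  · intro z' hz'
    rw [← hz']
    set u : ℍ := toGL !![(p : ℤ), -y; 0, 1] • z' with hu
    change invNorm w f (toGL (matV p) • u) = _
    -- With x p + y M = 1, the matrix (-x, -y; M, -p) of Γ₀(M) sends p u / (M u + 1) back to z',
    -- where u = p z' - y.
    rw [← hinv, ← invNorm_smul_eq hdetA (by simp) hf]
    congr 1
    apply UpperHalfPlane.ext
    have hu' : (u : ℂ) = p * z' - y := by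
      rw [hu, coe_toGL_smul hdetB]
      simp [sub_eq_add_neg]
    have hden : (M : ℂ) * u + 1 ≠ 0 := by
      simpa [matL] using cz_add_d_ne_zero (det_matL_pos (M : ℤ)) u
    have hcoe : ((toGL (matV p) • toGL (matL M) • u : ℍ) : ℂ) = p * u / (M * u + 1) := by
      rw [coe_toGL_smul (det_matV_pos hp.pos), coe_toGL_smul (det_matL_pos _)]
      simp [matV, matL]
      ring
    rw [coe_toGL_smul (by rw [hdetA]; exact one_pos), hcoe]
    have hxy' : (x : ℂ) * p + y * M = 1 := by exact_mod_cast hxy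
    have hnum : -(x : ℂ) * (p * u / (M * u + 1)) + -y = -(p * z') / (M * u + 1) := by
      rw [eq_div_iff hden, add_mul, mul_assoc, div_mul_cancel₀ _ hden]
      linear_combination (-(u : ℂ)) * hxy' - hu'
    have hden2 : (M : ℂ) * (p * u / (M * u + 1)) + -p = -p / (M * u + 1) := by
      rw [eq_div_iff hden, add_mul, mul_assoc, div_mul_cancel₀ _ hden]
      ring
    simp only [Matrix.of_apply, Matrix.cons_val', Matrix.cons_val_zero, Matrix.cons_val_one,
      Matrix.cons_val_fin_one]
    push_cast
    rw [hnum, hden2]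
    field_simp

/-! ### Finite dimensionality -/

/-- The quotient of F by q^B is holomorphic, periodic and bounded, so it has a q-expansion of its
own; multiplying by q^B shifts it. -/
lemma coeff_eq_zero_of_decay {F g : ℍ → ℂ} (B : ℕ) (hF : MDiff F)
    (hper : Function.Periodic (F ∘ ofComplex) ((1 : ℝ) : ℂ)) (hg : IsBoundedAtImInfty g)
    (h : ∀ τ : ℍ, F τ = Function.Periodic.qParam 1 τ ^ B * g τ) {n : ℕ} (hn : n < B) :
    coeff F n = 0 := by
  have hq : ∀ τ : ℂ, Function.Periodic.qParam 1 τ ≠ 0 := fun τ => Complex.exp_ne_zero _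
  have hgF : ∀ τ : ℍ, g τ = (Function.Periodic.qParam 1 τ ^ B)⁻¹ * F τ := fun τ => by
    rw [h, inv_mul_cancel_left₀ (pow_ne_zero _ (hq _))]
  have hqper : ∀ z : ℂ, Function.Periodic.qParam 1 (z + ((1 : ℝ) : ℂ)) =
      Function.Periodic.qParam 1 z := fun z => by
    simp only [Function.Periodic.qParam, Complex.ofReal_one, div_one, mul_add, mul_one,
      Complex.exp_add, Complex.exp_two_pi_mul_I]
  have hgd : MDiff g := by
    rw [UpperHalfPlane.mdifferentiable_iff] at hF ⊢
    have h1 : DifferentiableOn ℂ (fun z : ℂ => (Function.Periodic.qParam 1 z ^ B)⁻¹ *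
        (F ∘ ofComplex) z) {z | 0 < z.im} := by
      refine DifferentiableOn.mul (DifferentiableOn.inv (DifferentiableOn.pow ?_ _)
        fun z _ => pow_ne_zero _ (hq z)) hF
      unfold Function.Periodic.qParam
      fun_prop
    refine h1.congr fun z hz => ?_
    simp only [Function.comp_apply]
    rw [hgF, ofComplex_apply_of_im_pos hz]
  have hgp : Function.Periodic (g ∘ ofComplex) ((1 : ℝ) : ℂ) := fun z => by
    by_cases hz : 0 < z.im
    · have hz' : 0 < (z + ((1 : ℝ) : ℂ)).im := by simpa using hz
      have h1 := hper z
      simp only [Function.comp_apply, ofComplex_apply_of_im_pos hz,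
        ofComplex_apply_of_im_pos hz'] at h1 ⊢
      rw [hgF, hgF, h1]
      simp only [hqper]
    · have hz' : ¬ 0 < (z + ((1 : ℝ) : ℂ)).im := by simpa using hz
      rw [Function.comp_apply, Function.comp_apply, ofComplex_apply_of_im_nonpos (not_lt.mp hz),
        ofComplex_apply_of_im_nonpos (not_lt.mp hz')]
  have hgQ := isQ_of_periodic hgd hgp hg
  have := coeff_eq_of_hasSum hF (c := fun n => if n < B then 0 else coeff g (n - B)) (fun τ => by
    rw [h τ]
    have h1 := (hgQ.2 τ).mul_left (Function.Periodic.qParam 1 τ ^ B)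
    have hinj : Function.Injective fun n : ℕ => n + B := add_left_injective B
    rw [← hinj.hasSum_iff]
    · refine h1.congr_fun ?_ |> id
      intro n
      simp only [Function.comp_apply]
      rw [if_neg (by omega), Nat.add_sub_cancel, pow_add]
      ring
    · intro n hn
      have : n < B := by
        by_contra h2
        exact hn ⟨n - B, by simp only; omega⟩
      simp [this]) n
  rw [this, if_pos hn]

/-- This reduces to level one. The norm of f is the product of its translates over the cosets; the
trivial coset contributes f, which is divisible by q^B, and the other factors are bounded at
infinity. So the norm, of weight W, vanishes beyond order W / 12 and is zero by the Sturm bound, and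
then f is zero. -/
lemma exists_coeff_bound {M : ℕ} (hM : 0 < M) {w : ℤ} (hw : 0 < w) :
    ∃ B : ℕ, ∀ f ∈ cuspSpace M w, (∀ n < B, coeff f n = 0) → f = 0 := by
  have : NeZero M := ⟨hM.ne'⟩
  set Γ : Subgroup (GL (Fin 2) ℝ) := (CongruenceSubgroup.Gamma0 M : Subgroup (GL (Fin 2) ℝ))
  have : Fintype (𝒮ℒ ⧸ Γ.subgroupOf 𝒮ℒ) := Fintype.ofFinite _
  set W : ℤ := w * Nat.card (𝒮ℒ ⧸ Γ.subgroupOf 𝒮ℒ)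
  refine ⟨W.toNat / 12 + 1, fun f hf hc => ?_⟩
  set f' := mkCusp hw f hf
  have hfQ := isQ_of_mem hw hf
  rw [← mkCusp_coe hw f hf, ← ModularForm.norm_eq_zero_iff (𝒢 := Γ) (k := w) 𝒮ℒ]
  apply ModularForm.sturm_bound_levelOne
  set F := ModularForm.norm 𝒮ℒ f' with hF
  obtain ⟨B, hB⟩ : ∃ B, B = W.toNat / 12 + 1 := ⟨_, rfl⟩
  rw [← hB] at hc
  classical
  set q1 : 𝒮ℒ ⧸ Γ.subgroupOf 𝒮ℒ := ⟦1⟧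
  set g : ℍ → ℂ := (fun τ : ℍ => ∑' n, coeff f (n + B) * Function.Periodic.qParam 1 τ ^ n) *
    ∏ q ∈ Finset.univ.erase q1, SlashInvariantForm.quotientFunc (𝒢 := Γ) (ℋ := 𝒮ℒ) (k := w) f' q
      with hg
  have hcoe : (F : ℍ → ℂ) =
      ∏ q, SlashInvariantForm.quotientFunc (𝒢 := Γ) (ℋ := 𝒮ℒ) (k := w) f' q := by
    rw [hF, ModularForm.coe_norm]
    congr!
  have hq0 : ∀ τ : ℍ, Function.Periodic.qParam 1 (τ : ℂ) ≠ 0 := fun τ => Complex.exp_ne_zero _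
  have hsum : ∀ τ : ℍ, HasSum (fun n => coeff f (n + B) * Function.Periodic.qParam 1 τ ^ n)
      ((Function.Periodic.qParam 1 τ ^ B)⁻¹ * f τ) := fun τ => by
    have h1 := (hasSum_nat_add_iff' B).mpr (hfQ.2 τ)
    rw [Finset.sum_eq_zero fun n hn => by rw [hc n (Finset.mem_range.mp hn), zero_mul],
      sub_zero] at h1
    refine (h1.mul_left (Function.Periodic.qParam 1 τ ^ B)⁻¹).congr_fun ?_ |> id
    intro n
    rw [pow_add, mul_left_comm, mul_comm (_ ^ n) (_ ^ B), inv_mul_cancel_left₀ (pow_ne_zero _ (hq0 τ))]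
  have hsum' : ∀ τ : ℍ, HasSum (fun n => coeff f (n + B) • Function.Periodic.qParam 1 τ ^ n)
      (∑' n, coeff f (n + B) * Function.Periodic.qParam 1 τ ^ n) := fun τ => by
    simpa only [smul_eq_mul] using (hsum τ).summable.hasSum
  have key : ∀ n < B, coeff F n = 0 := by
    intro n hn
    refine coeff_eq_zero_of_decay (g := g) B F.holo' ?_ ?_ (fun τ => ?_) hn
    · exact SlashInvariantFormClass.periodic_comp_ofComplex F
        one_mem_strictPeriods_SL
    · refine Filter.BoundedAtFilter.mul
        (isBoundedAtImInfty_of_hasSum_qExpansion one_pos hsum') ?_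
      have hprod : ∀ s : Finset (𝒮ℒ ⧸ Γ.subgroupOf 𝒮ℒ),
          IsBoundedAtImInfty (∏ q ∈ s,
            SlashInvariantForm.quotientFunc (𝒢 := Γ) (ℋ := 𝒮ℒ) (k := w) f' q) := fun s => by
        induction s using Finset.induction_on with
        | empty => exact Filter.const_boundedAtFilter atImInfty (1 : ℂ)
        | insert a s ha ih =>
          rw [Finset.prod_insert ha]
          refine Filter.BoundedAtFilter.mul ?_ ih
          induction a using Quotient.inductionOn with
          | h r =>
            obtain ⟨_, γ, rfl⟩ := r
            rw [SlashInvariantForm.quotientFunc_mk]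
            have h1 : HasBound w (sl w ((γ⁻¹ : SL(2, ℤ)) : Matrix (Fin 2) (Fin 2) ℤ) f) :=
              hf.2.2.sl (by rw [Matrix.SpecialLinearGroup.det_coe]; exact one_pos)
            rw [sl, toGL_SL, map_inv] at h1
            exact (h1.isZeroAtImInfty hw).isBoundedAtImInfty
      exact hprod _
    · change F τ = _
      rw [hcoe, ← Finset.mul_prod_erase _ _ (Finset.mem_univ q1), hg, Pi.mul_apply, Pi.mul_apply,
        (hsum τ).tsum_eq, ← mul_assoc, ← mul_assoc,
        mul_inv_cancel₀ (pow_ne_zero B (hq0 τ)), one_mul]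
      congr 1
      simp [q1, f', mkCusp_coe]
  refine lt_of_lt_of_le ?_ (PowerSeries.nat_le_order _ B key)
  rw [hB]
  exact_mod_cast Nat.lt_succ_self _

lemma finiteDimensional_cuspSpace {M : ℕ} (hM : 0 < M) {w : ℤ} (hw : 0 < w) :
    FiniteDimensional ℂ (cuspSpace M w) := by
  obtain ⟨B, hB⟩ := exists_coeff_bound hM hw
  let L : cuspSpace M w →ₗ[ℂ] (Fin B → ℂ) :=
    { toFun := fun f n => coeff f n
      map_add' := fun f g => by
        funext n
        exact coeff_add (isQ_of_mem hw f.2) (isQ_of_mem hw g.2) n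
      map_smul' := fun c f => by
        funext n
        exact coeff_smul (isQ_of_mem hw f.2) c n }
  refine FiniteDimensional.of_injective L ((injective_iff_map_eq_zero L).mpr fun f hf => ?_)
  exact Subtype.ext (hB f f.2 fun n hn => congrFun hf ⟨n, hn⟩)

/-- `cuspSpace` is the space of functions underlying cusp forms. -/
def cuspEquiv {M : ℕ} [NeZero M] {w : ℤ} (hw : 0 < w) : S M w ≃ₗ[ℂ] cuspSpace M w where
  toFun f := ⟨f, coe_mem_cuspSpace f⟩
  invFun f := mkCusp hw f f.2
  map_add' _ _ := rfl
  map_smul' _ _ := rfl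
  left_inv _ := rfl
  right_inv _ := rfl

lemma finiteDimensional_cuspForm {M : ℕ} [NeZero M] {w : ℤ} (hw : 0 < w) :
    FiniteDimensional ℂ (S M w) :=
  have := finiteDimensional_cuspSpace (Nat.pos_of_ne_zero (NeZero.ne M)) hw
  Module.Finite.equiv (cuspEquiv hw).symm

section

open MeasureTheory

/-! ### Fundamental domains and weight functions -/

lemma volume_fd_lt_top : volume (ModularGroup.fd : Set ℍ) < ⊤ := by
  rw [volume_eq_lintegral]
  have hsub : (UpperHalfPlane.coe '' (ModularGroup.fd : Set ℍ)) ⊆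
      {z : ℂ | z.re ∈ Set.Icc (-1 : ℝ) 1 ∧ z.im ∈ Set.Ioi (1 / 2 : ℝ)} := by
    rintro _ ⟨z, ⟨h1, h2⟩, rfl⟩
    rw [abs_le] at h2
    refine ⟨⟨by simp only [UpperHalfPlane.coe_re]; linarith [h2.1],
      by simp only [UpperHalfPlane.coe_re]; linarith [h2.2]⟩, ?_⟩
    rw [Complex.normSq_apply] at h1
    simp only [UpperHalfPlane.coe_re, UpperHalfPlane.coe_im, Set.mem_Ioi] at h1 ⊢
    have := z.im_pos
    nlinarith [h2.1, h2.2]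
  refine lt_of_le_of_lt (lintegral_mono_set hsub) ?_
  have hpre : {z : ℂ | z.re ∈ Set.Icc (-1 : ℝ) 1 ∧ z.im ∈ Set.Ioi (1 / 2 : ℝ)} =
      Complex.measurableEquivRealProd ⁻¹' (Set.Icc (-1 : ℝ) 1 ×ˢ Set.Ioi (1 / 2 : ℝ)) := by
    ext z
    simp [Complex.measurableEquivRealProd]
  have hmeas : Measurable fun x : ℝ × ℝ => ((((1 / ‖x.2‖₊) ^ 2 : NNReal)) : ENNReal) := by
    fun_prop
  rw [hpre]
  have := Complex.volume_preserving_equiv_real_prod.setLIntegral_comp_preimage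
    (s := Set.Icc (-1 : ℝ) 1 ×ˢ Set.Ioi (1 / 2 : ℝ))
    (measurableSet_Icc.prod measurableSet_Ioi) hmeas
  have heq : (fun z : ℂ => ((((1 / ‖z.im‖₊) ^ 2 : NNReal)) : ENNReal)) = fun z : ℂ =>
    (fun x : ℝ × ℝ => ((((1 / ‖x.2‖₊) ^ 2 : NNReal)) : ENNReal))
      (Complex.measurableEquivRealProd z) := rfl
  rw [heq, this, Measure.volume_eq_prod, ← Measure.prod_restrict,
    lintegral_prod _ hmeas.aemeasurable]
  simp only [lintegral_const, Measure.restrict_apply MeasurableSet.univ, Set.univ_inter,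
    Real.volume_Icc]
  refine ENNReal.mul_lt_top ?_ (by simp)
  have hint : IntegrableOn (fun y : ℝ => y ^ (-2 : ℝ)) (Set.Ioi (1 / 2)) :=
    integrableOn_Ioi_rpow_of_lt (by norm_num) (by norm_num)
  have h2 := hint.2
  rw [HasFiniteIntegral] at h2
  refine lt_of_le_of_lt (le_of_eq ?_) h2
  refine setLIntegral_congr_fun measurableSet_Ioi fun y hy => ?_
  have hy0 : 0 < y := lt_trans (by norm_num) hy
  rw [enorm_eq_nnnorm]
  congr 1
  ext
  simp only [NNReal.coe_pow, NNReal.coe_div, NNReal.coe_one, coe_nnnorm]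
  rw [Real.rpow_neg hy0.le, norm_inv, Real.norm_of_nonneg (Real.rpow_nonneg hy0.le _),
    Real.norm_of_nonneg hy0.le]
  norm_num

/-- The heights of the points in an orbit have a maximum, so all translates lying in the fundamental
domain lie in a compact truncation of it; the action is properly discontinuous. -/
lemma finite_smul_mem_fd (z : ℍ) : {g : SL(2, ℤ) | g • z ∈ ModularGroup.fd}.Finite := by
  obtain ⟨g₀, hg₀⟩ := ModularGroup.exists_max_im z
  have hK := ModularGroup.isCompact_truncatedFundamentalDomain (g₀ • z).im
  have h1 := ProperlyDiscontinuousSMul.finite_disjoint_inter_image (Γ := 𝒮ℒ)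
    (isCompact_singleton (x := z)) hK
  have hinj : Function.Injective fun g : SL(2, ℤ) =>
      (⟨Matrix.SpecialLinearGroup.mapGL ℝ g, g, rfl⟩ : 𝒮ℒ) := fun a b hab =>
    Matrix.SpecialLinearGroup.mapGL_injective (congrArg Subtype.val hab)
  refine (h1.preimage hinj.injOn).subset fun g hg => ?_
  exact ⟨g • z, ⟨z, rfl, rfl⟩, hg, hg₀ g⟩

lemma isOpenPosMeasure_aux {U : Set ℍ} (hU : IsOpen U) (h : volume U = 0) : U = ∅ := by
  by_contra hne
  have hne := Set.nonempty_iff_ne_empty.mpr hne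
  have hUo : IsOpen (UpperHalfPlane.coe '' U) := isOpenEmbedding_coe.isOpenMap _ hU
  rw [volume_eq_lintegral, setLIntegral_eq_zero_iff hUo.measurableSet (by fun_prop)] at h
  have h2 : volume (UpperHalfPlane.coe '' U) = 0 := by
    refine measure_mono_null (fun z hz => ?_) h
    obtain ⟨u, hu, rfl⟩ := hz
    intro h3
    have := h3 ⟨u, hu, rfl⟩
    simp [u.im_ne_zero] at this
  exact (hUo.measure_pos volume (hne.image _)).ne' h2

/-- `ψ` is a weight function for `Γ₀(M)`: its translates sum to one. -/
structure IsWeight (M : ℕ) (ψ : ℍ → ℝ) : Prop where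
  nonneg : ∀ z, 0 ≤ ψ z
  meas : Measurable ψ
  integrable : Integrable ψ
  hasSum : ∀ z, HasSum (fun γ : CongruenceSubgroup.Gamma0 M => ψ (toGL γ.1.1 • z)) 1

lemma measurable_SL_smul (g : SL(2, ℤ)) : Measurable fun z : ℍ => g • z :=
  (continuous_const_smul (Matrix.SpecialLinearGroup.mapGL ℝ g : GL (Fin 2) ℝ)).measurable

lemma measurableSet_fd : MeasurableSet (ModularGroup.fd : Set ℍ) := by
  have h1 : Continuous fun z : ℍ => Complex.normSq z := Complex.continuous_normSq.comp continuous_coe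
  have h2 : Continuous fun z : ℍ => |z.re| := UpperHalfPlane.continuous_re.abs
  exact ((isClosed_le continuous_const h1).inter (isClosed_le h2 continuous_const)).measurableSet

lemma volume_smul_preimage (g : SL(2, ℤ)) (s : Set ℍ) :
    volume ((fun z : ℍ => g • z) ⁻¹' s) = volume s :=
  measure_preimage_smul volume (Matrix.SpecialLinearGroup.mapGL ℝ g : GL (Fin 2) ℝ) s

instance : Countable SL(2, ℤ) :=
  Function.Injective.countable (f := fun g : SL(2, ℤ) => (fun i j => g.1 i j : Fin 2 → Fin 2 → ℤ))
    fun _ _ hab => Subtype.ext (Matrix.ext fun i j => congrFun (congrFun hab i) j)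

/-- Take ψ = 1_E / n, where E is a finite union of translates of the standard domain that meets
every Γ₀(M)-orbit and n(z) is the number of γ with γz ∈ E. The count n is finite, positive and
Γ₀(M)-invariant. Overlaps and boundaries of the translates thus need no special care. -/
lemma exists_isWeight {M : ℕ} (hM : 0 < M) : ∃ ψ : ℍ → ℝ, IsWeight M ψ := by
  have : NeZero M := ⟨hM.ne'⟩
  have hfin : Finite (SL(2, ℤ) ⧸ CongruenceSubgroup.Gamma0 M) :=
    Subgroup.finite_quotient_of_finiteIndex
  have := Fintype.ofFinite (SL(2, ℤ) ⧸ CongruenceSubgroup.Gamma0 M)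
  set E : Set ℍ := ⋃ c : SL(2, ℤ) ⧸ CongruenceSubgroup.Gamma0 M,
    (fun z : ℍ => c.out • z) ⁻¹' (ModularGroup.fd) with hE
  have hEm : MeasurableSet E := MeasurableSet.iUnion fun c =>
    measurable_SL_smul _ measurableSet_fd
  have hEfin : volume E < ⊤ := by
    refine lt_of_le_of_lt (measure_iUnion_fintype_le _ _) ?_
    refine ENNReal.sum_lt_top.mpr fun c _ => ?_
    rw [volume_smul_preimage]
    exact volume_fd_lt_top
  have hfinE : ∀ z : ℍ, {γ : CongruenceSubgroup.Gamma0 M | γ.1 • z ∈ E}.Finite := fun z => by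
    have h1 : {γ : CongruenceSubgroup.Gamma0 M | γ.1 • z ∈ E} =
        ⋃ c : SL(2, ℤ) ⧸ CongruenceSubgroup.Gamma0 M,
          (fun γ : CongruenceSubgroup.Gamma0 M => c.out * γ.1) ⁻¹'
            {g : SL(2, ℤ) | g • z ∈ ModularGroup.fd} := by
      ext γ
      simp [hE, mul_smul]
    rw [h1]
    exact Set.finite_iUnion fun c => (finite_smul_mem_fd z).preimage
      fun a _ b _ hab => Subtype.ext (mul_left_cancel hab)
  have hneE : ∀ z : ℍ, ∃ γ : CongruenceSubgroup.Gamma0 M, γ.1 • z ∈ E := fun z => by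
    obtain ⟨g, hg⟩ := ModularGroup.exists_smul_mem_fd z
    obtain ⟨γ, hγ⟩ := QuotientGroup.mk_out_eq_mul (CongruenceSubgroup.Gamma0 M) g
    refine ⟨γ⁻¹, Set.mem_iUnion.mpr ⟨QuotientGroup.mk g, ?_⟩⟩
    rw [Set.mem_preimage, smul_smul, hγ]
    simpa using hg
  set n : ℍ → ENNReal := fun z => ∑' γ : CongruenceSubgroup.Gamma0 M,
    E.indicator 1 (γ.1 • z) with hn
  have hnm : Measurable n := Measurable.tsum fun γ =>
    (measurable_const.indicator hEm).comp (measurable_SL_smul γ.1)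
  have hncard : ∀ z, n z = ((hfinE z).toFinset.card : ENNReal) := fun z => by
    rw [hn]
    simp only
    rw [tsum_eq_sum (s := (hfinE z).toFinset) fun γ hγ => by
      rw [Set.indicator_of_notMem]; simpa using hγ]
    rw [Finset.sum_congr rfl fun γ hγ => Set.indicator_of_mem (by simpa using hγ) _]
    simp
  have hcpos : ∀ z, 0 < (hfinE z).toFinset.card := fun z => by
    obtain ⟨γ, hγ⟩ := hneE z
    exact Finset.card_pos.mpr ⟨γ, by simpa using hγ⟩
  have hnR : ∀ z, (n z).toReal = (hfinE z).toFinset.card := fun z => by rw [hncard]; simp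
  have hninv : ∀ (γ : CongruenceSubgroup.Gamma0 M) z, n (γ.1 • z) = n z := fun γ z => by
    rw [hn]
    simp only
    rw [← (Equiv.mulRight γ).tsum_eq (fun δ : CongruenceSubgroup.Gamma0 M =>
      E.indicator (1 : ℍ → ENNReal) (δ.1 • z))]
    simp [mul_smul]
  refine ⟨fun z => E.indicator (1 : ℍ → ℝ) z / (n z).toReal, fun z => ?_, ?_, ?_, fun z => ?_⟩
  · exact div_nonneg (Set.indicator_nonneg (fun _ _ => zero_le_one) _) ENNReal.toReal_nonneg
  · exact (measurable_const.indicator hEm).div hnm.ennreal_toReal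
  · refine Integrable.mono' (g := E.indicator (1 : ℍ → ℝ)) ?_
      ((measurable_const.indicator hEm).div hnm.ennreal_toReal).aestronglyMeasurable
      (Filter.Eventually.of_forall fun z => ?_)
    · exact (integrable_indicator_iff hEm).mpr (integrableOn_const hEfin.ne)
    · have h0 : 0 ≤ E.indicator (1 : ℍ → ℝ) z := Set.indicator_nonneg (fun _ _ => zero_le_one) _
      rw [Real.norm_of_nonneg (div_nonneg h0 ENNReal.toReal_nonneg)]
      refine div_le_self h0 ?_
      rw [hnR]
      exact_mod_cast hcpos z
  · have h1 : ∀ γ : CongruenceSubgroup.Gamma0 M, toGL γ.1.1 • z = γ.1 • z := fun γ => by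
      rw [toGL_SL]; rfl
    simp only [h1, hninv]
    have h2 : HasSum (fun γ : CongruenceSubgroup.Gamma0 M => E.indicator (1 : ℍ → ℝ) (γ.1 • z))
        ((hfinE z).toFinset.card : ℝ) := by
      have h3 : HasSum (fun γ : CongruenceSubgroup.Gamma0 M => E.indicator (1 : ℍ → ℝ) (γ.1 • z))
          (∑ γ ∈ (hfinE z).toFinset, E.indicator (1 : ℍ → ℝ) (γ.1 • z)) :=
        hasSum_sum_of_ne_finset_zero
          fun γ hγ => by rw [Set.indicator_of_notMem]; simpa using hγ
      rw [Finset.sum_congr rfl fun γ hγ => Set.indicator_of_mem (by simpa using hγ) _] at h3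
      simpa using h3
    have h4 := h2.div_const ((n z).toReal)
    rw [hnR, div_self (by exact_mod_cast (hcpos z).ne')] at h4
    rwa [hnR]

end

section

open MeasureTheory

/-! ### Self-adjointness of the Hecke operators -/

/-- The Petersson product computed with a weight function. -/
def ip (ψ : ℍ → ℝ) (w : ℤ) (f g : ℍ → ℂ) : ℂ :=
  ∫ z, UpperHalfPlane.petersson w f g z * (ψ z : ℂ)

lemma norm_petersson (w : ℤ) (f g : ℍ → ℂ) (z : ℍ) :
    ‖UpperHalfPlane.petersson w f g z‖ = invNorm w f z * invNorm w g z := by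
  rw [invNorm, invNorm, UpperHalfPlane.petersson, norm_mul, norm_mul, Complex.norm_conj, norm_zpow,
    Complex.norm_real, Real.norm_of_nonneg z.im_pos.le, ← Real.rpow_intCast]
  rw [show (w : ℝ) = w / 2 + w / 2 by ring, Real.rpow_add z.im_pos]
  ring_nf

lemma HasBound.exists_norm_petersson_le {w : ℤ} {f g : ℍ → ℂ} (hf : HasBound w f)
    (hg : HasBound w g) : ∃ C : ℝ, 0 ≤ C ∧ ∀ z, ‖UpperHalfPlane.petersson w f g z‖ ≤ C := by
  obtain ⟨C, hC⟩ := hf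
  obtain ⟨D, hD⟩ := hg
  have hC0 : 0 ≤ C := (invNorm_nonneg w f I).trans (hC I)
  have hD0 : 0 ≤ D := (invNorm_nonneg w g I).trans (hD I)
  refine ⟨C * D, mul_nonneg hC0 hD0, fun z => ?_⟩
  rw [norm_petersson]
  exact mul_le_mul (hC z) (hD z) (invNorm_nonneg w g z) hC0



lemma integrable_petersson_mul {M : ℕ} {ψ : ℍ → ℝ} (hψ : IsWeight M ψ) {w : ℤ} {f g : ℍ → ℂ}
    (hf : Continuous f) (hg : Continuous g) (hfb : HasBound w f) (hgb : HasBound w g) :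
    Integrable fun z => UpperHalfPlane.petersson w f g z * (ψ z : ℂ) := by
  obtain ⟨C, -, hC⟩ := hfb.exists_norm_petersson_le hgb
  exact hψ.integrable.ofReal.bdd_mul
    (UpperHalfPlane.petersson_continuous w hf hg).aestronglyMeasurable
    (Filter.Eventually.of_forall hC)

lemma ip_conj_symm (ψ : ℍ → ℝ) (w : ℤ) (f g : ℍ → ℂ) :
    (starRingEnd ℂ) (ip ψ w g f) = ip ψ w f g := by
  rw [ip, ip, ← integral_conj]
  congr 1
  funext z
  rw [map_mul, Complex.conj_ofReal, UpperHalfPlane.petersson_symm w f g, Complex.conj_conj]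

/-- The contribution of `δ` to the unfolded product of `f` and `T g`. -/
def unfolded (ψ : ℍ → ℝ) (w : ℤ) (f g : ℍ → ℂ) (δ : Matrix (Fin 2) (Fin 2) ℤ) : ℂ :=
  ∫ z, UpperHalfPlane.petersson w f (sl w δ g) z * ((ψ z * ψ (toGL δ • z) : ℝ) : ℂ)

/-- The slash of g does not change along the coset Γ₀(M) A, while the values ψ(γAz) sum to one.
Dominated convergence exchanges the sum and the integral. -/
lemma hasSum_unfolded_coset {M : ℕ} {ψ : ℍ → ℝ} (hψ : IsWeight M ψ) {w : ℤ} {f g : ℍ → ℂ}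
    (hf : f ∈ cuspSpace M w) (hg : g ∈ cuspSpace M w) {A : Matrix (Fin 2) (Fin 2) ℤ}
    (hA : 0 < A.det) :
    HasSum (fun γ : CongruenceSubgroup.Gamma0 M => unfolded ψ w f g (γ.1.1 * A))
      (ip ψ w f (sl w A g)) := by
  obtain ⟨C, hC0, hC⟩ := hf.2.2.exists_norm_petersson_le (hg.2.2.sl hA)
  have hγ : ∀ γ : CongruenceSubgroup.Gamma0 M, sl w (γ.1.1 * A) g = sl w A g := fun γ => by
    rw [sl_mul (by simp) hA.ne', hg.2.1 γ.1 γ.2]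
  have hact : ∀ (γ : CongruenceSubgroup.Gamma0 M) (z : ℍ),
      toGL (γ.1.1 * A) • z = toGL γ.1.1 • (toGL A • z) := fun γ z => by
    rw [toGL_mul (by simp) hA.ne', mul_smul]
  have hsum : ∀ z, HasSum (fun γ : CongruenceSubgroup.Gamma0 M =>
      C * (ψ z * ψ (toGL (γ.1.1 * A) • z))) (C * ψ z) := fun z => by
    simp only [hact]
    simpa using ((hψ.hasSum (toGL A • z)).mul_left (ψ z)).mul_left C
  refine hasSum_integral_of_dominated_convergence
    (fun γ z => C * (ψ z * ψ (toGL (γ.1.1 * A) • z))) (fun γ => ?_) (fun γ => ?_) ?_ ?_ ?_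
  · refine AEStronglyMeasurable.mul ?_ (Measurable.aestronglyMeasurable ?_)
    · exact (UpperHalfPlane.petersson_continuous w hf.1.continuous
        (mdiff_sl _ _ hg.1).continuous).aestronglyMeasurable
    · exact Complex.measurable_ofReal.comp (hψ.meas.mul
        (hψ.meas.comp (continuous_const_smul _).measurable))
  · refine Filter.Eventually.of_forall fun z => ?_
    rw [norm_mul, Complex.norm_real, Real.norm_of_nonneg (mul_nonneg (hψ.nonneg _) (hψ.nonneg _)),
      hγ]
    exact mul_le_mul_of_nonneg_right (hC z) (mul_nonneg (hψ.nonneg _) (hψ.nonneg _))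
  · exact Filter.Eventually.of_forall fun z => (hsum z).summable
  · simp only [fun z => (hsum z).tsum_eq]
    exact hψ.integrable.const_mul C
  · refine Filter.Eventually.of_forall fun z => ?_
    simp only [hγ, hact]
    have := ((Complex.hasSum_ofReal.mpr (hψ.hasSum (toGL A • z))).mul_left (ψ z : ℂ)).mul_left
      (UpperHalfPlane.petersson w f (sl w A g) z)
    simpa using this

/-- Integral matrices of determinant `ℓ` with lower left entry divisible by `M`. -/
def heckeSet (M ℓ : ℕ) : Set (Matrix (Fin 2) (Fin 2) ℤ) := {A | A.det = ℓ ∧ (M : ℤ) ∣ A 1 0}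

/-- Summing over coset representatives as well turns the product with T_ℓ g into a sum over all
integral matrices of determinant ℓ with lower left entry divisible by M. This set no longer depends
on choices and is stable under the adjugate. -/
lemma hasSum_unfolded {M ℓ : ℕ} (hℓ : ℓ.Prime) (hℓM : ¬ ℓ ∣ M) {ψ : ℍ → ℝ} (hψ : IsWeight M ψ)
    {w : ℤ} {f g : ℍ → ℂ} (hf : f ∈ cuspSpace M w) (hg : g ∈ cuspSpace M w) :
    HasSum (fun A : heckeSet M ℓ => unfolded ψ w f g A) (ip ψ w f (hecke M w ℓ g)) := by
  classical
  have hdet : ∀ i, (heckeRep ℓ i).det = ℓ := fun i => by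
    cases i with
    | none => exact det_matV _
    | some j => exact det_matU _ _
  have hdvd : ∀ i, (M : ℤ) ∣ heckeRep ℓ i 1 0 := fun i => by
    cases i <;> simp [heckeRep, matV, matU]
  have hpos := fun i => heckeRep_det_pos hℓ.pos i
  set t : Option (Fin ℓ) → Set (Matrix (Fin 2) (Fin 2) ℤ) := fun i =>
    Set.range fun γ : CongruenceSubgroup.Gamma0 M => γ.1.1 * heckeRep ℓ i with ht
  have hU : (⋃ i ∈ (Finset.univ : Finset (Option (Fin ℓ))), t i) = heckeSet M ℓ := by
    ext A
    simp only [Finset.mem_univ, Set.iUnion_true, Set.mem_iUnion, ht, Set.mem_range]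
    constructor
    · rintro ⟨i, γ, rfl⟩
      refine ⟨by rw [Matrix.det_mul, γ.1.det_coe, one_mul, hdet], ?_⟩
      rw [Matrix.mul_apply, Fin.sum_univ_two]
      exact dvd_add ((mem_Gamma0_iff_dvd.mp γ.2).mul_right _) ((hdvd i).mul_left _)
    · rintro ⟨h1, h2⟩
      obtain ⟨i, γ, hγ, h⟩ := rel_heckeRep hℓ hℓM h1 h2
      exact ⟨i, ⟨γ, hγ⟩, h.symm⟩
  have hdisj : ((Finset.univ : Finset (Option (Fin ℓ))) : Set (Option (Fin ℓ))).Pairwise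
      (Function.onFun Disjoint t) := by
    intro i _ j _ hij
    rw [Function.onFun, Set.disjoint_left]
    rintro A ⟨γ, rfl⟩ ⟨δ, hδ⟩
    refine hij (heckeRep_inj (M := M) hℓ i j ?_)
    refine ⟨γ.1⁻¹ * δ.1, mul_mem (inv_mem γ.2) δ.2, ?_⟩
    simp only at hδ
    rw [Matrix.SpecialLinearGroup.coe_mul, Matrix.mul_assoc, hδ, ← Matrix.mul_assoc,
      ← Matrix.SpecialLinearGroup.coe_mul, inv_mul_cancel, Matrix.SpecialLinearGroup.coe_one,
      Matrix.one_mul]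
  have hsum := hasSum_sum_disjoint (f := unfolded ψ w f g) Finset.univ hdisj
    (a := fun i => ip ψ w f (sl w (heckeRep ℓ i) g)) fun i _ => by
      have hinj : Function.Injective
          fun γ : CongruenceSubgroup.Gamma0 M => γ.1.1 * heckeRep ℓ i := fun γ δ h => by
        apply Subtype.ext
        apply Subtype.ext
        have h1 := congrArg (fun X => X * (heckeRep ℓ i).adjugate) h
        simp only [Matrix.mul_assoc, Matrix.mul_adjugate, Matrix.mul_smul, Matrix.mul_one] at h1
        exact smul_right_injective _ (hpos i).ne' h1
      exact hinj.hasSum_range_iff.mpr (hasSum_unfolded_coset hψ hf hg (hpos i))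
  rw [hU] at hsum
  have hip : ip ψ w f (hecke M w ℓ g) = ∑ i, ip ψ w f (sl w (heckeRep ℓ i) g) := by
    rw [hecke_eq_sum hℓ hℓM]
    simp only [ip]
    rw [← integral_finsetSum]
    · congr 1
      funext z
      simp only [UpperHalfPlane.petersson, Finset.sum_apply, Finset.mul_sum, Finset.sum_mul]
    · intro i _
      exact integrable_petersson_mul hψ hf.1.continuous (mdiff_sl _ _ hg.1).continuous hf.2.2
        (hg.2.2.sl (hpos i))
  rw [hip]
  exact hsum

lemma sl_smul_one {ℓ : ℕ} (hℓ : 0 < ℓ) (w : ℤ) (f : ℍ → ℂ) :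
    sl w ((ℓ : ℤ) • (1 : Matrix (Fin 2) (Fin 2) ℤ)) f = ((ℓ : ℂ) ^ (w - 2)) • f := by
  rw [← sl_scalar hℓ]
  congr 1
  ext i j
  fin_cases i <;> fin_cases j <;> simp [matU, matV, Matrix.mul_apply, Fin.sum_univ_two]

/-- Substitute z ↦ A' z with A' the adjugate of A. As A A' is scalar, this exchanges the two values
of ψ and moves the slash operator from g to f; the scalar ℓ^(w-2) cancels on both sides. -/
lemma unfolded_adjugate (ψ : ℍ → ℝ) (w : ℤ) (f g : ℍ → ℂ) {ℓ : ℕ} (hℓ : 0 < ℓ)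
    {A : Matrix (Fin 2) (Fin 2) ℤ} (hA : A.det = ℓ) :
    unfolded ψ w f g A = (starRingEnd ℂ) (unfolded ψ w g f A.adjugate) := by
  have hℓ' : (0 : ℤ) < ℓ := by exact_mod_cast hℓ
  have hA' : A.adjugate.det = ℓ := by rw [Matrix.det_adjugate]; simpa using hA
  have hApos : 0 < A.det := by rw [hA]; exact hℓ'
  have hA'pos : 0 < A.adjugate.det := by rw [hA']; exact hℓ'
  have hinv : ∀ z : ℍ, toGL A • (toGL A.adjugate • z) = z := fun z => by
    rw [smul_smul, ← toGL_mul hApos.ne' hA'pos.ne', Matrix.mul_adjugate, hA]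
    have h1 : 0 < ((ℓ : ℤ) • (1 : Matrix (Fin 2) (Fin 2) ℤ)).det := by
      rw [Matrix.det_smul]; simp; positivity
    apply UpperHalfPlane.ext
    rw [coe_toGL_smul h1]
    have : (ℓ : ℂ) ≠ 0 := by exact_mod_cast hℓ.ne'
    simp [this]
  have hsl : sl w A.adjugate (sl w A g) = ((ℓ : ℂ) ^ (w - 2)) • g := by
    rw [← sl_mul hApos.ne' hA'pos.ne', Matrix.mul_adjugate, hA, sl_smul_one hℓ]
  have hpet : ∀ z, UpperHalfPlane.petersson w f (sl w A g) (toGL A.adjugate • z) =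
      UpperHalfPlane.petersson w (sl w A.adjugate f) g z := fun z => by
    have h1 := UpperHalfPlane.petersson_slash w f (sl w A g) (toGL A.adjugate) z
    change UpperHalfPlane.petersson w (sl w A.adjugate f) (sl w A.adjugate (sl w A g)) z = _ at h1
    rw [hsl, σ, if_pos (toGL_det_pos hA'pos), toGL_det hA'pos, hA'] at h1
    have h2 : (ℓ : ℂ) ^ (w - 2) ≠ 0 := zpow_ne_zero _ (by exact_mod_cast hℓ.ne')
    apply mul_left_cancel₀ h2
    rw [ContinuousAlgEquiv.refl_apply] at h1
    have h3 : ((|((ℓ : ℤ) : ℝ)| : ℝ) : ℂ) = (ℓ : ℂ) := by simp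
    rw [h3] at h1
    rw [← h1]
    simp only [UpperHalfPlane.petersson, Pi.smul_apply, smul_eq_mul]
    ring
  rw [unfolded, unfolded, ← integral_conj, ← integral_smul_eq_self _ (g := toGL A.adjugate)]
  congr 1
  funext z
  rw [hpet, hinv, map_mul, Complex.conj_ofReal,
    UpperHalfPlane.petersson_symm w (sl w A.adjugate f) g, Complex.conj_conj, mul_comm (ψ _)]

/-- Both sides are sums over `heckeSet`, and the involution A ↦ adj A matches them term by term up
to complex conjugation. -/
lemma ip_hecke {M ℓ : ℕ} (hℓ : ℓ.Prime) (hℓM : ¬ ℓ ∣ M) {ψ : ℍ → ℝ} (hψ : IsWeight M ψ)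
    {w : ℤ} {f g : ℍ → ℂ} (hf : f ∈ cuspSpace M w) (hg : g ∈ cuspSpace M w) :
    ip ψ w f (hecke M w ℓ g) = ip ψ w (hecke M w ℓ f) g := by
  have h1 := hasSum_unfolded hℓ hℓM hψ hf hg
  have h2 := hasSum_unfolded hℓ hℓM hψ hg hf
  let e : heckeSet M ℓ ≃ heckeSet M ℓ :=
    { toFun := fun A => ⟨A.1.adjugate, by
        obtain ⟨A, h1, h2⟩ := A
        refine ⟨by rw [Matrix.det_adjugate]; simpa using h1, ?_⟩
        rw [Matrix.adjugate_fin_two]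
        simpa using h2⟩
      invFun := fun A => ⟨A.1.adjugate, by
        obtain ⟨A, h1, h2⟩ := A
        refine ⟨by rw [Matrix.det_adjugate]; simpa using h1, ?_⟩
        rw [Matrix.adjugate_fin_two]
        simpa using h2⟩
      left_inv := fun A => Subtype.ext (by simp [Matrix.adjugate_adjugate])
      right_inv := fun A => Subtype.ext (by simp [Matrix.adjugate_adjugate]) }
  have h3 := (e.hasSum_iff.mpr h2).map (starRingEnd ℂ) Complex.continuous_conj
  rw [ip_conj_symm] at h3
  refine h1.unique (h3.congr_fun ?_ |> id)
  intro A
  exact unfolded_adjugate ψ w f g hℓ.pos A.2.1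

end

section

open MeasureTheory

/-! ### Positivity and orthogonal complements -/

lemma petersson_self (w : ℤ) (f : ℍ → ℂ) (z : ℍ) :
    UpperHalfPlane.petersson w f f z = ((Complex.normSq (f z) * z.im ^ w : ℝ) : ℂ) := by
  rw [UpperHalfPlane.petersson, ← Complex.normSq_eq_conj_mul_self]
  push_cast
  rfl

lemma peterssonRe_ne_zero_iff (w : ℤ) (f : ℍ → ℂ) (z : ℍ) :
    Complex.normSq (f z) * z.im ^ w ≠ 0 ↔ f z ≠ 0 := by
  simp [zpow_ne_zero w z.im_ne_zero]

lemma peterssonRe_nonneg (w : ℤ) (f : ℍ → ℂ) (z : ℍ) : 0 ≤ Complex.normSq (f z) * z.im ^ w :=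
  mul_nonneg (Complex.normSq_nonneg _) (zpow_nonneg z.im_pos.le _)

lemma sl_ne_zero_iff {M : ℕ} {w : ℤ} {f : ℍ → ℂ} (hf : f ∈ cuspSpace M w)
    (γ : CongruenceSubgroup.Gamma0 M) (z : ℍ) : f (toGL γ.1.1 • z) ≠ 0 ↔ f z ≠ 0 := by
  conv_rhs => rw [← hf.2.1 γ.1 γ.2]
  have h := cz_add_d_ne_zero (A := (γ.1.1 : Matrix (Fin 2) (Fin 2) ℤ)) (by simp) z
  rw [sl_apply (by simp), Matrix.SpecialLinearGroup.det_coe]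
  simp only [ne_eq, mul_eq_zero, not_or, Int.cast_one, one_zpow, one_ne_zero, not_false_eq_true,
    true_and]
  exact ⟨fun h1 => ⟨zpow_ne_zero _ h, h1⟩, fun h1 => h1.2⟩

lemma eq_zero_of_null {f : ℍ → ℂ} (hf : Continuous f) (h : volume {z | f z ≠ 0} = 0) : f = 0 := by
  have h1 := isOpenPosMeasure_aux (isOpen_ne_fun hf continuous_const) h
  funext z
  by_contra h2
  have h3 : z ∈ {z | f z ≠ 0} := h2
  rw [h1] at h3
  exact h3

lemma ip_self_eq (ψ : ℍ → ℝ) (w : ℤ) (f : ℍ → ℂ) : ip ψ w f f =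
    ((∫ z, Complex.normSq (f z) * z.im ^ w * ψ z : ℝ) : ℂ) := by
  rw [ip, ← integral_complex_ofReal]
  congr 1
  funext z
  rw [petersson_self]
  push_cast
  rfl

/-- The weight ψ may vanish on large sets, but at each z some translate of it is non-zero. The set
where f ≠ 0 is therefore covered by countably many translates of a null set, and an open null set is
empty. -/
lemma eq_zero_of_ip_self {M : ℕ} {ψ : ℍ → ℝ} (hψ : IsWeight M ψ) {w : ℤ} {f : ℍ → ℂ}
    (hf : f ∈ cuspSpace M w) (h : ip ψ w f f = 0) : f = 0 := by
  have hint := (integrable_petersson_mul hψ hf.1.continuous hf.1.continuous hf.2.2 hf.2.2).re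
  have hre : ∀ z, RCLike.re (UpperHalfPlane.petersson w f f z * (ψ z : ℂ)) =
      Complex.normSq (f z) * z.im ^ w * ψ z := fun z => by
    rw [petersson_self, ← Complex.ofReal_mul]
    exact Complex.ofReal_re _
  simp only [hre] at hint
  rw [ip_self_eq, Complex.ofReal_eq_zero, integral_eq_zero_iff_of_nonneg
    (fun z => mul_nonneg (peterssonRe_nonneg w f z) (hψ.nonneg z)) hint] at h
  apply eq_zero_of_null hf.1.continuous
  have hnull : volume {z | Complex.normSq (f z) * z.im ^ w * ψ z ≠ 0} = 0 := h
  refine measure_mono_null (t := ⋃ γ : CongruenceSubgroup.Gamma0 M,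
    (fun z => toGL γ.1.1 • z) ⁻¹' {z | Complex.normSq (f z) * z.im ^ w * ψ z ≠ 0}) ?_
    (measure_iUnion_null fun γ => by rw [measure_preimage_smul]; exact hnull)
  intro z hz
  have : ∃ γ : CongruenceSubgroup.Gamma0 M, ψ (toGL γ.1.1 • z) ≠ 0 := by
    by_contra! h0
    have h1 := hψ.hasSum z
    simp only [h0] at h1
    exact zero_ne_one (hasSum_zero.unique h1)
  obtain ⟨γ, hγ⟩ := this
  refine Set.mem_iUnion.mpr ⟨γ, mul_ne_zero ?_ hγ⟩
  rw [peterssonRe_ne_zero_iff, sl_ne_zero_iff hf]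
  exact hz

lemma ip_add_left {M : ℕ} {ψ : ℍ → ℝ} (hψ : IsWeight M ψ) {w : ℤ} {f f' g : ℍ → ℂ}
    (hf : f ∈ cuspSpace M w) (hf' : f' ∈ cuspSpace M w) (hg : g ∈ cuspSpace M w) :
    ip ψ w (f + f') g = ip ψ w f g + ip ψ w f' g := by
  rw [ip, ip, ip, ← integral_add
    (integrable_petersson_mul hψ hf.1.continuous hg.1.continuous hf.2.2 hg.2.2)
    (integrable_petersson_mul hψ hf'.1.continuous hg.1.continuous hf'.2.2 hg.2.2)]
  congr 1
  funext z
  simp only [UpperHalfPlane.petersson, Pi.add_apply, map_add]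
  ring

lemma ip_smul_left (ψ : ℍ → ℝ) (w : ℤ) (c : ℂ) (f g : ℍ → ℂ) :
    ip ψ w (c • f) g = (starRingEnd ℂ) c * ip ψ w f g := by
  rw [ip, ip, ← integral_const_mul]
  congr 1
  funext z
  simp only [UpperHalfPlane.petersson, Pi.smul_apply, smul_eq_mul, map_mul]
  ring

lemma ip_smul_right (ψ : ℍ → ℝ) (w : ℤ) (c : ℂ) (f g : ℍ → ℂ) :
    ip ψ w f (c • g) = c * ip ψ w f g := by
  rw [← ip_conj_symm, ip_smul_left, map_mul, Complex.conj_conj, ip_conj_symm]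

/-- The Petersson product as an inner product on the space of cusp forms. -/
@[reducible]
def ipCore {M : ℕ} [NeZero M] {ψ : ℍ → ℝ} (hψ : IsWeight M ψ) (w : ℤ) :
    InnerProductSpace.Core ℂ (S M w) where
  inner f g := ip ψ w f g
  conj_inner_symm f g := ip_conj_symm ψ w f g
  re_inner_nonneg f := by
    rw [ip_self_eq]
    exact integral_nonneg fun z => mul_nonneg (peterssonRe_nonneg w f z) (hψ.nonneg z)
  add_left f g h := ip_add_left hψ (coe_mem_cuspSpace f) (coe_mem_cuspSpace g)
    (coe_mem_cuspSpace h)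
  smul_left f g c := ip_smul_left ψ w c f g
  definite f hf := DFunLike.coe_injective (eq_zero_of_ip_self hψ (coe_mem_cuspSpace f) hf)

lemma eigenvalue_real {M ℓ : ℕ} (hM : 0 < M) (hℓ : ℓ.Prime) (hℓM : ¬ ℓ ∣ M) {w : ℤ} {f : ℍ → ℂ}
    (hf : f ∈ cuspSpace M w) (hne : f ≠ 0) {b : ℂ} (hb : hecke M w ℓ f = b • f) :
    (starRingEnd ℂ) b = b := by
  obtain ⟨ψ, hψ⟩ := exists_isWeight hM
  have h := ip_hecke hℓ hℓM hψ hf hf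
  rw [hb, ip_smul_left, ip_smul_right] at h
  exact (mul_right_cancel₀ (fun h0 => hne (eq_zero_of_ip_self hψ hf h0)) h).symm

/-- The simultaneous eigenforms of the operators `T_ℓ`, for the primes `ℓ ∤ R`. -/
def eigComponent (R M : ℕ) (w : ℤ) (a : ℕ → ℂ) : Submodule ℂ (ℍ → ℂ) where
  carrier := {g | g ∈ cuspSpace M w ∧ ∀ ℓ : ℕ, ℓ.Prime → ¬ ℓ ∣ R → hecke R w ℓ g = a ℓ • g}
  add_mem' {f g} hf hg := ⟨Submodule.add_mem _ hf.1 hg.1, fun ℓ hℓ hR => by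
    rw [map_add, hf.2 ℓ hℓ hR, hg.2 ℓ hℓ hR, smul_add]⟩
  zero_mem' := ⟨Submodule.zero_mem _, fun ℓ _ _ => by rw [map_zero, smul_zero]⟩
  smul_mem' c f hf := ⟨Submodule.smul_mem _ _ hf.1, fun ℓ hℓ hR => by
    rw [map_smul, hf.2 ℓ hℓ hR, smul_comm]⟩

/-- The span of the images of the operators `T_ℓ - a_ℓ`, for the primes `ℓ ∤ R`. -/
def eigComplement (R M : ℕ) (w : ℤ) (a : ℕ → ℂ) : Submodule ℂ (ℍ → ℂ) :=
  Submodule.span ℂ {g | ∃ ℓ : ℕ, ℓ.Prime ∧ ¬ ℓ ∣ R ∧ ∃ x ∈ cuspSpace M w,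
    g = hecke R w ℓ x - a ℓ • x}

lemma hecke_congr {M M' ℓ : ℕ} (h : ¬ ℓ ∣ M) (h' : ¬ ℓ ∣ M') (w : ℤ) :
    hecke M w ℓ = hecke M' w ℓ := by
  rw [hecke, hecke, if_neg h, if_neg h']

/-- A cusp form as a function. -/
def coeLin (M : ℕ) (w : ℤ) : S M w →ₗ[ℂ] (ℍ → ℂ) where
  toFun f := f
  map_add' _ _ := rfl
  map_smul' _ _ := rfl

lemma coeLin_injective (M : ℕ) (w : ℤ) : Function.Injective (coeLin M w) :=
  DFunLike.coe_injective

lemma eigComplement_le {R M : ℕ} (hMR : M ∣ R) (w : ℤ) (a : ℕ → ℂ) :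
    eigComplement R M w a ≤ cuspSpace M w := by
  rw [eigComplement, Submodule.span_le]
  rintro _ ⟨ℓ, hℓ, hℓR, x, hx, rfl⟩
  have hℓM : ¬ ℓ ∣ M := fun h => hℓR (h.trans hMR)
  rw [hecke_congr hℓR hℓM]
  exact Submodule.sub_mem _ (hecke_mem hℓ hℓM hx) (Submodule.smul_mem _ _ hx)

/-- For real a_ℓ the operators T_ℓ - a_ℓ are self-adjoint, so their common kernel is the orthogonal
complement of the span of their images. In finite dimension a subspace and its orthogonal complement
are complementary. -/
theorem isCompl_eigComponent {R M : ℕ} [NeZero M] (hMR : M ∣ R) {w : ℤ} (hw : 0 < w) {a : ℕ → ℂ}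
    (ha : ∀ ℓ : ℕ, ℓ.Prime → ¬ ℓ ∣ R → (starRingEnd ℂ) (a ℓ) = a ℓ) :
    IsCompl ((eigComponent R M w a).comap (coeLin M w))
      ((eigComplement R M w a).comap (coeLin M w)) := by
  obtain ⟨ψ, hψ⟩ := exists_isWeight (Nat.pos_of_ne_zero (NeZero.ne M))
  have hfin : FiniteDimensional ℂ (S M w) := finiteDimensional_cuspForm hw
  let core := ipCore hψ w
  let : NormedAddCommGroup (S M w) := core.toNormedAddCommGroup
  let : InnerProductSpace ℂ (S M w) := InnerProductSpace.ofCore core.toCore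
  have hinner : ∀ f g : S M w, inner ℂ f g = ip ψ w f g := fun _ _ => rfl
  have hT : ∀ ℓ : ℕ, ℓ.Prime → ¬ ℓ ∣ R → ∀ f ∈ cuspSpace M w, hecke R w ℓ f ∈ cuspSpace M w :=
    fun ℓ hℓ hℓR f hf => by
      have hℓM : ¬ ℓ ∣ M := fun h => hℓR (h.trans hMR)
      rw [hecke_congr hℓR hℓM]
      exact hecke_mem hℓ hℓM hf
  have hadj : ∀ ℓ : ℕ, ℓ.Prime → ¬ ℓ ∣ R → ∀ f ∈ cuspSpace M w, ∀ g ∈ cuspSpace M w,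
      ip ψ w (hecke R w ℓ f - a ℓ • f) g = ip ψ w f (hecke R w ℓ g - a ℓ • g) := by
    intro ℓ hℓ hℓR f hf g hg
    have hℓM : ¬ ℓ ∣ M := fun h => hℓR (h.trans hMR)
    have hTf := hT ℓ hℓ hℓR f hf
    have hTg := hT ℓ hℓ hℓR g hg
    have hr : ∀ x y : ℍ → ℂ, ∀ z ∈ cuspSpace M w, x ∈ cuspSpace M w → y ∈ cuspSpace M w →
        ip ψ w (x - a ℓ • y) z = ip ψ w x z - a ℓ * ip ψ w y z := by
      intro x y z hz hx hy
      rw [sub_eq_add_neg, ← _root_.neg_smul, ip_add_left hψ hx (Submodule.smul_mem _ _ hy) hz,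
        ip_smul_left, map_neg, ha ℓ hℓ hℓR]
      ring
    rw [hr _ _ _ hg hTf hf, ← ip_conj_symm ψ w f (hecke R w ℓ g - a ℓ • g),
      hr _ _ _ hf hTg hg, map_sub, map_mul, ip_conj_symm, ip_conj_symm, ha ℓ hℓ hℓR,
      hecke_congr hℓR hℓM, ip_hecke hℓ hℓM hψ hf hg]
  have hcomp : ((eigComplement R M w a).comap (coeLin M w))ᗮ =
      (eigComponent R M w a).comap (coeLin M w) := by
    ext g
    have hg := coe_mem_cuspSpace g
    rw [Submodule.mem_orthogonal, Submodule.mem_comap]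
    constructor
    · intro h
      refine ⟨hg, fun ℓ hℓ hℓR => ?_⟩
      have hy : hecke R w ℓ g - a ℓ • (g : ℍ → ℂ) ∈ cuspSpace M w :=
        Submodule.sub_mem _ (hT ℓ hℓ hℓR _ hg) (Submodule.smul_mem _ _ hg)
      set y := hecke R w ℓ g - a ℓ • (g : ℍ → ℂ)
      have hy2 : hecke R w ℓ y - a ℓ • y ∈ cuspSpace M w :=
        Submodule.sub_mem _ (hT ℓ hℓ hℓR _ hy) (Submodule.smul_mem _ _ hy)
      -- Testing orthogonality against (T_ℓ - a_ℓ) y with y = (T_ℓ - a_ℓ) g and moving the operator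
      -- across gives the product of y with itself.
      have h1 := h (mkCusp hw _ hy2) (Submodule.subset_span ⟨ℓ, hℓ, hℓR, y, hy, rfl⟩)
      rw [hinner, mkCusp_coe, hadj ℓ hℓ hℓR _ hy _ hg] at h1
      exact sub_eq_zero.mp (eq_zero_of_ip_self hψ hy h1)
    · rintro ⟨-, h⟩ u hu
      have key : ∀ v ∈ eigComplement R M w a, ip ψ w v g = 0 := by
        intro v hv
        have hle := eigComplement_le hMR w a
        rw [eigComplement] at hv hle
        induction hv using Submodule.span_induction with
        | mem v hv =>
          obtain ⟨ℓ, hℓ, hℓR, x, hx, rfl⟩ := hv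
          have h2 : hecke R w ℓ g - a ℓ • (g : ℍ → ℂ) = 0 := sub_eq_zero.mpr (h ℓ hℓ hℓR)
          rw [hadj ℓ hℓ hℓR x hx g hg, h2]
          simp [ip, UpperHalfPlane.petersson]
        | zero => simp [ip, UpperHalfPlane.petersson]
        | add x y hx' hy' hx hy => rw [ip_add_left hψ (hle hx') (hle hy') hg, hx, hy, add_zero]
        | smul c x _ hx => rw [ip_smul_left, hx, mul_zero]
      exact key u hu
  rw [← hcomp]
  exact (Submodule.isCompl_orthogonal _).symm

lemma exists_eigComponent_add {R M : ℕ} [NeZero M] (hMR : M ∣ R) {w : ℤ} (hw : 0 < w) {a : ℕ → ℂ}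
    (ha : ∀ ℓ : ℕ, ℓ.Prime → ¬ ℓ ∣ R → (starRingEnd ℂ) (a ℓ) = a ℓ) {f : ℍ → ℂ}
    (hf : f ∈ cuspSpace M w) :
    ∃ g ∈ eigComponent R M w a, ∃ h ∈ eigComplement R M w a, f = g + h := by
  have h1 := (isCompl_eigComponent hMR hw ha).sup_eq_top
  have h2 : mkCusp hw f hf ∈ (⊤ : Submodule ℂ (S M w)) := trivial
  rw [← h1, Submodule.mem_sup] at h2
  obtain ⟨g, hg, h, hh, hgh⟩ := h2
  exact ⟨g, hg, h, hh, (congrArg (coeLin M w) hgh).symm⟩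

lemma eq_zero_of_mem_eigComponent_of_mem_eigComplement {R M : ℕ} [NeZero M] (hMR : M ∣ R) {w : ℤ}
    (hw : 0 < w) {a : ℕ → ℂ}
    (ha : ∀ ℓ : ℕ, ℓ.Prime → ¬ ℓ ∣ R → (starRingEnd ℂ) (a ℓ) = a ℓ) {f : ℍ → ℂ}
    (hf : f ∈ eigComponent R M w a) (hf' : f ∈ eigComplement R M w a) : f = 0 := by
  have h1 := (isCompl_eigComponent hMR hw ha).disjoint
  have h2 := Submodule.disjoint_def.mp h1 (mkCusp hw f hf.1) hf hf'
  exact congrArg (coeLin M w) h2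

/-! ### Identification with the component and the complement of the statement -/

lemma heckeComponent_eq (M : ℕ) [NeZero M] (w : ℤ) (a : ℕ → ℂ) :
    heckeComponent M w a = (eigComponent M M w a).comap (coeLin M w) := by
  ext g
  exact ⟨fun h => ⟨coe_mem_cuspSpace g, h⟩, fun h => h.2⟩

lemma heckeComplement_eq (M : ℕ) [NeZero M] {w : ℤ} (hw : 0 < w) (a : ℕ → ℂ) :
    heckeComplement M w a = (eigComplement M M w a).comap (coeLin M w) := by
  have h1 : (heckeComplement M w a).map (coeLin M w) = eigComplement M M w a := by
    rw [heckeComplement, eigComplement, Submodule.map_span]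
    congr 1
    ext g
    constructor
    · rintro ⟨x, ⟨ℓ, hℓ, hℓM, y, hy⟩, rfl⟩
      exact ⟨ℓ, hℓ, hℓM, y, coe_mem_cuspSpace y, hy⟩
    · rintro ⟨ℓ, hℓ, hℓM, y, hy, rfl⟩
      exact ⟨mkCusp hw _ (Submodule.sub_mem _ (hecke_mem hℓ hℓM hy) (Submodule.smul_mem _ _ hy)),
        ⟨ℓ, hℓ, hℓM, mkCusp hw y hy, rfl⟩, rfl⟩
  rw [← h1, Submodule.comap_map_eq_of_injective (coeLin_injective M w)]

/-! ### Newforms are not old -/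

lemma petersson_eq {M : ℕ} (w : ℤ) (f g : ℍ → ℂ) : petersson M (w : ℝ) f g =
    ((CongruenceSubgroup.Gamma0 M).index : ℂ)⁻¹ *
      ∑ᶠ c : SL(2, ℤ) ⧸ CongruenceSubgroup.Gamma0 M,
        ∫ z in ModularGroup.fd, UpperHalfPlane.petersson w g f (c.out⁻¹ • z) := by
  rw [petersson]
  congr 2
  funext c
  congr 1
  funext z
  rw [UpperHalfPlane.petersson, Real.rpow_intCast]
  push_cast
  ring

lemma integrableOn_petersson {w : ℤ} {f g : ℍ → ℂ} (hf : Continuous f) (hg : Continuous g)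
    (hfb : HasBound w f) (hgb : HasBound w g) (γ : SL(2, ℤ)) :
    IntegrableOn (fun z => UpperHalfPlane.petersson w f g (γ • z)) ModularGroup.fd := by
  obtain ⟨C, -, hC⟩ := hfb.exists_norm_petersson_le hgb
  refine Measure.integrableOn_of_bounded (M := C) volume_fd_lt_top.ne ?_
    (Filter.Eventually.of_forall fun z => hC _)
  exact ((UpperHalfPlane.petersson_continuous w hf hg).measurable.comp
    (measurable_SL_smul γ)).aestronglyMeasurable

lemma petersson_add_right {M : ℕ} (hM : 0 < M) {w : ℤ} {f g g' : ℍ → ℂ}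
    (hf : f ∈ cuspSpace M w) (hg : g ∈ cuspSpace M w) (hg' : g' ∈ cuspSpace M w) :
    petersson M (w : ℝ) f (g + g') = petersson M (w : ℝ) f g + petersson M (w : ℝ) f g' := by
  have : NeZero M := ⟨hM.ne'⟩
  have hfin : Finite (SL(2, ℤ) ⧸ CongruenceSubgroup.Gamma0 M) :=
    Subgroup.finite_quotient_of_finiteIndex
  rw [petersson_eq, petersson_eq, petersson_eq, ← mul_add, ← finsum_add_distrib
    (Set.toFinite _) (Set.toFinite _)]
  congr 2
  funext c
  rw [← integral_add
    (integrableOn_petersson hg.1.continuous hf.1.continuous hg.2.2 hf.2.2 _)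
    (integrableOn_petersson hg'.1.continuous hf.1.continuous hg'.2.2 hf.2.2 _)]
  congr 1
  funext z
  simp only [UpperHalfPlane.petersson, Pi.add_apply, map_add]
  ring

lemma petersson_smul_right {M : ℕ} (hM : 0 < M) (w : ℤ) (c : ℂ) (f g : ℍ → ℂ) :
    petersson M (w : ℝ) f (c • g) = (starRingEnd ℂ) c * petersson M (w : ℝ) f g := by
  have : NeZero M := ⟨hM.ne'⟩
  have hfin : Finite (SL(2, ℤ) ⧸ CongruenceSubgroup.Gamma0 M) :=
    Subgroup.finite_quotient_of_finiteIndex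
  rw [petersson_eq, petersson_eq, mul_left_comm]
  congr 1
  rw [mul_finsum' _ _ (Set.toFinite _)]
  congr 1
  funext d
  rw [← integral_const_mul]
  congr 1
  funext z
  simp only [UpperHalfPlane.petersson, Pi.smul_apply, smul_eq_mul, map_mul]
  ring

/-- All integrands are non-negative, so f vanishes almost everywhere on each chosen translate of the
fundamental domain. Up to Γ₀(M), under which the zero set of f is stable, these translates cover ℍ.
-/
lemma eq_zero_of_petersson_self {M : ℕ} (hM : 0 < M) {w : ℤ} {f : ℍ → ℂ}
    (hf : f ∈ cuspSpace M w) (h : petersson M (w : ℝ) f f = 0) : f = 0 := by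
  have : NeZero M := ⟨hM.ne'⟩
  have hfin : Finite (SL(2, ℤ) ⧸ CongruenceSubgroup.Gamma0 M) :=
    Subgroup.finite_quotient_of_finiteIndex
  have := Fintype.ofFinite (SL(2, ℤ) ⧸ CongruenceSubgroup.Gamma0 M)
  rw [petersson_eq, finsum_eq_sum_of_fintype] at h
  have hidx : ((CongruenceSubgroup.Gamma0 M).index : ℂ)⁻¹ ≠ 0 :=
    inv_ne_zero (by exact_mod_cast Subgroup.FiniteIndex.index_ne_zero)
  have h1 := (mul_eq_zero.mp h).resolve_left hidx
  simp only [petersson_self, integral_complex_ofReal] at h1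
  rw [← Complex.ofReal_sum, Complex.ofReal_eq_zero, Finset.sum_eq_zero_iff_of_nonneg
    fun c _ => integral_nonneg fun z => peterssonRe_nonneg w f _] at h1
  have hnull : ∀ c : SL(2, ℤ) ⧸ CongruenceSubgroup.Gamma0 M,
      volume {z : ℍ | z ∈ ModularGroup.fd ∧ f (c.out⁻¹ • z) ≠ 0} = 0 := by
    intro c
    have hint := (integrableOn_petersson hf.1.continuous hf.1.continuous hf.2.2 hf.2.2 c.out⁻¹).re
    simp only [petersson_self] at hint
    have h2 := h1 c (Finset.mem_univ c)
    rw [integral_eq_zero_iff_of_nonneg (fun z => peterssonRe_nonneg w f _) hint] at h2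
    have h3 := (ae_restrict_iff' measurableSet_fd).mp h2
    refine measure_mono_null (fun z hz => ?_) h3
    intro h4
    exact (peterssonRe_ne_zero_iff w f _).mpr hz.2 (h4 hz.1)
  apply eq_zero_of_null hf.1.continuous
  refine measure_mono_null (t := ⋃ g : SL(2, ℤ), (fun z : ℍ => g • z) ⁻¹'
    {z : ℍ | z ∈ ModularGroup.fd ∧
      f ((QuotientGroup.mk g : SL(2, ℤ) ⧸ CongruenceSubgroup.Gamma0 M).out⁻¹ • z) ≠ 0}) ?_
    (measure_iUnion_null fun g => by rw [volume_smul_preimage]; exact hnull _)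
  intro z hz
  obtain ⟨g, hg⟩ := ModularGroup.exists_smul_mem_fd z
  refine Set.mem_iUnion.mpr ⟨g, hg, ?_⟩
  obtain ⟨γ, hγ⟩ := QuotientGroup.mk_out_eq_mul (CongruenceSubgroup.Gamma0 M) g
  rw [hγ, smul_smul, mul_inv_rev, inv_mul_cancel_right]
  have h5 := (sl_ne_zero_iff hf γ⁻¹ z).mpr hz
  rw [toGL_SL] at h5
  exact h5

/-- The space of old forms spanned by the forms of level `M / q` and their images under `V_q`, for
primes `q ∣ M`. -/
def oldSpace (Q : Finset ℕ) (M : ℕ) (w : ℤ) : Submodule ℂ (ℍ → ℂ) :=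
  ⨆ q ∈ Q, (cuspSpace (M / q) w ⊔ (cuspSpace (M / q) w).map (opV q))

lemma opV_one (f : ℍ → ℂ) : opV 1 f = f := by
  funext τ
  change f (ofComplex (((1 : ℕ) : ℂ) * (τ : ℂ))) = f τ
  rw [Nat.cast_one, one_mul, ofComplex_apply]

/-- The forms orthogonal to φ make up a subspace which contains both pieces at each q, by `IsNew`
with d = 1 and d = q. So φ would be orthogonal to itself. -/
lemma eq_zero_of_isNew_of_mem_oldSpace {M : ℕ} [NeZero M] {w : ℤ} (hw : 0 < w) {φ : S M w}
    (hφ : IsNew M w φ) {Q : Finset ℕ} (hQ : ∀ q ∈ Q, q.Prime ∧ q ∣ M)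
    (h : (φ : ℍ → ℂ) ∈ oldSpace Q M w) : (φ : ℍ → ℂ) = 0 := by
  have hM := Nat.pos_of_ne_zero (NeZero.ne M)
  have hφm := coe_mem_cuspSpace φ
  let P : Submodule ℂ (ℍ → ℂ) :=
    { carrier := {g | g ∈ cuspSpace M w ∧ petersson M (w : ℝ) φ g = 0}
      add_mem' := fun {f g} hf hg => ⟨Submodule.add_mem _ hf.1 hg.1, by
        rw [petersson_add_right hM hφm hf.1 hg.1, hf.2, hg.2, add_zero]⟩
      zero_mem' := ⟨Submodule.zero_mem _, by simp [petersson]⟩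
      smul_mem' := fun c f hf => ⟨Submodule.smul_mem _ _ hf.1, by
        rw [petersson_smul_right hM, hf.2, mul_zero]⟩ }
  have hle : oldSpace Q M w ≤ P := by
    refine iSup₂_le fun q hq => ?_
    obtain ⟨hqp, d, hd⟩ := hQ q hq
    have hdiv : M / q = d := by rw [hd, Nat.mul_div_cancel_left _ hqp.pos]
    have hd0 : 0 < d := Nat.pos_of_ne_zero (by rintro rfl; rw [mul_zero] at hd; exact hM.ne' hd)
    have : NeZero d := ⟨hd0.ne'⟩
    have hdM : d ≠ M := by
      intro h0
      have := hqp.two_le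
      rw [h0] at hd
      nlinarith
    rw [hdiv]
    refine sup_le (fun g hg => ⟨cuspSpace_mono ⟨q, by rw [hd, mul_comm]⟩ w hg, ?_⟩) ?_
    · have := hφ d 1 (mkCusp hw g hg) (by rw [one_mul, hd]; exact dvd_mul_left _ _) hdM
      rwa [mkCusp_coe, opV_one] at this
    · rintro _ ⟨g, hg, rfl⟩
      refine ⟨?_, ?_⟩
      · have := opV_mem hqp.pos hg
        rwa [← hd] at this
      · exact hφ d q (mkCusp hw g hg) (by rw [hd]) hdM
  exact eq_zero_of_petersson_self hM hφm (hle h).2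

end

/-! ### Hecke operators on Fourier expansions -/

lemma opU_opU_comm {q ℓ : ℕ} (hq : 0 < q) (hℓ : 0 < ℓ) {f : ℍ → ℂ} (hf : IsQ f) :
    opU q (opU ℓ f) = opU ℓ (opU q f) := by
  refine ((hf.opU hℓ).opU hq).ext ((hf.opU hq).opU hℓ) fun n => ?_
  rw [coeff_opU hq (hf.opU hℓ), coeff_opU hℓ hf, coeff_opU hℓ (hf.opU hq), coeff_opU hq hf,
    mul_left_comm]

lemma opV_opV_comm {q ℓ : ℕ} (hq : 0 < q) (hℓ : 0 < ℓ) {f : ℍ → ℂ} (hf : IsQ f) :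
    opV q (opV ℓ f) = opV ℓ (opV q f) := by
  have key : ∀ {q ℓ : ℕ}, 0 < q → 0 < ℓ → ∀ n, coeff (opV q (opV ℓ f)) n =
      if ℓ * q ∣ n then coeff f (n / (ℓ * q)) else 0 := by
    intro q ℓ hq hℓ n
    rw [coeff_opV hq (hf.opV hℓ)]
    split_ifs with h1 h2 h2
    · rw [coeff_opV hℓ hf, if_pos ((Nat.dvd_div_iff_mul_dvd h1).mpr (by rwa [mul_comm])),
        Nat.div_div_eq_div_mul, mul_comm]
    · rw [coeff_opV hℓ hf, if_neg]
      rw [Nat.dvd_div_iff_mul_dvd h1, mul_comm]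
      exact h2
    · exact absurd ((Dvd.intro_left _ rfl).trans h2) h1
    · rfl
  refine ((hf.opV hℓ).opV hq).ext ((hf.opV hq).opV hℓ) fun n => ?_
  rw [key hq hℓ, key hℓ hq, mul_comm]

lemma opU_opV_comm {q ℓ : ℕ} (hq : 0 < q) (hℓ : 0 < ℓ) (h : q.Coprime ℓ) {f : ℍ → ℂ}
    (hf : IsQ f) : opU q (opV ℓ f) = opV ℓ (opU q f) := by
  refine ((hf.opV hℓ).opU hq).ext ((hf.opU hq).opV hℓ) fun n => ?_
  rw [coeff_opU hq (hf.opV hℓ), coeff_opV hℓ hf, coeff_opV hℓ (hf.opU hq)]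
  have : ℓ ∣ q * n ↔ ℓ ∣ n := h.symm.dvd_mul_left
  simp only [this]
  split_ifs with h1
  · rw [coeff_opU hq hf, Nat.mul_div_assoc _ h1]
  · rfl

lemma opU_opV_self {q : ℕ} (hq : 0 < q) {f : ℍ → ℂ} (hf : IsQ f) : opU q (opV q f) = f := by
  refine ((hf.opV hq).opU hq).ext hf fun n => ?_
  rw [coeff_opU hq (hf.opV hq), coeff_opV hq hf, if_pos (dvd_mul_right _ _),
    Nat.mul_div_cancel_left _ hq]

lemma hecke_opV_comm {R q ℓ : ℕ} (hq : 0 < q) (hℓ : 0 < ℓ) (h : q.Coprime ℓ) (w : ℤ) {f : ℍ → ℂ}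
    (hf : IsQ f) : hecke R w ℓ (opV q f) = opV q (hecke R w ℓ f) := by
  simp only [hecke, LinearMap.add_apply, LinearMap.smul_apply, map_add, map_smul]
  rw [opU_opV_comm hℓ hq h.symm hf, opV_opV_comm hℓ hq hf]

lemma hecke_opU_comm {R q ℓ : ℕ} (hq : 0 < q) (hℓ : 0 < ℓ) (h : q.Coprime ℓ) (w : ℤ) {f : ℍ → ℂ}
    (hf : IsQ f) : hecke R w ℓ (opU q f) = opU q (hecke R w ℓ f) := by
  simp only [hecke, LinearMap.add_apply, LinearMap.smul_apply, map_add, map_smul]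
  rw [opU_opV_comm hq hℓ h hf, opU_opU_comm hℓ hq hf]

lemma hecke_hecke_comm {R M q ℓ : ℕ} (hq : 0 < q) (hℓ : 0 < ℓ) (h : q.Coprime ℓ) (w : ℤ)
    {f : ℍ → ℂ} (hf : IsQ f) : hecke R w ℓ (hecke M w q f) = hecke M w q (hecke R w ℓ f) := by
  rw [hecke.eq_def M w q, LinearMap.add_apply, LinearMap.smul_apply, map_add, map_smul,
    hecke_opU_comm hq hℓ h w hf, hecke_opV_comm hq hℓ h w hf]
  rfl

lemma coeff_mul_eq_of_hecke {M ℓ : ℕ} (hℓ : 0 < ℓ) (w : ℤ) {f : ℍ → ℂ} (hf : IsQ f) (n : ℕ) :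
    coeff f (ℓ * n) = coeff (hecke M w ℓ f) n -
      (if ℓ ∣ M then 0 else (ℓ : ℂ) ^ (w - 1)) * (if ℓ ∣ n then coeff f (n / ℓ) else 0) := by
  rw [hecke, LinearMap.add_apply, LinearMap.smul_apply, coeff_add (hf.opU hℓ)
    ((hf.opV hℓ).smul _), coeff_smul (hf.opV hℓ), coeff_opU hℓ hf, coeff_opV hℓ hf]
  ring

/-! ### Simultaneous eigenforms -/

lemma eigComponent_mono {R M M' : ℕ} (h : M ∣ M') (w : ℤ) (a : ℕ → ℂ) :
    eigComponent R M w a ≤ eigComponent R M' w a :=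
  fun _ hg => ⟨cuspSpace_mono h w hg.1, hg.2⟩

/-- Splitting off the least prime factor ℓ of n, the eigenvalue equation of T_ℓ expresses the
coefficient through those at smaller indices prime to R. -/
lemma coeff_eq_zero_of_coprime {R M : ℕ} {w : ℤ} (hw : 0 < w) {a : ℕ → ℂ} {g : ℍ → ℂ}
    (hg : g ∈ eigComponent R M w a) (h1 : coeff g 1 = 0) (n : ℕ) (hn : n.Coprime R) :
    coeff g n = 0 := by
  have hQ := isQ_of_mem hw hg.1
  induction n using Nat.strong_induction_on with
  | _ n ih =>
    rcases eq_or_ne n 0 with rfl | hn0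
    · exact coeff_zero_of_mem hw hg.1
    rcases eq_or_ne n 1 with rfl | hn1
    · exact h1
    have hp := Nat.minFac_prime hn1
    set ℓ := n.minFac
    obtain ⟨m, hm⟩ : ℓ ∣ n := Nat.minFac_dvd n
    have hℓR : ¬ ℓ ∣ R := fun h =>
      hp.one_lt.ne' (Nat.eq_one_of_dvd_coprimes hn ⟨m, hm⟩ h)
    have hm0 : 0 < m := Nat.pos_of_ne_zero (by rintro rfl; simp at hm; exact hn0 hm)
    have hmn : m < n := by
      rw [hm]; nlinarith [hp.two_le]
    have hmR : m.Coprime R := hn.coprime_dvd_left ⟨ℓ, by rw [hm, mul_comm]⟩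
    rw [hm, coeff_mul_eq_of_hecke (M := R) hp.pos w hQ, hg.2 ℓ hp hℓR, coeff_smul hQ, ih m hmn hmR]
    have : (if ℓ ∣ m then coeff g (m / ℓ) else 0) = 0 := by
      split_ifs with h
      · exact ih _ ((Nat.div_le_self _ _).trans_lt hmn)
          (hmR.coprime_dvd_left (Nat.div_dvd_of_dvd h))
      · rfl
    rw [this, mul_zero, mul_zero, sub_zero]

lemma hecke_mem_eigComponent {R M q : ℕ} (hq : q.Prime) (hqR : q ∣ R) {w : ℤ} (hw : 0 < w)
    {a : ℕ → ℂ} {g : ℍ → ℂ} (hg : g ∈ eigComponent R M w a) :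
    hecke M w q g ∈ eigComponent R M w a := by
  refine ⟨?_, fun ℓ hℓ hℓR => ?_⟩
  · by_cases h : q ∣ M
    · rw [hecke, if_pos h, zero_smul, add_zero]
      exact opU_mem hq h hg.1
    · exact hecke_mem hq h hg.1
  · have hc : q.Coprime ℓ := (Nat.coprime_primes hq hℓ).mpr (by rintro rfl; exact hℓR hqR)
    rw [hecke_hecke_comm hq.pos hℓ.pos hc w (isQ_of_mem hw hg.1), hg.2 ℓ hℓ hℓR, map_smul]

lemma opV_mem_eigComponent {R M q : ℕ} (hq : q.Prime) (hqR : q ∣ R) {w : ℤ} (hw : 0 < w)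
    {a : ℕ → ℂ} {g : ℍ → ℂ} (hg : g ∈ eigComponent R M w a) :
    opV q g ∈ eigComponent R (q * M) w a := by
  refine ⟨opV_mem hq.pos hg.1, fun ℓ hℓ hℓR => ?_⟩
  have hc : q.Coprime ℓ := (Nat.coprime_primes hq hℓ).mpr (by rintro rfl; exact hℓR hqR)
  rw [hecke_opV_comm hq.pos hℓ.pos hc w (isQ_of_mem hw hg.1), hg.2 ℓ hℓ hℓR, map_smul]

lemma opV_mem_eigComplement {R M q : ℕ} (hq : q.Prime) (hqR : q ∣ R) {w : ℤ} (hw : 0 < w)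
    {a : ℕ → ℂ} {g : ℍ → ℂ} (hg : g ∈ eigComplement R M w a) :
    opV q g ∈ eigComplement R (q * M) w a := by
  have : eigComplement R M w a ≤ (eigComplement R (q * M) w a).comap (opV q) := by
    rw [eigComplement, Submodule.span_le]
    rintro _ ⟨ℓ, hℓ, hℓR, x, hx, rfl⟩
    have hc : q.Coprime ℓ := (Nat.coprime_primes hq hℓ).mpr (by rintro rfl; exact hℓR hqR)
    refine Submodule.subset_span ⟨ℓ, hℓ, hℓR, opV q x, opV_mem hq.pos hx, ?_⟩
    rw [map_sub, map_smul, hecke_opV_comm hq.pos hℓ.pos hc w (isQ_of_mem hw hx)]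
  exact this hg

lemma opU_mem_eigComponent {R M q : ℕ} (hq : q.Prime) (hqR : q ∣ R) (hqM : q ∣ M) {w : ℤ}
    (hw : 0 < w) {a : ℕ → ℂ} {g : ℍ → ℂ} (hg : g ∈ eigComponent R M w a) :
    opU q g ∈ eigComponent R M w a := by
  have := hecke_mem_eigComponent hq hqR hw hg
  rwa [hecke, if_pos hqM, zero_smul, add_zero] at this

lemma opU_mem_eigComplement {R M q : ℕ} (hq : q.Prime) (hqR : q ∣ R) (hqM : q ∣ M) {w : ℤ}
    (hw : 0 < w) {a : ℕ → ℂ} {g : ℍ → ℂ} (hg : g ∈ eigComplement R M w a) :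
    opU q g ∈ eigComplement R M w a := by
  have : eigComplement R M w a ≤ (eigComplement R M w a).comap (opU q) := by
    rw [eigComplement, Submodule.span_le]
    rintro _ ⟨ℓ, hℓ, hℓR, x, hx, rfl⟩
    have hc : q.Coprime ℓ := (Nat.coprime_primes hq hℓ).mpr (by rintro rfl; exact hℓR hqR)
    refine Submodule.subset_span ⟨ℓ, hℓ, hℓR, opU q x, opU_mem hq hqM hx, ?_⟩
    rw [map_sub, map_smul, hecke_opU_comm hq.pos hℓ.pos hc w (isQ_of_mem hw hx)]
  exact this hg

/-- The hypothesis concerns all members of the component, so it also applies to T_q g for the primes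
q ∣ R, under which the component is stable. Thus prime factors of n dividing R are removed by
changing the form, and the others by the eigenvalue equation. -/
lemma eigComponent_eq_bot {R M : ℕ} {w : ℤ} (hw : 0 < w) {a : ℕ → ℂ}
    (h : ∀ g ∈ eigComponent R M w a, coeff g 1 = 0) {g : ℍ → ℂ} (hg : g ∈ eigComponent R M w a) :
    g = 0 := by
  have key : ∀ n, ∀ g ∈ eigComponent R M w a, coeff g n = 0 := by
    intro n
    induction n using Nat.strong_induction_on with
    | _ n ih =>
      intro g hg
      have hQ := isQ_of_mem hw hg.1
      rcases eq_or_ne n 0 with rfl | hn0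
      · exact coeff_zero_of_mem hw hg.1
      rcases eq_or_ne n 1 with rfl | hn1
      · exact h g hg
      have hp := Nat.minFac_prime hn1
      set ℓ := n.minFac
      obtain ⟨m, hm⟩ : ℓ ∣ n := Nat.minFac_dvd n
      have hm0 : 0 < m := Nat.pos_of_ne_zero (by rintro rfl; simp at hm; exact hn0 hm)
      have hmn : m < n := by
        rw [hm]; nlinarith [hp.two_le]
      have h0 : (if ℓ ∣ m then coeff g (m / ℓ) else 0) = 0 := by
        split_ifs
        · exact ih _ ((Nat.div_le_self _ _).trans_lt hmn) g hg
        · rfl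
      by_cases hℓR : ℓ ∣ R
      · rw [hm, coeff_mul_eq_of_hecke (M := M) hp.pos w hQ, h0, mul_zero, sub_zero]
        exact ih m hmn _ (hecke_mem_eigComponent hp hℓR hw hg)
      · rw [hm, coeff_mul_eq_of_hecke (M := R) hp.pos w hQ, h0, mul_zero, sub_zero,
          hg.2 ℓ hp hℓR, coeff_smul hQ, ih m hmn g hg, mul_zero]
  exact (isQ_of_mem hw hg.1).ext isQ_zero fun n => by rw [key n g hg, coeff_zero]

/-- Equality would force |b| to equal the bound that `norm_eigenvalue_lt` shows to be strict. -/
lemma eigenvalue_sq_ne {M p : ℕ} (hM : 0 < M) (hp : p.Prime) (hpM : ¬ p ∣ M) {w : ℤ}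
    (hw : 0 < w) {f : ℍ → ℂ} (hf : f ∈ cuspSpace M w) (hne : f ≠ 0) {b : ℂ}
    (hb : hecke M w p f = b • f) : b ^ 2 ≠ (p : ℂ) ^ (w - 2) * ((p : ℂ) + 1) ^ 2 := by
  intro h
  have h1 := norm_eigenvalue_lt hM hp hpM hw hf hne hb
  have hp0 : (0 : ℝ) < p := by exact_mod_cast hp.pos
  have h2 : ‖b‖ ^ 2 = ((p : ℝ) ^ (w / 2 - 1 : ℝ) * ((p : ℝ) + 1)) ^ 2 := by
    have h4 : ‖(p : ℂ) + 1‖ = p + 1 := by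
      rw [← Nat.cast_succ, Complex.norm_natCast]; push_cast; rfl
    have h5 : ((p : ℝ) ^ (w / 2 - 1 : ℝ)) ^ 2 = (p : ℝ) ^ (w - 2) := by
      rw [← Real.rpow_natCast, ← Real.rpow_mul hp0.le, ← Real.rpow_intCast]
      congr 1
      push_cast
      ring
    rw [← norm_pow, h, norm_mul, norm_pow, norm_zpow, mul_pow, h4, h5, Complex.norm_natCast]
  have h3 := (sq_lt_sq₀ (norm_nonneg b) (by positivity)).mpr h1
  exact h3.ne h2

/-! ### Traces of old forms -/

lemma CosetRel.of_dvd {N M L : ℕ} {A B : Matrix (Fin 2) (Fin 2) ℤ} (h : CosetRel M A B)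
    (hB : B.det = 1) (hNA : (N : ℤ) ∣ A 1 0) (hNB : (N : ℤ) ∣ B 1 0)
    (hL : ∀ c : ℤ, (N : ℤ) ∣ c → (M : ℤ) ∣ c → (L : ℤ) ∣ c) : CosetRel L A B := by
  obtain ⟨a, b, c, d, hdet, hc, h00, h01, h10, h11⟩ := h.entries
  refine CosetRel.of_entries a b c d hdet (hL c ?_ hc) h00 h01 h10 h11
  rw [Matrix.det_fin_two] at hB
  have : c = A 1 0 * B 1 1 - A 1 1 * B 1 0 := by
    linear_combination -B 1 1 * h10 + B 1 0 * h11 - c * hB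
  rw [this]
  exact dvd_sub (hNA.mul_right _) (hNB.mul_left _)

/-- The trace from level `M q` to level `M` computes, on forms of level `M' q` with `M' ∣ M`, the
trace to level `M'`. -/
lemma trW_eq_trW {M' d q : ℕ} (hM : 0 < d * M') (hq : q.Prime) (hqM : ¬ q ∣ d * M')
    {x y z t : ℤ} (h : x * (q * t) - y * ((d * M' : ℕ) * z) = 1) {w : ℤ} {f : ℍ → ℂ}
    (hf : f ∈ cuspSpace (M' * q) w) :
    trW w (d * M') q x y z t f = trW w M' q x y (d * z) t f := by
  have h' : x * (q * t) - y * ((M' : ℕ) * (d * z)) = 1 := by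
    push_cast at h; linear_combination h
  refine sum_sl_eq_of_rel (fun j => by simp [traceRep_det h' j]) (fun i i' hii => ?_)
    (fun i => ?_) rfl hf
  · refine (isReps_traceRep hM hq h).inj i i' (hii.of_dvd (traceRep_det h i')
      (traceRep_dvd _ q x y z t i) (traceRep_dvd _ q x y z t i') fun c h1 h2 => ?_)
    push_cast
    refine IsCoprime.mul_dvd ?_ (by exact_mod_cast h1)
      ((Int.natCast_dvd_natCast.mpr (dvd_mul_left q M')).trans h2)
    have := Nat.isCoprime_iff_coprime.mpr ((Nat.Prime.coprime_iff_not_dvd hq).mpr hqM).symm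
    exact_mod_cast this
  · have hmem : (⟨traceRep (d * M') q x y z t i, traceRep_det h i⟩ : SL(2, ℤ)) ∈
        CongruenceSubgroup.Gamma0 M' :=
      mem_Gamma0_iff_dvd.mpr <| (Int.natCast_dvd_natCast.mpr (dvd_mul_left M' d)).trans
        (traceRep_dvd _ q x y z t i)
    have hM' : 0 < M' := Nat.pos_of_mul_pos_left hM
    -- The representative with index 0 is the identity, so `step` applied to it locates the coset of
    -- the given matrix itself.
    obtain ⟨j, hj⟩ := (isReps_traceRep hM' hq h').step _ hmem (some ⟨0, hq.pos⟩)
    refine ⟨j, ?_⟩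
    have h1 : traceRep M' q x y (d * z) t (some ⟨0, hq.pos⟩) = 1 := by
      simp [traceRep, matL, Matrix.one_fin_two]
    rwa [h1, one_mul] at hj

lemma map_mem_oldSpace {Q Q' : Finset ℕ} {M M' : ℕ} {w : ℤ} {T : (ℍ → ℂ) → ℍ → ℂ}
    (hadd : ∀ f g, T (f + g) = T f + T g) (h0 : T 0 = 0)
    (h1 : ∀ q ∈ Q, ∀ f ∈ cuspSpace (M / q) w, T f ∈ oldSpace Q' M' w)
    (h2 : ∀ q ∈ Q, ∀ f ∈ cuspSpace (M / q) w, T (opV q f) ∈ oldSpace Q' M' w) {f : ℍ → ℂ}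
    (hf : f ∈ oldSpace Q M w) : T f ∈ oldSpace Q' M' w := by
  rw [oldSpace] at hf
  induction hf using Submodule.iSup_induction' with
  | zero => rw [h0]; exact Submodule.zero_mem _
  | add f g _ _ hf hg => rw [hadd]; exact Submodule.add_mem _ hf hg
  | mem q f hf =>
    by_cases hq : q ∈ Q
    · rw [iSup_pos hq] at hf
      obtain ⟨u, hu, _, ⟨v, hv, rfl⟩, rfl⟩ := Submodule.mem_sup.mp hf
      rw [hadd]
      exact Submodule.add_mem _ (h1 q hq u hu) (h2 q hq v hv)
    · rw [iSup_neg hq, Submodule.mem_bot] at hf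
      rw [hf, h0]
      exact Submodule.zero_mem _

lemma mem_oldSpace {Q : Finset ℕ} {M q : ℕ} (hq : q ∈ Q) {w : ℤ} {f : ℍ → ℂ}
    (hf : f ∈ cuspSpace (M / q) w) : f ∈ oldSpace Q M w :=
  (le_iSup₂_of_le q hq le_sup_left :
    cuspSpace (M / q) w ≤ oldSpace Q M w) hf

lemma opV_mem_oldSpace {Q : Finset ℕ} {M q : ℕ} (hq : q ∈ Q) {w : ℤ} {f : ℍ → ℂ}
    (hf : f ∈ cuspSpace (M / q) w) : opV q f ∈ oldSpace Q M w :=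
  (le_iSup₂_of_le q hq le_sup_right :
    (cuspSpace (M / q) w).map (opV q) ≤ oldSpace Q M w) ⟨f, hf, rfl⟩

lemma trW_zero (w : ℤ) (M q : ℕ) (x y z t : ℤ) : trW w M q x y z t 0 = 0 := by
  have := trW_add w M q x y z t 0 0
  rwa [add_zero, left_eq_add] at this

/-- For q ∣ N the trace from level Np to level N acts on forms of level Np/q as the trace to level
N/q, and it commutes with V_q up to the choice of representatives. So oldness at q is preserved. -/
lemma trW_mem_oldSpace {N p : ℕ} (hN : 0 < N) (hp : p.Prime) (hpN : ¬ p ∣ N) {x y z t : ℤ}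
    (h : x * (p * t) - y * (N * z) = 1) {w : ℤ} {f : ℍ → ℂ}
    (hf : f ∈ oldSpace N.primeFactors (N * p) w) :
    trW w N p x y z t f ∈ oldSpace N.primeFactors N w := by
  refine map_mem_oldSpace (trW_add w N p x y z t) (trW_zero w N p x y z t) ?_ ?_ hf
  all_goals
    intro q hq f hf
    obtain ⟨M', rfl⟩ := Nat.dvd_of_mem_primeFactors hq
    have hq0 := (Nat.prime_of_mem_primeFactors hq).pos
    have hM' : 0 < M' := Nat.pos_of_mul_pos_left hN
    have h' : x * (p * t) - y * (M' * (q * z)) = 1 := by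
      push_cast at h; linear_combination h
    rw [mul_assoc, Nat.mul_div_cancel_left _ hq0] at hf
  · rw [trW_eq_trW hN hp hpN h hf]
    refine mem_oldSpace hq ?_
    rw [Nat.mul_div_cancel_left _ hq0]
    exact trW_mem hM' hp h' hf
  · rw [trW_opV w hq0 (by push_cast at h; exact h)]
    refine opV_mem_oldSpace hq ?_
    rw [Nat.mul_div_cancel_left _ hq0]
    exact trW_mem hM' hp (by linear_combination h') hf

lemma hecke_mem_oldSpace {Q : Finset ℕ} {M ℓ : ℕ} (hQ : ∀ q ∈ Q, q.Prime ∧ q ∣ M) (hℓ : ℓ.Prime)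
    (hℓM : ∀ q ∈ Q, q ≠ ℓ ∧ (ℓ ∣ M → ℓ ∣ M / q)) {w : ℤ} (hw : 0 < w) {f : ℍ → ℂ}
    (hf : f ∈ oldSpace Q M w) : hecke M w ℓ f ∈ oldSpace Q M w := by
  have key : ∀ q ∈ Q, ∀ f ∈ cuspSpace (M / q) w, hecke M w ℓ f ∈ cuspSpace (M / q) w := by
    intro q hq f hf
    by_cases h : ℓ ∣ M
    · rw [hecke, if_pos h, zero_smul, add_zero]
      exact opU_mem hℓ ((hℓM q hq).2 h) hf
    · have h' : ¬ ℓ ∣ M / q := fun h' => h (h'.trans (Nat.div_dvd_of_dvd (hQ q hq).2))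
      rw [hecke_congr h h']
      exact hecke_mem hℓ h' hf
  refine map_mem_oldSpace (map_add _) (map_zero _) (fun q hq f hf => ?_) (fun q hq f hf => ?_) hf
  · exact mem_oldSpace hq (key q hq f hf)
  · rw [hecke_opV_comm (hQ q hq).1.pos hℓ.pos ((Nat.coprime_primes (hQ q hq).1 hℓ).mpr
      (hℓM q hq).1) w (isQ_of_mem hw hf)]
    exact opV_mem_oldSpace hq (key q hq f hf)

/-- Work modulo old forms of level N, and let Tr be the trace from level Np to N. Applying U_p to φ
= o + V_p s and then Tr gives (p+1) s ≡ p b φ, while Tr of the original equation gives (p+1) φ ≡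
p^(1-w) T_p s. Eliminating s leaves ((p+1)² - p^(2-w) b²) φ ≡ 0, and the scalar is non-zero by the
strict eigenvalue bound. -/
lemma mem_oldSpace_of_eq_add {N p : ℕ} (hN : 0 < N) (hp : p.Prime) (hpN : ¬ p ∣ N) {w : ℤ}
    (hw : 0 < w) {φ : ℍ → ℂ} (hφ : φ ∈ cuspSpace N w) {b : ℂ} (hb : hecke N w p φ = b • φ)
    {o s : ℍ → ℂ} (ho : o ∈ oldSpace N.primeFactors (N * p) w) (hs : s ∈ cuspSpace N w)
    (h : φ = o + opV p s) : φ ∈ oldSpace N.primeFactors N w := by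
  rcases eq_or_ne φ 0 with h0 | hne
  · rw [h0]; exact Submodule.zero_mem _
  have hp0 : (p : ℂ) ≠ 0 := by exact_mod_cast hp.ne_zero
  obtain ⟨x, y, z, t, hxy⟩ := exists_trace_params hp hpN
  have hQφ := isQ_of_mem hw hφ
  have hQs := isQ_of_mem hw hs
  have hpf : ∀ q ∈ N.primeFactors, q.Prime ∧ q ∣ N := fun q hq =>
    ⟨Nat.prime_of_mem_primeFactors hq, Nat.dvd_of_mem_primeFactors hq⟩
  have hne' : ∀ q ∈ N.primeFactors, q ≠ p := fun q hq hqp =>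
    hpN (hqp ▸ Nat.dvd_of_mem_primeFactors hq)
  have hUo : opU p o ∈ oldSpace N.primeFactors (N * p) w := by
    have := hecke_mem_oldSpace (ℓ := p) (fun q hq => ⟨(hpf q hq).1, (hpf q hq).2.mul_right p⟩)
      hp (fun q hq => ⟨hne' q hq, fun _ => by
        rw [Nat.mul_comm, Nat.mul_div_assoc _ (hpf q hq).2]
        exact dvd_mul_right _ _⟩) hw ho
    rwa [hecke, if_pos (dvd_mul_left p N), zero_smul, add_zero] at this
  have hTφ : opU p φ = b • φ - (p : ℂ) ^ (w - 1) • opV p φ := by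
    rw [← hb, hecke, if_neg hpN]
    simp
  have hs' : s = b • φ - (p : ℂ) ^ (w - 1) • opV p φ - opU p o := by
    have h2 := congrArg (opU p) h
    rw [map_add, opU_opV_self hp.pos hQs, hTφ] at h2
    rw [h2]; abel
  set Tr := trW w N p x y z t with hTr
  have hTradd : ∀ f g, Tr (f + g) = Tr f + Tr g := trW_add w N p x y z t
  have hTrsmul : ∀ (c : ℂ) (f : ℍ → ℂ), Tr (c • f) = c • Tr f := fun c f => by
    simp only [hTr, trW]
    rw [Finset.smul_sum]
    exact Finset.sum_congr rfl fun i _ => sl_smul (by simp [traceRep_det hxy]) c f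
  have hTrp : ∀ f ∈ cuspSpace N w, Tr f = ((p : ℂ) + 1) • f := fun f hf => trW_of_mem hxy hf
  have hTrV : ∀ f ∈ cuspSpace N w, Tr (opV p f) = (p : ℂ) ^ (1 - w) • hecke N w p f :=
    fun f hf => trW_opV_self hN hp hpN hxy hf
  set u := Tr (opU p o) with hu
  have huO : u ∈ oldSpace N.primeFactors N w := trW_mem_oldSpace hN hp hpN hxy hUo
  have hvO : Tr o ∈ oldSpace N.primeFactors N w := trW_mem_oldSpace hN hp hpN hxy ho
  have hTuO : hecke N w p u ∈ oldSpace N.primeFactors N w :=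
    hecke_mem_oldSpace hpf hp (fun q hq => ⟨hne' q hq, fun h => absurd h hpN⟩) hw huO
  have e1 : ((p : ℂ) + 1) • s = (p * b) • φ - u := by
    have h3 : Tr (b • φ) = Tr (s + ((p : ℂ) ^ (w - 1) • opV p φ + opU p o)) := by
      congr 1
      rw [hs']; abel
    have h4 : (p : ℂ) ^ (w - 1) * (p : ℂ) ^ (1 - w) = 1 := by
      rw [← zpow_add₀ hp0, show w - 1 + (1 - w) = 0 by ring, zpow_zero]
    rw [hTradd, hTradd, hTrsmul, hTrsmul, hTrp _ hφ, hTrV _ hφ, hb, hTrp _ hs, ← hu,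
      smul_smul (_ ^ _), h4, one_smul, smul_smul] at h3
    rw [eq_sub_iff_add_eq, ← add_right_cancel_iff (a := b • φ), add_assoc, add_comm u, ← h3,
      ← add_smul]
    congr 1
    ring
  have e2 : ((p : ℂ) + 1) • φ = Tr o + (p : ℂ) ^ (1 - w) • hecke N w p s := by
    rw [← hTrp _ hφ, ← hTrV _ hs, ← trW_add, ← h]
  have e3 : ((p : ℂ) + 1) • hecke N w p s = (p * b ^ 2) • φ - hecke N w p u := by
    rw [← map_smul, e1, map_sub, map_smul, hb, smul_smul]
    congr 2; ring
  have e4 : (((p : ℂ) + 1) ^ 2 - (p : ℂ) ^ (2 - w) * b ^ 2) • φ =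
      ((p : ℂ) + 1) • Tr o - (p : ℂ) ^ (1 - w) • hecke N w p u := by
    have h5 : ((p : ℂ) + 1) ^ 2 • φ = ((p : ℂ) + 1) • Tr o +
        (p : ℂ) ^ (1 - w) • ((p * b ^ 2) • φ - hecke N w p u) := by
      rw [← e3, sq, mul_smul, e2, smul_add]
      congr 1
      rw [smul_comm]
    rw [sub_smul, h5, smul_sub, smul_smul]
    have : (p : ℂ) ^ (2 - w) * b ^ 2 = (p : ℂ) ^ (1 - w) * (p * b ^ 2) := by
      rw [show 2 - w = 1 - w + 1 by ring, zpow_add_one₀ hp0]; ring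
    rw [this]; abel
  have hc : ((p : ℂ) + 1) ^ 2 - (p : ℂ) ^ (2 - w) * b ^ 2 ≠ 0 := by
    intro h0
    refine eigenvalue_sq_ne hN hp hpN hw hφ hne hb ?_
    rw [sub_eq_zero.mp h0, ← mul_assoc, ← zpow_add₀ hp0]
    simp
  rw [← inv_smul_smul₀ hc φ, e4]
  exact Submodule.smul_mem _ _ (Submodule.sub_mem _ (Submodule.smul_mem _ _ hvO)
    (Submodule.smul_mem _ _ hTuO))

/-! ### Multiplicity one -/

/-- The setting of this section: `φ` is a function with the properties of a newform of level `N`,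
and the operators `T_ℓ` are considered for the primes `ℓ ∤ N p`. -/
structure IsPrimitive (N p : ℕ) (w : ℤ) (a : ℕ → ℂ) (φ : ℍ → ℂ) : Prop where
  sqf : Squarefree N
  prime : p.Prime
  not_dvd : ¬ p ∣ N
  pos : 0 < w
  mem : φ ∈ cuspSpace N w
  coeff_one : coeff φ 1 = 1
  eigen : ∀ ℓ : ℕ, ℓ.Prime → ¬ ℓ ∣ N → hecke N w ℓ φ = a ℓ • φ
  not_old : φ ∉ oldSpace N.primeFactors N w

namespace IsPrimitive

variable {N p : ℕ} {w : ℤ} {a : ℕ → ℂ} {φ : ℍ → ℂ}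

lemma level_pos (H : IsPrimitive N p w a φ) : 0 < N := Nat.pos_of_ne_zero H.sqf.ne_zero

lemma level_mul_pos (H : IsPrimitive N p w a φ) : 0 < N * p := Nat.mul_pos H.level_pos H.prime.pos

lemma sqf_mul (H : IsPrimitive N p w a φ) : Squarefree (N * p) :=
  (Nat.squarefree_mul ((Nat.Prime.coprime_iff_not_dvd H.prime).mpr H.not_dvd).symm).mpr
    ⟨H.sqf, H.prime.squarefree⟩

lemma ne_zero (H : IsPrimitive N p w a φ) : φ ≠ 0 := by
  intro h
  exact H.not_old (h ▸ Submodule.zero_mem _)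

lemma mem_eigComponent (H : IsPrimitive N p w a φ) : φ ∈ eigComponent (N * p) N w a :=
  ⟨H.mem, fun ℓ hℓ h => by
    have h' : ¬ ℓ ∣ N := fun h' => h (h'.mul_right p)
    rw [hecke_congr h h', H.eigen ℓ hℓ h']⟩

lemma conj_eigenvalue (H : IsPrimitive N p w a φ) (ℓ : ℕ) (hℓ : ℓ.Prime) (h : ¬ ℓ ∣ N) :
    (starRingEnd ℂ) (a ℓ) = a ℓ :=
  eigenvalue_real H.level_pos hℓ h H.mem H.ne_zero (H.eigen ℓ hℓ h)

lemma conj_eigenvalue' (H : IsPrimitive N p w a φ) (ℓ : ℕ) (hℓ : ℓ.Prime) (h : ¬ ℓ ∣ N * p) :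
    (starRingEnd ℂ) (a ℓ) = a ℓ :=
  H.conj_eigenvalue ℓ hℓ fun h' => h (h'.mul_right p)

lemma exists_of_coeff_one (H : IsPrimitive N p w a φ) {g : ℍ → ℂ}
    (hg : g ∈ eigComponent (N * p) (N * p) w a) (h1 : coeff g 1 = 0) :
    ∃ s : ℕ → ℍ → ℂ, (∀ q ∈ (N * p).primeFactors, s q ∈ cuspSpace (N * p / q) w) ∧
      g = ∑ q ∈ (N * p).primeFactors, opV q (s q) := by
  refine eq_sum_opV_of_coeff_eq_zero H.pos _ (N * p) H.level_mul_pos (fun q hq => ?_) g hg.1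
    fun n hn => ?_
  · have hqp := Nat.prime_of_mem_primeFactors hq
    refine ⟨hqp, Nat.dvd_of_mem_primeFactors hq, fun h => hqp.one_lt.ne' ?_⟩
    exact Nat.isUnit_iff.mp (H.sqf_mul q h)
  · refine coeff_eq_zero_of_coprime H.pos hg h1 n (Nat.Coprime.symm ?_)
    refine Nat.coprime_of_dvd fun q hq hqR hqn => hn q ?_ hqn
    exact Nat.mem_primeFactors.mpr ⟨hq, hqR, H.level_mul_pos.ne'⟩

/-- Suppose g has non-zero first coefficient, and let g₁ be its normalisation. Then φ - g₁ has first
coefficient zero, hence is a sum of forms V_q s_q. Some prime q₀ ∣ N does not divide M, so g₁ is old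
at q₀; the terms with q ∣ N are old as well. Thus φ is old up to V_p s_p, and
`mem_oldSpace_of_eq_add` contradicts newness. The vanishing of all first coefficients is enough by
`eigComponent_eq_bot`. -/
lemma eigComponent_eq_zero (H : IsPrimitive N p w a φ) {M : ℕ} (hM : M ∣ N * p) (hNM : ¬ N ∣ M)
    {g : ℍ → ℂ} (hg : g ∈ eigComponent (N * p) M w a) : g = 0 := by
  refine eigComponent_eq_bot H.pos (fun g hg => ?_) hg
  by_contra h1
  apply H.not_old
  obtain ⟨q₀, hq₀, hq₀N, hq₀M⟩ : ∃ q, q.Prime ∧ q ∣ N ∧ ¬ q ∣ M := by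
    by_contra! hall
    apply hNM
    rw [← Nat.prod_primeFactors_of_squarefree H.sqf]
    exact Finset.prod_primes_dvd M (fun q hq => (Nat.prime_of_mem_primeFactors hq).prime)
      fun q hq => hall q (Nat.prime_of_mem_primeFactors hq) (Nat.dvd_of_mem_primeFactors hq)
  set g₁ := (coeff g 1)⁻¹ • g with hg₁
  have hg₁' : g₁ ∈ eigComponent (N * p) M w a := Submodule.smul_mem _ _ hg
  have hdiff : φ - g₁ ∈ eigComponent (N * p) (N * p) w a :=
    Submodule.sub_mem _ (eigComponent_mono (dvd_mul_right N p) w a H.mem_eigComponent)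
      (eigComponent_mono hM w a hg₁')
  have hc : coeff (φ - g₁) 1 = 0 := by
    rw [coeff_sub (isQ_of_mem H.pos H.mem) (isQ_of_mem H.pos hg₁'.1), hg₁,
      coeff_smul (isQ_of_mem H.pos hg.1), inv_mul_cancel₀ h1, H.coeff_one, sub_self]
  obtain ⟨s, hs, hsum⟩ := H.exists_of_coeff_one hdiff hc
  have hpf : (N * p).primeFactors = insert p N.primeFactors := by
    rw [Nat.primeFactors_mul H.level_pos.ne' H.prime.ne_zero, H.prime.primeFactors,
      Finset.union_comm]
    rfl
  have hpn : p ∉ N.primeFactors := fun h => H.not_dvd (Nat.dvd_of_mem_primeFactors h)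
  rw [hpf, Finset.sum_insert hpn] at hsum
  have hsp := hs p (by rw [hpf]; exact Finset.mem_insert_self _ _)
  rw [Nat.mul_div_cancel _ H.prime.pos] at hsp
  refine mem_oldSpace_of_eq_add H.level_pos H.prime H.not_dvd H.pos H.mem
    (H.eigen p H.prime H.not_dvd) (o := g₁ + ∑ q ∈ N.primeFactors, opV q (s q)) ?_ hsp ?_
  · refine Submodule.add_mem _ ?_ (Submodule.sum_mem _ fun q hq => ?_)
    · refine mem_oldSpace (Nat.mem_primeFactors.mpr ⟨hq₀, hq₀N, H.level_pos.ne'⟩)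
        (cuspSpace_mono ?_ w hg₁'.1)
      have h2 : q₀ * (N * p / q₀) = N * p := Nat.mul_div_cancel' (hq₀N.mul_right p)
      rw [← h2] at hM
      exact (((Nat.Prime.coprime_iff_not_dvd hq₀).mpr hq₀M).symm).dvd_of_dvd_mul_left hM
    · exact opV_mem_oldSpace hq (hs q (by rw [hpf]; exact Finset.mem_insert_of_mem hq))
  · rw [add_assoc, add_comm (∑ q ∈ N.primeFactors, opV q (s q)), ← hsum]
    abel

/-- Write g as a sum of V_q s_q and split each s_q into its eigenpart and a complementary part.
Since V_q respects the splitting and g lies in the component, the complementary parts add up to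
zero. For q ≠ p the eigenpart has level Np/q, not divisible by N, so it vanishes, and only q = p
remains. -/
lemma exists_eq_opV (H : IsPrimitive N p w a φ) {g : ℍ → ℂ}
    (hg : g ∈ eigComponent (N * p) (N * p) w a) (h1 : coeff g 1 = 0) :
    ∃ s ∈ eigComponent (N * p) N w a, g = opV p s := by
  obtain ⟨s, hs, hsum⟩ := H.exists_of_coeff_one hg h1
  have hRne := H.level_mul_pos.ne'
  have hdec : ∀ q ∈ (N * p).primeFactors, ∃ u ∈ eigComponent (N * p) (N * p / q) w a,
      ∃ v ∈ eigComplement (N * p) (N * p / q) w a, s q = u + v := by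
    intro q hq
    have hd := Nat.div_dvd_of_dvd (Nat.dvd_of_mem_primeFactors hq)
    have : NeZero (N * p / q) := ⟨fun h0 => hRne (by rw [h0] at hd; exact zero_dvd_iff.mp hd)⟩
    exact exists_eigComponent_add hd H.pos H.conj_eigenvalue' (hs q hq)
  choose! u hu v hv huv using hdec
  have hq' : ∀ q ∈ (N * p).primeFactors, q * (N * p / q) = N * p := fun q hq =>
    Nat.mul_div_cancel' (Nat.dvd_of_mem_primeFactors hq)
  have hU : ∑ q ∈ (N * p).primeFactors, opV q (u q) ∈ eigComponent (N * p) (N * p) w a := by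
    refine Submodule.sum_mem _ fun q hq => ?_
    have := opV_mem_eigComponent (Nat.prime_of_mem_primeFactors hq)
      (Nat.dvd_of_mem_primeFactors hq) H.pos (hu q hq)
    rwa [hq' q hq] at this
  have hV : ∑ q ∈ (N * p).primeFactors, opV q (v q) ∈ eigComplement (N * p) (N * p) w a := by
    refine Submodule.sum_mem _ fun q hq => ?_
    have := opV_mem_eigComplement (Nat.prime_of_mem_primeFactors hq)
      (Nat.dvd_of_mem_primeFactors hq) H.pos (hv q hq)
    rwa [hq' q hq] at this
  have hsum2 : g = ∑ q ∈ (N * p).primeFactors, opV q (u q) +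
      ∑ q ∈ (N * p).primeFactors, opV q (v q) := by
    rw [hsum, ← Finset.sum_add_distrib]
    exact Finset.sum_congr rfl fun q hq => by rw [huv q hq, map_add]
  have : NeZero (N * p) := ⟨hRne⟩
  have hV0 : ∑ q ∈ (N * p).primeFactors, opV q (v q) = 0 := by
    refine eq_zero_of_mem_eigComponent_of_mem_eigComplement dvd_rfl H.pos H.conj_eigenvalue' ?_ hV
    rw [← sub_eq_iff_eq_add'.mpr hsum2]
    exact Submodule.sub_mem _ hg hU
  have hpR : p ∈ (N * p).primeFactors :=
    Nat.mem_primeFactors.mpr ⟨H.prime, dvd_mul_left p N, hRne⟩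
  have hup := hu p hpR
  rw [Nat.mul_div_cancel _ H.prime.pos] at hup
  refine ⟨u p, hup, ?_⟩
  rw [hsum2, hV0, add_zero]
  refine Finset.sum_eq_single_of_mem p hpR fun q hq hqp => ?_
  have hqprime := Nat.prime_of_mem_primeFactors hq
  have hz : u q = 0 := by
    refine H.eigComponent_eq_zero (Nat.div_dvd_of_dvd (Nat.dvd_of_mem_primeFactors hq))
      (fun h => hqp ?_) (hu q hq)
    have h2 := mul_dvd_mul_left q h
    rw [hq' q hq, mul_comm] at h2
    exact (Nat.prime_dvd_prime_iff_eq hqprime H.prime).mp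
      (Nat.dvd_of_mul_dvd_mul_left H.level_pos h2)
  rw [hz, map_zero]

/-- The difference g - a₁(g) φ has the form V_p s. Both it and s have level N, so s = 0 by
`eq_zero_of_opV_mem`. -/
lemma eq_smul (H : IsPrimitive N p w a φ) {g : ℍ → ℂ} (hg : g ∈ eigComponent (N * p) N w a) :
    g = coeff g 1 • φ := by
  have hd : g - coeff g 1 • φ ∈ eigComponent (N * p) N w a :=
    Submodule.sub_mem _ hg (Submodule.smul_mem _ _ H.mem_eigComponent)
  have hQ := isQ_of_mem H.pos H.mem
  obtain ⟨s, hs, h⟩ := H.exists_eq_opV (eigComponent_mono (dvd_mul_right N p) w a hd) (by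
    rw [coeff_sub (isQ_of_mem H.pos hg.1) (hQ.smul _), coeff_smul hQ, H.coeff_one, mul_one,
      sub_self])
  have h0 : s = 0 := eq_zero_of_opV_mem H.level_pos H.prime H.not_dvd H.pos hs.1 (h ▸ hd.1)
  rw [h0, map_zero] at h
  exact sub_eq_zero.mp h

lemma eq_smul_add_smul (H : IsPrimitive N p w a φ) {g : ℍ → ℂ}
    (hg : g ∈ eigComponent (N * p) (N * p) w a) :
    ∃ x y : ℂ, g = x • φ + y • opV p φ := by
  have hφ := eigComponent_mono (dvd_mul_right N p) w a H.mem_eigComponent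
  have hQ := isQ_of_mem H.pos H.mem
  obtain ⟨s, hs, h⟩ := H.exists_eq_opV (Submodule.sub_mem _ hg
    (Submodule.smul_mem _ (coeff g 1) hφ)) (by
    rw [coeff_sub (isQ_of_mem H.pos hg.1) (hQ.smul _), coeff_smul hQ, H.coeff_one, mul_one,
      sub_self])
  refine ⟨coeff g 1, coeff s 1, ?_⟩
  rw [← map_smul, ← H.eq_smul hs, ← h]
  abel

/-- At level N it does not matter whether T_p is among the operators: by multiplicity one, an
eigenform away from Np is a multiple of φ, hence also an eigenform of T_p. The two components agree,
and so do their complements. -/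
lemma eigComplement_eq (H : IsPrimitive N p w a φ) :
    eigComplement N N w a = eigComplement (N * p) N w a := by
  have : NeZero N := ⟨H.level_pos.ne'⟩
  have hle : eigComplement (N * p) N w a ≤ eigComplement N N w a := by
    refine Submodule.span_mono ?_
    rintro _ ⟨ℓ, hℓ, hℓR, x, hx, rfl⟩
    have h' : ¬ ℓ ∣ N := fun h' => hℓR (h'.mul_right p)
    exact ⟨ℓ, hℓ, h', x, hx, by rw [hecke_congr hℓR h']⟩
  refine le_antisymm (fun f hf => ?_) hle
  obtain ⟨g, hg, h, hh, rfl⟩ := exists_eigComponent_add (dvd_mul_right N p) H.pos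
    H.conj_eigenvalue' (eigComplement_le dvd_rfl w a hf)
  have h1 : g ∈ eigComplement N N w a := by
    have := Submodule.sub_mem _ hf (hle hh)
    rwa [add_sub_cancel_right] at this
  have h2 : g ∈ eigComponent N N w a := by
    rw [H.eq_smul hg]
    exact Submodule.smul_mem _ _ ⟨H.mem, H.eigen⟩
  have h3 : g = 0 :=
    eq_zero_of_mem_eigComponent_of_mem_eigComplement dvd_rfl H.pos H.conj_eigenvalue h2 h1
  rw [h3, zero_add]
  exact hh

end IsPrimitive

/-! ### The projections on the components -/

lemma heckeProj_eq {M : ℕ} [NeZero M] {w : ℤ} (hw : 0 < w) {a : ℕ → ℂ}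
    (ha : ∀ ℓ : ℕ, ℓ.Prime → ¬ ℓ ∣ M → (starRingEnd ℂ) (a ℓ) = a ℓ) {f : S M w} {g h : ℍ → ℂ}
    (hg : g ∈ eigComponent M M w a) (hh : h ∈ eigComplement M M w a)
    (hf : (f : ℍ → ℂ) = g + h) : (heckeProj M w a f : ℍ → ℂ) = g := by
  have H : IsCompl (heckeComponent M w a) (heckeComplement M w a) := by
    rw [heckeComponent_eq, heckeComplement_eq M hw]
    exact isCompl_eigComponent dvd_rfl hw ha
  rw [heckeProj, dif_pos H]
  have hg' : mkCusp hw g hg.1 ∈ heckeComponent M w a := by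
    rw [heckeComponent_eq]; exact hg
  have hh' : mkCusp hw h (eigComplement_le dvd_rfl w a hh) ∈ heckeComplement M w a := by
    rw [heckeComplement_eq M hw]; exact hh
  have hfe : f = mkCusp hw g hg.1 + mkCusp hw h (eigComplement_le dvd_rfl w a hh) :=
    coeLin_injective M w hf
  rw [hfe, map_add, Submodule.projection_apply_of_mem_left H hg',
    Submodule.projection_apply_of_mem_right H hh', add_zero]
  rfl

lemma heckeProj_mem {M : ℕ} [NeZero M] {w : ℤ} (hw : 0 < w) {a : ℕ → ℂ}
    (ha : ∀ ℓ : ℕ, ℓ.Prime → ¬ ℓ ∣ M → (starRingEnd ℂ) (a ℓ) = a ℓ) (f : S M w) :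
    ((heckeProj M w a f : S M w) : ℍ → ℂ) ∈ eigComponent M M w a := by
  obtain ⟨g, hg, h, hh, hf⟩ := exists_eigComponent_add dvd_rfl hw ha (coe_mem_cuspSpace f)
  rw [heckeProj_eq hw ha hg hh hf]
  exact hg

/-! ### Compatibility of the projections with level raising, V_p and U_p -/

namespace IsPrimitive

variable {N p : ℕ} {w : ℤ} {a : ℕ → ℂ} {φ : ℍ → ℂ}

/-- The projection at level N involves T_p, the one at level Np does not. Both are computed from the
splitting away from Np, which `eigComplement_eq` identifies with the one at level N. -/
lemma heckeProj_level_mul (H : IsPrimitive N p w a φ) [NeZero N] [NeZero (N * p)] (f : S N w)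
    (f' : S (N * p) w) (hf : (f' : ℍ → ℂ) = f) :
    (heckeProj (N * p) w a f' : ℍ → ℂ) = heckeProj N w a f := by
  obtain ⟨g, hg, h, hh, hgh⟩ := exists_eigComponent_add (dvd_mul_right N p) H.pos
    H.conj_eigenvalue' (coe_mem_cuspSpace f)
  have hg' : g ∈ eigComponent N N w a := by
    rw [H.eq_smul hg]
    exact Submodule.smul_mem _ _ ⟨H.mem, H.eigen⟩
  have hh' : h ∈ eigComplement (N * p) (N * p) w a := by
    refine Submodule.span_mono ?_ hh
    rintro _ ⟨ℓ, hℓ, hℓR, x, hx, rfl⟩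
    exact ⟨ℓ, hℓ, hℓR, x, cuspSpace_mono (dvd_mul_right N p) w hx, rfl⟩
  rw [heckeProj_eq H.pos H.conj_eigenvalue' (eigComponent_mono (dvd_mul_right N p) w a hg) hh'
    (hf.trans hgh), heckeProj_eq H.pos H.conj_eigenvalue hg' (H.eigComplement_eq ▸ hh) hgh]

lemma heckeProj_opV (H : IsPrimitive N p w a φ) [NeZero N] [NeZero (N * p)] (f : S N w)
    (f' : S (N * p) w) (hf : (f' : ℍ → ℂ) = opV p f) :
    (heckeProj (N * p) w a f' : ℍ → ℂ) = opV p (heckeProj N w a f) := by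
  obtain ⟨g, hg, h, hh, hgh⟩ := exists_eigComponent_add (dvd_mul_right N p) H.pos
    H.conj_eigenvalue' (coe_mem_cuspSpace f)
  have hg' : g ∈ eigComponent N N w a := by
    rw [H.eq_smul hg]
    exact Submodule.smul_mem _ _ ⟨H.mem, H.eigen⟩
  have h1 := opV_mem_eigComponent H.prime (dvd_mul_left p N) H.pos hg
  have h2 := opV_mem_eigComplement H.prime (dvd_mul_left p N) H.pos hh
  rw [mul_comm p N] at h1 h2
  rw [heckeProj_eq H.pos H.conj_eigenvalue' h1 h2 (by rw [hf, hgh, map_add]),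
    heckeProj_eq H.pos H.conj_eigenvalue hg' (H.eigComplement_eq ▸ hh) hgh]

lemma heckeProj_opU (H : IsPrimitive N p w a φ) [NeZero (N * p)] (f f' : S (N * p) w)
    (hf : (f' : ℍ → ℂ) = opU p f) :
    (heckeProj (N * p) w a f' : ℍ → ℂ) = opU p (heckeProj (N * p) w a f) := by
  obtain ⟨g, hg, h, hh, hgh⟩ := exists_eigComponent_add dvd_rfl H.pos
    H.conj_eigenvalue' (coe_mem_cuspSpace f)
  rw [heckeProj_eq H.pos H.conj_eigenvalue' hg hh hgh,
    heckeProj_eq H.pos H.conj_eigenvalue'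
      (opU_mem_eigComponent H.prime (dvd_mul_left p N) (dvd_mul_left p N) H.pos hg)
      (opU_mem_eigComplement H.prime (dvd_mul_left p N) (dvd_mul_left p N) H.pos hh)
      (by rw [hf, hgh, map_add])]

end IsPrimitive

lemma IsNormalisedNewform.isPrimitive {N p : ℕ} {w : ℤ} (hN : Squarefree N) (hp : p.Prime)
    (hpN : ¬ p ∣ N) (hw : 0 < w) {φ : S N w} (hφ : IsNormalisedNewform N w φ) :
    IsPrimitive N p w (coeff φ) φ where
  sqf := hN
  prime := hp
  not_dvd := hpN
  pos := hw
  mem := have : NeZero N := ⟨hN.ne_zero⟩; coe_mem_cuspSpace φ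
  coeff_one := hφ.coeff_one
  eigen ℓ hℓ _ := hφ.eigen ℓ hℓ
  not_old h := by
    have : NeZero N := ⟨hN.ne_zero⟩
    have h0 := eq_zero_of_isNew_of_mem_oldSpace hw hφ.isNew (fun q hq =>
      ⟨Nat.prime_of_mem_primeFactors hq, Nat.dvd_of_mem_primeFactors hq⟩) h
    have h1 := hφ.coeff_one
    rw [h0, coeff_zero] at h1
    exact zero_ne_one h1

section

open Matrix

/-! ### Siegel's upper half space -/

lemma map_im_symMat_form {s z t : ℂ} (h1 : 0 < s.im) (h2 : z.im ^ 2 < s.im * t.im)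
    {v : Fin 2 → ℂ} (hv : v ≠ 0) :
    0 < (star v ⬝ᵥ (symMat s z t - (symMat s z t)ᴴ) *ᵥ v).im := by
  have e : (star v ⬝ᵥ (symMat s z t - (symMat s z t)ᴴ) *ᵥ v).im =
      2 * (s.im * ((v 0).re ^ 2 + (v 0).im ^ 2) + 2 * z.im *
        ((v 0).re * (v 1).re + (v 0).im * (v 1).im) + t.im * ((v 1).re ^ 2 + (v 1).im ^ 2)) := by
    simp [symMat, Matrix.mulVec, dotProduct, Fin.sum_univ_two]
    ring
  rw [e]
  have hne : v 0 ≠ 0 ∨ v 1 ≠ 0 := by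
    by_contra! h
    exact hv (by ext i; fin_cases i <;> simp [h])
  -- Multiplying the form by Im s completes the squares.
  have key : 0 < s.im * (s.im * ((v 0).re ^ 2 + (v 0).im ^ 2) + 2 * z.im *
        ((v 0).re * (v 1).re + (v 0).im * (v 1).im) + t.im * ((v 1).re ^ 2 + (v 1).im ^ 2)) := by
    have e2 : s.im * (s.im * ((v 0).re ^ 2 + (v 0).im ^ 2) + 2 * z.im *
        ((v 0).re * (v 1).re + (v 0).im * (v 1).im) + t.im * ((v 1).re ^ 2 + (v 1).im ^ 2)) =
        (s.im * (v 0).re + z.im * (v 1).re) ^ 2 + (s.im * (v 0).im + z.im * (v 1).im) ^ 2 +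
        (s.im * t.im - z.im ^ 2) * ((v 1).re ^ 2 + (v 1).im ^ 2) := by ring
    rw [e2]
    by_cases h : v 1 = 0
    · have h0 : v 0 ≠ 0 := hne.resolve_right (not_not.mpr h)
      have h3 : 0 < (v 0).re ^ 2 + (v 0).im ^ 2 := by
        have := Complex.normSq_pos.mpr h0
        rw [Complex.normSq_apply] at this
        nlinarith
      simp only [h, Complex.zero_re, Complex.zero_im]
      nlinarith [mul_pos (mul_pos h1 h1) h3]
    · have h3 : 0 < (v 1).re ^ 2 + (v 1).im ^ 2 := by
        have := Complex.normSq_pos.mpr h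
        rw [Complex.normSq_apply] at this
        nlinarith
      have := mul_pos (sub_pos.mpr h2) h3
      positivity
  have := pos_of_mul_pos_right key h1.le
  linarith

lemma symMat_mem_siegelH {s z t : ℂ} :
    symMat s z t ∈ siegelH ↔ 0 < s.im ∧ z.im ^ 2 < s.im * t.im := by
  constructor
  · rintro ⟨-, h⟩
    have h1 := h.det_pos
    have h2 := h.diag_pos (i := 0)
    simp [symMat, Matrix.det_fin_two] at h1 h2
    exact ⟨h2, by nlinarith⟩
  · rintro ⟨h1, h2⟩
    refine ⟨by ext i j; fin_cases i <;> fin_cases j <;> rfl, ?_⟩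
    refine Matrix.PosDef.of_dotProduct_mulVec_pos
      (by ext i j; fin_cases i <;> fin_cases j <;> rfl) fun x hx => ?_
    have := map_im_symMat_form h1 h2 (v := fun i => (x i : ℂ)) (fun h0 => hx (by
      ext i; simpa using congrFun h0 i))
    simp [symMat, Matrix.mulVec, dotProduct, Fin.sum_univ_two] at this ⊢
    linarith

lemma eq_symMat {Z : Matrix (Fin 2) (Fin 2) ℂ} (hZ : Z.IsSymm) :
    Z = symMat (Z 0 0) (Z 0 1) (Z 1 1) := by
  ext i j
  fin_cases i <;> fin_cases j <;> simp [symMat, hZ.apply 0 1]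

lemma form_pos_of_mem_siegelH {Z : Matrix (Fin 2) (Fin 2) ℂ} (hZ : Z ∈ siegelH)
    {v : Fin 2 → ℂ} (hv : v ≠ 0) : 0 < (star v ⬝ᵥ (Z - Zᴴ) *ᵥ v).im := by
  have h := eq_symMat hZ.1
  rw [h] at hZ ⊢
  exact map_im_symMat_form (symMat_mem_siegelH.mp hZ).1 (symMat_mem_siegelH.mp hZ).2 hv

lemma mem_siegelH_of_form_pos {Z : Matrix (Fin 2) (Fin 2) ℂ} (hZ : Z.IsSymm)
    (h : ∀ v : Fin 2 → ℂ, v ≠ 0 → 0 < (star v ⬝ᵥ (Z - Zᴴ) *ᵥ v).im) : Z ∈ siegelH := by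
  refine ⟨hZ, Matrix.PosDef.of_dotProduct_mulVec_pos ?_ fun x hx => ?_⟩
  · ext i j
    simp [hZ.apply i j]
  have := h (fun i => (x i : ℂ)) (fun h0 => hx (by
      ext i; simpa using congrFun h0 i))
  simp [Matrix.mulVec, dotProduct, Fin.sum_univ_two] at this ⊢
  linarith

/-! ### The symplectic group -/

/-- The numerator `A Z + B` of `γ = (A, B; C, D)`. -/
def siegelNum (γ : Matrix (Fin 2 ⊕ Fin 2) (Fin 2 ⊕ Fin 2) ℤ) (Z : Matrix (Fin 2) (Fin 2) ℂ) :
    Matrix (Fin 2) (Fin 2) ℂ :=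
  γ.toBlocks₁₁.map (Int.cast : ℤ → ℂ) * Z + γ.toBlocks₁₂.map (Int.cast : ℤ → ℂ)

lemma siegelAct_eq (γ : Matrix (Fin 2 ⊕ Fin 2) (Fin 2 ⊕ Fin 2) ℤ)
    (Z : Matrix (Fin 2) (Fin 2) ℂ) : siegelAct γ Z = siegelNum γ Z * (siegelDenom γ Z)⁻¹ := rfl

/-- The matrix with first block column `(X; Y)` and second block column zero. -/
def stack (X Y : Matrix (Fin 2) (Fin 2) ℂ) : Matrix (Fin 2 ⊕ Fin 2) (Fin 2 ⊕ Fin 2) ℂ :=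
  fromBlocks X 0 Y 0

lemma map_mul_stack (γ : Matrix (Fin 2 ⊕ Fin 2) (Fin 2 ⊕ Fin 2) ℤ)
    (Z X : Matrix (Fin 2) (Fin 2) ℂ) : γ.map (Int.cast : ℤ → ℂ) * stack (Z * X) X =
      stack (siegelNum γ Z * X) (siegelDenom γ Z * X) := by
  conv_lhs => rw [← fromBlocks_toBlocks γ]
  rw [fromBlocks_map, stack, fromBlocks_multiply]
  simp [stack, siegelNum, siegelDenom, Matrix.add_mul, Matrix.mul_assoc]

lemma map_transpose_J_map {γ : Matrix (Fin 2 ⊕ Fin 2) (Fin 2 ⊕ Fin 2) ℤ}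
    (hγ : γ ∈ symplecticGroup (Fin 2) ℤ) :
    (γ.map (Int.cast : ℤ → ℂ))ᵀ * Matrix.J (Fin 2) ℂ * γ.map (Int.cast : ℤ → ℂ) =
      Matrix.J (Fin 2) ℂ :=
  SymplecticGroup.mem_iff'.mp (SymplecticGroup.map_mem (f := Int.castRingHom ℂ) hγ)

/-- This is γᵀ J γ = J evaluated on the block columns (Y; 1) and (Z; 1). Taking Y = Z detects
symmetry, and Y the complex conjugate of Z detects positivity of the imaginary part. -/
lemma siegel_form {γ : Matrix (Fin 2 ⊕ Fin 2) (Fin 2 ⊕ Fin 2) ℤ}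
    (hγ : γ ∈ symplecticGroup (Fin 2) ℤ) (Y Z : Matrix (Fin 2) (Fin 2) ℂ) :
    (siegelDenom γ Y)ᵀ * siegelNum γ Z - (siegelNum γ Y)ᵀ * siegelDenom γ Z = Z - Yᵀ := by
  have h1 := map_mul_stack γ Z 1
  have h2 := congrArg Matrix.transpose (map_mul_stack γ Y 1)
  rw [transpose_mul] at h2
  have h3 : (stack (Y * 1) 1)ᵀ * (γ.map (Int.cast : ℤ → ℂ))ᵀ * Matrix.J (Fin 2) ℂ *
      (γ.map (Int.cast : ℤ → ℂ) * stack (Z * 1) 1) =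
      (stack (Y * 1) 1)ᵀ * Matrix.J (Fin 2) ℂ * stack (Z * 1) 1 := by
    conv_rhs => rw [← map_transpose_J_map hγ]
    simp only [Matrix.mul_assoc]
  rw [h1, h2, Matrix.J, stack, stack, stack, stack, fromBlocks_transpose, fromBlocks_transpose, fromBlocks_multiply,
    fromBlocks_multiply, fromBlocks_multiply, fromBlocks_multiply] at h3
  have h4 := (fromBlocks_inj.mp h3).1
  simpa [sub_eq_add_neg] using h4

lemma siegel_transpose_form {γ : Matrix (Fin 2 ⊕ Fin 2) (Fin 2 ⊕ Fin 2) ℤ}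
    (hγ : γ ∈ symplecticGroup (Fin 2) ℤ) (Z : Matrix (Fin 2) (Fin 2) ℂ) :
    (siegelDenom γ Z)ᵀ * siegelNum γ Z - (siegelNum γ Z)ᵀ * siegelDenom γ Z = Z - Zᵀ :=
  siegel_form hγ Z Z

lemma map_star_siegel (γ : Matrix (Fin 2 ⊕ Fin 2) (Fin 2 ⊕ Fin 2) ℤ)
    (Z : Matrix (Fin 2) (Fin 2) ℂ) :
    siegelDenom γ (Z.map star) = (siegelDenom γ Z).map star ∧
      siegelNum γ (Z.map star) = (siegelNum γ Z).map star := by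
  constructor <;> ext i j <;>
    simp [siegelDenom, siegelNum, Matrix.mul_apply, Fin.sum_univ_two]

lemma siegel_conjTranspose_form {γ : Matrix (Fin 2 ⊕ Fin 2) (Fin 2 ⊕ Fin 2) ℤ}
    (hγ : γ ∈ symplecticGroup (Fin 2) ℤ) (Z : Matrix (Fin 2) (Fin 2) ℂ) :
    (siegelDenom γ Z)ᴴ * siegelNum γ Z - (siegelNum γ Z)ᴴ * siegelDenom γ Z = Z - Zᴴ := by
  have h := siegel_form hγ (Z.map star) Z
  rw [(map_star_siegel γ Z).1, (map_star_siegel γ Z).2] at h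
  exact h

/-- A vector killed by CZ + D would make the positive form attached to Z - Zᴴ vanish. -/
lemma det_siegelDenom_ne_zero {γ : Matrix (Fin 2 ⊕ Fin 2) (Fin 2 ⊕ Fin 2) ℤ}
    (hγ : γ ∈ symplecticGroup (Fin 2) ℤ) {Z : Matrix (Fin 2) (Fin 2) ℂ} (hZ : Z ∈ siegelH) :
    (siegelDenom γ Z).det ≠ 0 := by
  intro h
  obtain ⟨v, hv, h0⟩ := Matrix.exists_mulVec_eq_zero_iff.mpr h
  have h1 := form_pos_of_mem_siegelH hZ hv
  rw [← siegel_conjTranspose_form hγ, Matrix.sub_mulVec, ← Matrix.mulVec_mulVec,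
    ← Matrix.mulVec_mulVec, h0, Matrix.mulVec_zero, sub_zero, Matrix.dotProduct_mulVec,
    ← Matrix.star_mulVec, h0] at h1
  simp at h1

lemma siegelAct_mem {γ : Matrix (Fin 2 ⊕ Fin 2) (Fin 2 ⊕ Fin 2) ℤ}
    (hγ : γ ∈ symplecticGroup (Fin 2) ℤ) {Z : Matrix (Fin 2) (Fin 2) ℂ} (hZ : Z ∈ siegelH) :
    siegelAct γ Z ∈ siegelH := by
  have hdet := det_siegelDenom_ne_zero hγ hZ
  have hu : IsUnit (siegelDenom γ Z).det := isUnit_iff_ne_zero.mpr hdet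
  set Q := siegelDenom γ Z with hQ
  set P := siegelNum γ Z with hP
  have hPQ : P = siegelAct γ Z * Q := by
    rw [siegelAct_eq, Matrix.mul_assoc, Matrix.nonsing_inv_mul _ hu, Matrix.mul_one]
  set W := siegelAct γ Z
  have hT := siegel_transpose_form hγ Z
  have hC := siegel_conjTranspose_form hγ Z
  rw [← hP, ← hQ, hPQ] at hT hC
  have hsymm : W.IsSymm := by
    rw [hZ.1.eq, sub_self, transpose_mul, Matrix.mul_assoc, ← Matrix.mul_sub, ← Matrix.sub_mul] at hT
    have h1 : W - Wᵀ = Qᵀ⁻¹ * (Qᵀ * ((W - Wᵀ) * Q)) * Q⁻¹ := by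
      rw [← Matrix.mul_assoc Qᵀ⁻¹, Matrix.nonsing_inv_mul _ (by rwa [det_transpose]),
        Matrix.one_mul, Matrix.mul_assoc, Matrix.mul_nonsing_inv _ hu, Matrix.mul_one]
    rw [hT, Matrix.mul_zero, Matrix.zero_mul] at h1
    exact (sub_eq_zero.mp h1).symm
  refine mem_siegelH_of_form_pos hsymm fun u hu0 => ?_
  have hv : Q *ᵥ (Q⁻¹ *ᵥ u) = u := by
    rw [Matrix.mulVec_mulVec, Matrix.mul_nonsing_inv _ hu, Matrix.one_mulVec]
  have hv0 : Q⁻¹ *ᵥ u ≠ 0 := fun h => hu0 (by rw [← hv, h, Matrix.mulVec_zero])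
  have h1 := form_pos_of_mem_siegelH hZ hv0
  rw [← hC, conjTranspose_mul, Matrix.mul_assoc, ← Matrix.mul_sub, ← Matrix.sub_mul,
    ← Matrix.mulVec_mulVec, ← Matrix.mulVec_mulVec, hv, Matrix.dotProduct_mulVec,
    ← Matrix.star_mulVec, hv] at h1
  exact h1

lemma siegel_cocycle {γ δ : Matrix (Fin 2 ⊕ Fin 2) (Fin 2 ⊕ Fin 2) ℤ}
    (hδ : δ ∈ symplecticGroup (Fin 2) ℤ) {Z : Matrix (Fin 2) (Fin 2) ℂ} (hZ : Z ∈ siegelH) :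
    siegelNum (γ * δ) Z = siegelNum γ (siegelAct δ Z) * siegelDenom δ Z ∧
      siegelDenom (γ * δ) Z = siegelDenom γ (siegelAct δ Z) * siegelDenom δ Z := by
  have hu : IsUnit (siegelDenom δ Z).det := isUnit_iff_ne_zero.mpr (det_siegelDenom_ne_zero hδ hZ)
  have h0 : siegelNum δ Z = siegelAct δ Z * siegelDenom δ Z := by
    rw [siegelAct_eq, Matrix.mul_assoc, Matrix.nonsing_inv_mul _ hu, Matrix.mul_one]
  have h1 := map_mul_stack δ Z 1
  rw [Matrix.mul_one, Matrix.mul_one, Matrix.mul_one, h0] at h1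
  have h2 := map_mul_stack γ (siegelAct δ Z) (siegelDenom δ Z)
  have h3 : (γ * δ).map (Int.cast : ℤ → ℂ) =
      γ.map (Int.cast : ℤ → ℂ) * δ.map (Int.cast : ℤ → ℂ) :=
    Matrix.map_mul (f := Int.castRingHom ℂ)
  have h4 := map_mul_stack (γ * δ) Z 1
  rw [Matrix.mul_one, Matrix.mul_one, Matrix.mul_one, h3, Matrix.mul_assoc, h1, h2] at h4
  obtain ⟨h5, -, h6, -⟩ := fromBlocks_inj.mp h4
  exact ⟨h5.symm, h6.symm⟩

lemma siegelAct_mul {γ δ : Matrix (Fin 2 ⊕ Fin 2) (Fin 2 ⊕ Fin 2) ℤ}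
    (hδ : δ ∈ symplecticGroup (Fin 2) ℤ) {Z : Matrix (Fin 2) (Fin 2) ℂ} (hZ : Z ∈ siegelH) :
    siegelAct (γ * δ) Z = siegelAct γ (siegelAct δ Z) := by
  have hu : IsUnit (siegelDenom δ Z).det := isUnit_iff_ne_zero.mpr (det_siegelDenom_ne_zero hδ hZ)
  obtain ⟨h1, h2⟩ := siegel_cocycle (γ := γ) hδ hZ
  rw [siegelAct_eq, h1, h2, Matrix.mul_inv_rev, Matrix.mul_assoc, ← Matrix.mul_assoc (siegelDenom δ Z),
    Matrix.mul_nonsing_inv _ hu, Matrix.one_mul, ← siegelAct_eq]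

/-- The weight `w` slash action of integral symplectic matrices. -/
def siegelSlash (w : ℤ) (γ : Matrix (Fin 2 ⊕ Fin 2) (Fin 2 ⊕ Fin 2) ℤ)
    (F : Matrix (Fin 2) (Fin 2) ℂ → ℂ) (Z : Matrix (Fin 2) (Fin 2) ℂ) : ℂ :=
  (siegelDenom γ Z).det ^ (-w) * F (siegelAct γ Z)

lemma siegelSlash_mul (w : ℤ) {γ δ : Matrix (Fin 2 ⊕ Fin 2) (Fin 2 ⊕ Fin 2) ℤ}
    (hδ : δ ∈ symplecticGroup (Fin 2) ℤ) (F : Matrix (Fin 2) (Fin 2) ℂ → ℂ)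
    {Z : Matrix (Fin 2) (Fin 2) ℂ} (hZ : Z ∈ siegelH) :
    siegelSlash w (γ * δ) F Z = siegelSlash w δ (siegelSlash w γ F) Z := by
  rw [siegelSlash, siegelSlash, siegelSlash, siegelAct_mul hδ hZ, (siegel_cocycle hδ hZ).2,
    Matrix.det_mul, mul_zpow]
  ring

end

section

open Matrix

/-! ### Special symplectic matrices -/

/-- The matrix of the translation `Z ↦ Z + S`. -/
def trMat (x y z : ℤ) : Matrix (Fin 2 ⊕ Fin 2) (Fin 2 ⊕ Fin 2) ℤ :=
  fromBlocks 1 !![x, y; y, z] 0 1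

lemma trMat_mem (x y z : ℤ) : trMat x y z ∈ symplecticGroup (Fin 2) ℤ := by
  rw [trMat, SymplecticGroup.fromBlocks_mem_iff]
  refine ⟨by simp, ?_, by simp⟩
  ext i j; fin_cases i <;> fin_cases j <;> simp

lemma siegelSlash_trMat (w : ℤ) (x y z : ℤ) (H : Matrix (Fin 2) (Fin 2) ℂ → ℂ) (a b c : ℂ) :
    siegelSlash w (trMat x y z) H (symMat a b c) = H (symMat (a + x) (b + y) (c + z)) := by
  have h1 : siegelDenom (trMat x y z) (symMat a b c) = 1 := by
    simp [siegelDenom, trMat]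
  have h2 : siegelNum (trMat x y z) (symMat a b c) = symMat (a + x) (b + y) (c + z) := by
    rw [siegelNum, trMat, toBlocks_fromBlocks₁₁, toBlocks_fromBlocks₁₂]
    ext i j; fin_cases i <;> fin_cases j <;> simp [symMat]
  rw [siegelSlash, siegelAct_eq, h1, h2]
  simp

/-- The matrix of the map `Z ↦ A Z Aᵀ`; here `B` is the inverse of `Aᵀ`. -/
def leviMat (A B : Matrix (Fin 2) (Fin 2) ℤ) : Matrix (Fin 2 ⊕ Fin 2) (Fin 2 ⊕ Fin 2) ℤ :=
  fromBlocks A 0 0 B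

lemma leviMat_mem {A B : Matrix (Fin 2) (Fin 2) ℤ} (h : Aᵀ * B = 1) :
    leviMat A B ∈ symplecticGroup (Fin 2) ℤ := by
  rw [leviMat, SymplecticGroup.fromBlocks_mem_iff]
  exact ⟨by simp, by simp, by simpa using h⟩

lemma siegelSlash_leviMat (w : ℤ) {A B : Matrix (Fin 2) (Fin 2) ℤ} (h : Aᵀ * B = 1)
    (H : Matrix (Fin 2) (Fin 2) ℂ → ℂ) (a b c : ℂ) :
    siegelSlash w (leviMat A B) H (symMat a b c) = (B.det : ℂ) ^ (-w) *
      H (symMat (A 0 0 ^ 2 * a + 2 * A 0 0 * A 0 1 * b + A 0 1 ^ 2 * c)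
        (A 0 0 * A 1 0 * a + (A 0 0 * A 1 1 + A 0 1 * A 1 0) * b + A 0 1 * A 1 1 * c)
        (A 1 0 ^ 2 * a + 2 * A 1 0 * A 1 1 * b + A 1 1 ^ 2 * c)) := by
  have h1 : siegelDenom (leviMat A B) (symMat a b c) = B.map (Int.cast : ℤ → ℂ) := by
    simp [siegelDenom, leviMat]
  have h2 : siegelNum (leviMat A B) (symMat a b c) = A.map (Int.cast : ℤ → ℂ) * symMat a b c := by
    simp [siegelNum, leviMat]
  have h3 : (B.map (Int.cast : ℤ → ℂ))⁻¹ = (A.map (Int.cast : ℤ → ℂ))ᵀ := by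
    refine Matrix.inv_eq_left_inv ?_
    have := congrArg (fun X => X.map (Int.castRingHom ℂ)) h
    rw [Matrix.map_mul, Matrix.map_one _ (map_zero _) (map_one _)] at this
    exact this
  have h4 : (B.map (Int.cast : ℤ → ℂ)).det = (B.det : ℂ) := by
    simp [Matrix.det_fin_two]
  rw [siegelSlash, siegelAct_eq, h1, h2, h3, h4]
  congr 2
  ext i j
  fin_cases i <;> fin_cases j <;>
    simp [symMat, Matrix.mul_apply, Fin.sum_univ_two] <;> ring

/-- The image of `γ ∈ SL₂(ℤ)` under the embedding in the second factor. -/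
def embMat (γ : Matrix (Fin 2) (Fin 2) ℤ) : Matrix (Fin 2 ⊕ Fin 2) (Fin 2 ⊕ Fin 2) ℤ :=
  fromBlocks !![1, 0; 0, γ 0 0] !![0, 0; 0, γ 0 1] !![0, 0; 0, γ 1 0] !![1, 0; 0, γ 1 1]

lemma embMat_mem {γ : Matrix (Fin 2) (Fin 2) ℤ} (h : γ.det = 1) :
    embMat γ ∈ symplecticGroup (Fin 2) ℤ := by
  rw [Matrix.det_fin_two] at h
  rw [embMat, SymplecticGroup.fromBlocks_mem_iff]
  refine ⟨?_, ?_, ?_⟩ <;> ext i j <;> fin_cases i <;> fin_cases j <;>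
    simp [Matrix.mul_apply, Fin.sum_univ_two] <;> linarith

lemma siegelSlash_embMat (w : ℤ) {γ : Matrix (Fin 2) (Fin 2) ℤ} (h : γ.det = 1)
    (H : Matrix (Fin 2) (Fin 2) ℂ → ℂ) (a b c : ℂ) (hc : (γ 1 0 : ℂ) * c + γ 1 1 ≠ 0) :
    siegelSlash w (embMat γ) H (symMat a b c) = ((γ 1 0 : ℂ) * c + γ 1 1) ^ (-w) *
      H (symMat (a - γ 1 0 * b ^ 2 / (γ 1 0 * c + γ 1 1)) (b / (γ 1 0 * c + γ 1 1))
        ((γ 0 0 * c + γ 0 1) / (γ 1 0 * c + γ 1 1))) := by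
  set j := (γ 1 0 : ℂ) * c + γ 1 1 with hj
  have h1 : siegelDenom (embMat γ) (symMat a b c) = !![1, 0; γ 1 0 * b, j] := by
    rw [siegelDenom, embMat, toBlocks_fromBlocks₂₁, toBlocks_fromBlocks₂₂]
    ext i k; fin_cases i <;> fin_cases k <;> simp [symMat, Matrix.mul_apply, Fin.sum_univ_two, hj]
  have h2 : siegelNum (embMat γ) (symMat a b c) = !![a, b; γ 0 0 * b, γ 0 0 * c + γ 0 1] := by
    rw [siegelNum, embMat, toBlocks_fromBlocks₁₁, toBlocks_fromBlocks₁₂]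
    ext i k; fin_cases i <;> fin_cases k <;> simp [symMat, Matrix.mul_apply, Fin.sum_univ_two]
  have h3 : (!![1, 0; γ 1 0 * b, j] : Matrix (Fin 2) (Fin 2) ℂ)⁻¹ =
      !![1, 0; -(γ 1 0 * b / j), 1 / j] := by
    refine Matrix.inv_eq_right_inv ?_
    ext i k; fin_cases i <;> fin_cases k <;> simp [Matrix.mul_apply, Fin.sum_univ_two, hc]
    field_simp
    ring
  have hdet : (γ 0 0 : ℂ) * γ 1 1 - γ 0 1 * γ 1 0 = 1 := by
    rw [Matrix.det_fin_two] at h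
    exact_mod_cast h
  rw [siegelSlash, siegelAct_eq, h1, h2, h3]
  congr 2
  · rw [Matrix.det_fin_two_of]; ring
  · ext i k
    fin_cases i <;> fin_cases k <;>
      simp [symMat, Matrix.mul_apply, Fin.sum_univ_two]
    · field_simp; ring
    · ring
    · field_simp
      rw [hj]
      linear_combination b * hdet
    · ring

/-! ### Slash translates of Siegel cusp forms -/

lemma IsSiegelCuspForm.siegelSlash_eq {N : ℕ} {w : ℤ} {F : Matrix (Fin 2) (Fin 2) ℂ → ℂ}
    (hF : IsSiegelCuspForm N w F) {γ : Matrix (Fin 2 ⊕ Fin 2) (Fin 2 ⊕ Fin 2) ℤ}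
    (hγ : γ ∈ symplecticGroup (Fin 2) ℤ) (hN : ∀ i j, (N : ℤ) ∣ γ.toBlocks₂₁ i j)
    {Z : Matrix (Fin 2) (Fin 2) ℂ} (hZ : Z ∈ siegelH) : siegelSlash w γ F Z = F Z := by
  rw [siegelSlash, hF.transf γ hγ hN Z hZ, ← mul_assoc, ← zpow_add₀ (det_siegelDenom_ne_zero hγ hZ),
    neg_add_cancel, zpow_zero, one_mul]

/-- The principal congruence subgroup of level N is normal: γ δ γ⁻¹ is again congruent to 1 modulo
N, so it fixes F. Hence every translate of F keeps the periods needed for Koecher's argument. -/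
lemma IsSiegelCuspForm.siegelSlash_siegelSlash {N : ℕ} {w : ℤ}
    {F : Matrix (Fin 2) (Fin 2) ℂ → ℂ} (hF : IsSiegelCuspForm N w F)
    {γ δ X : Matrix (Fin 2 ⊕ Fin 2) (Fin 2 ⊕ Fin 2) ℤ} (hγ : γ ∈ symplecticGroup (Fin 2) ℤ)
    (hδ : δ ∈ symplecticGroup (Fin 2) ℤ) (hX : δ = 1 + (N : ℤ) • X)
    {Z : Matrix (Fin 2) (Fin 2) ℂ} (hZ : Z ∈ siegelH) :
    siegelSlash w δ (siegelSlash w γ F) Z = siegelSlash w γ F Z := by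
  let g : symplecticGroup (Fin 2) ℤ := ⟨γ, hγ⟩
  let g' : Matrix (Fin 2 ⊕ Fin 2) (Fin 2 ⊕ Fin 2) ℤ := ((g⁻¹ : symplecticGroup (Fin 2) ℤ) : _)
  have hg1 : g' * γ = 1 := congrArg Subtype.val (inv_mul_cancel g)
  have hg2 : γ * g' = 1 := congrArg Subtype.val (mul_inv_cancel g)
  have hε : γ * δ * g' ∈ symplecticGroup (Fin 2) ℤ :=
    mul_mem (mul_mem hγ hδ) (g⁻¹).2
  have hε' : γ * δ * g' = 1 + (N : ℤ) • (γ * X * g') := by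
    rw [hX, Matrix.mul_add, Matrix.add_mul, Matrix.mul_one, hg2, Matrix.mul_smul, Matrix.smul_mul]
  rw [← siegelSlash_mul w hδ F hZ]
  have h1 : γ * δ = γ * δ * g' * γ := by
    rw [Matrix.mul_assoc (γ * δ), hg1, Matrix.mul_one]
  rw [h1, siegelSlash_mul w hγ F hZ, siegelSlash, hF.siegelSlash_eq hε (fun i j => ?_)
    (siegelAct_mem hγ hZ), siegelSlash]
  rw [hε', toBlocks₂₁, of_apply, Matrix.add_apply, Matrix.one_apply_ne Sum.inr_ne_inl, zero_add,
    Matrix.smul_apply, smul_eq_mul]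
  exact dvd_mul_right _ _

lemma IsSiegelCuspForm.differentiableOn_siegelSlash {N : ℕ} {w : ℤ}
    {F : Matrix (Fin 2) (Fin 2) ℂ → ℂ} (hF : IsSiegelCuspForm N w F)
    {γ : Matrix (Fin 2 ⊕ Fin 2) (Fin 2 ⊕ Fin 2) ℤ} (hγ : γ ∈ symplecticGroup (Fin 2) ℤ) :
    DifferentiableOn ℂ (fun x : ℂ × ℂ × ℂ => siegelSlash w γ F (symMat x.1 x.2.1 x.2.2))
      {x | symMat x.1 x.2.1 x.2.2 ∈ siegelH} := by
  have hsym : ∀ i j, Differentiable ℂ (fun x : ℂ × ℂ × ℂ => symMat x.1 x.2.1 x.2.2 i j) := by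
    intro i j
    fin_cases i <;> fin_cases j <;> simp [symMat]
  have hD : ∀ i j, Differentiable ℂ
      (fun x : ℂ × ℂ × ℂ => siegelDenom γ (symMat x.1 x.2.1 x.2.2) i j) := by
    intro i j
    simp only [siegelDenom, Matrix.add_apply, Matrix.mul_apply, Fin.sum_univ_two]
    have h0 := hsym 0 j
    have h1 := hsym 1 j
    fun_prop
  have hP : ∀ i j, Differentiable ℂ
      (fun x : ℂ × ℂ × ℂ => siegelNum γ (symMat x.1 x.2.1 x.2.2) i j) := by
    intro i j
    simp only [siegelNum, Matrix.add_apply, Matrix.mul_apply, Fin.sum_univ_two]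
    have h0 := hsym 0 j
    have h1 := hsym 1 j
    fun_prop
  have hdet : Differentiable ℂ
      (fun x : ℂ × ℂ × ℂ => (siegelDenom γ (symMat x.1 x.2.1 x.2.2)).det) := by
    simp only [Matrix.det_fin_two]
    have := hD 0 0; have := hD 0 1; have := hD 1 0; have := hD 1 1
    fun_prop
  have hA : ∀ i j, DifferentiableOn ℂ
      (fun x : ℂ × ℂ × ℂ => siegelAct γ (symMat x.1 x.2.1 x.2.2) i j)
      {x | symMat x.1 x.2.1 x.2.2 ∈ siegelH} := by
    intro i j x hx
    have hne := det_siegelDenom_ne_zero hγ hx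
    have hadj : ∀ k l, Differentiable ℂ
        (fun x : ℂ × ℂ × ℂ => (siegelDenom γ (symMat x.1 x.2.1 x.2.2)).adjugate k l) := by
      intro k l
      simp only [Matrix.adjugate_fin_two]
      have := hD 0 0; have := hD 0 1; have := hD 1 0; have := hD 1 1
      fin_cases k <;> fin_cases l <;> simp <;> fun_prop
    simp only [siegelAct_eq, Matrix.inv_def, Ring.inverse_eq_inv',
      Matrix.smul_apply, Matrix.mul_apply, Fin.sum_univ_two, smul_eq_mul]
    refine DifferentiableAt.differentiableWithinAt ?_
    have hinv := hdet.differentiableAt.inv hne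
    exact (((hP i 0) x).mul (hinv.mul (hadj 0 j x))).add
      (((hP i 1) x).mul (hinv.mul (hadj 1 j x)))
  refine DifferentiableOn.mul (fun x hx => ?_) ?_
  · exact (DifferentiableAt.zpow hdet.differentiableAt
      (Or.inl (det_siegelDenom_ne_zero hγ hx))).differentiableWithinAt
  · have hmaps : Set.MapsTo (fun x : ℂ × ℂ × ℂ => (siegelAct γ (symMat x.1 x.2.1 x.2.2) 0 0,
        siegelAct γ (symMat x.1 x.2.1 x.2.2) 0 1, siegelAct γ (symMat x.1 x.2.1 x.2.2) 1 1))
        {x | symMat x.1 x.2.1 x.2.2 ∈ siegelH} {x | symMat x.1 x.2.1 x.2.2 ∈ siegelH} := by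
      intro x hx
      have h := siegelAct_mem hγ hx
      rw [eq_symMat h.1] at h
      exact h
    refine (hF.holo.comp ((hA 0 0).prodMk ((hA 0 1).prodMk (hA 1 1))) hmaps).congr fun x hx => ?_
    rw [eq_symMat (siegelAct_mem hγ hx).1]
    rfl

end

section

open Filter

/-! ### Koecher's argument -/

/-- Holomorphic functions on Siegel's upper half space that are invariant under the congruence
subgroup of level `M` of the Jacobi group, and vanish at the cusp along the diagonal. -/
structure IsJacobiCusp (M : ℝ) (H : ℂ → ℂ → ℂ → ℂ) : Prop where
  pos : 0 < M
  holo : DifferentiableOn ℂ (fun x : ℂ × ℂ × ℂ => H x.1 x.2.1 x.2.2)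
    {x | symMat x.1 x.2.1 x.2.2 ∈ siegelH}
  add_mid : ∀ s z t, symMat s z t ∈ siegelH → H s (z + M) t = H s z t
  add_right : ∀ s z t, symMat s z t ∈ siegelH → H s z (t + M) = H s z t
  shear : ∀ s z t, symMat s z t ∈ siegelH →
    H s (z + M * s) (t + 2 * M * z + M ^ 2 * s) = H s z t
  tendsto : ∀ τ : ℍ, Tendsto (fun y : ℝ => H τ 0 (y * Complex.I)) atTop (𝓝 0)

lemma periodic_eq_Ico {M : ℝ} (hM : 0 < M) {α : Type*} {f : ℝ → α} (hf : Function.Periodic f M)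
    (x : ℝ) : ∃ y ∈ Set.Icc 0 M, f x = f y := by
  obtain ⟨y, hy, h⟩ := hf.exists_mem_Ico₀ hM x
  exact ⟨y, ⟨hy.1, hy.2.le⟩, h⟩

namespace IsJacobiCusp

variable {M : ℝ} {H : ℂ → ℂ → ℂ → ℂ} {s : ℂ}

/-- A parametrization of the points `(z, t)` with `Im t - (Im z)² / Im s = T`. -/
lemma exists_param (hs : 0 < s.im) {T : ℝ} {z t : ℂ} (h : t.im - z.im ^ 2 / s.im = T) :
    ∃ x α y : ℝ, z = x + α * s ∧ t = y + 2 * α * x + α ^ 2 * s + T * Complex.I := by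
  obtain ⟨α, hα⟩ : ∃ α : ℝ, α * s.im = z.im := ⟨z.im / s.im, div_mul_cancel₀ _ hs.ne'⟩
  have e : z.im ^ 2 / s.im = α ^ 2 * s.im := by
    rw [← hα]; field_simp
  rw [e] at h
  refine ⟨z.re - α * s.re, α, t.re - 2 * α * (z.re - α * s.re) - α ^ 2 * s.re, ?_, ?_⟩
  · apply Complex.ext
    · simp
    · simp [hα]
  · apply Complex.ext
    · simp [← Complex.ofReal_pow]
      ring
    · simp [← Complex.ofReal_pow]
      rw [← h]; ring

lemma param_mem (hs : 0 < s.im) {T : ℝ} (hT : 0 < T) (x α y : ℝ) :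
    symMat s (x + α * s) (y + 2 * α * x + α ^ 2 * s + T * Complex.I) ∈ siegelH := by
  rw [symMat_mem_siegelH]
  refine ⟨hs, ?_⟩
  simp [← Complex.ofReal_pow]
  nlinarith [mul_pos hs hT]

/-- In the coordinates z = x + αs, t = y + 2αx + α²s + iT, the three invariances reduce α, then x,
then y to [0, M]. So only a compact set of values has to be bounded. -/
lemma exists_bound_slice (hH : IsJacobiCusp M H) (hs : 0 < s.im) {T : ℝ} (hT : 0 < T) :
    ∃ C : ℝ, ∀ z t : ℂ, t.im - z.im ^ 2 / s.im = T → ‖H s z t‖ ≤ C := by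
  set Ψ : ℝ × ℝ × ℝ → ℂ := fun v => H s (v.1 + v.2.1 * s)
    (v.2.2 + 2 * v.2.1 * v.1 + v.2.1 ^ 2 * s + T * Complex.I) with hΨ
  have hcont : Continuous Ψ := by
    have h1 := hH.holo.continuousOn
    refine h1.comp_continuous (f := fun v : ℝ × ℝ × ℝ => ((s, (v.1 + v.2.1 * s : ℂ),
      (v.2.2 + 2 * v.2.1 * v.1 + v.2.1 ^ 2 * s + T * Complex.I : ℂ)) : ℂ × ℂ × ℂ)) (by fun_prop)
      fun v => param_mem hs hT _ _ _
  obtain ⟨C, hC⟩ := ((isCompact_Icc (a := (0 : ℝ)) (b := M)).prod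
    ((isCompact_Icc (a := (0 : ℝ)) (b := M)).prod
      (isCompact_Icc (a := (0 : ℝ)) (b := M)))).exists_bound_of_continuousOn hcont.continuousOn
  have hy : ∀ x α, Function.Periodic (fun y => Ψ (x, α, y)) M := by
    intro x α y
    have := hH.add_right _ _ _ (param_mem hs hT x α y)
    simp only [hΨ]
    rw [← this]
    congr 1
    push_cast
    ring
  have hα : ∀ x y, Function.Periodic (fun α => Ψ (x, α, y)) M := by
    intro x y α
    have := hH.shear _ _ _ (param_mem hs hT x α y)
    simp only [hΨ]
    rw [← this]
    congr 1 <;> push_cast <;> ring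
  have hx : ∀ x α y, ∃ x' ∈ Set.Icc 0 M, ∃ y', Ψ (x, α, y) = Ψ (x', α, y') := by
    intro x α y
    have h2 : Function.Periodic (fun x' => Ψ (x', α, y + 2 * α * x - 2 * α * x')) M := by
      intro x₁
      have := hH.add_mid _ _ _ (param_mem hs hT x₁ α (y + 2 * α * x - 2 * α * x₁))
      simp only [hΨ]
      rw [← this]
      congr 1 <;> push_cast <;> ring
    obtain ⟨x', hx', h⟩ := periodic_eq_Ico hH.pos h2 x
    refine ⟨x', hx', _, Eq.trans ?_ h⟩
    congr 3
    ring
  refine ⟨C, fun z t h => ?_⟩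
  obtain ⟨x, α, y, rfl, rfl⟩ := exists_param hs h
  change ‖Ψ (x, α, y)‖ ≤ C
  obtain ⟨α', hα', h1⟩ := periodic_eq_Ico hH.pos (hα x y) α
  obtain ⟨x', hx', y', h2⟩ := hx x α' y
  obtain ⟨y'', hy'', h3⟩ := periodic_eq_Ico hH.pos (hy x' α') y'
  rw [h1, h2, h3]
  exact hC _ ⟨hx', hα', hy''⟩

lemma differentiableAt_mid (hH : IsJacobiCusp M H) {z t : ℂ} (h : symMat s z t ∈ siegelH) :
    DifferentiableAt ℂ (fun z => H s z t) z := by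
  have hopen : IsOpen {x : ℂ × ℂ × ℂ | symMat x.1 x.2.1 x.2.2 ∈ siegelH} := by
    simp only [symMat_mem_siegelH, Set.ofPred_and]
    refine IsOpen.inter (isOpen_lt (by fun_prop) (by fun_prop)) (isOpen_lt ?_ ?_) <;> fun_prop
  have h1 : DifferentiableAt ℂ (fun x : ℂ × ℂ × ℂ => H x.1 x.2.1 x.2.2) (s, z, t) :=
    (hH.holo _ h).differentiableAt (hopen.mem_nhds h)
  exact h1.comp (f := fun z : ℂ => ((s, z, t) : ℂ × ℂ × ℂ)) z (by fun_prop)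

lemma differentiableAt_right (hH : IsJacobiCusp M H) {z t : ℂ} (h : symMat s z t ∈ siegelH) :
    DifferentiableAt ℂ (fun t => H s z t) t := by
  have hopen : IsOpen {x : ℂ × ℂ × ℂ | symMat x.1 x.2.1 x.2.2 ∈ siegelH} := by
    simp only [symMat_mem_siegelH, Set.ofPred_and]
    refine IsOpen.inter (isOpen_lt (by fun_prop) (by fun_prop)) (isOpen_lt ?_ ?_) <;> fun_prop
  have h1 : DifferentiableAt ℂ (fun x : ℂ × ℂ × ℂ => H x.1 x.2.1 x.2.2) (s, z, t) :=
    (hH.holo _ h).differentiableAt (hopen.mem_nhds h)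
  exact h1.comp (f := fun t : ℂ => ((s, z, t) : ℂ × ℂ × ℂ)) t (by fun_prop)

/-- Fix t and let z vary. The region Im t - (Im z)²/Im s ≥ T is a horizontal strip in z whose
boundary lines belong to the slice of parameter T. The bound there is independent of t and extends
to the interior by Phragmén-Lindelöf, periodicity in z controlling the growth. -/
lemma exists_bound (hH : IsJacobiCusp M H) (hs : 0 < s.im) {T : ℝ} (hT : 0 < T) :
    ∃ C : ℝ, ∀ z t : ℂ, T ≤ t.im - z.im ^ 2 / s.im → ‖H s z t‖ ≤ C := by
  obtain ⟨C, hC⟩ := hH.exists_bound_slice hs hT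
  refine ⟨C, fun z t hzt => ?_⟩
  set r := √(s.im * (t.im - T)) with hr
  have ht : 0 ≤ t.im - T := by
    have : 0 ≤ z.im ^ 2 / s.im := by positivity
    linarith
  have hr2 : r ^ 2 = s.im * (t.im - T) := Real.sq_sqrt (mul_nonneg hs.le ht)
  have hr0 : 0 ≤ r := Real.sqrt_nonneg _
  have hz : z.im ^ 2 ≤ r ^ 2 := by
    have : z.im ^ 2 / s.im ≤ t.im - T := by linarith
    rw [div_le_iff₀ hs] at this
    rw [hr2]; linarith
  have habs := abs_le_of_sq_le_sq' hz hr0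
  have hmem : ∀ u : ℂ, u.im ∈ Set.Icc (-r) r → symMat s u t ∈ siegelH := by
    intro u hu
    rw [symMat_mem_siegelH]
    refine ⟨hs, ?_⟩
    have h1 : u.im ^ 2 ≤ r ^ 2 := sq_le_sq' hu.1 hu.2
    nlinarith [mul_pos hs hT]
  have hbd : ∀ u : ℂ, u.im ^ 2 = r ^ 2 → ‖H s u t‖ ≤ C := by
    intro u hu
    refine hC u t ?_
    rw [hu, hr2]
    field_simp
    ring
  rcases hr0.eq_or_lt with h0 | h0
  · refine hbd z (le_antisymm hz ?_)
    rw [← h0, zero_pow two_ne_zero]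
    positivity
  -- boundedness on the strip, by periodicity
  obtain ⟨D, hD⟩ : ∃ D : ℝ, ∀ u : ℂ, u.im ∈ Set.Icc (-r) r → ‖H s u t‖ ≤ D := by
    have hcont : ContinuousOn (fun v : ℝ × ℝ => H s (v.1 + v.2 * Complex.I) t)
        (Set.Icc 0 M ×ˢ Set.Icc (-r) r) := by
      intro v hv
      have hv' : symMat s ((v.1 : ℂ) + v.2 * Complex.I) t ∈ siegelH :=
        hmem _ (by simpa using hv.2)
      exact ((hH.differentiableAt_mid hv').continuousAt.comp (f := fun v : ℝ × ℝ =>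
        ((v.1 : ℂ) + v.2 * Complex.I)) (by fun_prop)).continuousWithinAt
    obtain ⟨D, hD⟩ := (isCompact_Icc.prod isCompact_Icc).exists_bound_of_continuousOn hcont
    refine ⟨D, fun u hu => ?_⟩
    have hper : Function.Periodic (fun x : ℝ => H s (x + u.im * Complex.I) t) M := by
      intro x
      have := hH.add_mid s (x + u.im * Complex.I) t (hmem _ (by simpa using hu))
      simp only
      rw [← this]
      congr 1
      push_cast; ring
    obtain ⟨x, hx, h⟩ := periodic_eq_Ico hH.pos hper u.re
    simp only [Complex.re_add_im] at h
    rw [h]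
    exact hD (x, u.im) ⟨hx, hu⟩
  have hclos : closure (Complex.im ⁻¹' Set.Ioo (-r) r) ⊆ Complex.im ⁻¹' Set.Icc (-r) r :=
    closure_minimal (Set.preimage_mono Set.Ioo_subset_Icc_self)
      (isClosed_Icc.preimage Complex.continuous_im)
  refine PhragmenLindelof.horizontal_strip (a := -r) (b := r) (f := fun u => H s u t) ?_ ?_
    (fun u hu => hbd u (by rw [hu]; ring)) (fun u hu => hbd u (by rw [hu])) habs.1 habs.2
  · refine DifferentiableOn.diffContOnCl fun u hu => ?_
    exact (hH.differentiableAt_mid (hmem u (hclos hu))).differentiableWithinAt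
  · refine ⟨0, div_pos Real.pi_pos (by linarith), 0, ?_⟩
    refine Asymptotics.IsBigO.of_bound D ?_
    filter_upwards [mem_inf_of_right (mem_principal_self _)] with u hu
    simpa using hD u ⟨hu.1.le, hu.2.le⟩

/-- At z = 0 the function is periodic and bounded in t, so it has a limit as Im t grows, which must
be the limit 0 known along the imaginary axis. For other z, the function of z is uniformly bounded
on a disc of radius about √(Im s · Im t), and the Schwarz lemma makes the difference to z = 0 tend
to zero. -/
theorem tendsto_zero (hH : IsJacobiCusp M H) (hs : 0 < s.im) (z : ℂ) :
    Tendsto (fun t => H s z t) (comap Complex.im atTop) (𝓝 0) := by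
  obtain ⟨C, hC⟩ := hH.exists_bound hs one_pos
  -- the value at `z = 0`
  have h0 : Tendsto (fun t => H s 0 t) (comap Complex.im atTop) (𝓝 0) := by
    have hmem : ∀ t : ℂ, 1 ≤ t.im → symMat s 0 t ∈ siegelH := by
      intro t ht
      rw [symMat_mem_siegelH]
      refine ⟨hs, ?_⟩
      simpa using mul_pos hs (one_pos.trans_le ht)
    set g : ℂ → ℂ := fun t => H s 0 t with hg
    -- extend periodically below the line
    classical
    set g' : ℂ → ℂ := fun t => if 1 ≤ t.im then g t else 0 with hg'
    have hev : ∀ᶠ t in comap Complex.im atTop, (1 : ℝ) < t.im :=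
      (eventually_gt_atTop (1 : ℝ)).comap _
    have heq : g' =ᶠ[comap Complex.im atTop] g := by
      filter_upwards [hev] with t ht
      simp only [hg', if_pos ht.le]
    have hper : Function.Periodic g' (M : ℂ) := by
      intro t
      simp only [hg', Complex.add_im, Complex.ofReal_im, add_zero]
      split_ifs with h
      · exact hH.add_right s 0 t (hmem t h)
      · rfl
    have hhol : ∀ᶠ t in comap Complex.im atTop, DifferentiableAt ℂ g' t := by
      filter_upwards [hev] with t ht
      have h1 : DifferentiableAt ℂ g t := hH.differentiableAt_right (hmem t ht.le)
      refine h1.congr_of_eventuallyEq ?_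
      filter_upwards [(isOpen_lt continuous_const Complex.continuous_im).mem_nhds ht] with u hu
      simp only [hg', if_pos (le_of_lt hu)]
    have hbd : BoundedAtFilter (comap Complex.im atTop) g' := by
      refine Asymptotics.IsBigO.of_bound C ?_
      filter_upwards [hev] with t ht
      simp only [hg', if_pos ht.le, Pi.one_apply, norm_one, mul_one]
      exact hC 0 t (by simpa using ht.le)
    have hlim := Function.Periodic.tendsto_at_I_inf hH.pos hper hhol hbd
    have hline : Tendsto (fun y : ℝ => (y : ℂ) * Complex.I) atTop (comap Complex.im atTop) := by
      rw [tendsto_comap_iff]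
      refine tendsto_id.congr fun y => ?_
      simp
    have h2 := hlim.comp hline
    have h3 : Tendsto (g' ∘ fun y : ℝ => (y : ℂ) * Complex.I) atTop (𝓝 0) := by
      refine (hH.tendsto ⟨s, hs⟩).congr' ?_
      exact (heq.comp_tendsto hline).symm
    rw [tendsto_nhds_unique h2 h3] at hlim
    exact hlim.congr' heq
  -- the difference, by the Schwarz lemma
  have hC0 : 0 ≤ C := (norm_nonneg _).trans (hC 0 (2 * Complex.I) (by simp))
  have hdiff : Tendsto (fun t => H s z t - H s 0 t) (comap Complex.im atTop) (𝓝 0) := by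
    set ρ : ℂ → ℝ := fun t => √(s.im * (t.im - 1)) with hρ
    have hρlim : Tendsto ρ (comap Complex.im atTop) atTop := by
      refine Real.tendsto_sqrt_atTop.comp (Tendsto.const_mul_atTop hs ?_)
      exact (tendsto_atTop_add_const_right _ (-1) tendsto_comap)
    have hbound : ∀ᶠ t in comap Complex.im atTop,
        ‖H s z t - H s 0 t‖ ≤ (2 * C + 1) / ρ t * ‖z‖ := by
      filter_upwards [hρlim.eventually_gt_atTop ‖z‖, (eventually_gt_atTop (1 : ℝ)).comap _]
        with t ht ht1
      have hρ2 : ρ t ^ 2 = s.im * (t.im - 1) :=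
        Real.sq_sqrt (mul_nonneg hs.le (by linarith [show (1 : ℝ) < t.im from ht1]))
      have hle : ∀ u : ℂ, u ∈ Metric.ball (0 : ℂ) (ρ t) → 1 ≤ t.im - u.im ^ 2 / s.im := by
        intro u hu
        have h1 : |u.im| < ρ t := (Complex.abs_im_le_norm u).trans_lt (by simpa using hu)
        have h2 : u.im ^ 2 ≤ ρ t ^ 2 := by
          rw [← sq_abs u.im]
          exact pow_le_pow_left₀ (abs_nonneg _) h1.le 2
        have h3 : u.im ^ 2 / s.im ≤ t.im - 1 := by
          rw [div_le_iff₀ hs]; linarith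
        linarith
      have hd : DifferentiableOn ℂ (fun u => H s u t) (Metric.ball 0 (ρ t)) := by
        intro u hu
        refine (hH.differentiableAt_mid ?_).differentiableWithinAt
        rw [symMat_mem_siegelH]
        refine ⟨hs, ?_⟩
        have h4 : u.im ^ 2 / s.im < t.im := by linarith [hle u hu]
        rw [div_lt_iff₀ hs] at h4
        linarith
      have hz : z ∈ Metric.ball (0 : ℂ) (ρ t) := by simpa using ht
      have hz0 : (0 : ℂ) ∈ Metric.ball (0 : ℂ) (ρ t) := by
        simpa using (norm_nonneg z).trans_lt ht
      have hmaps : Set.MapsTo (fun u => H s u t) (Metric.ball 0 (ρ t))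
          (Metric.closedBall (H s 0 t) (2 * C + 1)) := by
        intro u hu
        rw [Metric.mem_closedBall, dist_eq_norm]
        have h5 := hC u t (hle u hu)
        have h6 := hC 0 t (hle 0 hz0)
        have h7 := norm_sub_le (H s u t) (H s 0 t)
        linarith
      have := Complex.dist_le_div_mul_dist_of_mapsTo_ball hd hmaps hz
      simpa [dist_eq_norm] using this
    refine squeeze_zero_norm' hbound ?_
    have h1 := hρlim.inv_tendsto_atTop
    have h2 := (h1.const_mul (2 * C + 1)).mul_const ‖z‖
    simpa [div_eq_mul_inv] using h2
  have := hdiff.add h0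
  simpa using this

end IsJacobiCusp

end

section

open Filter Matrix

/-! ### Restriction of Siegel cusp forms -/

lemma IsSiegelCuspForm.isJacobiCusp {N : ℕ} (hN : 0 < N) {w : ℤ}
    {F : Matrix (Fin 2) (Fin 2) ℂ → ℂ} (hF : IsSiegelCuspForm N w F)
    {γ : Matrix (Fin 2 ⊕ Fin 2) (Fin 2 ⊕ Fin 2) ℤ} (hγ : γ ∈ symplecticGroup (Fin 2) ℤ) :
    IsJacobiCusp N (fun s z t => siegelSlash w γ F (symMat s z t)) where
  pos := by exact_mod_cast hN
  holo := hF.differentiableOn_siegelSlash hγ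
  add_mid s z t h := by
    have h1 := hF.siegelSlash_siegelSlash hγ (trMat_mem 0 N 0)
      (X := fromBlocks 0 !![0, 1; 1, 0] 0 0) (by
        rw [trMat, ← fromBlocks_one, fromBlocks_smul, fromBlocks_add]
        congr 1 <;> simp) h
    rw [siegelSlash_trMat] at h1
    simpa using h1
  add_right s z t h := by
    have h1 := hF.siegelSlash_siegelSlash hγ (trMat_mem 0 0 N)
      (X := fromBlocks 0 !![0, 0; 0, 1] 0 0) (by
        rw [trMat, ← fromBlocks_one, fromBlocks_smul, fromBlocks_add]
        congr 1 <;> simp) h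
    rw [siegelSlash_trMat] at h1
    simpa using h1
  shear s z t h := by
    have hAB : (!![1, 0; (N : ℤ), 1] : Matrix (Fin 2) (Fin 2) ℤ)ᵀ * !![1, -(N : ℤ); 0, 1] = 1 := by
      ext i j; fin_cases i <;> fin_cases j <;> simp [Matrix.mul_apply, Fin.sum_univ_two]
    have h1 := hF.siegelSlash_siegelSlash hγ (leviMat_mem hAB)
      (X := fromBlocks !![0, 0; 1, 0] 0 0 !![0, -1; 0, 0]) (by
        rw [leviMat, ← fromBlocks_one, fromBlocks_smul, fromBlocks_add]
        congr 1 <;> ext i j <;> fin_cases i <;> fin_cases j <;> simp) h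
    rw [siegelSlash_leviMat w hAB] at h1
    simp [Matrix.det_fin_two] at h1
    simp only [Complex.ofReal_natCast]
    convert h1 using 3
    · ring
    · ring
  tendsto τ := by
    have := hF.zero_at_cusps γ hγ τ
    simpa only [siegelSlash] using this

lemma tendsto_im_atImInfty : Tendsto (fun τ : ℍ => τ.im) atImInfty atTop := tendsto_comap

/-- The restriction of a Siegel modular form to a line. -/
def siegelSlice (F : Matrix (Fin 2) (Fin 2) ℂ → ℂ) (s r : ℂ) (τ : ℍ) : ℂ := F (symMat s r τ)

lemma sl_siegelSlice (w : ℤ) (F : Matrix (Fin 2) (Fin 2) ℂ → ℂ) (s r : ℂ)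
    {γ : Matrix (Fin 2) (Fin 2) ℤ} (hγ : γ.det = 1) (τ : ℍ) :
    sl w γ (siegelSlice F s r) τ = siegelSlash w (embMat γ) F
      (symMat (s + γ 1 0 * r ^ 2 * (γ 1 0 * τ + γ 1 1)) (r * (γ 1 0 * τ + γ 1 1)) τ) := by
  have hpos : 0 < γ.det := by rw [hγ]; exact one_pos
  have hj := cz_add_d_ne_zero hpos τ
  rw [siegelSlash_embMat w hγ F _ _ _ hj, sl_apply hpos, hγ, siegelSlice, coe_toGL_smul hpos,
    Int.cast_one, _root_.one_zpow, one_mul]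
  congr 3
  · field_simp; ring
  · field_simp

lemma siegelSlice_mem_siegelH {s : ℂ} (hs : 0 < s.im) {r : ℝ}
    {γ : Matrix (Fin 2) (Fin 2) ℤ} (τ : ℍ) :
    symMat (s + γ 1 0 * (r : ℂ) ^ 2 * (γ 1 0 * τ + γ 1 1)) (r * (γ 1 0 * τ + γ 1 1)) τ ∈
      siegelH := by
  have hτ := τ.im_pos
  rw [symMat_mem_siegelH]
  simp [← Complex.ofReal_pow, ← Complex.ofReal_intCast]
  constructor
  · have : 0 ≤ (γ 1 0 : ℝ) * r ^ 2 * (γ 1 0 * τ.im) := by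
      have : (γ 1 0 : ℝ) * r ^ 2 * (γ 1 0 * τ.im) = (γ 1 0 * r) ^ 2 * τ.im := by ring
      rw [this]; positivity
    linarith
  · nlinarith [mul_pos hs hτ]

lemma exists_bezout_of_pos (m : ℤ) {p : ℤ} (hp : 0 < p) :
    ∃ x y v₁ v₂ : ℤ, x * v₂ - y * v₁ = 1 ∧ v₁ * p = m * v₂ ∧ v₂ ≠ 0 := by
  obtain ⟨g, hg⟩ : ∃ g, g = (Int.gcd m p : ℤ) := ⟨_, rfl⟩
  have hg0 : g ≠ 0 := by
    rw [hg]
    exact_mod_cast (Int.gcd_pos_of_ne_zero_right m hp.ne').ne'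
  obtain ⟨v₁, h1⟩ : g ∣ m := hg ▸ Int.gcd_dvd_left ..
  obtain ⟨v₂, h2⟩ : g ∣ p := hg ▸ Int.gcd_dvd_right ..
  have hb := Int.gcd_eq_gcd_ab m p
  rw [← hg] at hb
  refine ⟨Int.gcdB m p, -Int.gcdA m p, v₁, v₂, ?_, ?_, ?_⟩
  · apply mul_left_cancel₀ hg0
    linear_combination -hb - Int.gcdB m p * h2 - Int.gcdA m p * h1
  · rw [h1, h2]; ring
  · rintro rfl
    rw [mul_zero] at h2
    exact hp.ne' h2

/-- After slashing, the argument is a matrix whose τ-part is τ times the rank one form of the vector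
(rc, 1), so all its entries move with τ. As r is rational, an integral unimodular change of basis
makes that vector a multiple of the second basis vector. Then the first two coordinates are
constants s', z', only the last one varies, as t₀ + τ/v₂², and `IsJacobiCusp.tendsto_zero` applies.
-/
lemma tendsto_sl_siegelSlice {N : ℕ} (hN : 0 < N) {w : ℤ}
    {F : Matrix (Fin 2) (Fin 2) ℂ → ℂ} (hF : IsSiegelCuspForm N w F) {s : ℂ} (hs : 0 < s.im)
    (b : ℤ) {p : ℕ} (hp : 0 < p) {γ : Matrix (Fin 2) (Fin 2) ℤ} (hγ : γ.det = 1) :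
    Tendsto (sl w γ (siegelSlice F s (b / p))) atImInfty (𝓝 0) := by
  -- The pair (v₁, v₂) is the primitive integral vector proportional to (bc/p, 1), completed to a
  -- unimodular matrix by x and y.
  obtain ⟨x, y, v₁, v₂, hdet, hv, hv2⟩ :=
    exists_bezout_of_pos (b * γ 1 0) (p := p) (by exact_mod_cast hp)
  have hp0 : (p : ℂ) ≠ 0 := by exact_mod_cast hp.ne'
  set A : Matrix (Fin 2) (Fin 2) ℤ := !![x, v₁; y, v₂] with hA
  set B : Matrix (Fin 2) (Fin 2) ℤ := !![v₂, -y; -v₁, x] with hB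
  have hAB : Aᵀ * B = 1 := by
    ext i j; fin_cases i <;> fin_cases j <;>
      simp [hA, hB, Matrix.mul_apply, Fin.sum_univ_two] <;> linarith
  have hBdet : B.det = 1 := by
    rw [hB, Matrix.det_fin_two_of]; linarith
  set r : ℂ := (b : ℂ) / p with hr
  set c : ℂ := (γ 1 0 : ℂ)
  set d : ℂ := (γ 1 1 : ℂ)
  have hdet' : (x : ℂ) * v₂ - y * v₁ = 1 := by exact_mod_cast hdet
  have hv' : (v₁ : ℂ) = r * c * v₂ := by
    have : (v₁ : ℂ) * p = b * c * v₂ := by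
      have := congrArg (Int.cast : ℤ → ℂ) hv
      push_cast at this
      exact this
    rw [hr]; field_simp; linear_combination this
  have hv20 : (v₂ : ℂ) ≠ 0 := by exact_mod_cast hv2
  have hx : (x : ℂ) - y * (r * c) = 1 / v₂ := by
    field_simp
    rw [hv'] at hdet'
    linear_combination hdet'
  have hx' : (x : ℂ) = y * (r * c) + 1 / v₂ := by linear_combination hx
  set s' : ℂ := v₂ ^ 2 * (s - c * d * r ^ 2) with hs'
  set z' : ℂ := -y * v₂ * (s + c * r ^ 2 * d) + (x * v₂ + y * v₁) * (r * d) with hz'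
  set t₀ : ℂ := y ^ 2 * (s + c * r ^ 2 * d) - 2 * x * y * (r * d) with ht₀
  have hrr : r = ((b / p : ℝ) : ℂ) := by rw [hr]; push_cast; rfl
  have hs'im : 0 < s'.im := by
    have h1 : s' = ((v₂ ^ 2 : ℝ) : ℂ) * (s - ((γ 1 0 * γ 1 1 * (b / p : ℝ) ^ 2 : ℝ) : ℂ)) := by
      rw [hs', hrr]; push_cast; rfl
    rw [h1, Complex.im_ofReal_mul, Complex.sub_im, Complex.ofReal_im, sub_zero]
    have : (v₂ : ℝ) ≠ 0 := by exact_mod_cast hv2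
    positivity
  have hlev := leviMat_mem hAB
  have hemb := embMat_mem hγ
  have key := (hF.isJacobiCusp hN (mul_mem hemb hlev)).tendsto_zero hs'im z'
  have hlim : Tendsto (fun τ : ℍ => t₀ + (τ : ℂ) / v₂ ^ 2) atImInfty (comap Complex.im atTop) := by
    rw [tendsto_comap_iff]
    have h1 : ∀ τ : ℍ, (t₀ + (τ : ℂ) / v₂ ^ 2).im = t₀.im + τ.im / (v₂ : ℝ) ^ 2 := by
      intro τ
      have : ((v₂ : ℂ) ^ 2) = ((v₂ ^ 2 : ℝ) : ℂ) := by push_cast; rfl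
      rw [this, Complex.add_im, Complex.div_ofReal_im]
      simp
    have h2 : (0 : ℝ) < (v₂ : ℝ) ^ 2 := by
      have : (v₂ : ℝ) ≠ 0 := by exact_mod_cast hv2
      positivity
    refine (tendsto_atTop_add_const_left _ t₀.im
      (tendsto_im_atImInfty.atTop_div_const h2)).congr fun τ => (h1 τ).symm
  refine (key.comp hlim).congr' ?_
  have hev : ∀ᶠ τ : ℍ in atImInfty, symMat s' z' (t₀ + (τ : ℂ) / v₂ ^ 2) ∈ siegelH := by
    have h3 : ∀ᶠ t in comap Complex.im atTop, symMat s' z' t ∈ siegelH := by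
      filter_upwards [(eventually_gt_atTop (z'.im ^ 2 / s'.im)).comap _] with t ht
      rw [symMat_mem_siegelH]
      refine ⟨hs'im, ?_⟩
      rw [div_lt_iff₀ hs'im] at ht
      linarith
    exact hlim.eventually h3
  filter_upwards [hev] with τ hτ
  rw [Function.comp_apply, sl_siegelSlice w F s r hγ, siegelSlash_mul w hlev F hτ,
    siegelSlash_leviMat w hAB, hBdet, Int.cast_one, _root_.one_zpow, one_mul]
  congr 1
  simp only [hA, Matrix.of_apply, Matrix.cons_val', Matrix.cons_val_zero, Matrix.cons_val_one,
    Matrix.cons_val_fin_one]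
  congr 1
  · rw [hs', hz', ht₀, hv', hx']
    field_simp
    ring
  · rw [hs', hz', ht₀, hv', hx']
    field_simp
    ring
  · rw [hs', hz', ht₀, hv', hx']
    field_simp
    ring

end

section

open Filter Matrix

/-! ### Averages of restrictions -/

lemma sum_range_eq_sum_zmod {p : ℕ} [NeZero p] (g : ℤ → ℂ) :
    ∑ a ∈ Finset.range p, g a = ∑ x : ZMod p, g (x.val : ℤ) := by
  refine (Finset.sum_nbij' (fun x : ZMod p => x.val) (fun a => (a : ZMod p)) ?_ ?_ ?_ ?_ ?_).symm
  · intro x _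
    exact Finset.mem_range.mpr x.val_lt
  · simp
  · intro x _
    exact ZMod.natCast_zmod_val x
  · intro a ha
    exact ZMod.val_natCast_of_lt (Finset.mem_range.mp ha)
  · intro x _
    rfl

lemma Periodic.eq_of_dvd {p : ℕ} {g : ℤ → ℂ} (hg : Function.Periodic g p) {m n : ℤ}
    (h : (p : ℤ) ∣ m - n) : g m = g n := by
  obtain ⟨c, hc⟩ := h
  have : m = n + c * p := by linarith
  rw [this]
  have := hg.int_mul c n
  simpa using this

lemma eq_zmod_val {p : ℕ} [NeZero p] {g : ℤ → ℂ} (hg : Function.Periodic g p) (m : ℤ) :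
    g m = g ((m : ZMod p).val : ℤ) := by
  refine Periodic.eq_of_dvd hg ?_
  rw [← ZMod.intCast_zmod_eq_zero_iff_dvd]
  simp

lemma sum_range_comp_equiv {p : ℕ} [NeZero p] {g : ℤ → ℂ} (hg : Function.Periodic g p)
    (e : ZMod p ≃ ZMod p) (u : ℤ → ℤ) (hu : ∀ m : ℤ, ((u m : ℤ) : ZMod p) = e m) :
    ∑ a ∈ Finset.range p, g (u a) = ∑ a ∈ Finset.range p, g a := by
  rw [sum_range_eq_sum_zmod (fun m => g (u m)), sum_range_eq_sum_zmod g,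
    ← e.sum_comp (fun x => g (x.val : ℤ))]
  refine Finset.sum_congr rfl fun x _ => ?_
  rw [eq_zmod_val hg, hu]
  simp

lemma sum_sum_range_shift {p : ℕ} (hp : 0 < p) {G : ℤ → ℤ → ℂ}
    (h1 : ∀ b, Function.Periodic (fun a => G a b) p) (h2 : ∀ a, Function.Periodic (G a) p)
    (e : ℕ → ℤ) {d d' : ℤ} (hd : (p : ℤ) ∣ d * d' - 1) :
    ∑ a ∈ Finset.range p, ∑ b ∈ Finset.range p, G (a + e b) (b * d) =
      ∑ a ∈ Finset.range p, ∑ b ∈ Finset.range p, G a b := by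
  have : NeZero p := ⟨hp.ne'⟩
  have hd1 : (d : ZMod p) * d' = 1 := by
    have := (ZMod.intCast_zmod_eq_zero_iff_dvd _ p).mpr hd
    push_cast at this
    exact sub_eq_zero.mp this
  rw [Finset.sum_comm]
  have hA : ∀ b : ℕ, ∑ a ∈ Finset.range p, G (a + e b) (b * d) =
      ∑ a ∈ Finset.range p, G a (b * d) := fun b =>
    sum_range_comp_equiv (h1 (b * d)) (Equiv.addRight ((e b : ℤ) : ZMod p)) (fun m => m + e b)
      (fun m => by simp)
  simp only [hA]
  rw [Finset.sum_comm]
  refine Finset.sum_congr rfl fun a _ => ?_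
  refine sum_range_comp_equiv (h2 a) ⟨fun x => x * d, fun x => x * d', fun x => by
    simp only [mul_assoc, hd1, mul_one], fun x => by
    simp only [mul_assoc, mul_comm (d' : ZMod p), hd1, mul_one]⟩ (fun m => m * d) (fun m => ?_)
  simp

/-- The average of the restrictions of `F` to the lines through the points `(s + a / p, b / p)`. -/
def siegelAvg (F : Matrix (Fin 2) (Fin 2) ℂ → ℂ) (p : ℕ) (s : ℂ) : ℍ → ℂ :=
  ∑ a ∈ Finset.range p, ∑ b ∈ Finset.range p, siegelSlice F (s + a / p) (b / p)

lemma siegelSlash_one (w : ℤ) (F : Matrix (Fin 2) (Fin 2) ℂ → ℂ) (a b c : ℂ) :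
    siegelSlash w 1 F (symMat a b c) = F (symMat a b c) := by
  have := siegelSlash_trMat w 0 0 0 F a b c
  have h : trMat 0 0 0 = 1 := by
    rw [trMat, ← fromBlocks_one]
    congr 1
    ext i j; fin_cases i <;> fin_cases j <;> rfl
  rw [h] at this
  simpa using this

lemma IsSiegelCuspForm.add_int {N : ℕ} {w : ℤ} {F : Matrix (Fin 2) (Fin 2) ℂ → ℂ}
    (hF : IsSiegelCuspForm N w F) (x y z : ℤ) {a b c : ℂ} (h : symMat a b c ∈ siegelH) :
    F (symMat (a + x) (b + y) (c + z)) = F (symMat a b c) := by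
  rw [← siegelSlash_trMat w x y z F, hF.siegelSlash_eq (trMat_mem x y z) (by simp [trMat]) h]

lemma IsSiegelCuspForm.shear {N : ℕ} {w : ℤ} {F : Matrix (Fin 2) (Fin 2) ℂ → ℂ}
    (hF : IsSiegelCuspForm N w F) (m : ℤ) {a b c : ℂ} (h : symMat a b c ∈ siegelH) :
    F (symMat (a + 2 * m * b + m ^ 2 * c) (b + m * c) c) = F (symMat a b c) := by
  have hAB : (!![1, m; 0, 1] : Matrix (Fin 2) (Fin 2) ℤ)ᵀ * !![1, 0; -m, 1] = 1 := by
    ext i j; fin_cases i <;> fin_cases j <;> simp [Matrix.mul_apply, Fin.sum_univ_two]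
  have := hF.siegelSlash_eq (leviMat_mem hAB) (by simp [leviMat]) h
  rw [← this, siegelSlash_leviMat w hAB]
  simp [Matrix.det_fin_two]

lemma mdiff_siegelSlice {N : ℕ} (hN : 0 < N) {w : ℤ} {F : Matrix (Fin 2) (Fin 2) ℂ → ℂ}
    (hF : IsSiegelCuspForm N w F) {s : ℂ} (hs : 0 < s.im) (r : ℝ) :
    MDiff (siegelSlice F s r) := by
  rw [UpperHalfPlane.mdifferentiable_iff]
  intro t ht
  have ht' : 0 < t.im := ht
  have hmem : ∀ t : ℂ, 0 < t.im → symMat s r t ∈ siegelH := fun t ht => by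
    rw [symMat_mem_siegelH]
    exact ⟨hs, by simpa using mul_pos hs ht⟩
  have h1 := (hF.isJacobiCusp hN (one_mem _)).differentiableAt_right (hmem t ht')
  refine (h1.congr_of_eventuallyEq ?_).differentiableWithinAt
  filter_upwards [(isOpen_lt continuous_const Complex.continuous_im).mem_nhds ht'] with u hu
  rw [Function.comp_apply, siegelSlice, siegelSlash_one, ofComplex_apply_of_im_pos hu]

/-- For γ in Γ₀(Np) the embedded matrix lies in the Siegel group of level N and fixes F, but it
moves the line z = b/p. With c = Npc', the integral shear by bNc' removes the dependence on τ and
leaves the line with indices a - Nc'd b² and bd. As d is a unit modulo p, this permutes the pairs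
(a, b) modulo p, so the sum over both is invariant although single slices need not be. -/
theorem siegelAvg_mem {N : ℕ} (hN : 0 < N) {w : ℤ} {F : Matrix (Fin 2) (Fin 2) ℂ → ℂ}
    (hF : IsSiegelCuspForm N w F) {p : ℕ} (hp : 0 < p) {s : ℂ} (hs : 0 < s.im) :
    siegelAvg F p s ∈ cuspSpace (N * p) w := by
  have hp0 : (p : ℂ) ≠ 0 := by exact_mod_cast hp.ne'
  have hsa : ∀ x : ℝ, 0 < (s + x).im := fun x => by simpa using hs
  have hcast : ∀ a : ℕ, s + (a : ℂ) / p = s + ((a / p : ℝ) : ℂ) := fun a => by push_cast; rfl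
  have hcast' : ∀ a : ℕ, (a : ℂ) / p = ((a / p : ℝ) : ℂ) := fun a => by push_cast; rfl
  have hmd : MDiff (siegelAvg F p s) :=
    mdiff_finsetSum _ fun a _ => mdiff_finsetSum _ fun b _ => by
      rw [hcast, hcast' b]
      exact mdiff_siegelSlice hN hF (hsa _) _
  have hinv : ∀ γ ∈ CongruenceSubgroup.Gamma0 (N * p),
      sl w (γ : Matrix (Fin 2) (Fin 2) ℤ) (siegelAvg F p s) = siegelAvg F p s := by
    intro γ hγ
    obtain ⟨c', hc'⟩ := mem_Gamma0_iff_dvd.mp hγ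
    have hdet := γ.det_coe
    funext τ
    set G : ℤ → ℤ → ℂ := fun x y => F (symMat (s + x / p) (y / p) τ) with hG
    have hmem : ∀ x y : ℤ, symMat (s + (x : ℂ) / p) ((y : ℂ) / p) τ ∈ siegelH := by
      intro x y
      have h1 : (x : ℂ) / p = ((x / p : ℝ) : ℂ) := by push_cast; rfl
      have h2 : (y : ℂ) / p = ((y / p : ℝ) : ℂ) := by push_cast; rfl
      rw [symMat_mem_siegelH, h1, h2]
      exact ⟨hsa _, by simpa using mul_pos hs τ.im_pos⟩
    have hG1 : ∀ b, Function.Periodic (fun a => G a b) p := by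
      intro b a
      have := hF.add_int 1 0 0 (hmem a b)
      simp only [hG]
      rw [← this]
      congr 2
      · push_cast; field_simp; ring
      · simp
      · simp
    have hG2 : ∀ a, Function.Periodic (G a) p := by
      intro a b
      have := hF.add_int 0 1 0 (hmem a b)
      simp only [hG]
      rw [← this]
      congr 2
      · simp
      · push_cast; field_simp
      · simp
    have hterm : ∀ a b : ℕ, sl w (γ : Matrix (Fin 2) (Fin 2) ℤ)
        (siegelSlice F (s + a / p) (b / p)) τ =
        G (a + -(N * c' * γ 1 1 * b ^ 2)) (b * γ 1 1) := by
      intro a b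
      have hc : ((γ 1 0 : ℤ) : ℂ) = N * p * c' := by
        rw [hc']; push_cast; ring
      rw [sl_siegelSlice w F _ _ hdet, hF.siegelSlash_eq (embMat_mem hdet)]
      · have h3 := hmem (a + -(N * c' * γ 1 1 * b ^ 2)) (b * γ 1 1)
        rw [hG]
        simp only
        rw [← hF.shear (b * N * c') h3]
        congr 2
        · rw [hc]; push_cast; field_simp; ring
        · rw [hc]; push_cast; field_simp; ring
      · intro i j
        rw [embMat, toBlocks_fromBlocks₂₁]
        fin_cases i <;> fin_cases j <;> simp
        rw [hc']
        exact ⟨p * c', by push_cast; ring⟩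
      · rw [hcast, hcast' b]
        exact siegelSlice_mem_siegelH (hsa _) τ
    rw [siegelAvg, sl_sum]
    simp only [sl_sum, Finset.sum_apply, hterm]
    have hd : (p : ℤ) ∣ γ 1 1 * γ 0 0 - 1 := by
      rw [Matrix.det_fin_two] at hdet
      have : γ 1 1 * γ 0 0 - 1 = γ 0 1 * γ 1 0 := by linear_combination hdet
      rw [this, hc']
      exact ⟨γ 0 1 * N * c', by push_cast; ring⟩
    exact (sum_sum_range_shift hp hG1 hG2 (fun b => -(N * c' * γ 1 1 * b ^ 2)) hd).trans
      (by simp [hG, siegelSlice])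
  have hzero : ∀ γ : SL(2, ℤ), IsZeroAtImInfty (siegelAvg F p s ∣[w] γ) := by
    intro γ
    have h1 : siegelAvg F p s ∣[w] γ = sl w (γ : Matrix (Fin 2) (Fin 2) ℤ) (siegelAvg F p s) := by
      rw [sl, toGL_SL]; rfl
    -- Vanishing at the cusps, unlike invariance, holds for each slice separately.
    rw [h1, siegelAvg, sl_sum]
    simp only [sl_sum]
    change Tendsto _ _ _
    have h2 : Tendsto (fun τ => ∑ a ∈ Finset.range p, ∑ b ∈ Finset.range p,
        sl w (γ : Matrix (Fin 2) (Fin 2) ℤ) (siegelSlice F (s + a / p) (b / p)) τ) atImInfty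
        (𝓝 (∑ a ∈ Finset.range p, ∑ b ∈ Finset.range p, 0)) :=
      tendsto_finsetSum _ fun a _ => tendsto_finsetSum _ fun b _ => by
        have := tendsto_sl_siegelSlice hN hF (s := s + (a : ℂ) / p) (by rw [hcast]; exact hsa _)
          b hp γ.det_coe
        exact_mod_cast this
    simp only [Finset.sum_const_zero] at h2
    refine h2.congr fun τ => ?_
    simp only [Finset.sum_apply]
  have : NeZero (N * p) := ⟨(Nat.mul_pos hN hp).ne'⟩
  let K : S (N * p) w :=
    { toFun := siegelAvg F p s
      slash_action_eq' := by
        rintro _ ⟨γ, hγ, rfl⟩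
        rw [← toGL_SL]
        exact hinv γ hγ
      holo' := hmd
      zero_at_cusps' := fun {c} hc => by
        rw [Subgroup.IsArithmetic.isCusp_iff_isCusp_SL2Z] at hc
        rw [OnePoint.isZeroAt_iff_forall_SL2Z hc]
        exact fun γ _ => hzero γ }
  exact coe_mem_cuspSpace K

end

/-! ### Functions of two variables -/

lemma tensorFun_tmul {M : ℕ} {w : ℤ} (f g : S M w) (τ₁ τ₂ : ℍ) :
    tensorFun M w (f ⊗ₜ[ℂ] g) τ₁ τ₂ = f τ₁ * g τ₂ := rfl

/-- Linear independence of a basis of cusp forms as functions is applied in one variable and then in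
the other. -/
lemma tensorFun_injective {M : ℕ} [NeZero M] {w : ℤ} (hw : 0 < w) :
    Function.Injective (tensorFun M w) := by
  have hfin : FiniteDimensional ℂ (S M w) := finiteDimensional_cuspForm hw
  rw [← LinearMap.ker_eq_bot, LinearMap.ker_eq_bot']
  intro t ht
  let e := Module.finBasis ℂ (S M w)
  have hsum := (e.tensorProduct e).sum_repr t
  set c := (e.tensorProduct e).repr t with hc
  have hfun : ∀ τ₁ τ₂ : ℍ, ∑ i, ∑ j, c (i, j) * (e i τ₁ * e j τ₂) = 0 := by
    intro τ₁ τ₂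
    have h := congrFun (congrFun (congrArg (tensorFun M w) hsum) τ₁) τ₂
    rw [ht, map_sum, Fintype.sum_prod_type] at h
    simpa [Module.Basis.tensorProduct_apply, Finset.sum_apply, tensorFun_tmul] using h
  have hli : ∀ v : Fin (Module.finrank ℂ (S M w)) → ℂ,
      (∀ τ : ℍ, ∑ i, v i * e i τ = 0) → ∀ i, v i = 0 := by
    intro v hv
    refine Fintype.linearIndependent_iff.mp e.linearIndependent v ?_
    refine coeLin_injective M w ?_
    rw [map_sum, map_zero]
    funext τ
    have := hv τ
    simpa [Finset.sum_apply, coeLin] using this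
  have h0 : ∀ i j, c (i, j) = 0 := by
    intro i j
    refine hli (fun j => c (i, j)) (fun τ₂ => ?_) j
    refine hli (fun i => ∑ j, c (i, j) * e j τ₂) (fun τ₁ => ?_) i
    rw [← hfun τ₁ τ₂]
    refine Finset.sum_congr rfl fun i _ => ?_
    rw [Finset.sum_mul]
    exact Finset.sum_congr rfl fun j _ => by ring
  rw [← hsum]
  exact Finset.sum_eq_zero fun ij _ => by rw [h0 ij.1 ij.2, zero_smul]

/-- Expand in a basis with respect to τ₁, with coefficients depending on τ₂. Point evaluations span
the dual of a finite dimensional space of functions, so each coefficient is a finite combination of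
functions Φ τ, and therefore a cusp form in τ₂. -/
lemma exists_tensorFun_eq {M : ℕ} [NeZero M] {w : ℤ} (hw : 0 < w) {Φ : ℍ → ℍ → ℂ}
    (h1 : ∀ τ₁, Φ τ₁ ∈ cuspSpace M w) (h2 : ∀ τ₂, (fun τ₁ => Φ τ₁ τ₂) ∈ cuspSpace M w) :
    ∃ t : S M w ⊗[ℂ] S M w, ∀ τ₁ τ₂ : ℍ, tensorFun M w t τ₁ τ₂ = Φ τ₁ τ₂ := by
  have hfin : FiniteDimensional ℂ (S M w) := finiteDimensional_cuspForm hw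
  set Ψ : ℍ → S M w := fun τ₂ => mkCusp hw _ (h2 τ₂) with hΨ
  let ev : ℍ → (S M w →ₗ[ℂ] ℂ) := fun τ => (LinearMap.proj τ) ∘ₗ coeLin M w
  have htop : Submodule.span ℂ (Set.range ev) = ⊤ := by
    refine Submodule.span_eq_top_of_ne_zero fun f hf => ?_
    by_contra! h
    exact hf (DFunLike.ext _ _ fun τ => h _ ⟨τ, rfl⟩)
  let Q : Submodule ℂ (S M w →ₗ[ℂ] ℂ) :=
    { carrier := {ξ | (fun τ₂ => ξ (Ψ τ₂)) ∈ cuspSpace M w}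
      add_mem' := fun {x y} hx hy => by
        have h : (fun τ₂ => x (Ψ τ₂)) ∈ cuspSpace M w := hx
        have h' : (fun τ₂ => y (Ψ τ₂)) ∈ cuspSpace M w := hy
        exact Submodule.add_mem _ h h'
      zero_mem' := Submodule.zero_mem (cuspSpace M w)
      smul_mem' := fun c x hx => by
        have h : (fun τ₂ => x (Ψ τ₂)) ∈ cuspSpace M w := hx
        exact Submodule.smul_mem _ c h }
  have hQ : ∀ ξ : S M w →ₗ[ℂ] ℂ, (fun τ₂ => ξ (Ψ τ₂)) ∈ cuspSpace M w := by
    have : Submodule.span ℂ (Set.range ev) ≤ Q := by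
      rw [Submodule.span_le]
      rintro _ ⟨τ, rfl⟩
      exact h1 τ
    intro ξ
    have h3 : ξ ∈ Submodule.span ℂ (Set.range ev) := htop ▸ trivial
    exact this h3
  let e := Module.finBasis ℂ (S M w)
  refine ⟨∑ i, e i ⊗ₜ[ℂ] mkCusp hw _ (hQ (e.coord i)), fun τ₁ τ₂ => ?_⟩
  have h4 := congrArg (fun f : S M w => f τ₁) (e.sum_repr (Ψ τ₂))
  have h5 : coeLin M w (∑ i, e.repr (Ψ τ₂) i • e i) τ₁ = Φ τ₁ τ₂ := h4
  rw [map_sum, Finset.sum_apply] at h5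
  rw [map_sum, Finset.sum_apply, Finset.sum_apply, ← h5]
  refine Finset.sum_congr rfl fun i _ => ?_
  rw [tensorFun_tmul, map_smul, Pi.smul_apply, smul_eq_mul, mul_comm]
  rfl

lemma tensorFun_pullback {M : ℕ} [NeZero M] {w : ℤ} (hw : 0 < w)
    {F : Matrix (Fin 2) (Fin 2) ℂ → ℂ}
    (h1 : ∀ τ₁ : ℍ, (fun τ₂ : ℍ => F (symMat τ₁ 0 τ₂)) ∈ cuspSpace M w)
    (h2 : ∀ τ₂ : ℍ, (fun τ₁ : ℍ => F (symMat τ₁ 0 τ₂)) ∈ cuspSpace M w) (τ₁ τ₂ : ℍ) :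
    tensorFun M w (pullback M w F) τ₁ τ₂ = F (symMat τ₁ 0 τ₂) := by
  have H := exists_tensorFun_eq hw (Φ := fun τ₁ τ₂ => F (symMat τ₁ 0 τ₂)) h1 h2
  rw [pullback, dif_pos H]
  exact H.choose_spec τ₁ τ₂

/-! ### Pullbacks of Siegel cusp forms -/

namespace IsSiegelCuspForm

variable {N : ℕ} {w : ℤ} {F : Matrix (Fin 2) (Fin 2) ℂ → ℂ}

lemma swap (hF : IsSiegelCuspForm N w F) {a b c : ℂ} (h : symMat a b c ∈ siegelH) :
    F (symMat c b a) = (-1) ^ w * F (symMat a b c) := by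
  have hAB : (!![0, 1; 1, 0] : Matrix (Fin 2) (Fin 2) ℤ).transpose * !![0, 1; 1, 0] = 1 := by
    ext i j; fin_cases i <;> fin_cases j <;> simp [Matrix.mul_apply, Fin.sum_univ_two]
  have := hF.siegelSlash_eq (leviMat_mem hAB) (by simp [leviMat]) h
  rw [← this, siegelSlash_leviMat w hAB]
  simp [Matrix.det_fin_two]
  rw [← mul_assoc, mul_inv_cancel₀ (zpow_ne_zero _ (by norm_num)), one_mul]

lemma slice_mem (hN : 0 < N) (hF : IsSiegelCuspForm N w F) (τ : ℍ) :
    (fun τ₂ : ℍ => F (symMat τ 0 τ₂)) ∈ cuspSpace N w := by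
  -- With p = 1 the average consists of the single slice z = 0.
  have := siegelAvg_mem hN hF one_pos (s := τ) τ.im_pos
  rw [mul_one] at this
  convert this using 1
  funext τ₂
  simp [siegelAvg, siegelSlice]

lemma slice_mem' (hN : 0 < N) (hF : IsSiegelCuspForm N w F) (τ : ℍ) :
    (fun τ₁ : ℍ => F (symMat τ₁ 0 τ)) ∈ cuspSpace N w := by
  convert Submodule.smul_mem _ (((-1 : ℂ)) ^ w) (hF.slice_mem hN τ) using 1
  funext τ₁
  refine hF.swap ?_
  rw [symMat_mem_siegelH]
  exact ⟨τ.im_pos, by simpa using mul_pos τ.im_pos τ₁.im_pos⟩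

/-- Of the three sums in the operator U, the one over the lower right entry is U_p in τ₂, with
factor p⁻¹; the other two form the average over lines. -/
lemma siegelU_eq {p : ℕ} (hp : 0 < p) (F : Matrix (Fin 2) (Fin 2) ℂ → ℂ) (τ₁ τ₂ : ℍ) :
    siegelU p F (symMat τ₁ 0 τ₂) =
      ((p : ℂ) ^ 2)⁻¹ * opU p (siegelAvg F p (τ₁ / p)) τ₂ := by
  have hp0 : (p : ℂ) ≠ 0 := by exact_mod_cast hp.ne'
  have hpr : (0 : ℝ) < p := by exact_mod_cast hp
  have hterm : ∀ a b c : ℕ, F ((p : ℂ)⁻¹ • (symMat τ₁ 0 τ₂ + symMat a b c)) =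
      siegelSlice F ((τ₁ : ℂ) / p + a / p) (b / p)
        (ofComplex (((τ₂ : ℂ) + c) / p)) := by
    intro a b c
    rw [siegelSlice, ofComplex_apply_of_im_pos (by
      simpa using div_pos τ₂.im_pos hpr)]
    congr 1
    ext i j
    fin_cases i <;> fin_cases j <;> simp [symMat] <;> ring
  simp only [siegelU, hterm]
  change _ = ((p : ℂ) ^ 2)⁻¹ * ((p : ℂ)⁻¹ * ∑ c ∈ Finset.range p,
    siegelAvg F p (τ₁ / p) (ofComplex (((τ₂ : ℂ) + (c : ℂ)) / (p : ℂ))))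
  rw [← mul_assoc, ← mul_inv, ← pow_succ]
  congr 1
  simp only [siegelAvg, Finset.sum_apply]
  symm
  rw [Finset.sum_comm]
  exact Finset.sum_congr rfl fun a _ => Finset.sum_comm

lemma siegelU_slice_mem (hN : 0 < N) (hF : IsSiegelCuspForm N w F) {p : ℕ} (hp : p.Prime)
    (τ : ℍ) : (fun τ₂ : ℍ => siegelU p F (symMat τ 0 τ₂)) ∈ cuspSpace (N * p) w := by
  have hpr : (0 : ℝ) < p := by exact_mod_cast hp.pos
  have h1 := siegelAvg_mem hN hF hp.pos (s := τ / p) (by simpa using div_pos τ.im_pos hpr)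
  convert Submodule.smul_mem _ (((p : ℂ) ^ 2)⁻¹) (opU_mem hp (dvd_mul_left p N) h1) using 1
  funext τ₂
  exact siegelU_eq hp.pos F τ τ₂

lemma siegelU_swap (hF : IsSiegelCuspForm N w F) {p : ℕ} (hp : 0 < p) (τ₁ τ₂ : ℍ) :
    siegelU p F (symMat τ₂ 0 τ₁) = (-1) ^ w * siegelU p F (symMat τ₁ 0 τ₂) := by
  have hpr : (0 : ℝ) < p := by exact_mod_cast hp
  have hterm : ∀ a b c : ℕ, F ((p : ℂ)⁻¹ • (symMat τ₂ 0 τ₁ + symMat a b c)) =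
      (-1) ^ w * F ((p : ℂ)⁻¹ • (symMat τ₁ 0 τ₂ + symMat c b a)) := by
    intro a b c
    have e : ∀ (τ₁ τ₂ : ℍ) (a b c : ℕ), (p : ℂ)⁻¹ • (symMat τ₁ 0 τ₂ + symMat a b c) =
        symMat (((p : ℝ)⁻¹ : ℝ) * (τ₁ + a)) (((p : ℝ)⁻¹ * b : ℝ)) (((p : ℝ)⁻¹ : ℝ) * (τ₂ + c)) := by
      intro τ₁ τ₂ a b c
      ext i j
      fin_cases i <;> fin_cases j <;> simp [symMat]
    rw [e, e]
    refine hF.swap ?_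
    rw [symMat_mem_siegelH, Complex.im_ofReal_mul, Complex.im_ofReal_mul, Complex.ofReal_im]
    simp only [Complex.add_im, Complex.natCast_im, add_zero, coe_im]
    have h1 := τ₁.im_pos
    have h2 := τ₂.im_pos
    constructor
    · positivity
    · rw [zero_pow two_ne_zero]; positivity
  rw [siegelU, siegelU]
  simp only [hterm, ← Finset.mul_sum]
  rw [mul_left_comm]
  congr 2
  rw [Finset.sum_comm, Finset.sum_congr rfl fun b _ => Finset.sum_comm, Finset.sum_comm]

lemma siegelU_slice_mem' (hN : 0 < N) (hF : IsSiegelCuspForm N w F) {p : ℕ} (hp : p.Prime)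
    (τ : ℍ) : (fun τ₁ : ℍ => siegelU p F (symMat τ₁ 0 τ)) ∈ cuspSpace (N * p) w := by
  convert Submodule.smul_mem _ (((-1 : ℂ)) ^ w) (hF.siegelU_slice_mem hN hp τ) using 1
  funext τ₁
  exact hF.siegelU_swap hp.pos τ τ₁

end IsSiegelCuspForm

/-! ### Fourier coefficients of Saito--Kurokawa lifts -/

lemma sum_divisors_prime_mul {p g : ℕ} (hp : p.Prime) (hg : g ≠ 0) {N : ℕ} (hpN : ¬ p ∣ N)
    (f : ℕ → ℂ) :
    ∑ d ∈ (Nat.divisors (p * g)).filter (Nat.Coprime · N), f d =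
      ∑ d ∈ (Nat.divisors g).filter (Nat.Coprime · N), f (p * d) +
        ∑ d ∈ ((Nat.divisors g).filter (Nat.Coprime · N)).filter (¬ p ∣ ·), f d := by
  rw [← Finset.sum_filter_add_sum_filter_not _ (p ∣ ·)]
  congr 1
  · symm
    refine Finset.sum_nbij (p * ·) ?_ ?_ ?_ ?_
    · intro d hd
      simp only [Finset.mem_filter, Nat.mem_divisors] at hd ⊢
      exact ⟨⟨⟨mul_dvd_mul_left p hd.1.1, mul_ne_zero hp.ne_zero hg⟩,
        Nat.Coprime.mul_left ((Nat.Prime.coprime_iff_not_dvd hp).mpr hpN) hd.2⟩,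
        dvd_mul_right p d⟩
    · intro a _ b _ h
      exact Nat.eq_of_mul_eq_mul_left hp.pos h
    · intro d hd
      simp only [Finset.coe_filter, Finset.mem_filter, Nat.mem_divisors, Set.mem_ofPred_eq] at hd
      obtain ⟨⟨⟨h1, -⟩, h2⟩, d', rfl⟩ := hd
      refine ⟨d', ?_, rfl⟩
      simp only [Finset.coe_filter, Nat.mem_divisors, Set.mem_ofPred_eq]
      exact ⟨⟨Nat.dvd_of_mul_dvd_mul_left hp.pos h1, hg⟩, h2.coprime_dvd_left (dvd_mul_left d' p)⟩
    · intro d _; rfl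
  · refine Finset.sum_congr ?_ fun d _ => rfl
    ext d
    simp only [Finset.mem_filter, Nat.mem_divisors]
    constructor
    · rintro ⟨⟨⟨h1, -⟩, h2⟩, h3⟩
      exact ⟨⟨⟨((Nat.Prime.coprime_iff_not_dvd hp).mpr h3).symm.dvd_of_dvd_mul_left h1, hg⟩, h2⟩, h3⟩
    · rintro ⟨⟨⟨h1, -⟩, h2⟩, h3⟩
      exact ⟨⟨⟨h1.mul_left p, mul_ne_zero hp.ne_zero hg⟩, h2⟩, h3⟩

/-- `gcd(n, r, m)`. -/
def gcd3 (n r m : ℤ) : ℕ := Int.gcd (Int.gcd n r) m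

lemma gcd3_mul (p : ℕ) (n r m : ℤ) : gcd3 (p * n) (p * r) (p * m) = p * gcd3 n r m := by
  rw [gcd3, Int.gcd_mul_left, Int.natAbs_natCast, Nat.cast_mul, Int.gcd_mul_left,
    Int.natAbs_natCast]
  rfl

lemma dvd_gcd3 {d : ℕ} {n r m : ℤ} : d ∣ gcd3 n r m ↔ (d : ℤ) ∣ n ∧ (d : ℤ) ∣ r ∧ (d : ℤ) ∣ m := by
  constructor
  · intro h
    have h1 : (d : ℤ) ∣ (Int.gcd n r : ℤ) :=
      (Int.natCast_dvd_natCast.mpr h).trans (Int.gcd_dvd_left ..)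
    exact ⟨h1.trans (Int.gcd_dvd_left ..), h1.trans (Int.gcd_dvd_right ..),
      (Int.natCast_dvd_natCast.mpr h).trans (Int.gcd_dvd_right ..)⟩
  · rintro ⟨h1, h2, h3⟩
    exact Int.natCast_dvd_natCast.mp (Int.dvd_coe_gcd (Int.dvd_coe_gcd h1 h2) h3)

/-- `∑ d^k c(x (4 n m - r²) / d²)`, over the divisors `d` of `gcd(n, r, m)` prime to `N`. -/
def skSum (N k : ℕ) (h : ℍ → ℂ) (n r m : ℤ) : ℂ :=
  ∑ d ∈ (Nat.divisors (gcd3 n r m)).filter (Nat.Coprime · N),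
    (d : ℂ) ^ k * coeff h ((4 * n * m - r ^ 2) / (d : ℤ) ^ 2).toNat

/-- The part of `skSum` with `p ∤ d`, where the argument of the coefficients is multiplied by
`p^(2 i)`. -/
def skPart (N k p i : ℕ) (h : ℍ → ℂ) (n r m : ℤ) : ℂ :=
  ∑ d ∈ ((Nat.divisors (gcd3 n r m)).filter (Nat.Coprime · N)).filter (¬ p ∣ ·),
    (d : ℂ) ^ k * coeff h (p ^ (2 * i) * ((4 * n * m - r ^ 2) / (d : ℤ) ^ 2).toNat)

lemma exists_disc_eq {d : ℕ} (hd : d ≠ 0) {n r m : ℤ} (h : d ∣ gcd3 n r m)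
    (hD : 0 < 4 * n * m - r ^ 2) :
    ∃ n₁ r₁ m₁ : ℤ, ∃ v : ℕ, n = d * n₁ ∧ r = d * r₁ ∧ m = d * m₁ ∧ 0 < v ∧
      (v : ℤ) = 4 * n₁ * m₁ - r₁ ^ 2 ∧ 4 * n * m - r ^ 2 = (d : ℤ) ^ 2 * v := by
  obtain ⟨⟨n₁, rfl⟩, ⟨r₁, rfl⟩, ⟨m₁, rfl⟩⟩ := dvd_gcd3.mp h
  have hd' : (0 : ℤ) < (d : ℤ) ^ 2 := by positivity
  have e : 4 * (d * n₁) * (d * m₁) - (d * r₁) ^ 2 = (d : ℤ) ^ 2 * (4 * n₁ * m₁ - r₁ ^ 2) := by ring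
  have hpos : 0 < 4 * n₁ * m₁ - r₁ ^ 2 := by
    rw [e] at hD
    exact pos_of_mul_pos_right hD hd'.le
  refine ⟨n₁, r₁, m₁, (4 * n₁ * m₁ - r₁ ^ 2).toNat, rfl, rfl, rfl, by omega,
    Int.toNat_of_nonneg hpos.le, ?_⟩
  rw [Int.toNat_of_nonneg hpos.le, e]

lemma gcd3_ne_zero {n r m : ℤ} (hn : 0 < n) : gcd3 n r m ≠ 0 := by
  intro h
  have := (dvd_gcd3 (d := 0) (n := n) (r := r) (m := m)).mp (by rw [h])
  simp at this
  omega

lemma toNat_ediv {d v : ℕ} (hd : d ≠ 0) {x : ℤ} (h : x = (d : ℤ) ^ 2 * v) :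
    (x / (d : ℤ) ^ 2).toNat = v := by
  rw [h, Int.mul_ediv_cancel_left _ (by positivity), Int.toNat_natCast]

section

variable {N k p : ℕ} {h : ℍ → ℂ} {n r m : ℤ}

/-- The divisors of p · gcd divisible by p reproduce the old sum with the factor p^k; for those
prime to p the discriminant gains a factor p². -/
lemma skSum_mul (hp : p.Prime) (hpN : ¬ p ∣ N) (hn : 0 < n) (hD : 0 < 4 * n * m - r ^ 2) :
    skSum N k h (p * n) (p * r) (p * m) =
      (p : ℂ) ^ k * skSum N k h n r m + skPart N k p 1 h n r m := by
  rw [skSum, gcd3_mul, sum_divisors_prime_mul hp (gcd3_ne_zero hn) hpN, skSum, skPart,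
    Finset.mul_sum]
  have e : 4 * (p * n) * (p * m) - (p * r) ^ 2 = (p : ℤ) ^ 2 * (4 * n * m - r ^ 2) := by ring
  have hp0 : (p : ℤ) ≠ 0 := by exact_mod_cast hp.ne_zero
  congr 1
  · refine Finset.sum_congr rfl fun d hd => ?_
    rw [e]
    push_cast
    rw [mul_pow, mul_pow, Int.mul_ediv_mul_of_pos _ _ (by positivity)]
    ring
  · refine Finset.sum_congr rfl fun d hd => ?_
    simp only [Finset.mem_filter, Nat.mem_divisors] at hd
    have hd0 : d ≠ 0 := by rintro rfl; exact hd.1.1.2 (zero_dvd_iff.mp hd.1.1.1)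
    obtain ⟨n₁, r₁, m₁, v, -, -, -, -, -, hv⟩ := exists_disc_eq hd0 hd.1.1.1 hD
    rw [toNat_ediv hd0 hv, toNat_ediv (v := p ^ 2 * v) hd0 (by rw [e, hv]; push_cast; ring)]

lemma skPart_mul (hp : p.Prime) (i : ℕ) (hn : 0 < n) (hD : 0 < 4 * n * m - r ^ 2) :
    skPart N k p i h (p * n) (p * r) (p * m) = skPart N k p (i + 1) h n r m := by
  have e : 4 * (p * n) * (p * m) - (p * r) ^ 2 = (p : ℤ) ^ 2 * (4 * n * m - r ^ 2) := by ring
  rw [skPart, skPart, gcd3_mul]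
  refine Finset.sum_congr ?_ fun d hd => ?_
  · ext d
    simp only [Finset.mem_filter, Nat.mem_divisors]
    constructor
    · rintro ⟨⟨⟨h1, -⟩, h2⟩, h3⟩
      exact ⟨⟨⟨((Nat.Prime.coprime_iff_not_dvd hp).mpr h3).symm.dvd_of_dvd_mul_left h1,
        gcd3_ne_zero hn⟩, h2⟩, h3⟩
    · rintro ⟨⟨⟨h1, h4⟩, h2⟩, h3⟩
      exact ⟨⟨⟨h1.mul_left p, mul_ne_zero hp.ne_zero h4⟩, h2⟩, h3⟩
  · simp only [Finset.mem_filter, Nat.mem_divisors] at hd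
    have hd0 : d ≠ 0 := by rintro rfl; exact hd.1.1.2 (zero_dvd_iff.mp hd.1.1.1)
    obtain ⟨n₁, r₁, m₁, v, -, -, -, -, -, hv⟩ := exists_disc_eq hd0 hd.1.1.1 hD
    rw [toNat_ediv hd0 hv, toNat_ediv (v := p ^ 2 * v) hd0 (by rw [e, hv]; push_cast; ring)]
    congr 2
    ring

lemma skSum_eq_skPart (hpr : ¬ p ∣ gcd3 n r m) :
    skSum N k h n r m = skPart N k p 0 h n r m := by
  rw [skSum, skPart, Finset.filter_true_of_mem (p := (¬ p ∣ ·))]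
  · refine Finset.sum_congr rfl fun d _ => ?_
    rw [mul_zero, pow_zero, one_mul]
  · intro d hd hpd
    simp only [Finset.mem_filter, Nat.mem_divisors] at hd
    exact hpr (hpd.trans hd.1.1)

lemma isPlusIndex_of_eq (hk : Odd k) {v : ℕ} {x y : ℤ} (hv : (v : ℤ) = 4 * y - x ^ 2) :
    IsPlusIndex k v := by
  rw [IsPlusIndex, hk.neg_one_pow, hv]
  rcases Int.even_or_odd x with ⟨z, rfl⟩ | ⟨z, rfl⟩
  · left
    have : -1 * (4 * y - (z + z) ^ 2) = 4 * (z ^ 2 - y) := by ring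
    rw [this]; omega
  · right
    have : -1 * (4 * y - (2 * z + 1) ^ 2) = 1 + 4 * (z ^ 2 + z - y) := by ring
    rw [this]; omega

/-- This is the eigenvalue equation at index p² v, where the quadratic symbol vanishes and the last
term returns to v. -/
lemma halfHecke_of_dvd {a : ℂ} (hp2 : p ≠ 2) (hp : p.Prime) (hk : Odd k)
    (heig : ∀ v : ℕ, IsPlusIndex k v → halfHeckeCoeff k p h v = a * coeff h v) {v : ℕ} {x y : ℤ}
    (hv : (v : ℤ) = 4 * y - x ^ 2) :
    coeff h (p ^ (2 * 2) * v) = a * coeff h (p ^ (2 * 1) * v) -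
      (p : ℂ) ^ (2 * k - 1) * coeff h v := by
  have hplus : IsPlusIndex k (p ^ 2 * v) := isPlusIndex_of_eq hk (x := p * x) (y := p ^ 2 * y) (by
    push_cast; rw [hv]; ring)
  have h1 := heig _ hplus
  have hj : jacobiSym ((-1) ^ k * ((p ^ 2 * v : ℕ) : ℤ)) p = 0 := by
    have : NeZero p := ⟨hp.ne_zero⟩
    rw [jacobiSym.eq_zero_iff]
    refine ⟨hp.ne_zero, fun h0 => hp.one_lt.ne' ?_⟩
    have h2 : p ∣ Int.gcd ((-1) ^ k * ((p ^ 2 * v : ℕ) : ℤ)) p :=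
      Int.dvd_gcd (Dvd.dvd.mul_left (by exact_mod_cast (Dvd.intro (p * v) (by ring))) _) dvd_rfl
    rw [h0] at h2
    exact Nat.dvd_one.mp h2
  rw [halfHeckeCoeff, kronecker, if_neg hp2, hj, if_pos (dvd_mul_right _ _),
    Nat.mul_div_cancel_left _ (by positivity [hp.pos])] at h1
  rw [mul_one, ← h1]
  have e : p ^ (2 * 2) * v = p ^ 2 * (p ^ 2 * v) := by ring
  rw [e]
  simp

/-- Here -v = x² - 4y is a non-zero square modulo p, so the symbol, with sign -1 because k is odd,
equals 1; also p² ∤ v, so the last term of the Hecke equation is absent. -/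
lemma halfHecke_of_not_dvd {a : ℂ} (hp2 : p ≠ 2) (hp : p.Prime) (hk : Odd k)
    (heig : ∀ v : ℕ, IsPlusIndex k v → halfHeckeCoeff k p h v = a * coeff h v) {v : ℕ} {x y : ℤ}
    (hv : (v : ℤ) = 4 * y - x ^ 2) (hx : ¬ (p : ℤ) ∣ x) (hy : (p : ℤ) ∣ y) :
    coeff h (p ^ (2 * 1) * v) = (a - (p : ℂ) ^ (k - 1)) * coeff h v := by
  have h1 := heig _ (isPlusIndex_of_eq hk hv)
  have hpp : Prime (p : ℤ) := Nat.prime_iff_prime_int.mp hp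
  have hpv : ¬ (p : ℤ) ∣ v := fun h0 => by
    rw [hv] at h0
    exact hx (hpp.dvd_of_dvd_pow ((dvd_sub_right (hy.mul_left 4)).mp h0))
  have hpv2 : ¬ p ^ 2 ∣ v := fun h0 => hpv
    (by exact_mod_cast (dvd_pow_self p two_ne_zero).trans h0)
  have hj : jacobiSym ((-1) ^ k * (v : ℤ)) p = 1 := by
    have h2 : ((-1) ^ k * (v : ℤ)) % p = x ^ 2 % p := by
      rw [hk.neg_one_pow, hv]
      apply Int.emod_emod_of_dvd _ dvd_rfl |>.symm.trans
      have : (-1) * (4 * y - x ^ 2) ≡ x ^ 2 [ZMOD p] := by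
        apply Int.ModEq.symm
        rw [Int.modEq_iff_dvd]
        have : (-1) * (4 * y - x ^ 2) - x ^ 2 = -4 * y := by ring
        rw [this]
        exact hy.mul_left _
      rw [Int.emod_emod_of_dvd _ dvd_rfl]
      exact this
    rw [jacobiSym.mod_left, h2, ← jacobiSym.mod_left]
    refine jacobiSym.sq_one' ?_
    rw [Int.gcd_comm]
    exact Int.isCoprime_iff_gcd_eq_one.mp ((Prime.coprime_iff_not_dvd hpp).mpr hx)
  rw [halfHeckeCoeff, kronecker, if_neg hp2, hj, if_neg hpv2] at h1
  push_cast at h1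
  rw [mul_one]
  linear_combination h1

lemma skPart_two {a : ℂ} (hp2 : p ≠ 2) (hp : p.Prime) (hk : Odd k)
    (heig : ∀ v : ℕ, IsPlusIndex k v → halfHeckeCoeff k p h v = a * coeff h v)
    (hD : 0 < 4 * n * m - r ^ 2) :
    skPart N k p 2 h n r m = a * skPart N k p 1 h n r m -
      (p : ℂ) ^ (2 * k - 1) * skPart N k p 0 h n r m := by
  rw [skPart, skPart, skPart, Finset.mul_sum, Finset.mul_sum, ← Finset.sum_sub_distrib]
  refine Finset.sum_congr rfl fun d hd => ?_
  simp only [Finset.mem_filter, Nat.mem_divisors] at hd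
  have hd0 : d ≠ 0 := by rintro rfl; exact hd.1.1.2 (zero_dvd_iff.mp hd.1.1.1)
  obtain ⟨n₁, r₁, m₁, v, -, -, -, -, hv₁, hv⟩ := exists_disc_eq hd0 hd.1.1.1 hD
  rw [toNat_ediv hd0 hv, halfHecke_of_dvd hp2 hp hk heig (x := r₁) (y := n₁ * m₁)
    (by rw [hv₁]; ring), mul_zero, pow_zero, one_mul]
  ring

lemma skPart_one {a : ℂ} (hp2 : p ≠ 2) (hp : p.Prime) (hk : Odd k)
    (heig : ∀ v : ℕ, IsPlusIndex k v → halfHeckeCoeff k p h v = a * coeff h v)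
    (hn : (p : ℤ) ∣ n) (hr : ¬ (p : ℤ) ∣ r) (hD : 0 < 4 * n * m - r ^ 2) :
    skPart N k p 1 h n r m = (a - (p : ℂ) ^ (k - 1)) * skPart N k p 0 h n r m := by
  have hpp : Prime (p : ℤ) := Nat.prime_iff_prime_int.mp hp
  rw [skPart, skPart, Finset.mul_sum]
  refine Finset.sum_congr rfl fun d hd => ?_
  simp only [Finset.mem_filter, Nat.mem_divisors] at hd
  have hd0 : d ≠ 0 := by rintro rfl; exact hd.1.1.2 (zero_dvd_iff.mp hd.1.1.1)
  obtain ⟨n₁, r₁, m₁, v, h1, h2, -, -, hv₁, hv⟩ := exists_disc_eq hd0 hd.1.1.1 hD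
  have hy : (p : ℤ) ∣ n₁ * m₁ := by
    rw [h1] at hn
    exact ((hpp.dvd_mul.mp hn).resolve_left (by exact_mod_cast hd.2)).mul_right m₁
  have hx : ¬ (p : ℤ) ∣ r₁ := fun h0 => hr (by rw [h2]; exact h0.mul_left _)
  rw [toNat_ediv hd0 hv, halfHecke_of_not_dvd hp2 hp hk heig (x := r₁) (y := n₁ * m₁)
    (by rw [hv₁]; ring) hx hy, mul_zero, pow_zero, one_mul]
  ring

end

/-- The Fourier coefficients of the lift, extended by zero to all integral quadratic forms. -/
def skExt (N k : ℕ) (h : ℍ → ℂ) (n r m : ℤ) : ℂ :=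
  if 0 < n ∧ 0 < 4 * n * m - r ^ 2 then skSum N k h n r m else 0

/-- Write A for the coefficients and Pᵢ for `skPart` with exponent i. Always A(p²n, pr, p²m) = p^k
A(pn, r, pm) + P₁(pn, r, pm). If p ∤ r, then P₁ = (a - p^(k-1)) P₀ and P₀ = A. If r = ps, then
P₁(pn, ps, pm) = P₂(n, s, m) = a P₁ - p^(2k-1) P₀ at (n, s, m), where P₁ is A(pn, ps, pm) - p^k A(n,
s, m) and P₀ is A(n, s, m) minus p^k times the coefficient at the quotient by p. The separate term
p^(k-1) A for p ∣ r lets both cases share one formula. -/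
theorem skExt_relation {N k p : ℕ} {h : ℍ → ℂ} {a : ℂ} (hp2 : p ≠ 2) (hp : p.Prime)
    (hpN : ¬ p ∣ N) (hk : Odd k)
    (heig : ∀ v : ℕ, IsPlusIndex k v → halfHeckeCoeff k p h v = a * coeff h v) (n r m : ℤ) :
    skExt N k h (p * (p * n)) (p * r) (p * (p * m)) =
      ((p : ℂ) ^ k + a - (p : ℂ) ^ (k - 1)) * skExt N k h (p * n) r (p * m) +
      (p : ℂ) ^ (k - 1) * (if (p : ℤ) ∣ r then skExt N k h (p * n) r (p * m) else 0) -
      (a * (p : ℂ) ^ k + (p : ℂ) ^ (2 * k - 1)) *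
        (if (p : ℤ) ∣ r then skExt N k h n (r / p) m else 0) +
      (p : ℂ) ^ (3 * k - 1) *
        (if (p : ℤ) ∣ n ∧ (p : ℤ) ∣ m ∧ (p : ℤ) ^ 2 ∣ r then
          skExt N k h (n / p) (r / p ^ 2) (m / p) else 0) := by
  have hp0 : (0 : ℤ) < p := by exact_mod_cast hp.pos
  have hpos : ∀ n r m : ℤ, (0 < p * n ∧ 0 < 4 * (p * n) * (p * m) - (p * r) ^ 2) ↔
      (0 < n ∧ 0 < 4 * n * m - r ^ 2) := by
    intro n r m
    have e : 4 * (p * n) * (p * m) - (p * r) ^ 2 = (p : ℤ) ^ 2 * (4 * n * m - r ^ 2) := by ring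
    rw [e, mul_pos_iff_of_pos_left hp0, mul_pos_iff_of_pos_left (by positivity)]
  by_cases hB : 0 < p * n ∧ 0 < 4 * (p * n) * (p * m) - r ^ 2
  · have e1 : skExt N k h (p * (p * n)) (p * r) (p * (p * m)) = (p : ℂ) ^ k *
        skExt N k h (p * n) r (p * m) + skPart N k p 1 h (p * n) r (p * m) := by
      rw [skExt, if_pos ((hpos _ _ _).mpr hB), skExt, if_pos hB, skSum_mul hp hpN hB.1 hB.2]
    rw [e1]
    by_cases hr : (p : ℤ) ∣ r
    · obtain ⟨s, rfl⟩ := hr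
      have hB₀ := (hpos n s m).mp hB
      have e2 : skExt N k h (p * n) (p * s) (p * m) = (p : ℂ) ^ k *
          skExt N k h n s m + skPart N k p 1 h n s m := by
        rw [skExt, if_pos hB, skExt, if_pos hB₀, skSum_mul hp hpN hB₀.1 hB₀.2]
      -- Peeling off one factor p: the divisors divisible by p contribute p^k times the coefficient
      -- of the form divided by p, and nothing if the form is not divisible by p.
      have e3 : skExt N k h n s m = skPart N k p 0 h n s m + (p : ℂ) ^ k *
          (if (p : ℤ) ∣ n ∧ (p : ℤ) ∣ m ∧ (p : ℤ) ^ 2 ∣ p * s then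
          skExt N k h (n / p) (p * s / p ^ 2) (m / p) else 0) := by
        have hs : (p : ℤ) ^ 2 ∣ p * s ↔ (p : ℤ) ∣ s := by
          rw [sq, mul_dvd_mul_iff_left hp0.ne']
        split_ifs with hc
        · rw [hs] at hc
          obtain ⟨⟨n', rfl⟩, ⟨m', rfl⟩, ⟨s', rfl⟩⟩ := hc
          have hB₁ := (hpos n' s' m').mp hB₀
          have e4 : (p : ℤ) * (p * s') / p ^ 2 = s' := by
            rw [← mul_assoc, ← sq, Int.mul_ediv_cancel_left _ (by positivity)]
          rw [Int.mul_ediv_cancel_left _ hp0.ne', Int.mul_ediv_cancel_left _ hp0.ne', e4, skExt,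
            if_pos hB₀, skExt, if_pos hB₁, skSum_mul hp hpN hB₁.1 hB₁.2,
            skPart_mul hp 0 hB₁.1 hB₁.2]
          ring
        · rw [mul_zero, add_zero, skExt, if_pos hB₀, skSum_eq_skPart]
          intro h0
          obtain ⟨h1, h2, h3⟩ := dvd_gcd3.mp h0
          exact hc ⟨h1, h3, hs.mpr h2⟩
      rw [if_pos (dvd_mul_right _ _), if_pos (dvd_mul_right _ _),
        Int.mul_ediv_cancel_left _ hp0.ne', skPart_mul hp 1 hB₀.1 hB₀.2,
        skPart_two hp2 hp hk heig hB₀.2]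
      have e5 : (p : ℂ) ^ (3 * k - 1) = (p : ℂ) ^ (2 * k - 1) * (p : ℂ) ^ k := by
        have := hk.pos
        rw [← pow_add]
        congr 1
        omega
      rw [e5]
      linear_combination (-a) * e2 + (p : ℂ) ^ (2 * k - 1) * e3
    · have hr2 : ¬ (p : ℤ) ^ 2 ∣ r := fun h0 => hr ((dvd_pow_self _ two_ne_zero).trans h0)
      rw [if_neg hr, if_neg hr, if_neg (fun h0 => hr2 h0.2.2),
        skPart_one hp2 hp hk heig (dvd_mul_right _ _) hr hB.2, skExt, if_pos hB,
        skSum_eq_skPart (p := p) (fun h0 => hr (dvd_gcd3.mp h0).2.1)]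
      ring
  -- Scaling by p preserves definiteness, so if (pn, r, pm) is not positive definite every term is
  -- zero.
  · have h1 : skExt N k h (p * (p * n)) (p * r) (p * (p * m)) = 0 :=
      if_neg (fun h0 => hB ((hpos _ _ _).mp h0))
    have h2 : skExt N k h (p * n) r (p * m) = 0 := if_neg hB
    have h3 : (if (p : ℤ) ∣ r then skExt N k h n (r / p) m else 0) = 0 := by
      split_ifs with hr
      · obtain ⟨s, rfl⟩ := hr
        rw [Int.mul_ediv_cancel_left _ hp0.ne', skExt, if_neg (fun h0 => hB ((hpos n s m).mpr h0))]
      · rfl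
    have h4 : (if (p : ℤ) ∣ n ∧ (p : ℤ) ∣ m ∧ (p : ℤ) ^ 2 ∣ r then
          skExt N k h (n / p) (r / p ^ 2) (m / p) else 0) = 0 := by
      split_ifs with hc
      · obtain ⟨⟨n', rfl⟩, ⟨m', rfl⟩, ⟨s', rfl⟩⟩ := hc
        rw [Int.mul_ediv_cancel_left _ hp0.ne', Int.mul_ediv_cancel_left _ hp0.ne',
          Int.mul_ediv_cancel_left _ (by positivity), skExt, if_neg (fun h0 => hB ?_)]
        have h5 := (hpos _ _ _).mpr ((hpos _ _ _).mpr h0)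
        rwa [← mul_assoc (p : ℤ) p s', ← sq] at h5
      · rfl
    rw [h1, h2, h3, h4]
    simp

/-! ### Exponential expansions in two variables -/

/-- `Φ(τ₁, τ₂) = ∑ c(n, r, m) exp(2 π i (n τ₁ + m τ₂))`, the sum being over all integers
`n`, `r`, `m`. -/
def HasExp (c : ℤ → ℤ → ℤ → ℂ) (Φ : ℍ → ℍ → ℂ) : Prop :=
  ∀ τ₁ τ₂ : ℍ, HasSum (fun x : ℤ × ℤ × ℤ => c x.1 x.2.1 x.2.2 *
    Complex.exp (2 * Real.pi * Complex.I * ((x.1 : ℂ) * τ₁ + (x.2.2 : ℂ) * τ₂))) (Φ τ₁ τ₂)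

namespace HasExp

variable {c d : ℤ → ℤ → ℤ → ℂ} {Φ Ψ : ℍ → ℍ → ℂ}

lemma congr_coeff (h : HasExp c Φ) (hcd : ∀ n r m, d n r m = c n r m) : HasExp d Φ := by
  intro τ₁ τ₂
  simpa only [hcd] using h τ₁ τ₂

lemma unique (h : HasExp c Φ) (h' : HasExp c Ψ) (τ₁ τ₂ : ℍ) : Φ τ₁ τ₂ = Ψ τ₁ τ₂ :=
  (h τ₁ τ₂).unique (h' τ₁ τ₂)

lemma add (h : HasExp c Φ) (h' : HasExp d Ψ) :
    HasExp (fun n r m => c n r m + d n r m) (fun τ₁ τ₂ => Φ τ₁ τ₂ + Ψ τ₁ τ₂) := by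
  intro τ₁ τ₂
  simpa only [add_mul] using (h τ₁ τ₂).add (h' τ₁ τ₂)

lemma const_mul (a : ℂ) (h : HasExp c Φ) :
    HasExp (fun n r m => a * c n r m) (fun τ₁ τ₂ => a * Φ τ₁ τ₂) := by
  intro τ₁ τ₂
  simpa only [mul_assoc] using (h τ₁ τ₂).mul_left a

lemma swap (h : HasExp c Φ) : HasExp (fun n r m => c m r n) (fun τ₁ τ₂ => Φ τ₂ τ₁) := by
  intro τ₁ τ₂
  let e : ℤ × ℤ × ℤ ≃ ℤ × ℤ × ℤ :=
    ⟨fun x => (x.2.2, x.2.1, x.1), fun x => (x.2.2, x.2.1, x.1), fun _ => rfl, fun _ => rfl⟩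
  have := (e.hasSum_iff (f := fun x : ℤ × ℤ × ℤ => c x.1 x.2.1 x.2.2 *
    Complex.exp (2 * Real.pi * Complex.I * ((x.1 : ℂ) * τ₂ + (x.2.2 : ℂ) * τ₁)))).mpr (h τ₂ τ₁)
  convert this using 2 with x
  simp only [Function.comp_apply, e, Equiv.coe_fn_mk]
  rw [add_comm]

/-- On the diagonal the exponential does not involve r, so spreading the middle index over the
multiples of q does not change the sum. This aligns the shifts of r in the coefficient relation. -/
lemma middle (h : HasExp c Φ) {q : ℤ} (hq : q ≠ 0) :
    HasExp (fun n r m => if q ∣ r then c n (r / q) m else 0) Φ := by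
  intro τ₁ τ₂
  have hinj : Function.Injective (fun x : ℤ × ℤ × ℤ => (x.1, q * x.2.1, x.2.2)) := by
    rintro ⟨a, b, c⟩ ⟨a', b', c'⟩ h
    simpa [hq] using h
  rw [← hinj.hasSum_iff]
  · convert h τ₁ τ₂ using 2 with x
    simp [Int.mul_ediv_cancel_left _ hq]
  · rintro ⟨n, r, m⟩ hx
    beta_reduce
    rw [if_neg, zero_mul]
    rintro ⟨s, rfl⟩
    exact hx ⟨(n, s, m), rfl⟩

lemma opV_right (h : HasExp c Φ) {p : ℕ} (hp : 0 < p) :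
    HasExp (fun n r m => if (p : ℤ) ∣ m then c n r (m / p) else 0)
      (fun τ₁ => opV p (Φ τ₁)) := by
  intro τ₁ τ₂
  have hp0 : (p : ℤ) ≠ 0 := by exact_mod_cast hp.ne'
  have hinj : Function.Injective (fun x : ℤ × ℤ × ℤ => (x.1, x.2.1, p * x.2.2)) := by
    rintro ⟨a, b, c⟩ ⟨a', b', c'⟩ h
    simpa [hp.ne'] using h
  rw [← hinj.hasSum_iff]
  · change HasSum _ (Φ τ₁ (ofComplex ((p : ℂ) * τ₂)))
    convert h τ₁ (ofComplex ((p : ℂ) * τ₂)) using 2 with x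
    rw [ofComplex_apply_of_im_pos (by simpa using mul_pos (Nat.cast_pos.mpr hp) τ₂.im_pos)]
    simp [Int.mul_ediv_cancel_left _ hp0]
    left
    ring_nf
  · rintro ⟨n, r, m⟩ hx
    beta_reduce
    rw [if_neg, zero_mul]
    rintro ⟨s, rfl⟩
    exact hx ⟨(n, r, s), rfl⟩

lemma opV_left (h : HasExp c Φ) {p : ℕ} (hp : 0 < p) :
    HasExp (fun n r m => if (p : ℤ) ∣ n then c (n / p) r m else 0)
      (fun τ₁ τ₂ => opV p (fun σ => Φ σ τ₂) τ₁) :=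
  (h.swap.opV_right hp).swap

lemma opU_right (h : HasExp c Φ) {p : ℕ} (hp : 0 < p) :
    HasExp (fun n r m => c n r (p * m)) (fun τ₁ => opU p (Φ τ₁)) := by
  intro τ₁ τ₂
  have hp0 : (p : ℤ) ≠ 0 := by exact_mod_cast hp.ne'
  have hpc : (p : ℂ) ≠ 0 := by exact_mod_cast hp.ne'
  have hinj : Function.Injective (fun x : ℤ × ℤ × ℤ => (x.1, x.2.1, p * x.2.2)) := by
    rintro ⟨a, b, c⟩ ⟨a', b', c'⟩ h
    simpa [hp.ne'] using h
  have hsum := ((hasSum_sum (s := Finset.range p)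
    fun b _ => h τ₁ (ofComplex (((τ₂ : ℂ) + (b : ℂ)) / (p : ℂ)))).mul_left ((p : ℂ)⁻¹))
  have key : ∀ x : ℤ × ℤ × ℤ, (p : ℂ)⁻¹ * ∑ b ∈ Finset.range p, c x.1 x.2.1 x.2.2 *
      Complex.exp (2 * Real.pi * Complex.I * ((x.1 : ℂ) * τ₁ +
        (x.2.2 : ℂ) * (ofComplex (((τ₂ : ℂ) + (b : ℂ)) / (p : ℂ)) : ℍ))) =
      if (p : ℤ) ∣ x.2.2 then c x.1 x.2.1 x.2.2 *
        Complex.exp (2 * Real.pi * Complex.I * ((x.1 : ℂ) * τ₁ + (x.2.2 : ℂ) * τ₂ / p)) else 0 := by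
    intro x
    have e : ∀ b : ℕ, Complex.exp (2 * Real.pi * Complex.I * ((x.1 : ℂ) * τ₁ +
        (x.2.2 : ℂ) * (ofComplex (((τ₂ : ℂ) + (b : ℂ)) / (p : ℂ)) : ℍ))) =
        Complex.exp (2 * Real.pi * Complex.I * ((x.1 : ℂ) * τ₁ + (x.2.2 : ℂ) * τ₂ / p)) *
        Complex.exp (2 * Real.pi * Complex.I * ((x.2.2 : ℂ) * b / p)) := by
      intro b
      rw [ofComplex_apply_of_im_pos (by
        simpa using div_pos τ₂.im_pos (Nat.cast_pos.mpr hp)), ← Complex.exp_add]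
      congr 1
      simp
      ring
    simp only [e]
    rw [← Finset.mul_sum, ← Finset.mul_sum, sum_exp_range hp]
    split_ifs
    · field_simp
    · simp
  simp only [key] at hsum
  rw [← hinj.hasSum_iff] at hsum
  · refine Eq.mp (congrArg (fun f => HasSum f _) (funext fun x => ?_)) hsum
    rw [Function.comp_apply, if_pos (dvd_mul_right _ _)]
    push_cast
    congr 4
    field_simp
  · rintro ⟨n, r, m⟩ hx
    rw [if_neg]
    rintro ⟨s, rfl⟩
    exact hx ⟨(n, r, s), rfl⟩

lemma opU_left (h : HasExp c Φ) {p : ℕ} (hp : 0 < p) :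
    HasExp (fun n r m => c (p * n) r m) (fun τ₁ τ₂ => opU p (fun σ => Φ σ τ₂) τ₁) :=
  (h.swap.opU_right hp).swap

end HasExp

/-- `F(Z) = ∑ c(n, r, m) exp(2 π i (n τ₁ + r z + m τ₂))`. -/
def HasSiegelExp (c : ℤ → ℤ → ℤ → ℂ) (F : Matrix (Fin 2) (Fin 2) ℂ → ℂ) : Prop :=
  ∀ Z ∈ siegelH, HasSum (fun x : ℤ × ℤ × ℤ => c x.1 x.2.1 x.2.2 *
    Complex.exp (2 * Real.pi * Complex.I *
      ((x.1 : ℂ) * Z 0 0 + (x.2.1 : ℂ) * Z 0 1 + (x.2.2 : ℂ) * Z 1 1))) (F Z)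

namespace HasSiegelExp

variable {c : ℤ → ℤ → ℤ → ℂ} {F : Matrix (Fin 2) (Fin 2) ℂ → ℂ}

lemma hasExp (h : HasSiegelExp c F) : HasExp c (fun τ₁ τ₂ => F (symMat τ₁ 0 τ₂)) := by
  intro τ₁ τ₂
  have hmem : symMat τ₁ 0 τ₂ ∈ siegelH := by
    rw [symMat_mem_siegelH]
    exact ⟨τ₁.im_pos, by simpa using mul_pos τ₁.im_pos τ₂.im_pos⟩
  simpa [symMat] using h _ hmem

lemma siegelU_diag (h : HasSiegelExp c F) {p : ℕ} (hp : 0 < p) :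
    HasExp (fun n r m => c (p * n) (p * r) (p * m)) (fun τ₁ τ₂ => siegelU p F (symMat τ₁ 0 τ₂)) := by
  intro τ₁ τ₂
  have hpr : (0 : ℝ) < p := by exact_mod_cast hp
  have hp0 : (p : ℤ) ≠ 0 := by exact_mod_cast hp.ne'
  have hpc : (p : ℂ) ≠ 0 := by exact_mod_cast hp.ne'
  have e : ∀ a b c : ℕ, (p : ℂ)⁻¹ • (symMat τ₁ 0 τ₂ + symMat a b c) =
      symMat (((p : ℝ)⁻¹ : ℝ) * (τ₁ + a)) (((p : ℝ)⁻¹ * b : ℝ)) (((p : ℝ)⁻¹ : ℝ) * (τ₂ + c)) := by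
    intro a b c
    ext i j
    fin_cases i <;> fin_cases j <;> simp [symMat]
  have hmem : ∀ a b c : ℕ, (p : ℂ)⁻¹ • (symMat τ₁ 0 τ₂ + symMat a b c) ∈ siegelH := by
    intro a b c
    rw [e, symMat_mem_siegelH, Complex.im_ofReal_mul, Complex.im_ofReal_mul, Complex.ofReal_im]
    simp only [Complex.add_im, Complex.natCast_im, add_zero, coe_im]
    have h1 := τ₁.im_pos
    have h2 := τ₂.im_pos
    constructor
    · positivity
    · rw [zero_pow two_ne_zero]; positivity
  have hinj : Function.Injective
      (fun x : ℤ × ℤ × ℤ => ((p : ℤ) * x.1, (p : ℤ) * x.2.1, (p : ℤ) * x.2.2)) := by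
    rintro ⟨a, b, c⟩ ⟨a', b', c'⟩ h
    simpa [hp.ne'] using h
  have hsum := ((hasSum_sum (s := Finset.range p) fun a _ =>
    hasSum_sum (s := Finset.range p) fun b _ =>
    hasSum_sum (s := Finset.range p) fun c _ => h _ (hmem a b c)).mul_left (((p : ℂ) ^ 3)⁻¹))
  have key : ∀ x : ℤ × ℤ × ℤ, ((p : ℂ) ^ 3)⁻¹ * ∑ a ∈ Finset.range p, ∑ b ∈ Finset.range p,
      ∑ d ∈ Finset.range p, c x.1 x.2.1 x.2.2 * Complex.exp (2 * Real.pi * Complex.I *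
      ((x.1 : ℂ) * ((p : ℂ)⁻¹ • (symMat τ₁ 0 τ₂ + symMat a b d)) 0 0 +
       (x.2.1 : ℂ) * ((p : ℂ)⁻¹ • (symMat τ₁ 0 τ₂ + symMat a b d)) 0 1 +
       (x.2.2 : ℂ) * ((p : ℂ)⁻¹ • (symMat τ₁ 0 τ₂ + symMat a b d)) 1 1)) =
      if (p : ℤ) ∣ x.1 ∧ (p : ℤ) ∣ x.2.1 ∧ (p : ℤ) ∣ x.2.2 then c x.1 x.2.1 x.2.2 *
        Complex.exp (2 * Real.pi * Complex.I * ((x.1 : ℂ) * τ₁ / p + (x.2.2 : ℂ) * τ₂ / p))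
      else 0 := by
    intro x
    have e : ∀ a b d : ℕ, Complex.exp (2 * Real.pi * Complex.I *
      ((x.1 : ℂ) * ((p : ℂ)⁻¹ • (symMat τ₁ 0 τ₂ + symMat a b d)) 0 0 +
       (x.2.1 : ℂ) * ((p : ℂ)⁻¹ • (symMat τ₁ 0 τ₂ + symMat a b d)) 0 1 +
       (x.2.2 : ℂ) * ((p : ℂ)⁻¹ • (symMat τ₁ 0 τ₂ + symMat a b d)) 1 1)) =
        Complex.exp (2 * Real.pi * Complex.I * ((x.1 : ℂ) * τ₁ / p + (x.2.2 : ℂ) * τ₂ / p)) *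
        Complex.exp (2 * Real.pi * Complex.I * ((x.1 : ℂ) * a / p)) *
        Complex.exp (2 * Real.pi * Complex.I * ((x.2.1 : ℂ) * b / p)) *
        Complex.exp (2 * Real.pi * Complex.I * ((x.2.2 : ℂ) * d / p)) := by
      intro a b d
      rw [← Complex.exp_add, ← Complex.exp_add, ← Complex.exp_add]
      congr 1
      simp [symMat]
      ring
    simp only [e, ← Finset.mul_sum, ← Finset.sum_mul, sum_exp_range hp]
    by_cases h1 : (p : ℤ) ∣ x.1 <;> by_cases h2 : (p : ℤ) ∣ x.2.1 <;>
      by_cases h3 : (p : ℤ) ∣ x.2.2 <;> simp only [h1, h2, h3, if_true, if_false, and_self,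
        and_true, and_false, mul_zero, zero_mul]
    field_simp
  simp only [key] at hsum
  rw [← hinj.hasSum_iff] at hsum
  · refine Eq.mp (congrArg (fun f => HasSum f _) (funext fun x => ?_)) hsum
    rw [Function.comp_apply, if_pos ⟨dvd_mul_right _ _, dvd_mul_right _ _, dvd_mul_right _ _⟩]
    push_cast
    congr 4 <;> field_simp
  · rintro ⟨n, r, m⟩ hx
    rw [if_neg]
    rintro ⟨⟨s, rfl⟩, ⟨t, rfl⟩, ⟨u, rfl⟩⟩
    exact hx ⟨(s, t, u), rfl⟩

end HasSiegelExp

lemma IsSaitoKurokawaLift.hasSiegelExp {N k : ℕ} {h : ℍ → ℂ} {F : Matrix (Fin 2) (Fin 2) ℂ → ℂ}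
    (hF : IsSaitoKurokawaLift N k h F) : HasSiegelExp (skExt N k h) F := by
  intro Z hZ
  have hinj : Function.Injective (fun B : PosHalfInt => B.1) := Subtype.val_injective
  rw [← hinj.hasSum_iff]
  · convert hF.expansion Z hZ using 2 with B
    simp only [Function.comp_apply]
    rw [skExt, if_pos B.2]
    rfl
  · intro x hx
    rw [skExt, if_neg, zero_mul]
    exact fun h => hx ⟨⟨x, h⟩, rfl⟩

/-- Sum `skExt_relation` over all (n, r, m). The part with p ∣ r of the coefficients A(pn, r, pm) is
the restriction of UF, and the quotients r/p and r/p² are absorbed by `HasExp.middle`. -/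
theorem IsSaitoKurokawaLift.diag_relation {N k p : ℕ} {h : ℍ → ℂ}
    {F : Matrix (Fin 2) (Fin 2) ℂ → ℂ} (hF : IsSaitoKurokawaLift N k h F) {a : ℂ} (hp2 : p ≠ 2)
    (hp : p.Prime) (hpN : ¬ p ∣ N) (hk : Odd k)
    (heig : ∀ v : ℕ, IsPlusIndex k v → halfHeckeCoeff k p h v = a * coeff h v) (τ₁ τ₂ : ℍ) :
    opU p (fun σ => opU p (fun τ => siegelU p F (symMat σ 0 τ)) τ₂) τ₁ =
      ((p : ℂ) ^ k + a - (p : ℂ) ^ (k - 1)) *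
        opU p (fun σ => opU p (fun τ => F (symMat σ 0 τ)) τ₂) τ₁ +
      (p : ℂ) ^ (k - 1) * siegelU p F (symMat τ₁ 0 τ₂) +
      -(a * (p : ℂ) ^ k + (p : ℂ) ^ (2 * k - 1)) * F (symMat τ₁ 0 τ₂) +
      (p : ℂ) ^ (3 * k - 1) * opV p (fun σ => opV p (fun τ => F (symMat σ 0 τ)) τ₂) τ₁ := by
  have hp0 : (p : ℤ) ≠ 0 := by exact_mod_cast hp.ne_zero
  have hG := hF.hasSiegelExp.hasExp
  have hE := hF.hasSiegelExp.siegelU_diag hp.pos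
  have h1 := (hE.opU_right hp.pos).opU_left hp.pos
  have h2 := (((((hG.opU_right hp.pos).opU_left hp.pos).const_mul
    ((p : ℂ) ^ k + a - (p : ℂ) ^ (k - 1))).add ((hE.middle hp0).const_mul ((p : ℂ) ^ (k - 1)))).add
    ((hG.middle hp0).const_mul (-(a * (p : ℂ) ^ k + (p : ℂ) ^ (2 * k - 1))))).add
    ((((hG.middle (pow_ne_zero 2 hp0)).opV_right hp.pos).opV_left hp.pos).const_mul
      ((p : ℂ) ^ (3 * k - 1)))
  refine h1.unique (h2.congr_coeff fun n r m => ?_) τ₁ τ₂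
  have h3 := skExt_relation hp2 hp hpN hk heig n r m
  have e1 : (if (p : ℤ) ∣ r then skExt N k h (p * n) (p * (r / p)) (p * m) else 0) =
      if (p : ℤ) ∣ r then skExt N k h (p * n) r (p * m) else 0 := by
    split_ifs with hr
    · rw [Int.mul_ediv_cancel' hr]
    · rfl
  have e2 : (if (p : ℤ) ∣ n then if (p : ℤ) ∣ m then if (p : ℤ) ^ 2 ∣ r then
      skExt N k h (n / p) (r / p ^ 2) (m / p) else 0 else 0 else 0) =
      if (p : ℤ) ∣ n ∧ (p : ℤ) ∣ m ∧ (p : ℤ) ^ 2 ∣ r then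
          skExt N k h (n / p) (r / p ^ 2) (m / p) else 0 := by
    simp only [ite_and]
  rw [e1, e2, h3]
  ring

/-! ### The component of the pullback -/

/-- A linear operator on functions that maps cusp forms to cusp forms. -/
def cuspMap {M M' : ℕ} [NeZero M] [NeZero M'] {w : ℤ} (hw : 0 < w)
    (T : (ℍ → ℂ) →ₗ[ℂ] (ℍ → ℂ)) (hT : ∀ f ∈ cuspSpace M w, T f ∈ cuspSpace M' w) :
    S M w →ₗ[ℂ] S M' w where
  toFun f := mkCusp hw (T f) (hT _ (coe_mem_cuspSpace f))
  map_add' f g := DFunLike.coe_injective (T.map_add f g)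
  map_smul' c f := DFunLike.coe_injective (T.map_smul c (f : ℍ → ℂ))

/-- The operator `T ⊗ T` on functions of two variables. -/
def twoVar (T : (ℍ → ℂ) →ₗ[ℂ] (ℍ → ℂ)) (Φ : ℍ → ℍ → ℂ) (τ₁ τ₂ : ℍ) : ℂ :=
  T (fun σ => T (Φ σ) τ₂) τ₁

lemma twoVar_add (T : (ℍ → ℂ) →ₗ[ℂ] (ℍ → ℂ)) (Φ Ψ : ℍ → ℍ → ℂ) :
    twoVar T (Φ + Ψ) = twoVar T Φ + twoVar T Ψ := by
  funext τ₁ τ₂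
  have h : (fun σ => T ((Φ + Ψ) σ) τ₂) = (fun σ => T (Φ σ) τ₂) + (fun σ => T (Ψ σ) τ₂) := by
    funext σ
    rw [Pi.add_apply, map_add]
    rfl
  rw [twoVar, h, map_add]
  rfl

lemma twoVar_smul (T : (ℍ → ℂ) →ₗ[ℂ] (ℍ → ℂ)) (c : ℂ) (Φ : ℍ → ℍ → ℂ) :
    twoVar T (c • Φ) = c • twoVar T Φ := by
  funext τ₁ τ₂
  have h : (fun σ => T ((c • Φ) σ) τ₂) = c • (fun σ => T (Φ σ) τ₂) := by
    funext σ
    rw [Pi.smul_apply, map_smul]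
    rfl
  rw [twoVar, h, map_smul]
  rfl

/-- `φ × ψ`. -/
def cross (f g : ℍ → ℂ) (τ₁ τ₂ : ℍ) : ℂ := f τ₁ * g τ₂

lemma twoVar_cross (T : (ℍ → ℂ) →ₗ[ℂ] (ℍ → ℂ)) (f g : ℍ → ℂ) :
    twoVar T (cross f g) = cross (T f) (T g) := by
  funext τ₁ τ₂
  have h : (fun σ => T (cross f g σ) τ₂) = T g τ₂ • f := by
    funext σ
    have h' : cross f g σ = f σ • g := rfl
    rw [h', map_smul, Pi.smul_apply, Pi.smul_apply, smul_eq_mul, smul_eq_mul, mul_comm]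
  rw [twoVar, h, map_smul, Pi.smul_apply, smul_eq_mul, mul_comm]
  rfl

lemma tensorFun_map_cuspMap {M M' : ℕ} [NeZero M] [NeZero M'] {w : ℤ} (hw : 0 < w)
    (T : (ℍ → ℂ) →ₗ[ℂ] (ℍ → ℂ)) (hT : ∀ f ∈ cuspSpace M w, T f ∈ cuspSpace M' w)
    (t : S M w ⊗[ℂ] S M w) :
    tensorFun M' w (TensorProduct.map (cuspMap hw T hT) (cuspMap hw T hT) t) =
      twoVar T (tensorFun M w t) := by
  induction t with
  | zero =>
    rw [map_zero, map_zero, map_zero, ← zero_smul ℂ (0 : ℍ → ℍ → ℂ), twoVar_smul, zero_smul, zero_smul]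
  | tmul f g => exact (twoVar_cross T f g).symm
  | add s t hs ht => rw [map_add, map_add, hs, ht, map_add, twoVar_add]

lemma map_comp_comm {M M' : ℕ} [NeZero M] [NeZero M'] {w : ℤ} {e : S M w →ₗ[ℂ] S M w}
    {e' : S M' w →ₗ[ℂ] S M' w} {T : S M w →ₗ[ℂ] S M' w} (h : ∀ f, e' (T f) = T (e f))
    (t : S M w ⊗[ℂ] S M w) :
    TensorProduct.map e' e' (TensorProduct.map T T t) =
      TensorProduct.map T T (TensorProduct.map e e t) := by
  induction t with
  | zero => simp only [map_zero]
  | tmul f g => simp only [TensorProduct.map_tmul, h]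
  | add s t hs ht => simp only [map_add, hs, ht]

/-! ### Coordinates of the component with respect to φ and Vφ, and the linear system -/

namespace IsPrimitive

variable {N p : ℕ} {w : ℤ} {a : ℕ → ℂ} {φ : ℍ → ℂ}

lemma exists_cross (H : IsPrimitive N p w a φ) [NeZero (N * p)]
    (t : S (N * p) w ⊗[ℂ] S (N * p) w) :
    ∃ x₁ x₂ x₃ x₄ : ℂ, tensorFun (N * p) w (TensorProduct.map (heckeProj (N * p) w a)
        (heckeProj (N * p) w a) t) =
      x₁ • cross φ φ + x₂ • cross φ (opV p φ) + x₃ • cross (opV p φ) φ +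
        x₄ • cross (opV p φ) (opV p φ) := by
  induction t with
  | zero => exact ⟨0, 0, 0, 0, by simp⟩
  | tmul f g =>
    obtain ⟨x, y, hf⟩ := H.eq_smul_add_smul (heckeProj_mem H.pos H.conj_eigenvalue' f)
    obtain ⟨u, v, hg⟩ := H.eq_smul_add_smul (heckeProj_mem H.pos H.conj_eigenvalue' g)
    refine ⟨x * u, x * v, y * u, y * v, ?_⟩
    funext τ₁ τ₂
    rw [TensorProduct.map_tmul, tensorFun_tmul, hf, hg]
    simp only [cross, Pi.add_apply, Pi.smul_apply, smul_eq_mul]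
    ring
  | add s t hs ht =>
    obtain ⟨x₁, x₂, x₃, x₄, hs⟩ := hs
    obtain ⟨y₁, y₂, y₃, y₄, ht⟩ := ht
    refine ⟨x₁ + y₁, x₂ + y₂, x₃ + y₃, x₄ + y₄, ?_⟩
    rw [map_add, map_add, hs, ht]
    module

lemma eq_zero_of_add_eq_zero (H : IsPrimitive N p w a φ) {x y : ℂ}
    (h : x • φ + y • opV p φ = 0) : x = 0 ∧ y = 0 := by
  have hQ := isQ_of_mem H.pos H.mem
  have hc : ∀ n, x * coeff φ n + y * coeff (opV p φ) n = coeff (0 : ℍ → ℂ) n := fun n => by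
    rw [← h, coeff_add (hQ.smul _) ((hQ.opV H.prime.pos).smul _), coeff_smul hQ,
      coeff_smul (hQ.opV H.prime.pos)]
  have h0 : ∀ n, coeff (0 : ℍ → ℂ) n = 0 := fun n => by
    rw [← zero_smul ℂ φ, coeff_smul hQ, zero_mul]
  have h1 := hc 1
  rw [H.coeff_one, coeff_opV H.prime.pos hQ, h0,
    if_neg (fun h => H.prime.one_lt.ne' (Nat.dvd_one.mp h))] at h1
  have hx : x = 0 := by simpa using h1
  have h2 := hc p
  rw [coeff_opV H.prime.pos hQ, h0, if_pos dvd_rfl, Nat.div_self H.prime.pos, H.coeff_one, hx] at h2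
  exact ⟨hx, by simpa using h2⟩

/-- Independence of φ and V_p φ, visible at the coefficients of index 1 and p, is used first in τ₁
and then in τ₂. -/
lemma eq_zero_of_cross (H : IsPrimitive N p w a φ) {x₁ x₂ x₃ x₄ : ℂ}
    (h : x₁ • cross φ φ + x₂ • cross φ (opV p φ) + x₃ • cross (opV p φ) φ +
        x₄ • cross (opV p φ) (opV p φ) = 0) : x₁ = 0 ∧ x₂ = 0 ∧ x₃ = 0 ∧ x₄ = 0 := by
  have h' : ∀ τ₁ τ₂ : ℍ, x₁ * (φ τ₁ * φ τ₂) + x₂ * (φ τ₁ * opV p φ τ₂) +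
      x₃ * (opV p φ τ₁ * φ τ₂) + x₄ * (opV p φ τ₁ * opV p φ τ₂) = 0 :=
    fun τ₁ τ₂ => congrFun (congrFun h τ₁) τ₂
  have h1 : ∀ τ₂ : ℍ, x₁ * φ τ₂ + x₂ * opV p φ τ₂ = 0 ∧ x₃ * φ τ₂ + x₄ * opV p φ τ₂ = 0 := by
    intro τ₂
    refine H.eq_zero_of_add_eq_zero ?_
    funext τ₁
    simp only [Pi.add_apply, Pi.smul_apply, smul_eq_mul, Pi.zero_apply]
    linear_combination h' τ₁ τ₂
  have h2 := H.eq_zero_of_add_eq_zero (x := x₁) (y := x₂) (funext fun τ => (h1 τ).1)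
  have h3 := H.eq_zero_of_add_eq_zero (x := x₃) (y := x₄) (funext fun τ => (h1 τ).2)
  exact ⟨h2.1, h2.2, h3.1, h3.2⟩

end IsPrimitive

/-- Here P = p and q = p^(k-1). The difference of `h3` and `h2` gives x₂ = x₃, since q (P - 1) ≠ 0.
Then `h2` and `h4` express x₂ and x₄ through x₁, and substituting them in `h1` leaves an equation
for x₁ with leading coefficient (P - 1) (b² - q (P+1)²), up to sign. -/
lemma solve_linear {P q a b l x₁ x₂ x₃ x₄ : ℂ} (hq : q ≠ 0) (hP : P ≠ 1) (hP' : P + 1 ≠ 0)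
    (hden : b ^ 2 - q * (P + 1) ^ 2 ≠ 0)
    (h1 : b ^ 2 * x₁ + b * x₂ + b * x₃ + x₄ =
      (P * q + a - q) * l * b ^ 2 + q * x₁ - (a * (P * q) + P * q ^ 2) * l)
    (h2 : -(b * (P * q) * x₁) - P * q * x₃ = -((P * q + a - q) * l * b * (P * q)) + q * x₂)
    (h3 : -(b * (P * q) * x₁) - P * q * x₂ = -((P * q + a - q) * l * b * (P * q)) + q * x₃)
    (h4 : (P * q) ^ 2 * x₁ = (P * q + a - q) * l * (P * q) ^ 2 + q * x₄ + P ^ 2 * q ^ 3 * l)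
    {A : ℂ} (hA : A = ((q * (P - 1) + a) * b ^ 2 - P * q * (P + 1) * (q * (P + 1) + a)) /
      (b ^ 2 - q * (P + 1) ^ 2)) :
    x₁ = l * A ∧ x₂ = l * (P * b / (P + 1) * (P * q - q + a - A)) ∧
      x₃ = l * (P * b / (P + 1) * (P * q - q + a - A)) ∧
      x₄ = l * (-(P ^ 2 * q) * (P * q + a - A)) := by
  have hP1 : P - 1 ≠ 0 := sub_ne_zero.mpr hP
  have h23 : x₃ = x₂ := by
    refine sub_eq_zero.mp ((mul_eq_zero.mp (?_ : (q * (P - 1)) * (x₃ - x₂) = 0)).resolve_left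
      (mul_ne_zero hq hP1))
    linear_combination h3 - h2
  subst h23
  have e2 : (P + 1) * x₃ = P * b * ((P * q + a - q) * l - x₁) := by
    refine mul_left_cancel₀ hq ?_
    linear_combination -h2
  have e4 : x₄ = P ^ 2 * q * (x₁ - (P * q + a - q) * l) - P ^ 2 * q ^ 2 * l := by
    refine mul_left_cancel₀ hq ?_
    linear_combination -h4
  have e1 : x₁ = l * A := by
    rw [hA, ← mul_div_assoc, eq_div_iff hden]
    refine mul_left_cancel₀ hP1 ?_
    linear_combination -(P + 1) * h1 + 2 * b * e2 + (P + 1) * e4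
  have e3 : x₃ = l * (P * b / (P + 1) * (P * q - q + a - A)) := by
    field_simp
    rw [mul_comm x₃, e2, e1]
    ring
  refine ⟨e1, e3, e3, ?_⟩
  rw [e4, e1]
  ring

/-- The relation between the restrictions of F and UF is projected on the φ-component, where it
becomes an identity between combinations of the four products of φ and Vφ. Their independence yields
the system of `solve_linear`. -/
theorem pullbackComponent_siegelU {N k p : ℕ} {h : ℍ → ℂ} {F : Matrix (Fin 2) (Fin 2) ℂ → ℂ}
    (hF : IsSaitoKurokawaLift N k h F) {a lam : ℂ} (hp2 : p ≠ 2) (hk : Odd k)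
    (heig : ∀ v : ℕ, IsPlusIndex k v → halfHeckeCoeff k p h v = a * coeff h v) {φ : ℍ → ℂ}
    (H : IsPrimitive N p ((k : ℤ) + 1) (coeff φ) φ)
    (hlam : pullbackComponent N ((k : ℤ) + 1) φ F = lam • cross φ φ)
    (hden : coeff φ p ^ 2 - (p : ℂ) ^ (k - 1) * ((p : ℂ) + 1) ^ 2 ≠ 0)
    {A : ℂ} (hA : A = (((p : ℂ) ^ (k - 1) * ((p : ℂ) - 1) + a) * coeff φ p ^ 2 -
      (p : ℂ) * (p : ℂ) ^ (k - 1) * ((p : ℂ) + 1) * ((p : ℂ) ^ (k - 1) * ((p : ℂ) + 1) + a)) /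
        (coeff φ p ^ 2 - (p : ℂ) ^ (k - 1) * ((p : ℂ) + 1) ^ 2)) :
    pullbackComponent (N * p) ((k : ℤ) + 1) φ (siegelU p F) =
      (lam * A) • cross φ φ +
      (lam * ((p : ℂ) * coeff φ p / ((p : ℂ) + 1) *
        ((p : ℂ) * (p : ℂ) ^ (k - 1) - (p : ℂ) ^ (k - 1) + a - A))) • cross φ (opV p φ) +
      (lam * ((p : ℂ) * coeff φ p / ((p : ℂ) + 1) *
        ((p : ℂ) * (p : ℂ) ^ (k - 1) - (p : ℂ) ^ (k - 1) + a - A))) • cross (opV p φ) φ +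
      (lam * (-((p : ℂ) ^ 2 * (p : ℂ) ^ (k - 1)) * ((p : ℂ) * (p : ℂ) ^ (k - 1) + a - A))) •
        cross (opV p φ) (opV p φ) := by
  have hp := H.prime
  have hw := H.pos
  have : NeZero N := ⟨H.level_pos.ne'⟩
  have : NeZero (N * p) := ⟨H.level_mul_pos.ne'⟩
  set P : ℂ := (p : ℂ) with hP
  set q : ℂ := P ^ (k - 1) with hq
  set b : ℂ := coeff φ p with hb
  have hP0 : P ≠ 0 := Nat.cast_ne_zero.mpr hp.ne_zero
  have hPk : P ^ k = P * q := by rw [hq, ← pow_succ', Nat.sub_add_cancel hk.pos]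
  have hP2k : P ^ (2 * k - 1) = P * q ^ 2 := by
    rw [hq, ← pow_mul, ← pow_succ']
    congr 1
    have := hk.pos
    omega
  have hP3k : P ^ (3 * k - 1) = P ^ 2 * q ^ 3 := by
    rw [hq, ← pow_mul, ← pow_add]
    congr 1
    have := hk.pos
    omega
  set e := heckeProj (N * p) ((k : ℤ) + 1) (coeff φ) with he
  set GG := pullback N ((k : ℤ) + 1) F with hGG
  set EE := pullback (N * p) ((k : ℤ) + 1) (siegelU p F) with hEE
  have hGfun : tensorFun N _ GG = fun τ₁ τ₂ : ℍ => F (symMat τ₁ 0 τ₂) := by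
    funext τ₁ τ₂
    exact tensorFun_pullback hw (hF.isSiegel.slice_mem H.level_pos)
      (hF.isSiegel.slice_mem' H.level_pos) τ₁ τ₂
  have hEfun : tensorFun (N * p) _ EE = fun τ₁ τ₂ : ℍ => siegelU p F (symMat τ₁ 0 τ₂) := by
    funext τ₁ τ₂
    exact tensorFun_pullback hw (hF.isSiegel.siegelU_slice_mem H.level_pos hp)
      (hF.isSiegel.siegelU_slice_mem' H.level_pos hp) τ₁ τ₂
  let I := cuspMap (M := N) (M' := N * p) hw LinearMap.id
    fun f hf => cuspSpace_mono (dvd_mul_right N p) _ hf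
  let V := cuspMap (M := N) (M' := N * p) hw (opV p)
    fun f hf => mul_comm p N ▸ opV_mem hp.pos hf
  let U := cuspMap (M := N * p) (M' := N * p) hw (opU p)
    fun f hf => opU_mem hp (dvd_mul_left p N) hf
  have hI : ∀ f, e (I f) = I (heckeProj N _ (coeff φ) f) := fun f =>
    DFunLike.coe_injective (H.heckeProj_level_mul f (I f) rfl)
  have hV : ∀ f, e (V f) = V (heckeProj N _ (coeff φ) f) := fun f =>
    DFunLike.coe_injective (H.heckeProj_opV f (V f) rfl)
  have hU : ∀ f, e (U f) = U (e f) := fun f =>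
    DFunLike.coe_injective (H.heckeProj_opU f (U f) rfl)
  -- The projections act on tensors rather than on functions of two variables, so the relation is
  -- first lifted to the tensor product by injectivity of `tensorFun`.
  have hrel : TensorProduct.map U U EE =
      (P * q + a - q) • TensorProduct.map U U (TensorProduct.map I I GG) + q • EE +
        (-(a * (P * q) + P * q ^ 2)) • TensorProduct.map I I GG +
        (P ^ 2 * q ^ 3) • TensorProduct.map V V GG := by
    refine tensorFun_injective hw ?_
    simp only [map_add, map_smul, U, I, V, tensorFun_map_cuspMap, hGfun, hEfun]
    funext τ₁ τ₂
    have := hF.diag_relation hp2 hp H.not_dvd hk heig τ₁ τ₂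
    rw [← hP, ← hq, hPk, hP2k, hP3k] at this
    exact this
  set Φ := pullbackComponent (N * p) ((k : ℤ) + 1) φ (siegelU p F) with hΦ
  have hrelfun : twoVar (opU p) Φ = (P * q + a - q) • twoVar (opU p) (lam • cross φ φ) + q • Φ +
      (-(a * (P * q) + P * q ^ 2)) • (lam • cross φ φ) +
      (P ^ 2 * q ^ 3) • twoVar (opV p) (lam • cross φ φ) := by
    have h0 := congrArg (fun t => tensorFun (N * p) _ (TensorProduct.map e e t)) hrel
    simp only [map_add, map_smul] at h0
    rw [map_comp_comm hU, map_comp_comm hU, map_comp_comm hI, map_comp_comm hV,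
      tensorFun_map_cuspMap, tensorFun_map_cuspMap, tensorFun_map_cuspMap,
      tensorFun_map_cuspMap] at h0
    rw [← hlam]
    exact h0
  obtain ⟨x₁, x₂, x₃, x₄, hx⟩ := H.exists_cross EE
  change Φ = _ at hx
  have hQ := isQ_of_mem hw H.mem
  -- In weight k + 1 one has T_p = U_p + p^k V_p, and p^k = P q.
  have hUφ : opU p φ = b • φ - (P * q) • opV p φ := by
    have h0 := H.eigen p hp H.not_dvd
    rw [hecke, if_neg H.not_dvd, add_sub_cancel_right, zpow_natCast, ← hP, hPk] at h0
    exact eq_sub_of_add_eq h0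
  have hUV : opU p (opV p φ) = φ := opU_opV_self hp.pos hQ
  have hc : ∀ (x y z t : ℂ) (f g f' g' : ℍ → ℂ), cross (x • f - y • g) (z • f' - t • g') =
      (x * z) • cross f f' - (x * t) • cross f g' - (y * z) • cross g f' +
        (y * t) • cross g g' := by
    intro x y z t f g f' g'
    funext τ₁ τ₂
    simp only [cross, Pi.add_apply, Pi.sub_apply, Pi.smul_apply, smul_eq_mul]
    ring
  have hc1 : ∀ (x y : ℂ) (f g f' : ℍ → ℂ), cross (x • f - y • g) f' =
      x • cross f f' - y • cross g f' := by
    intro x y f g f'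
    funext τ₁ τ₂
    simp only [cross, Pi.sub_apply, Pi.smul_apply, smul_eq_mul]
    ring
  have hc2 : ∀ (x y : ℂ) (f g f' : ℍ → ℂ), cross f' (x • f - y • g) =
      x • cross f' f - y • cross f' g := by
    intro x y f g f'
    funext τ₁ τ₂
    simp only [cross, Pi.sub_apply, Pi.smul_apply, smul_eq_mul]
    ring
  rw [hx] at hrelfun
  simp only [twoVar_add, twoVar_smul, twoVar_cross, hUφ, hUV, hc, hc1, hc2] at hrelfun
  obtain ⟨h1, h2, h3, h4⟩ := H.eq_zero_of_cross
    (x₁ := b ^ 2 * x₁ + b * x₂ + b * x₃ + x₄ -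
      ((P * q + a - q) * lam * b ^ 2 + q * x₁ - (a * (P * q) + P * q ^ 2) * lam))
    (x₂ := -(b * (P * q) * x₁) - P * q * x₃ - (-((P * q + a - q) * lam * b * (P * q)) + q * x₂))
    (x₃ := -(b * (P * q) * x₁) - P * q * x₂ - (-((P * q + a - q) * lam * b * (P * q)) + q * x₃))
    (x₄ := (P * q) ^ 2 * x₁ - ((P * q + a - q) * lam * (P * q) ^ 2 + q * x₄ +
      P ^ 2 * q ^ 3 * lam)) (by
    rw [← sub_eq_zero] at hrelfun
    rw [← hrelfun]
    module)
  obtain ⟨r1, r2, r3, r4⟩ := solve_linear (pow_ne_zero _ hP0) (Nat.cast_ne_one.mpr hp.one_lt.ne')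
    (Nat.cast_add_one_ne_zero p) hden (sub_eq_zero.mp h1) (sub_eq_zero.mp h2)
    (sub_eq_zero.mp h3) (sub_eq_zero.mp h4) hA
  rw [hx, r1, r2, r3, r4]

end SKPullback

end

/-! ### The theorem with the constants as stated -/

theorem theorem4p2 (N k p : ℕ) (hN_odd : Odd N) (hN_sqf : Squarefree N) (hk : Odd k)
    (hp : p.Prime) (hp_odd : Odd p) (hpN : ¬ p ∣ N)
    (f : S N (2 * (k : ℤ))) (hf : IsNormalisedNewform N (2 * (k : ℤ)) f)
    (h : ℍ → ℂ) (hh : IsShimuraShintani N k f h)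
    (F : Matrix (Fin 2) (Fin 2) ℂ → ℂ) (hF : IsSaitoKurokawaLift N k h F)
    (φ : S N ((k : ℤ) + 1)) (hφ : IsNormalisedNewform N ((k : ℤ) + 1) φ)
    (lam : ℂ)
    (hlam : ∀ τ₁ τ₂ : ℍ, pullbackComponent N ((k : ℤ) + 1) φ F τ₁ τ₂ = lam * (φ τ₁ * φ τ₂)) :
    let P : ℂ := (p : ℂ)
    let a : ℂ := coeff f p
    let b : ℂ := coeff φ p
    let A : ℂ := ((P ^ (k - 1) * (P - 1) + a) * b ^ 2
        - P ^ k * (P + 1) * (P ^ (k - 1) * (P + 1) + a)) / (b ^ 2 - P ^ (k - 1) * (P + 1) ^ 2)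
    let B : ℂ := P * b / (P + 1) * (P ^ k - P ^ (k - 1) + a - A)
    let C : ℂ := P * b / (P + 1) * (P ^ k - P ^ (k - 1) + a - A)
    let D : ℂ := -P ^ (k + 1) * (P ^ k + a - A)
    b ^ 2 - P ^ (k - 1) * (P + 1) ^ 2 ≠ 0 ∧
    ∀ τ₁ τ₂ : ℍ, pullbackComponent (N * p) ((k : ℤ) + 1) φ (siegelU p F) τ₁ τ₂ =
      lam * (A * (φ τ₁ * φ τ₂) + B * (φ τ₁ * opV p φ τ₂) + C * (opV p φ τ₁ * φ τ₂)
        + D * (opV p φ τ₁ * opV p φ τ₂)) := by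
  have hw : (0 : ℤ) < (k : ℤ) + 1 := by positivity
  have H := hφ.isPrimitive (p := p) hN_sqf hp hpN hw
  have hk1 := hk.pos
  have hden : coeff φ p ^ 2 - (p : ℂ) ^ (k - 1) * ((p : ℂ) + 1) ^ 2 ≠ 0 := by
    have h0 := eigenvalue_sq_ne H.level_pos hp hpN hw H.mem H.ne_zero (H.eigen p hp hpN)
    -- The exponent w - 2 of the eigenvalue bound is the natural number k - 1, because k is odd and
    -- hence positive.
    have e : (k : ℤ) + 1 - 2 = ((k - 1 : ℕ) : ℤ) := by omega
    rw [e, zpow_natCast] at h0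
    exact sub_ne_zero.mpr h0
  intro P a b A B C D
  refine ⟨hden, fun τ₁ τ₂ => ?_⟩
  have hPk : P ^ k = P * P ^ (k - 1) := by rw [← pow_succ', Nat.sub_add_cancel hk1]
  have hPk' : P ^ (k + 1) = P ^ 2 * P ^ (k - 1) := by
    rw [← pow_add]
    congr 1
    omega
  have hp2 : p ≠ 2 := by rintro rfl; exact absurd hp_odd (by decide)
  have key := pullbackComponent_siegelU hF hp2 hk (hh.eigen p hp hpN) H
    (funext fun τ₁ => funext fun τ₂ => hlam τ₁ τ₂) hden (A := A) (by simp only [A, hPk]; rfl)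
  rw [key]
  simp only [Pi.add_apply, Pi.smul_apply, smul_eq_mul, cross, B, C, D, hPk, hPk']
  ring
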